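/- **Setting.** Let $m,n\ge 1$, $r\ge 0$. Let $P(\lambda)=\sum_{j=0}^m\lambda^jA_j$ with $A_j\in\mathbb C^{n\times n}$, $A_m\ne 0$, and let $G(\lambda)=P(\lambda)+C(\lambda E-A)^{-1}B$ be a minimal realization (no realization of $G$ of this kind has a smaller state dimension) with $A,E\in\mathbb C^{r\times r}$, $E$ nonsingular, $B\in\mathbb C^{r\times n}$, $C\in\mathbb C^{n\times r}$. Its system matrix is $\mathcal S(\lambda)=\begin{bmatrix}P(\lambda)&C\\ B&A-\lambda E\end{bmatrix}$. **Elementary and Fiedler matrices.** For $X\in\mathbb C^{n\times n}$ put $M_0(X)=\mathrm{diag}(I_{(m-1)n},X)$, $M_{-m}(X)=\mathrm{diag}(X,I_{(m-1)n})$ and, for $1\le i\le m-1$, $M_i(X)=\mathrm{diag}\big(I_{(m-i-1)n},\begin{bmatrix}X&I\\I&0\end{bmatrix},I_{(i-1)n}\big)$ and $M_{-i}(X)=\mathrm{diag}\big(I_{(m-i-1)n},\begin{bmatrix}0&I\\I&X\end{bmatrix},I_{(i-1)n}\big)$. Put $\mathbb M_i(X)=\mathrm{diag}(M_i(X),I_r)$;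 $M_i^P=M_i(-A_i)$ for $i\ge0$, $M_i^P=M_i(A_{-i})$ for $i<0$; $\mathbb M_i^P=\mathrm{diag}(M_i^P,I_r)$. Put $\mathbb M_0^{\mathcal S}=\begin{bmatrix}M_0^P&-e_m\otimes C\\-e_m^T\otimes B&-A\end{bmatrix}$, $\mathbb M_{-m}^{\mathcal S}=\mathrm{diag}(M_{-m}^P,-E)$ and, for $1\le i\le m-1$, $\mathbb M_i^{\mathcal S}=\mathbb M_i^P$, $\mathbb M_{-i}^{\mathcal S}=(\mathbb M_i^{\mathcal S})^{-1}$. For an index tuple $\mathbf t=(t_1,\dots,t_k)$ and a tuple $X=(X_1,\dots,X_k)$ of $n\times n$ matrices (a matrix assignment for $\mathbf t$), $M_{\mathbf t}(X)=M_{t_1}(X_1)\cdots M_{t_k}(X_k)$; $\mathbb M_{\mathbf t}(X)$, $M^P_{\mathbf t}$, $\mathbb M^P_{\mathbf t}$, $\mathbb M^{\mathcal S}_{\mathbf t}$ are the analogous products. The assignment is nonsingular if every $X_j$ with $t_j\in\{0,-m\}$ is nonsingular. $\mathrm{rev}$ reverses tuples, and $(a:b)=(a,a+1,\dots,b)$,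 which is empty if $a>b$. **GFPRs.** A tuple satisfies the SIP if between any two equal entries $i$ there is an entry $i+1$. A GFPR of $\mathcal S$ is a pencil $\mathbb M_{\tau_1}(Y_1)\mathbb M_{\sigma_1}(X_1)(\lambda\mathbb M^{\mathcal S}_\tau-\mathbb M^{\mathcal S}_\sigma)\mathbb M_{\sigma_2}(X_2)\mathbb M_{\tau_2}(Y_2)$, where $0\le h\le m-1$, $\sigma$ and $\tau$ are permutations of $\{0,\dots,h\}$ and $\{-m,\dots,-h-1\}$, the entries of $\sigma_1,\sigma_2$ lie in $\{0,\dots,h-1\}$, those of $\tau_1,\tau_2$ lie in $\{-m,\dots,-h-2\}$, both $(\sigma_1,\sigma,\sigma_2)$ and $(\tau_1,\tau,\tau_2)$ satisfy the SIP, and $X_1,X_2,Y_1,Y_2$ are matrix assignments for $\sigma_1,\sigma_2,\tau_1,\tau_2$. **The pencils.** The simple admissible tuple of $\{0,\dots,k\}$ is $(k-1:k,\,k-3:k-2,\dots,1:2,\,0)$ with symmetric complement $(k-1,k-3,\dots,1)$ if $k$ is even, and $(k-1:k,\dots,2:3,\,0:1)$ with symmetric complement $(k-1,k-3,\dots,2,0)$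 if $k$ is odd. A tuple is in canonical form for $k$ if it is $(a_1:k-2,\,a_2:k-4,\dots,a_s:k-2s)$ with $s=\lfloor k/2\rfloor$ and all $a_i\ge0$. For $0\le h\le m-1$ let $\mathbf w_h$ and $\mathbf v_h+m$ be the simple admissible tuples of $\{0,\dots,h\}$ and $\{0,\dots,m-h-1\}$, with symmetric complements $\mathbf c_{w_h}$ and $\mathbf c_{v_h}+m$; let $\mathbf t_{w_h}$ and $\mathbf t_{v_h}+m$ be in canonical form for $h$ and $m-h-1$, with matrix assignments $\mathcal X$ for $\mathbf t_{w_h}$ and $\mathcal Y$ for $\mathbf t_{v_h}$. Define $$\mathbb L_{\mathcal S}(h,\mathbf t_{w_h},\mathbf t_{v_h},\mathcal X,\mathcal Y)=\mathbb M_{(\mathbf t_{v_h},\mathbf t_{w_h})}(\mathcal Y,\mathcal X)\,(\lambda\mathbb M^{\mathcal S}_{\mathbf v_h}-\mathbb M^{\mathcal S}_{\mathbf w_h})\,\mathbb M^P_{(\mathbf c_{w_h},\mathbf c_{v_h})}\,\mathbb M_{(\mathrm{rev}(\mathbf t_{w_h}),\mathrm{rev}(\mathbf t_{v_h}))}(\mathrm{rev}(\mathcal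 X),\mathrm{rev}(\mathcal Y)),$$ and let $L_P(h,\mathbf t_{w_h},\mathbf t_{v_h},\mathcal X,\mathcal Y)$ be the same product with $M$, $M^P$ in place of $\mathbb M$, $\mathbb M^{\mathcal S}$, $\mathbb M^P$. For a tuple $\mathbf t$ containing $0$ let $c_0(\mathbf t)$ (resp. $i_0(\mathbf t)$) be the largest $p$ such that $(0,1,\dots,p)$ (resp. $(p,\dots,1,0)$) is a subtuple of $\mathbf t$. **Block symmetry.** The block transpose of $\begin{bmatrix}H&u\otimes X\\v^T\otimes Y&Z\end{bmatrix}$, where $H$ is an $m\times m$ block matrix with $n\times n$ blocks, $u,v\in\mathbb C^m$, $X\in\mathbb C^{n\times r}$, $Y\in\mathbb C^{r\times n}$ and $Z$ is $r\times r$, is $\begin{bmatrix}H^{\mathcal B}&v\otimes X\\u^T\otimes Y&Z\end{bmatrix}$ with $(H^{\mathcal B})_{ij}=H_{ji}$; a pencil of this form is block symmetric if it equals its block transpose. **Rosenbrock strong linearization.** A pencil $\mathbb L(\lambda)=\begin{bmatrix}\mathcal A_0-\lambda\mathcal A_1&\mathcal C\\\mathcal B&H-\lambda K\end{bmatrix}$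 of size $mn+r$, with $K\in\mathbb C^{r\times r}$ nonsingular, which is irreducible (that is, $\mathbb G(\lambda)=\mathcal A_0-\lambda\mathcal A_1+\mathcal C(\lambda K-H)^{-1}\mathcal B$ is a minimal realization), is a Rosenbrock strong linearization of $\mathcal S$ if there are unimodular $U(\lambda),V(\lambda)$ and nonsingular constant $U_0,V_0$ with $\mathrm{diag}(U,U_0)\,\mathbb L\,\mathrm{diag}(V,V_0)=\mathrm{diag}(I_{(m-1)n},\mathcal S)$, and rational matrices $\mathcal O_\ell,\mathcal O_r$ that tend to nonsingular matrices as $\lambda\to\infty$ with $\mathcal O_\ell\,\lambda^{-1}\mathbb G\,\mathcal O_r=\mathrm{diag}(I_{(m-1)n},\lambda^{-m}G)$. **Theorem.** Let $0\le h\le m-1$ be even, let $\mathbf t_{w_h},\mathbf t_{v_h},\mathcal X,\mathcal Y$ be as above, and let $\mathbb L=\mathbb L_{\mathcal S}(h,\mathbf t_{w_h},\mathbf t_{v_h},\mathcal X,\mathcal Y)$. Then $$\mathbb L(\lambda)=\begin{bmatrix}L_P(h,\mathbf t_{w_h},\mathbf t_{v_h},\mathcal X,\mathcal Y)&e_{m-i_0(\mathbf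 t_{w_h},\mathbf w_h)}\otimes C\\ e^T_{m-c_0(\mathbf w_h,\mathbf c_{w_h},\mathrm{rev}(\mathbf t_{w_h}))}\otimes B&A-\lambda E\end{bmatrix}.$$ (a) $\mathbb L$ is a block symmetric GFPR of $\mathcal S$. Conversely, let $r\ge1$ and let $\mathbb L'$ be a block symmetric GFPR of $\mathcal S$ given by assignments $X_1,X_2,Y_1,Y_2$ in which no matrix assigned to a position occupied by $0$ or $-m$ is zero (for instance, nonsingular assignments). Then $\mathbb L'=\mathbb L_{\mathcal S}(h,\mathbf t_{w_h},\mathbf t_{v_h},\mathcal X,\mathcal Y)$ for some even $0\le h\le m-1$ and some $\mathbf t_{w_h},\mathbf t_{v_h},\mathcal X,\mathcal Y$ as above, and here $\mathcal X$ and $\mathcal Y$ can be taken nonsingular if $X_1,X_2,Y_1,Y_2$ are nonsingular. (b) Suppose that $\mathcal X$ and $\mathcal Y$ are nonsingular. If $m$ is odd, then $\mathbb L$ is a Rosenbrock strong linearization of $\mathcal S$. If $m$ is even and $A_m$ is nonsingular, then $\mathbb L$ is a Rosenbrock strong linearization of $\mathcal S$. -/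

import Mathlib

open scoped Polynomial

noncomputable section

namespace GFPR

/-! ## Realizations, system matrices, transfer functions -/

/-- The data of a realization `P(λ) + C (λE - A)⁻¹ B` with state dimension `r` and with `E`
nonsingular; rows and columns of the square polynomial part `P(λ)` are indexed by `ι`. -/
structure Realization (ι : Type) [Fintype ι] [DecidableEq ι] (r : ℕ) where
  P : Matrix ι ι ℂ[X]
  A : Matrix (Fin r) (Fin r) ℂ
  E : Matrix (Fin r) (Fin r) ℂ
  B : Matrix (Fin r) ι ℂ
  C : Matrix ι (Fin r) ℂ
  E_nonsing : IsUnit E.det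

section Realization

variable {ι : Type} [Fintype ι] [DecidableEq ι] {r : ℕ}

/-- The coefficient matrix `A_j` of `λ ^ j` in `P(λ)`. -/
def Realization.coeff (S : Realization ι r) (j : ℕ) : Matrix ι ι ℂ :=
  S.P.map fun p => p.coeff j

/-- The pencil `λ K - H` with constant matrices `K` and `H`. -/
def pencil {κ : Type} (K H : Matrix κ κ ℂ) : Matrix κ κ ℂ[X] :=
  (Polynomial.X : ℂ[X]) • K.map Polynomial.C - H.map Polynomial.C

/-- The system matrix `[P(λ), C; B, A - λE]`. -/
def Realization.systemMatrix (S : Realization ι r) : Matrix (ι ⊕ Fin r) (ι ⊕ Fin r) ℂ[X] :=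
  Matrix.fromBlocks S.P (S.C.map Polynomial.C) (S.B.map Polynomial.C) (-pencil S.E S.A)

/-- The transfer function `P(λ) + C (λE - A)⁻¹ B`, a matrix of rational functions. -/
def Realization.transfer (S : Realization ι r) : Matrix ι ι (RatFunc ℂ) :=
  S.P.map (algebraMap ℂ[X] (RatFunc ℂ)) +
    S.C.map RatFunc.C *
      ((RatFunc.X : RatFunc ℂ) • S.E.map RatFunc.C - S.A.map RatFunc.C)⁻¹ *
    S.B.map RatFunc.C

/-- The realization is minimal (equivalently, its system matrix is called irreducible): no
realization of the same rational matrix has a smaller state dimension. -/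
def Realization.IsMinimal (S : Realization ι r) : Prop :=
  ∀ (r' : ℕ) (S' : Realization ι r'), S'.transfer = S.transfer → r ≤ r'

end Realization

/-! ## Block matrices

An `mn × mn` matrix regarded as an `m × m` block matrix with `n × n` blocks is indexed by
`Fin m × Fin n`, and an `(mn + r) × (mn + r)` matrix by `(Fin m × Fin n) ⊕ Fin r`. -/

section Blocks

variable {m n r : ℕ}

/-- The Kronecker product `u ⊗ X` of a column `u` with an `n × r` matrix `X`. -/
def colBlock (u : Fin m → ℂ) (X : Matrix (Fin n) (Fin r) ℂ) :
    Matrix (Fin m × Fin n) (Fin r) ℂ :=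
  Matrix.of fun p k => u p.1 * X p.2 k

/-- The Kronecker product `vᵀ ⊗ Y` of a row `vᵀ` with an `r × n` matrix `Y`. -/
def rowBlock (v : Fin m → ℂ) (Y : Matrix (Fin r) (Fin n) ℂ) :
    Matrix (Fin r) (Fin m × Fin n) ℂ :=
  Matrix.of fun k p => v p.1 * Y k p.2

/-- The `k`-th standard column `e_k` of length `m`, with `k = 1, …, m` counted from one. -/
def stdCol (m : ℕ) (k : ℤ) : Fin m → ℂ := fun a => if (a : ℤ) + 1 = k then 1 else 0

/-- `diag(I_{(m-1)n}, Q)`. -/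
def diagLast {R : Type} [Zero R] [One R] (m : ℕ) (Q : Matrix (Fin n) (Fin n) R) :
    Matrix (Fin m × Fin n) (Fin m × Fin n) R :=
  Matrix.of fun p q =>
    if p.1 = q.1 then
      (if (p.1 : ℕ) + 1 = m then Q p.2 q.2 else (1 : Matrix (Fin n) (Fin n) R) p.2 q.2)
    else 0

/-- The block transpose: the `(i, j)` block of the result is the `(j, i)` block of `H`. -/
def blockTranspose {R : Type} (H : Matrix (Fin m × Fin n) (Fin m × Fin n) R) :
    Matrix (Fin m × Fin n) (Fin m × Fin n) R :=
  Matrix.of fun p q => H (q.1, p.2) (p.1, q.2)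

/-- A matrix polynomial `[H, u ⊗ X; vᵀ ⊗ Y, Z]` is block symmetric if it is equal to its block
transpose `[Hᴮ, v ⊗ X; uᵀ ⊗ Y, Z]`. -/
def IsBlockSymmetric
    (L : Matrix ((Fin m × Fin n) ⊕ Fin r) ((Fin m × Fin n) ⊕ Fin r) ℂ[X]) : Prop :=
  ∃ (H : Matrix (Fin m × Fin n) (Fin m × Fin n) ℂ[X]) (u v : Fin m → ℂ)
    (X : Matrix (Fin n) (Fin r) ℂ) (Y : Matrix (Fin r) (Fin n) ℂ)
    (Z : Matrix (Fin r) (Fin r) ℂ[X]),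
    L = Matrix.fromBlocks H ((colBlock u X).map Polynomial.C)
      ((rowBlock v Y).map Polynomial.C) Z ∧
    L = Matrix.fromBlocks (blockTranspose H) ((colBlock v X).map Polynomial.C)
      ((rowBlock u Y).map Polynomial.C) Z

end Blocks

/-! ## Rosenbrock strong linearizations -/

/-- A square rational matrix is biproper if it tends to a nonsingular matrix as `λ → ∞`. -/
def IsBiproper {ι : Type} [Fintype ι] [DecidableEq ι] (F : Matrix ι ι (RatFunc ℂ)) : Prop :=
  ∃ D : Matrix ι ι ℂ, IsUnit D.det ∧
    ∀ i j, Filter.Tendsto (fun z : ℂ => RatFunc.eval (RingHom.id ℂ) z (F i j))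
      (Filter.cocompact ℂ) (nhds (D i j))

/-- `L` is a Rosenbrock strong linearization of the system matrix of `S` (with `m` the degree of
the polynomial part of `S`). Here `T` is `L` read as a system matrix
`[𝒳 - λ𝒴, 𝒞; ℬ, H - λK]` with `K` nonsingular. A matrix polynomial is unimodular if its
determinant is a nonzero constant, that is, a unit of `ℂ[λ]`. -/
def IsRosenbrockStrongLinearization {n r : ℕ} (m : ℕ) (S : Realization (Fin n) r)
    (L : Matrix ((Fin m × Fin n) ⊕ Fin r) ((Fin m × Fin n) ⊕ Fin r) ℂ[X]) : Prop :=
  ∃ T : Realization (Fin m × Fin n) r,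
    (∀ i j, (T.P i j).natDegree ≤ 1) ∧
    L = T.systemMatrix ∧
    T.IsMinimal ∧
    (∃ (U V : Matrix (Fin m × Fin n) (Fin m × Fin n) ℂ[X]) (U₀ V₀ : Matrix (Fin r) (Fin r) ℂ),
      IsUnit U.det ∧ IsUnit V.det ∧ IsUnit U₀.det ∧ IsUnit V₀.det ∧
      Matrix.fromBlocks U 0 0 (U₀.map Polynomial.C) * L *
          Matrix.fromBlocks V 0 0 (V₀.map Polynomial.C) =
        -- `diag(I_{(m-1)n}, S(λ))`, with `S(λ)` split along its own two block rows and columns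
        Matrix.fromBlocks (diagLast m S.P)
          ((colBlock (stdCol m m) S.C).map Polynomial.C)
          ((rowBlock (stdCol m m) S.B).map Polynomial.C) (-pencil S.E S.A)) ∧
    (∃ Ol Or : Matrix (Fin m × Fin n) (Fin m × Fin n) (RatFunc ℂ),
      IsBiproper Ol ∧ IsBiproper Or ∧
      Ol * ((RatFunc.X : RatFunc ℂ)⁻¹ • T.transfer) * Or =
        diagLast m (((RatFunc.X : RatFunc ℂ)⁻¹ ^ m) • S.transfer))

/-! ## Index tuples -/

/-- The string `(a : b) = (a, a + 1, …, b)`, empty if `b < a`. -/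
def str (a b : ℤ) : List ℤ := (List.range (b + 1 - a).toNat).map fun i => a + (i : ℤ)

/-- The successor infix property: between two equal indices `x` there is an index `x + 1`. -/
def SIP (t : List ℤ) : Prop :=
  ∀ (a b : ℕ) (x : ℤ), a < b → t[a]? = some x → t[b]? = some x →
    ∃ c : ℕ, a < c ∧ c < b ∧ t[c]? = some (x + 1)

/-- The number `c_k(t)` of consecutive consecutions of `t` at `k`: the largest `p` such that
`(k, k + 1, …, k + p)` is a subtuple of `t`, and `-1` if `k` is not in `t`. -/
def consec (t : List ℤ) (k : ℤ) : ℤ :=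
  if k ∈ t then (Nat.findGreatest (fun p => List.Sublist (str k (k + p)) t) t.length : ℤ) else -1

/-- The number `i_k(t)` of consecutive inversions of `t` at `k`: the largest `p` such that
`(k + p, …, k + 1, k)` is a subtuple of `t`, and `-1` if `k` is not in `t`. -/
def invers (t : List ℤ) (k : ℤ) : ℤ :=
  if k ∈ t then
    (Nat.findGreatest (fun p => List.Sublist (str k (k + p)).reverse t) t.length : ℤ)
  else -1

/-- The admissible tuple `(h-1:h, h-3:h-2, …, p+1:p+2, 0:p)` of `{0 : h}` with index `p`
(for `p ≤ h` of the same parity as `h`). -/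
def admissibleTuple (h p : ℕ) : List ℤ :=
  ((List.range ((h - p) / 2)).flatMap fun i => str ((h : ℤ) - 1 - 2 * i) ((h : ℤ) - 2 * i)) ++
    str 0 p

/-- The symmetric complement `(h-1, h-3, …, p+1, (0:p-1, 0:p-2, …, 0:1, 0))` of the admissible
tuple of `{0 : h}` with index `p`. -/
def symmComplement (h p : ℕ) : List ℤ :=
  ((List.range ((h - p) / 2)).map fun i => (h : ℤ) - 1 - 2 * i) ++
    ((List.range p).flatMap fun i => str 0 ((p : ℤ) - 1 - i))

/-- The simple admissible tuple of `{0 : h}`: its index is `0` or `1`. -/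
def simpleTuple (h : ℕ) : List ℤ := admissibleTuple h (h % 2)

/-- The symmetric complement of the simple admissible tuple of `{0 : h}`. -/
def simpleComplement (h : ℕ) : List ℤ := symmComplement h (h % 2)

/-- `t` is in canonical form for `h`: `t = (a_1:h-2, a_2:h-4, …, a_s:h-2s)` with `s = ⌊h/2⌋` and
`a_i ≥ 0` (a string is empty if its first entry exceeds its last one). -/
def IsCanonical (h : ℕ) (t : List ℤ) : Prop :=
  ∃ a : ℕ → ℕ, t = (List.range (h / 2)).flatMap fun i => str (a i) ((h : ℤ) - 2 * (i + 1))

/-! ## Elementary matrices and Fiedler matrices -/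

section Fiedler

variable {n r : ℕ}

/-- The `(a + 1, b + 1)` block of the elementary matrix `M_i(X)`, for `i = -m, …, m - 1`. -/
def elemBlock (m : ℕ) (i : ℤ) (X : Matrix (Fin n) (Fin n) ℂ) (a b : Fin m) :
    Matrix (Fin n) (Fin n) ℂ :=
  let k : ℤ := (a : ℤ) + 1
  let l : ℤ := (b : ℤ) + 1
  let p : ℤ := m - |i|
  if i = 0 then (if k = l then (if k = m then X else 1) else 0)
  else if i = -(m : ℤ) then (if k = l then (if k = 1 then X else 1) else 0)
  else if k = p ∧ l = p then (if 0 < i then X else 0)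
  else if k = p + 1 ∧ l = p + 1 then (if 0 < i then 0 else X)
  else if (k = p ∧ l = p + 1) ∨ (k = p + 1 ∧ l = p) then 1
  else if k = l then 1 else 0

/-- The `mn × mn` elementary matrix `M_i(X)`. -/
def elem (m : ℕ) (i : ℤ) (X : Matrix (Fin n) (Fin n) ℂ) :
    Matrix (Fin m × Fin n) (Fin m × Fin n) ℂ :=
  Matrix.of fun p q => elemBlock m i X p.1 q.1 p.2 q.2

/-- The `(mn + r) × (mn + r)` matrix `diag(M, I_r)`. -/
def border {m : ℕ} (r : ℕ) (M : Matrix (Fin m × Fin n) (Fin m × Fin n) ℂ) :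
    Matrix ((Fin m × Fin n) ⊕ Fin r) ((Fin m × Fin n) ⊕ Fin r) ℂ :=
  Matrix.fromBlocks M 0 0 1

/-- The matrix `-A_i` (for `i ≥ 0`) or `A_{-i}` (for `i < 0`) that the trivial matrix assignment
puts at the index `i`. -/
def trivialCoeff (S : Realization (Fin n) r) (i : ℤ) : Matrix (Fin n) (Fin n) ℂ :=
  if 0 ≤ i then -S.coeff i.natAbs else S.coeff i.natAbs

/-- The Fiedler matrices `M_i^P` of `P(λ)`. -/
def fiedlerP (S : Realization (Fin n) r) (m : ℕ) (i : ℤ) :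
    Matrix (Fin m × Fin n) (Fin m × Fin n) ℂ :=
  elem m i (trivialCoeff S i)

/-- The Fiedler matrices of the system matrix of `S`. -/
def fiedlerS (S : Realization (Fin n) r) (m : ℕ) (i : ℤ) :
    Matrix ((Fin m × Fin n) ⊕ Fin r) ((Fin m × Fin n) ⊕ Fin r) ℂ :=
  if i = 0 then
    Matrix.fromBlocks (fiedlerP S m 0) (-colBlock (stdCol m m) S.C)
      (-rowBlock (stdCol m m) S.B) (-S.A)
  else if i = -(m : ℤ) then Matrix.fromBlocks (fiedlerP S m i) 0 0 (-S.E)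
  else if 0 < i then border r (fiedlerP S m i)
  else (border r (fiedlerP S m (-i)))⁻¹

/-- `M_t(X)` for an index tuple `t` with a matrix assignment `X`. Such a pair is represented by
the list of the pairs `(t_j, X_j)`. -/
def assignProd (m : ℕ) (x : List (ℤ × Matrix (Fin n) (Fin n) ℂ)) :
    Matrix (Fin m × Fin n) (Fin m × Fin n) ℂ :=
  (x.map fun p => elem m p.1 p.2).prod

/-- The `(mn + r) × (mn + r)` version of `M_t(X)`, a product of matrices `diag(M_i(X), I_r)`. -/
def assignProdS (m r : ℕ) (x : List (ℤ × Matrix (Fin n) (Fin n) ℂ)) :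
    Matrix ((Fin m × Fin n) ⊕ Fin r) ((Fin m × Fin n) ⊕ Fin r) ℂ :=
  (x.map fun p => border r (elem m p.1 p.2)).prod

/-- The index tuple underlying a tuple with a matrix assignment. -/
def indices (x : List (ℤ × Matrix (Fin n) (Fin n) ℂ)) : List ℤ := x.map Prod.fst

/-- The tuple `t` with the trivial matrix assignment. -/
def trivialAssign (S : Realization (Fin n) r) (t : List ℤ) :
    List (ℤ × Matrix (Fin n) (Fin n) ℂ) :=
  t.map fun i => (i, trivialCoeff S i)

/-- A nonsingular matrix assignment: the matrices at positions occupied by `0` or `-m` are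
nonsingular. -/
def IsNonsingular (m : ℕ) (x : List (ℤ × Matrix (Fin n) (Fin n) ℂ)) : Prop :=
  ∀ p ∈ x, p.1 = 0 ∨ p.1 = -(m : ℤ) → IsUnit p.2.det

/-- The matrices at positions occupied by `0` or `-m` are nonzero. -/
def IsNonzero (m : ℕ) (x : List (ℤ × Matrix (Fin n) (Fin n) ℂ)) : Prop :=
  ∀ p ∈ x, p.1 = 0 ∨ p.1 = -(m : ℤ) → p.2 ≠ 0

end Fiedler

/-! ## Generalized Fiedler pencils with repetition -/

/-- The data that define a GFPR: `h`, permutations `σ` of `{0 : h}` and `τ` of `{-m : -h-1}`,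
and tuples `σ₁, σ₂` with indices in `{0 : h-1}` and `τ₁, τ₂` with indices in `{-m : -h-2}`, each
with an arbitrary matrix assignment. -/
structure Data (m n : ℕ) where
  h : ℕ
  h_lt : h < m
  σ : List ℤ
  τ : List ℤ
  σ₁ : List (ℤ × Matrix (Fin n) (Fin n) ℂ)
  σ₂ : List (ℤ × Matrix (Fin n) (Fin n) ℂ)
  τ₁ : List (ℤ × Matrix (Fin n) (Fin n) ℂ)
  τ₂ : List (ℤ × Matrix (Fin n) (Fin n) ℂ)
  σ_perm : σ.Perm (str 0 h)
  τ_perm : τ.Perm (str (-(m : ℤ)) (-(h : ℤ) - 1))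
  σ₁_mem : ∀ i ∈ indices σ₁, 0 ≤ i ∧ i ≤ (h : ℤ) - 1
  σ₂_mem : ∀ i ∈ indices σ₂, 0 ≤ i ∧ i ≤ (h : ℤ) - 1
  τ₁_mem : ∀ i ∈ indices τ₁, -(m : ℤ) ≤ i ∧ i ≤ -(h : ℤ) - 2
  τ₂_mem : ∀ i ∈ indices τ₂, -(m : ℤ) ≤ i ∧ i ≤ -(h : ℤ) - 2
  sip_σ : SIP (indices σ₁ ++ σ ++ indices σ₂)
  sip_τ : SIP (indices τ₁ ++ τ ++ indices τ₂)

section Pencils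

variable {m n r : ℕ}

/-- The GFPR of the system matrix of `S` with the given data. -/
def Data.gfpr (D : Data m n) (S : Realization (Fin n) r) :
    Matrix ((Fin m × Fin n) ⊕ Fin r) ((Fin m × Fin n) ⊕ Fin r) ℂ[X] :=
  (assignProdS m r D.τ₁).map Polynomial.C * (assignProdS m r D.σ₁).map Polynomial.C *
    pencil (D.τ.map (fiedlerS S m)).prod (D.σ.map (fiedlerS S m)).prod *
    (assignProdS m r D.σ₂).map Polynomial.C * (assignProdS m r D.τ₂).map Polynomial.C

/-- All four matrix assignments of the data are nonsingular. -/
def Data.Nonsingular (D : Data m n) : Prop :=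
  IsNonsingular m D.σ₁ ∧ IsNonsingular m D.σ₂ ∧ IsNonsingular m D.τ₁ ∧ IsNonsingular m D.τ₂

/-- No matrix that the data assign to a position occupied by `0` or `-m` is zero. -/
def Data.Nonzero (D : Data m n) : Prop :=
  IsNonzero m D.σ₁ ∧ IsNonzero m D.σ₂ ∧ IsNonzero m D.τ₁ ∧ IsNonzero m D.τ₂

/-- The tuple `v_h`: `v_h + m` is the simple admissible tuple of `{0 : m-h-1}`. -/
def vTuple (m h : ℕ) : List ℤ := (simpleTuple (m - h - 1)).map fun i => i - (m : ℤ)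

/-- The tuple `c_{v_h}`: `c_{v_h} + m` is the symmetric complement of `v_h + m`. -/
def vComplement (m h : ℕ) : List ℤ := (simpleComplement (m - h - 1)).map fun i => i - (m : ℤ)

/-- The pencil `L_P(h, t_w, t_v, 𝒳, 𝒴)`, where `x` is `t_w` with the assignment `𝒳` and `y` is
`t_v` with the assignment `𝒴`. -/
def symmPencilP (S : Realization (Fin n) r) (m h : ℕ)
    (x y : List (ℤ × Matrix (Fin n) (Fin n) ℂ)) :
    Matrix (Fin m × Fin n) (Fin m × Fin n) ℂ[X] :=
  (assignProd m (y ++ x)).map Polynomial.C *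
    pencil ((vTuple m h).map (fiedlerP S m)).prod ((simpleTuple h).map (fiedlerP S m)).prod *
    (assignProd m (trivialAssign S (simpleComplement h ++ vComplement m h))).map Polynomial.C *
    (assignProd m (x.reverse ++ y.reverse)).map Polynomial.C

/-- The pencil `𝕃_S(h, t_w, t_v, 𝒳, 𝒴)`, where `x` is `t_w` with the assignment `𝒳` and `y` is
`t_v` with the assignment `𝒴`. -/
def symmPencilS (S : Realization (Fin n) r) (m h : ℕ)
    (x y : List (ℤ × Matrix (Fin n) (Fin n) ℂ)) :
    Matrix ((Fin m × Fin n) ⊕ Fin r) ((Fin m × Fin n) ⊕ Fin r) ℂ[X] :=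
  (assignProdS m r (y ++ x)).map Polynomial.C *
    pencil ((vTuple m h).map (fiedlerS S m)).prod ((simpleTuple h).map (fiedlerS S m)).prod *
    (assignProdS m r (trivialAssign S (simpleComplement h ++ vComplement m h))).map
      Polynomial.C *
    (assignProdS m r (x.reverse ++ y.reverse)).map Polynomial.C

/-- `t_w` is in canonical form for `h`, and `t_v + m` is in canonical form for `m - h - 1`. -/
def IsCanonicalPair (m h : ℕ) (x y : List (ℤ × Matrix (Fin n) (Fin n) ℂ)) : Prop :=
  IsCanonical h (indices x) ∧ IsCanonical (m - h - 1) ((indices y).map fun i => i + (m : ℤ))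

end Pencils

end GFPR

end

open GFPR

open scoped Polynomial

noncomputable section

namespace GFPR

/-! ## Index tuples -/

/-! An $mn\times mn$ matrix is regarded as an $m\times m$ matrix over the ring $\mathcal A$ of
$n\times n$ matrices, with one extra border index that stands for the state space. If the levels are
counted from the last block for the indices $k\ge0$ and from the first block for the indices $k-m$,
every elementary matrix becomes the same letter `glet` at level $k$: the block $[X,1;1,0]$ on the
levels $k,k-1$ for $k\ge1$, and $X$ alone at level $0$. Only the Fiedler matrix of index $0$ of the
system is different: it couples level $0$ to the border. The words in nonnegative indices and those
in negative indices act on disjoint sets of levels. So a GFPR is a pencil of two block matrices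
(`Data.gfpr_eq`), each of them a product of two one-sided words, and symmetry can be examined on
each side separately (`symm_mul_iff`).

Direct part of (a). A letter multiplies only one column by its matrix. The SIP ensures that the
entries of this column are still central at that moment, so the transpose of a word is the reversed
word although $\mathcal A$ is not commutative (`wprod_sip`). The words of the theorem equal their
reversals up to commuting letters (`symmWord_transpose`). The border row and column of a word are
unit vectors, whose position is found by following $0,1,2,\dots$ through the word (`wprod_row`).
This gives the positions of $B$ and $C$.

Converse. The pair $(M_{\sigma_1}M_\sigma M_{\sigma_2},\,M_{\sigma_1}M_{\sigma_2})$ arises from a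
pair with a smaller largest index by adding the new largest letter and one descending string on one
side (`gen_of_words`, `Cls`). If both matrices are symmetric, the comparison of a last row with a
last column shows that the smaller pair begins on the other side with the reversed string
(`Cls.swap`). The string can be recovered from a single row because its last matrix is not zero
(`chain_rigid`). What remains is a symmetric pair two levels lower (`symm_of_chain`), and induction
in steps of two produces the canonical form (`Cls.exists_word`). In the odd case the induction would
end with a letter $0$ that equals a repeated letter $0$, which is impossible at the border; hence
$h$ is even. Block symmetry of the pencil yields symmetry of both block matrices, border included,
because minimality with $r\ge1$ makes $B$ and $C$ nonzero.

Part (b). Under the nonsingularity assumptions all factors around the proper generalized Fiedler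
pencil are invertible (`symmData_eq_mul`). Such a pencil reduces to level $0$ by Horner's rule
carried out with shears and letters (`topDiag_sub_prod`, `smul_prod_sub_rv_prod`), which gives the
unimodular equivalence. Minimality is inherited because multiplying a transfer function by
polynomial matrices does not raise the state dimension (division by $\lambda E-A$). At infinity the
same reduction is applied in $1/\lambda$ over the ring `limRing` of rational functions with a limit,
with the two sides exchanged and with $C(\lambda E-A)^{-1}B$ absorbed into $A_0$ by a Schur
complement. -/

/-- Every occurrence of `j` in `t` is followed by a later occurrence of `j + 1`. -/
def LastOK (j : ℤ) (t : List ℤ) : Prop := ∀ l₁ l₂, t = l₁ ++ j :: l₂ → j + 1 ∈ l₂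

theorem lastOK_nil (j : ℤ) : LastOK j [] := by
  intro l₁ l₂ h; simp at h

/-- The update rule for inductions from the right: appending $k$ blocks $k$, releases $k-1$ and does
not affect the other indices. -/
theorem lastOK_concat (j k : ℤ) (t : List ℤ) :
    LastOK j (t ++ [k]) ↔ k ≠ j ∧ (k = j + 1 ∨ LastOK j t) := by
  constructor
  · intro h
    refine ⟨?_, ?_⟩
    · rintro rfl
      simpa using h t [] rfl
    · by_contra! hc
      obtain ⟨h1, h2⟩ := hc
      apply h2
      intro l₁ l₂ ht
      have := h l₁ (l₂ ++ [k]) (by simp [ht])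
      simp only [List.mem_append, List.mem_singleton] at this
      rcases this with h | h
      · exact h
      · exact absurd h.symm h1
  · rintro ⟨h1, h2⟩ l₁ l₂ ht
    rcases List.eq_nil_or_concat l₂ with rfl | ⟨l, b, rfl⟩
    · have : t ++ [k] = l₁ ++ [j] := ht
      have := List.append_inj_right' this rfl
      simp at this; exact absurd this h1
    · have h3 : t ++ [k] = (l₁ ++ j :: l) ++ [b] := by simpa using ht
      have h4 := List.append_inj_left' h3 rfl
      have h5 := List.append_inj_right' h3 rfl
      simp only [List.cons.injEq, and_true] at h5
      rcases h2 with h2 | h2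
      · simp [← h5, h2]
      · simp [h2 _ _ h4]

theorem sip_iff (t : List ℤ) :
    SIP t ↔ ∀ (j : ℤ) (l₁ l₂ l₃ : List ℤ), t = l₁ ++ j :: (l₂ ++ j :: l₃) → j + 1 ∈ l₂ := by
  constructor
  · intro h j l₁ l₂ l₃ ht
    obtain ⟨c, h1, h2, h3⟩ := h l₁.length (l₁.length + 1 + l₂.length) j (by omega)
      (by simp [ht]) (by
        rw [ht, List.getElem?_append_right (by omega)]
        rw [show l₁.length + 1 + l₂.length - l₁.length = l₂.length + 1 by omega]
        simp)
    rw [ht, List.getElem?_append_right (by omega)] at h3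
    obtain ⟨d, rfl⟩ : ∃ d, c = l₁.length + (d + 1) := ⟨c - l₁.length - 1, by omega⟩
    rw [show l₁.length + (d + 1) - l₁.length = d + 1 by omega, List.getElem?_cons_succ,
      List.getElem?_append_left (by omega)] at h3
    exact List.mem_of_getElem? h3
  · intro h a b x hab ha hb
    obtain ⟨hb', hbx⟩ := List.getElem?_eq_some_iff.1 hb
    obtain ⟨ha', hax⟩ := List.getElem?_eq_some_iff.1 ha
    have e1 : t = t.take b ++ x :: t.drop (b + 1) := by
      conv_lhs => rw [← List.take_append_drop b t, List.drop_eq_getElem_cons hb', hbx]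
    have hal : a < (t.take b).length := by simp; omega
    have e2 : t.take b = (t.take b).take a ++ x :: (t.take b).drop (a + 1) := by
      conv_lhs => rw [← List.take_append_drop a (t.take b), List.drop_eq_getElem_cons hal]
      simp [hax]
    have := h x ((t.take b).take a) ((t.take b).drop (a + 1)) (t.drop (b + 1)) (by
      conv_lhs => rw [e1, e2]
      simp)
    obtain ⟨d, hd, hdx⟩ := List.getElem_of_mem this
    simp only [List.length_drop, List.length_take] at hd
    refine ⟨a + 1 + d, by omega, by omega, ?_⟩
    rw [List.getElem?_eq_some_iff]
    refine ⟨by omega, ?_⟩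
    simpa using hdx

theorem sip_nil : SIP [] := by
  rw [sip_iff]; intro j l₁ l₂ l₃ h; simp at h

theorem sip_infix {s t : List ℤ} (h : s <:+: t) (ht : SIP t) : SIP s := by
  obtain ⟨p, q, rfl⟩ := h
  rw [sip_iff] at ht ⊢
  intro j l₁ l₂ l₃ hs
  exact ht j (p ++ l₁) l₂ (l₃ ++ q) (by simp [hs])

theorem sip_reverse {t : List ℤ} (h : SIP t) : SIP t.reverse := by
  rw [sip_iff] at h ⊢
  intro j l₁ l₂ l₃ ht
  have := h j l₃.reverse l₂.reverse l₁.reverse (by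
    rw [← List.reverse_reverse t, ht]; simp)
  simpa using this

theorem sip_map_add {t : List ℤ} (d : ℤ) (h : SIP t) : SIP (t.map (· + d)) := by
  intro a b x hab ha hb
  simp only [List.getElem?_map, Option.map_eq_some_iff] at ha hb ⊢
  obtain ⟨y, hy, rfl⟩ := ha
  obtain ⟨z, hz, hzy⟩ := hb
  obtain rfl : z = y := by omega
  obtain ⟨c, h1, h2, h3⟩ := h a b z hab hy hz
  exact ⟨c, h1, h2, _, h3, by ring⟩

theorem sip_concat (t : List ℤ) (k : ℤ) : SIP (t ++ [k]) ↔ SIP t ∧ LastOK k t := by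
  constructor
  · intro h
    refine ⟨sip_infix ⟨[], [k], by simp⟩ h, ?_⟩
    intro l₁ l₂ ht
    rw [sip_iff] at h
    exact h k l₁ l₂ [] (by simp [ht])
  · rintro ⟨h1, h2⟩
    rw [sip_iff] at h1 ⊢
    intro j l₁ l₂ l₃ ht
    rcases List.eq_nil_or_concat l₃ with rfl | ⟨l, b, rfl⟩
    · have h3 : t ++ [k] = (l₁ ++ j :: l₂) ++ [j] := by simpa using ht
      have h4 := List.append_inj_left' h3 rfl
      have h5 := List.append_inj_right' h3 rfl
      simp only [List.cons.injEq, and_true] at h5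
      subst h5
      exact h2 _ _ h4
    · have h3 : t ++ [k] = (l₁ ++ j :: (l₂ ++ j :: l)) ++ [b] := by simpa using ht
      exact h1 j l₁ l₂ l (List.append_inj_left' h3 rfl)

/-- One step of the automaton that checks the SIP at the index `j`. The state is `none` after a
violation, and otherwise tells whether `j` may come next. -/
def sipStep (j : ℤ) (s : Option Bool) (k : ℤ) : Option Bool :=
  if k = j then (if s = some true then some false else none)
  else if k = j + 1 then s.map fun _ => true
  else s

/-- The last two clauses are the invariant of the induction. They let the SIP of explicit tuples be
checked by evaluating folds, one index $j$ at a time. -/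
theorem sipRun_eq (j : ℤ) (t : List ℤ) :
    ((t.foldl (sipStep j) (some true) ≠ none) ↔
      ∀ l₁ l₂ l₃ : List ℤ, t = l₁ ++ j :: (l₂ ++ j :: l₃) → j + 1 ∈ l₂) ∧
    (t.foldl (sipStep j) (some true) = some true →  LastOK j t) ∧
    (t.foldl (sipStep j) (some true) = some false → ¬ LastOK j t) := by
  induction t using List.reverseRecOn with
  | nil => simp [lastOK_nil]
  | append_singleton t k ih =>
    have key : (∀ l₁ l₂ l₃ : List ℤ, t ++ [k] = l₁ ++ j :: (l₂ ++ j :: l₃) → j + 1 ∈ l₂) ↔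
        (∀ l₁ l₂ l₃ : List ℤ, t = l₁ ++ j :: (l₂ ++ j :: l₃) → j + 1 ∈ l₂) ∧
          (k = j → LastOK j t) := by
      constructor
      · intro h
        refine ⟨fun l₁ l₂ l₃ ht => h l₁ l₂ (l₃ ++ [k]) (by simp [ht]), ?_⟩
        rintro rfl l₁ l₂ ht
        exact h l₁ l₂ [] (by simp [ht])
      · rintro ⟨h1, h2⟩ l₁ l₂ l₃ ht
        rcases List.eq_nil_or_concat l₃ with rfl | ⟨l, b, rfl⟩
        · have h3 : t ++ [k] = (l₁ ++ j :: l₂) ++ [j] := by simpa using ht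
          have h4 := List.append_inj_left' h3 rfl
          have h5 := List.append_inj_right' h3 rfl
          simp only [List.cons.injEq, and_true] at h5
          exact h2 h5 _ _ h4
        · have h3 : t ++ [k] = (l₁ ++ j :: (l₂ ++ j :: l)) ++ [b] := by simpa using ht
          exact h1 l₁ l₂ l (List.append_inj_left' h3 rfl)
    rw [key, lastOK_concat, List.foldl_append, List.foldl_cons, List.foldl_nil]
    obtain ⟨i1, i2, i3⟩ := ih
    rw [← i1]
    generalize List.foldl (sipStep j) (some true) t = s at *
    rcases s with _ | _ | _
    · by_cases h1 : k = j <;> by_cases h2 : k = j + 1 <;> simp [sipStep, h1, h2]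
    · have := i3 rfl
      by_cases h1 : k = j
      · simp [sipStep, h1, this]
      · by_cases h2 : k = j + 1 <;> simp [sipStep, h1, h2, this]
    · have := i2 rfl
      by_cases h1 : k = j
      · simp [sipStep, h1, this]
      · by_cases h2 : k = j + 1 <;> simp [sipStep, h1, h2, this]

theorem sip_iff_run (t : List ℤ) :
    SIP t ↔ ∀ j, t.foldl (sipStep j) (some true) ≠ none := by
  rw [sip_iff]
  exact forall_congr' fun j => ((sipRun_eq j t).1).symm

theorem sipRun_of_forall_ne (j : ℤ) (t : List ℤ) (s : Option Bool)
    (h : ∀ k ∈ t, k ≠ j ∧ k ≠ j + 1) : t.foldl (sipStep j) s = s := by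
  induction t generalizing s with
  | nil => rfl
  | cons k t ih =>
    have hk := h k (by simp)
    rw [List.foldl_cons, ih _ fun l hl => h l (by simp [hl])]
    simp [sipStep, hk]

/-! ### Strings -/

theorem str_eq (a b : ℤ) :
    str a b = (List.range (b + 1 - a).toNat).map fun i : ℕ => a + (i : ℤ) := by
  simp [str, ← List.map_eq_flatMap, Function.comp_def, List.map_map]

theorem admissibleTuple_eq (h p : ℕ) : admissibleTuple h p =
    ((List.range ((h - p) / 2)).flatMap fun i : ℕ => str ((h : ℤ) - 1 - 2 * i) ((h : ℤ) - 2 * i)) ++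
      str 0 p := by
  simp [admissibleTuple, ← List.map_eq_flatMap, List.flatMap_map]

theorem symmComplement_eq (h p : ℕ) : symmComplement h p =
    ((List.range ((h - p) / 2)).map fun i : ℕ => (h : ℤ) - 1 - 2 * i) ++
      ((List.range p).flatMap fun i : ℕ => str 0 ((p : ℤ) - 1 - i)) := by
  simp [symmComplement, ← List.map_eq_flatMap, Function.comp_def, List.map_map, List.flatMap_map]

theorem mem_str {a b k : ℤ} : k ∈ str a b ↔ a ≤ k ∧ k ≤ b := by
  simp only [str_eq, List.mem_map, List.mem_range]
  constructor
  · rintro ⟨i, hi, rfl⟩; omega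
  · intro h; exact ⟨(k - a).toNat, by omega, by omega⟩

theorem str_of_lt {a b : ℤ} (h : b < a) : str a b = [] := by
  simp [str_eq, show (b + 1 - a).toNat = 0 by omega]

theorem str_succ {a b : ℤ} (h : a ≤ b + 1) : str a (b + 1) = str a b ++ [b + 1] := by
  simp only [str_eq]
  rw [show (b + 1 + 1 - a).toNat = (b + 1 - a).toNat + 1 by omega, List.range_succ]
  simp; omega

theorem str_cons {a b : ℤ} (h : a ≤ b) : str a b = a :: str (a + 1) b := by
  simp only [str_eq]
  rw [show (b + 1 - a).toNat = (b + 1 - (a + 1)).toNat + 1 by omega, List.range_succ_eq_map]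
  simp only [List.map_cons, List.map_map, Function.comp_def, Nat.cast_zero, add_zero]
  congr 2
  ext i; push_cast; ring

theorem str_append {a b c : ℤ} (h1 : a ≤ b + 1) (h2 : b ≤ c) :
    str a c = str a b ++ str (b + 1) c := by
  obtain ⟨n, rfl⟩ : ∃ n : ℕ, c = b + n := ⟨(c - b).toNat, by omega⟩
  clear h2
  induction n with
  | zero => simp [str_of_lt (show b < b + 1 by omega)]
  | succ n ih =>
    have e : b + ((n + 1 : ℕ) : ℤ) = (b + n) + 1 := by push_cast; ring
    rw [e, str_succ (by omega), ih, str_succ (a := b + 1) (by omega), List.append_assoc]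

theorem str_map_add (a b d : ℤ) : (str a b).map (· + d) = str (a + d) (b + d) := by
  simp only [str_eq, List.map_map, Function.comp_def]
  rw [show b + d + 1 - (a + d) = b + 1 - a by ring]
  congr 1; ext; ring

theorem str_nodup (a b : ℤ) : (str a b).Nodup := by
  rw [str_eq]
  refine List.Nodup.map ?_ List.nodup_range
  intro i j h; simpa using h

/-! ### Simple admissible tuples -/

theorem simpleTuple_zero : simpleTuple 0 = [0] := by decide
theorem simpleTuple_one : simpleTuple 1 = [0, 1] := by decide
theorem simpleComplement_zero : simpleComplement 0 = [] := by decide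
theorem simpleComplement_one : simpleComplement 1 = [0] := by decide

/-- The explicit families of tuples are handled through recursions in steps of two of this kind,
which fit the induction that peels off two levels at a time. -/
theorem simpleTuple_add_two (h : ℕ) :
    simpleTuple (h + 2) = ((h : ℤ) + 1) :: ((h : ℤ) + 2) :: simpleTuple h := by
  have e : (h + 2 - (h + 2) % 2) / 2 = (h - h % 2) / 2 + 1 := by omega
  simp only [simpleTuple, admissibleTuple_eq, e, List.range_succ_eq_map]
  simp only [List.flatMap_cons, List.flatMap_map, List.append_assoc]
  have h1 : str (((h + 2 : ℕ) : ℤ) - 1 - 2 * ((0 : ℕ) : ℤ)) (((h + 2 : ℕ) : ℤ) - 2 * ((0 : ℕ) : ℤ)) =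
      [(h : ℤ) + 1, (h : ℤ) + 2] := by
    rw [str_cons (by push_cast; omega), str_cons (by push_cast; omega),
      str_of_lt (by push_cast; omega)]
    simp; ring
  rw [h1]
  have h2 : (h + 2) % 2 = h % 2 := by omega
  rw [h2]
  simp only [List.cons_append, List.nil_append]
  congr 4
  ext i : 1
  congr 1 <;> push_cast <;> ring

theorem simpleComplement_add_two (h : ℕ) :
    simpleComplement (h + 2) = ((h : ℤ) + 1) :: simpleComplement h := by
  have e : (h + 2 - (h + 2) % 2) / 2 = (h - h % 2) / 2 + 1 := by omega
  simp only [simpleComplement, symmComplement_eq, e, List.range_succ_eq_map]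
  have h2 : (h + 2) % 2 = h % 2 := by omega
  rw [h2]
  simp only [List.map_cons, List.map_map, List.cons_append, Function.comp_def]
  congr 1
  · push_cast; ring
  · congr 3
    ext i : 1
    push_cast; ring

theorem mem_simpleTuple {h : ℕ} {k : ℤ} (hk : k ∈ simpleTuple h) : 0 ≤ k ∧ k ≤ h := by
  induction h using Nat.twoStepInduction with
  | zero => simp [simpleTuple_zero] at hk; omega
  | one => simp [simpleTuple_one] at hk; omega
  | more h ih _ =>
    rw [simpleTuple_add_two] at hk
    simp only [List.mem_cons] at hk
    push_cast
    rcases hk with rfl | rfl | hk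
    · omega
    · omega
    · have := ih hk; omega

/-- The last clause is where parity enters the linearization: for even $h$ the complement avoids
$0$, the one index at which a coefficient matrix has to be invertible for its letter to be so. -/
theorem mem_simpleComplement {h : ℕ} {k : ℤ} (hk : k ∈ simpleComplement h) :
    0 ≤ k ∧ k ≤ (h : ℤ) - 1 ∧ (Even h → k ≠ 0) := by
  induction h using Nat.twoStepInduction with
  | zero => simp [simpleComplement_zero] at hk
  | one => simp [simpleComplement_one] at hk; simp [hk]
  | more h ih _ =>
    rw [simpleComplement_add_two] at hk
    simp only [List.mem_cons] at hk
    push_cast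
    rcases hk with rfl | hk
    · omega
    · have := ih hk
      refine ⟨this.1, by omega, fun he => this.2.2 ?_⟩
      rw [Nat.even_add] at he; simpa using he

theorem simpleTuple_perm (h : ℕ) : (simpleTuple h).Perm (str 0 h) := by
  induction h using Nat.twoStepInduction with
  | zero => decide
  | one => decide
  | more h ih _ =>
    rw [simpleTuple_add_two]
    have : str 0 ((h + 2 : ℕ) : ℤ) = str 0 h ++ [(h : ℤ) + 1, (h : ℤ) + 2] := by
      rw [show ((h + 2 : ℕ) : ℤ) = ((h : ℤ) + 1) + 1 by push_cast; ring, str_succ (by omega),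
        str_succ (by omega)]
      simp; ring
    rw [this]
    exact (ih.append_left [(h : ℤ) + 1, (h : ℤ) + 2]).trans List.perm_append_comm

/-! ### Canonical forms -/

theorem isCanonical_of_le_one {h : ℕ} (hh : h ≤ 1) {t : List ℤ} : IsCanonical h t ↔ t = [] := by
  have : h / 2 = 0 := by omega
  simp [IsCanonical, this]

theorem isCanonical_add_two {h : ℕ} {t : List ℤ} :
    IsCanonical (h + 2) t ↔ ∃ (a : ℕ) (t' : List ℤ), IsCanonical h t' ∧ t = str a h ++ t' := by
  have e : (h + 2) / 2 = h / 2 + 1 := by omega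
  have aux : ∀ a : ℕ → ℕ, ((List.range ((h + 2) / 2)).flatMap fun i =>
      str (a i) (((h + 2 : ℕ) : ℤ) - 2 * (i + 1))) = str (a 0) h ++
        (List.range (h / 2)).flatMap fun i => str (a (i + 1)) ((h : ℤ) - 2 * (i + 1)) := by
    intro a
    rw [e, List.range_succ_eq_map]
    simp only [List.flatMap_cons, List.flatMap_map]
    congr 1
    · congr 1; push_cast; ring
    · congr 1; ext i : 1; congr 1; push_cast; ring
  constructor
  · rintro ⟨a, rfl⟩
    exact ⟨a 0, _, ⟨fun i => a (i + 1), rfl⟩, aux a⟩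
  · rintro ⟨a, _, ⟨b, rfl⟩, rfl⟩
    exact ⟨fun i => Nat.casesOn i a b, (aux fun i => Nat.casesOn i a b).symm⟩

theorem mem_of_isCanonical {h : ℕ} {t : List ℤ} (ht : IsCanonical h t) {k : ℤ} (hk : k ∈ t) :
    0 ≤ k ∧ k ≤ (h : ℤ) - 2 := by
  induction h using Nat.twoStepInduction generalizing t with
  | zero => rw [isCanonical_of_le_one (by omega)] at ht; simp [ht] at hk
  | one => rw [isCanonical_of_le_one (by omega)] at ht; simp [ht] at hk
  | more h ih _ =>
    obtain ⟨a, t', ht', rfl⟩ := isCanonical_add_two.1 ht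
    rcases List.mem_append.1 hk with hk | hk
    · rw [mem_str] at hk; push_cast; omega
    · have := ih ht' hk; push_cast; omega

/-- Below the end of the string, $j$ is either followed at once by $j+1$ or absent, so the initial
state is restored. In the reversed string $j+1$ comes before $j$, so no violation occurs from either
admissible state. -/
theorem sipRun_str {j a b : ℤ} (hj : j < b) :
    (str a b).foldl (sipStep j) (some true) = some true ∧
      ∀ v, (str a b).reverse.foldl (sipStep j) (some v) ≠ none := by
  rcases lt_trichotomy a (j + 1) with h | h | h
  · have e : str a b = str a (j - 1) ++ (j :: (j + 1) :: str (j + 2) b) := by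
      rw [str_append (b := j - 1) (by omega) (by omega), show j - 1 + 1 = j by ring,
        str_cons (a := j) (by omega), str_cons (a := j + 1) (by omega),
        show j + 1 + 1 = j + 2 by ring]
    have n1 : ∀ k ∈ str a (j - 1), k ≠ j ∧ k ≠ j + 1 := fun k hk => by rw [mem_str] at hk; omega
    have n2 : ∀ k ∈ str (j + 2) b, k ≠ j ∧ k ≠ j + 1 := fun k hk => by rw [mem_str] at hk; omega
    have n1' : ∀ k ∈ (str a (j - 1)).reverse, k ≠ j ∧ k ≠ j + 1 := fun k hk => n1 k (by simpa using hk)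
    have n2' : ∀ k ∈ (str (j + 2) b).reverse, k ≠ j ∧ k ≠ j + 1 := fun k hk => n2 k (by simpa using hk)
    constructor
    · rw [e, List.foldl_append, sipRun_of_forall_ne _ _ _ n1, List.foldl_cons, List.foldl_cons,
        sipRun_of_forall_ne _ _ _ n2]
      simp [sipStep]
    · intro v
      rw [e, List.reverse_append, List.reverse_cons, List.reverse_cons, List.foldl_append,
        List.foldl_append, List.foldl_append, sipRun_of_forall_ne _ _ _ n2', sipRun_of_forall_ne _ _ _ n1']
      simp [sipStep]
  · subst h
    have e : str (j + 1) b = (j + 1) :: str (j + 2) b := by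
      rw [str_cons (by omega), show j + 1 + 1 = j + 2 by ring]
    have n2 : ∀ k ∈ str (j + 2) b, k ≠ j ∧ k ≠ j + 1 := fun k hk => by rw [mem_str] at hk; omega
    have n2' : ∀ k ∈ (str (j + 2) b).reverse, k ≠ j ∧ k ≠ j + 1 := fun k hk => n2 k (by simpa using hk)
    constructor
    · rw [e, List.foldl_cons, sipRun_of_forall_ne _ _ _ n2]
      simp [sipStep]
    · intro v
      rw [e, List.reverse_cons, List.foldl_append, sipRun_of_forall_ne _ _ _ n2']
      simp [sipStep]
  · have n1 : ∀ k ∈ str a b, k ≠ j ∧ k ≠ j + 1 := fun k hk => by rw [mem_str] at hk; omega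
    refine ⟨sipRun_of_forall_ne _ _ _ n1, fun v => ?_⟩
    rw [sipRun_of_forall_ne _ _ _ fun k hk => n1 k (by simpa using hk)]
    simp

/-- Induction in steps of two, with the outer layer $(a:h),h+1,h+2,\dots,h+1,\mathrm{rev}(a:h)$. For
$j<h$ the opening string restores the initial state, the inner word is covered by induction, and the
closing string cannot fail. For $j\ge h$ only a few letters concern $j$ and they are checked
directly. -/
theorem sip_symm {h : ℕ} {t : List ℤ} (ht : IsCanonical h t) :
    SIP (t ++ simpleTuple h ++ simpleComplement h ++ t.reverse) := by
  induction h using Nat.twoStepInduction generalizing t with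
  | zero =>
    rw [isCanonical_of_le_one (by omega)] at ht; subst ht
    rw [sip_iff_run]; intro j
    simp only [simpleTuple_zero, simpleComplement_zero, List.nil_append, List.append_nil,
      List.reverse_nil, List.foldl_cons, List.foldl_nil, sipStep]
    split_ifs <;> simp
  | one =>
    rw [isCanonical_of_le_one (by omega)] at ht; subst ht
    rw [sip_iff_run]; intro j
    simp only [simpleTuple_one, simpleComplement_one, List.nil_append,
      List.reverse_nil, List.append_nil, List.cons_append, List.foldl_cons, List.foldl_nil, sipStep]
    rcases eq_or_ne j 0 with rfl | h0
    · simp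
    rcases eq_or_ne j 1 with rfl | h1
    · simp
    rcases eq_or_ne j (-1) with rfl | h2
    · simp
    rw [if_neg h0.symm, if_neg (by omega : ¬ (0 : ℤ) = j + 1), if_neg h1.symm,
      if_neg (by omega : ¬ (1 : ℤ) = j + 1), if_neg h0.symm, if_neg (by omega : ¬ (0 : ℤ) = j + 1)]
    simp
  | more h ih _ =>
    obtain ⟨a, t', ht', rfl⟩ := isCanonical_add_two.1 ht
    have IH := ih ht'
    rw [sip_iff_run] at IH ⊢
    intro j
    rw [simpleTuple_add_two, simpleComplement_add_two]
    have mx : ∀ k ∈ str a h, k ≤ h := fun k hk => (mem_str.1 hk).2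
    have mx' : ∀ k ∈ (str a h).reverse, k ≤ h := fun k hk => mx k (by simpa using hk)
    have mt : ∀ k ∈ t', k ≤ (h : ℤ) - 2 := fun k hk => (mem_of_isCanonical ht' hk).2
    have mt' : ∀ k ∈ t'.reverse, k ≤ (h : ℤ) - 2 := fun k hk => mt k (by simpa using hk)
    have mw : ∀ k ∈ simpleTuple h, k ≤ h := fun k hk => (mem_simpleTuple hk).2
    have mc : ∀ k ∈ simpleComplement h, k ≤ (h : ℤ) - 1 := fun k hk => (mem_simpleComplement hk).2.1
    have irr : ∀ (l : List ℤ) (b : ℤ), (∀ k ∈ l, k ≤ b) → b < j → ∀ s, l.foldl (sipStep j) s = s := by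
      intro l b hl hb s
      exact sipRun_of_forall_ne _ _ _ fun k hk => by have := hl k hk; omega
    have IHj := IH j
    simp only [List.reverse_append, List.foldl_append, List.foldl_cons, List.foldl_nil,
      List.append_assoc, List.cons_append] at IHj ⊢
    rcases lt_or_ge j h with hj | hj
    · have s1 : ∀ s, sipStep j s ((h : ℤ) + 1) = s := fun s => by
        simp [sipStep, show (h : ℤ) + 1 ≠ j by omega, show (h : ℤ) ≠ j by omega]
      have s2 : ∀ s, sipStep j s ((h : ℤ) + 2) = s := fun s => by
        simp [sipStep, show (h : ℤ) + 2 ≠ j by omega, show (h : ℤ) + 2 ≠ j + 1 by omega]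
      rw [(sipRun_str hj).1, s1, s1, s2]
      obtain ⟨v, hv⟩ := Option.ne_none_iff_exists'.1 IHj
      rw [hv]
      exact (sipRun_str hj).2 v
    · rw [irr t' _ mt (by omega), irr t'.reverse _ mt' (by omega), irr _ _ mc (by omega)]
      rcases hj.eq_or_lt with hj | hj
      · subst hj
        -- The string and its reverse contain $h$ equally often, at most once, and never $h+1$, so
        -- both lead from the initial state to the same state.
        have hx : ∃ v, (str a h).foldl (sipStep h) (some true) = some v ∧
            (str a h).reverse.foldl (sipStep h) (some true) = some v := by
          rcases lt_or_ge (h : ℤ) a with ha | ha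
          · exact ⟨true, by simp [str_of_lt ha], by simp [str_of_lt ha]⟩
          · have n1 : ∀ k ∈ str a ((h : ℤ) - 1), k ≠ h ∧ k ≠ h + 1 := fun k hk => by
              rw [mem_str] at hk; omega
            have n1' : ∀ k ∈ (str a ((h : ℤ) - 1)).reverse, k ≠ h ∧ k ≠ h + 1 :=
              fun k hk => n1 k (by simpa using hk)
            have e : str a h = str a ((h : ℤ) - 1) ++ [(h : ℤ)] := by
              have := str_succ (a := a) (b := (h : ℤ) - 1) (by omega)
              simpa using this
            refine ⟨false, ?_, ?_⟩
            · rw [e, List.foldl_append, sipRun_of_forall_ne _ _ _ n1]; simp [sipStep]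
            · rw [e, List.reverse_append, List.foldl_append, sipRun_of_forall_ne _ _ _ n1']
              simp [sipStep]
        have hw : (simpleTuple h).foldl (sipStep h) (some true) = some false := by
          have hm : (h : ℤ) ∈ simpleTuple h := (simpleTuple_perm h).mem_iff.2 (mem_str.2 (by omega))
          have nd : (simpleTuple h).Nodup := (simpleTuple_perm h).nodup_iff.2 (str_nodup _ _)
          obtain ⟨l₁, l₂, e⟩ := List.append_of_mem hm
          rw [e] at nd mw ⊢
          rw [List.nodup_middle, List.nodup_cons] at nd
          have n : ∀ k ∈ l₁ ++ l₂, k ≠ h ∧ k ≠ h + 1 := fun k hk =>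
            ⟨fun e => nd.1 (e ▸ hk), by
              have := mw k (by
                rcases List.mem_append.1 hk with h | h
                · simp [h]
                · simp [h])
              omega⟩
          rw [List.foldl_append, sipRun_of_forall_ne _ l₁ _ fun k hk => n k (by simp [hk]),
            List.foldl_cons, sipRun_of_forall_ne _ l₂ _ fun k hk => n k (by simp [hk])]
          simp [sipStep]
        obtain ⟨v, h1, h2⟩ := hx
        rw [h1]
        have e1 : ∀ u, sipStep (h : ℤ) (some u) ((h : ℤ) + 1) = some true := fun u => by simp [sipStep]
        have e2 : ∀ u, sipStep (h : ℤ) u ((h : ℤ) + 2) = u := fun u => by simp [sipStep]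
        rw [e1, e2, hw, e1, h2]
        simp
      · rw [irr _ _ mx hj, irr _ _ mx' hj, irr _ _ mw hj]
        rcases (show (h : ℤ) + 1 ≤ j by omega).eq_or_lt with hj | hj
        · subst hj
          have : (h : ℤ) + 2 = h + 1 + 1 := by ring
          simp [sipStep, this]
        · by_cases h3 : (h : ℤ) + 2 = j
          · subst h3; simp [sipStep]
          · have : (h : ℤ) + 1 ≠ j := by omega
            simp [sipStep, h3, this, show (h : ℤ) ≠ j by omega, show (h : ℤ) + 2 ≠ j + 1 by omega]

/-- The greedy search for the subtuple `(0, 1, …, p)` with the largest `p`. -/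
def greedyStep (p k : ℤ) : ℤ := if k = p + 1 then k else p

theorem greedy_ge (t : List ℤ) (p : ℤ) : p ≤ t.foldl greedyStep p := by
  induction t generalizing p with
  | nil => simp
  | cons k t ih =>
    rw [List.foldl_cons]
    refine le_trans ?_ (ih _)
    unfold greedyStep; split_ifs <;> omega

/-- Taking each required index at its first occurrence leaves the longest remainder, so the greedy
choice is optimal. -/
theorem str_sublist_iff (t : List ℤ) (p q : ℤ) (hpq : p ≤ q) :
    List.Sublist (str (p + 1) q) t ↔ q ≤ t.foldl greedyStep p := by
  induction t generalizing p with
  | nil =>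
    simp only [List.sublist_nil, List.foldl_nil]
    constructor
    · intro h
      by_contra hc
      have : q ∈ str (p + 1) q := mem_str.2 (by omega)
      rw [h] at this; simp at this
    · intro h; exact str_of_lt (by omega)
  | cons k t ih =>
    rcases hpq.eq_or_lt with rfl | hpq
    · rw [str_of_lt (by omega)]
      simpa using greedy_ge (k :: t) p
    · rw [List.foldl_cons]
      by_cases hk : k = p + 1
      · subst hk
        rw [str_cons (by omega), List.cons_sublist_cons, greedyStep, if_pos rfl]
        exact ih (p + 1) (by omega)
      · rw [greedyStep, if_neg hk, ← ih p (by omega), str_cons (by omega)]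
        constructor
        · intro h
          cases h with
          | cons _ h => exact h
          | cons_cons _ h => exact absurd rfl hk
        · intro h; exact h.cons _

theorem greedy_neg_one {t : List ℤ} (h : (0 : ℤ) ∉ t) : t.foldl greedyStep (-1) = -1 := by
  induction t with
  | nil => rfl
  | cons k t ih =>
    simp only [List.mem_cons, not_or] at h
    rw [List.foldl_cons, greedyStep, if_neg (by omega), ih h.2]

/-- The search starts at $-1$ so that it has to find $0$ first; if $0$ is missing it stays at $-1$,
which is the default value of `consec`. -/
theorem consec_zero (t : List ℤ) : consec t 0 = t.foldl greedyStep (-1) := by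
  unfold consec
  split_ifs with h
  · have h0 : 0 ≤ t.foldl greedyStep (-1) := by
      rw [← str_sublist_iff _ _ _ (by omega)]
      simpa [str_cons, str_of_lt] using h
    obtain ⟨q, hq⟩ := Int.eq_ofNat_of_zero_le h0
    rw [hq, Nat.cast_inj, Nat.findGreatest_eq_iff]
    have key : ∀ p : ℕ, List.Sublist (str 0 (0 + p)) t ↔ p ≤ q := by
      intro p
      rw [← Int.ofNat_le, ← hq, ← str_sublist_iff _ _ _ (by omega)]
      simp
    refine ⟨?_, fun _ => (key q).2 le_rfl, fun p hp _ => by rw [key]; omega⟩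
    have := ((key q).2 le_rfl).length_le
    rw [str_eq] at this
    simp at this; omega
  · exact (greedy_neg_one h).symm

theorem invers_zero (t : List ℤ) : invers t 0 = consec t.reverse 0 := by
  simp only [invers, consec, List.mem_reverse, List.length_reverse]
  congr 3
  ext p
  rw [← List.reverse_sublist, List.reverse_reverse]

/-! ## Elementary block matrices over a ring -/

section Entries

variable {ι : Type} [Fintype ι] [DecidableEq ι] {𝓐 : Type} [Ring 𝓐]

/-- One factor differs from the identity only inside $s\times s$, the other only outside, so in each
sum one factor may be replaced by the identity. Since the result does not depend on the order, this
gives both the commutation of distant letters and the separation of the two sides of a GFPR. -/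
theorem mul_of_supp {A B : Matrix ι ι 𝓐} (s : ι → Prop) [DecidablePred s]
    (hA : ∀ a b, (¬ s a ∨ ¬ s b) → A a b = (1 : Matrix ι ι 𝓐) a b)
    (hB : ∀ a b, (s a ∨ s b) → B a b = (1 : Matrix ι ι 𝓐) a b) (a b : ι) :
    (A * B) a b = (if s a then A a b else B a b) ∧ (B * A) a b = (if s a then A a b else B a b) := by
  constructor
  · split_ifs with h
    · rw [← Matrix.mul_one A, Matrix.mul_assoc, Matrix.one_mul, Matrix.mul_apply, Matrix.mul_apply]
      refine Finset.sum_congr rfl fun c _ => ?_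
      by_cases hc : s c
      · rw [hB c b (Or.inl hc)]
      · rw [hA a c (Or.inr hc), Matrix.one_apply_ne (by rintro rfl; exact hc h), zero_mul, zero_mul]
    · rw [← Matrix.one_mul B, Matrix.mul_apply, Matrix.one_mul, ← Matrix.one_mul B, Matrix.mul_apply,
        Matrix.one_mul]
      refine Finset.sum_congr rfl fun c _ => ?_
      rw [hA a c (Or.inl h)]
  · have key : (B * A) a b = if s b then A a b else B a b := by
      split_ifs with h
      · rw [← Matrix.one_mul A, Matrix.mul_apply, Matrix.one_mul, ← Matrix.one_mul A,
          Matrix.mul_apply, Matrix.one_mul]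
        refine Finset.sum_congr rfl fun c _ => ?_
        by_cases hc : s c
        · rw [hB a c (Or.inr hc)]
        · rw [hA c b (Or.inl hc), Matrix.one_apply_ne (by rintro rfl; exact hc h), mul_zero, mul_zero]
      · rw [← Matrix.mul_one B, Matrix.mul_assoc, Matrix.one_mul, Matrix.mul_apply, Matrix.mul_apply]
        refine Finset.sum_congr rfl fun c _ => ?_
        rw [hA c b (Or.inr h)]
    rw [key]
    by_cases h1 : s a <;> by_cases h2 : s b <;> simp only [h1, h2, if_true, if_false]
    · rw [hA a b (Or.inr h2), hB a b (Or.inl h1)]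
    · rw [hA a b (Or.inl h1), hB a b (Or.inr h2)]

theorem commute_of_supp {A B : Matrix ι ι 𝓐} (s : ι → Prop)
    (hA : ∀ a b, (¬ s a ∨ ¬ s b) → A a b = (1 : Matrix ι ι 𝓐) a b)
    (hB : ∀ a b, (s a ∨ s b) → B a b = (1 : Matrix ι ι 𝓐) a b) : Commute A B := by
  classical
  ext a b
  rw [(mul_of_supp s hA hB a b).1, (mul_of_supp s hA hB a b).2]

/-- The matrix with `[X, 1; 1, 0]` at the indices `i, j` that is the identity elsewhere. -/
def swapM (i j : ι) (X : 𝓐) : Matrix ι ι 𝓐 := Matrix.of fun a b =>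
  if a = i then (if b = i then X else if b = j then 1 else 0)
  else if a = j then (if b = i then 1 else 0) else if a = b then 1 else 0

/-- The diagonal matrix with `X` at the index `i` that is the identity elsewhere. -/
def diagM (i : ι) (X : 𝓐) : Matrix ι ι 𝓐 := Matrix.diagonal fun a => if a = i then X else 1

variable (A : Matrix ι ι 𝓐) {i j : ι} (X : 𝓐)

theorem mul_swapM (hij : i ≠ j) (a b : ι) : (A * swapM i j X) a b =
    if b = i then A a i * X + A a j else if b = j then A a i else A a b := by
  have : (A * swapM i j X) a b = ∑ c, (if c = i then A a i * swapM i j X i b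
      else if c = j then A a j * swapM i j X j b
      else if c = b then A a b else 0) := by
    rw [Matrix.mul_apply]
    refine Finset.sum_congr rfl fun c _ => ?_
    by_cases h1 : c = i
    · simp [h1]
    · by_cases h2 : c = j
      · simp [h2, hij.symm]
      · by_cases h3 : c = b
        · subst h3; simp [swapM, h1, h2]
        · simp [swapM, h1, h2, h3]
  rw [this]
  have e : ∀ c, (if c = i then A a i * swapM i j X i b
      else if c = j then A a j * swapM i j X j b
      else if c = b then A a b else 0) = (if c = i then A a i * swapM i j X i b else 0) +
      (if c = j then A a j * swapM i j X j b else 0) +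
      (if c = b then (if b = i ∨ b = j then 0 else A a b) else 0) := by
    intro c
    by_cases h1 : c = i
    · subst h1
      by_cases h3 : c = b
      · subst h3; simp [hij]
      · simp [hij, h3]
    · by_cases h2 : c = j
      · subst h2
        by_cases h3 : c = b
        · subst h3; simp [hij.symm]
        · simp [hij.symm, h3]
      · by_cases h3 : c = b
        · subst h3; simp [h1, h2]
        · simp [h1, h2, h3]
  simp only [e, Finset.sum_add_distrib, Finset.sum_ite_eq', Finset.mem_univ, if_true]
  by_cases h1 : b = i
  · subst h1; simp [swapM, hij.symm]
  · by_cases h2 : b = j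
    · subst h2; simp [swapM, hij.symm]
    · simp [swapM, h1, h2, hij.symm]

theorem swapM_mul (hij : i ≠ j) (a b : ι) : (swapM i j X * A) a b =
    if a = i then X * A i b + A j b else if a = j then A i b else A a b := by
  have : (swapM i j X * A) a b = ∑ c, ((if c = i then swapM i j X a i * A i b else 0) +
      (if c = j then swapM i j X a j * A j b else 0) +
      (if c = a then (if a = i ∨ a = j then 0 else A a b) else 0)) := by
    rw [Matrix.mul_apply]
    refine Finset.sum_congr rfl fun c _ => ?_
    by_cases h1 : c = i
    · subst h1
      by_cases h3 : c = a
      · subst h3; simp [hij]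
      · simp [hij, h3]
    · by_cases h2 : c = j
      · subst h2
        by_cases h3 : c = a
        · subst h3; simp [h1]
        · simp [h1, h3]
      · by_cases h3 : c = a
        · subst h3; simp [h1, h2, swapM]
        · simp [h1, h2, h3, Ne.symm h3, swapM]
  rw [this]
  simp only [Finset.sum_add_distrib, Finset.sum_ite_eq', Finset.mem_univ, if_true]
  by_cases h1 : a = i
  · subst h1; simp [swapM, hij.symm]
  · by_cases h2 : a = j
    · subst h2; simp [swapM, hij.symm]
    · simp [swapM, h1, h2]

theorem mul_diagM (a b : ι) : (A * diagM i X) a b = if b = i then A a i * X else A a b := by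
  rw [diagM, Matrix.mul_diagonal]
  split_ifs with h
  · rw [h]
  · simp

theorem diagM_mul (a b : ι) : (diagM i X * A) a b = if a = i then X * A i b else A a b := by
  rw [diagM, Matrix.diagonal_mul]
  split_ifs with h
  · rw [h]
  · simp

theorem diagM_one : diagM i (1 : 𝓐) = 1 := by simp [diagM]

theorem swapM_transpose : (swapM i j X).transpose = swapM i j X := by
  ext a b
  simp only [swapM, Matrix.transpose_apply, Matrix.of_apply]
  by_cases h1 : a = i <;> by_cases h2 : b = i <;> by_cases h3 : a = j <;> by_cases h4 : b = j <;>
    by_cases h5 : a = b <;> simp_all [eq_comm]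

theorem diagM_transpose : (diagM i X).transpose = diagM i X := by simp [diagM]

theorem swapM_apply_of_ne {a b : ι} (h : (a ≠ i ∧ a ≠ j) ∨ (b ≠ i ∧ b ≠ j)) :
    swapM i j X a b = (1 : Matrix ι ι 𝓐) a b := by
  simp only [swapM, Matrix.of_apply, Matrix.one_apply]
  rcases h with h | h
  · simp [h.1, h.2]
  · by_cases h1 : a = i
    · subst h1; simp [h.1, h.2, Ne.symm h.1]
    · by_cases h2 : a = j
      · subst h2; simp [h.1, Ne.symm h.2, h1]
      · simp [h1, h2]

theorem diagM_apply_of_ne {a b : ι} (h : a ≠ i ∨ b ≠ i) :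
    diagM i X a b = (1 : Matrix ι ι 𝓐) a b := by
  simp only [diagM, Matrix.diagonal_apply, Matrix.one_apply]
  by_cases h1 : a = b
  · subst h1; simp at h; simp [h]
  · simp [h1]

end Entries

/-! ### Levels -/

/-- The index type of the block matrices with `m` levels and a border. -/
abbrev Ix (m : ℕ) : Type := Fin m ⊕ Unit

/-- The index of the level `k`. -/
def lv (m k : ℕ) : Ix m := if h : k < m then Sum.inl ⟨k, h⟩ else Sum.inr ()

section Levels

variable {m : ℕ} {𝓐 : Type} [Ring 𝓐]

theorem lv_inj {k l : ℕ} (hk : k < m) (hl : l < m) : lv m k = lv m l ↔ k = l := by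
  simp [lv, hk, hl]

theorem lv_ne {k l : ℕ} (hk : k < m) (hkl : k ≠ l) : lv m k ≠ lv m l := by
  unfold lv; split_ifs <;> simp [hkl]

theorem lv_ne_inr {k : ℕ} (hk : k < m) : lv m k ≠ Sum.inr () := by simp [lv, hk]

theorem lv_cases (i : Ix m) : (∃ k, k < m ∧ i = lv m k) ∨ i = Sum.inr () := by
  rcases i with ⟨k, hk⟩ | ⟨⟩
  · exact Or.inl ⟨k, hk, by simp [lv, hk]⟩
  · exact Or.inr rfl

/-- The elementary matrix with `X` at the level `k`. With the flag `b`, the matrix at the level `0`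
is the one that interacts with the border. -/
def glet (m : ℕ) (b : Bool) (k : ℕ) (X : 𝓐) : Matrix (Ix m) (Ix m) 𝓐 :=
  if k = 0 then (if b then swapM (lv m 0) (Sum.inr ()) X else diagM (lv m 0) X)
  else swapM (lv m k) (lv m (k - 1)) X

theorem glet_of_pos {k : ℕ} (hk : k ≠ 0) (b : Bool) (X : 𝓐) :
    glet m b k X = swapM (lv m k) (lv m (k - 1)) X := by simp [glet, hk]

theorem glet_succ (k : ℕ) (b : Bool) (X : 𝓐) :
    glet m b (k + 1) X = swapM (lv m (k + 1)) (lv m k) X := by simp [glet]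

theorem glet_zero_one : glet m false 0 (1 : 𝓐) = 1 := by simp [glet, diagM_one]

theorem glet_transpose (b : Bool) (k : ℕ) (X : 𝓐) : (glet m b k X).transpose = glet m b k X := by
  unfold glet; split_ifs <;> simp [swapM_transpose, diagM_transpose]

/-- The levels that the letter `k` involves. -/
def gsupp (m : ℕ) (b : Bool) (k : ℕ) (i : Ix m) : Prop :=
  i = lv m k ∨ (k ≠ 0 ∧ i = lv m (k - 1)) ∨ (k = 0 ∧ b = true ∧ i = Sum.inr ())

theorem glet_apply_of_not (b : Bool) (k : ℕ) (X : 𝓐) {i j : Ix m}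
    (h : ¬ gsupp m b k i ∨ ¬ gsupp m b k j) : glet m b k X i j = (1 : Matrix (Ix m) (Ix m) 𝓐) i j := by
  unfold gsupp at h
  unfold glet
  split_ifs with h1 h2
  · apply swapM_apply_of_ne; subst h1; simp [h2] at h; exact h
  · apply diagM_apply_of_ne; subst h1; simp [h2] at h; exact h
  · apply swapM_apply_of_ne; simp [h1] at h; exact h

/-- The letters involve disjoint sets of levels. The border acts as a level below $0$ and is out of
reach of the larger letter, so the flags are arbitrary. -/
theorem glet_commute {b b' : Bool} {k l : ℕ} (hk : k < m) (hl : l < m) (h : k + 2 ≤ l)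
    (X Y : 𝓐) : Commute (glet m b k X) (glet m b' l Y) := by
  refine commute_of_supp (gsupp m b k) (fun i j h => glet_apply_of_not _ _ _ h) fun i j hs =>
    glet_apply_of_not _ _ _ ?_
  have : ∀ i, gsupp m b k i → ¬ gsupp m b' l i := by
    rintro i (rfl | ⟨h0, rfl⟩ | ⟨h0, -, rfl⟩) (h' | ⟨-, h'⟩ | ⟨h', -⟩)
    · rw [lv_inj hk hl] at h'; omega
    · rw [lv_inj hk (by omega)] at h'; omega
    · omega
    · rw [lv_inj (by omega) hl] at h'; omega
    · rw [lv_inj (by omega) (by omega)] at h'; omega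
    · omega
    · exact lv_ne_inr hl h'.symm
    · exact lv_ne_inr (by omega) h'.symm
    · omega
  exact hs.imp (this i) (this j)

/-- An element that commutes with every element of the ring. -/
def Cen (x : 𝓐) : Prop := ∀ y, Commute x y

theorem cen_one_apply {ι : Type} [DecidableEq ι] (i j : ι) : Cen ((1 : Matrix ι ι 𝓐) i j) := by
  intro y
  rw [Matrix.one_apply]; split_ifs
  · exact Commute.one_left y
  · exact Commute.zero_left y

/-- Over a noncommutative ring the transpose of a product is not the reversed product of transposes.
Here only column $k$ of $A$ is multiplied by $X$, the other entries being moved unchanged, so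
central entries in that column suffice. -/
theorem mul_glet_transpose {b : Bool} {k : ℕ} (hk : k < m) {A : Matrix (Ix m) (Ix m) 𝓐} (X : 𝓐)
    (hA : ∀ i, Cen (A i (lv m k))) : (A * glet m b k X).transpose = glet m b k X * A.transpose := by
  ext i j
  rw [Matrix.transpose_apply]
  unfold glet
  split_ifs with h1 h2
  · subst h1
    rw [mul_swapM _ _ (lv_ne_inr hk), swapM_mul _ _ (lv_ne_inr hk)]
    simp only [Matrix.transpose_apply, (hA j X).eq]
  · subst h1
    rw [mul_diagM, diagM_mul]
    simp only [Matrix.transpose_apply, (hA j X).eq]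
  · have := lv_ne hk (show k ≠ k - 1 by omega)
    rw [mul_swapM _ _ this, swapM_mul _ _ this]
    simp only [Matrix.transpose_apply, (hA j X).eq]

/-! ### Words -/

/-- The product of the letters of a word. -/
def wprod (m : ℕ) (t : List (Bool × ℕ × 𝓐)) : Matrix (Ix m) (Ix m) 𝓐 :=
  (t.map fun p => glet m p.1 p.2.1 p.2.2).prod

/-- The index tuple of a word. -/
def widx (t : List (Bool × ℕ × 𝓐)) : List ℤ := t.map fun p => (p.2.1 : ℤ)

theorem wprod_append (s t : List (Bool × ℕ × 𝓐)) : wprod m (s ++ t) = wprod m s * wprod m t := by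
  simp [wprod]

theorem wprod_cons (p : Bool × ℕ × 𝓐) (t : List (Bool × ℕ × 𝓐)) :
    wprod m (p :: t) = glet m p.1 p.2.1 p.2.2 * wprod m t := by
  simp [wprod]

theorem wprod_nil : wprod m ([] : List (Bool × ℕ × 𝓐)) = 1 := rfl

/-- Right multiplication by the letter $k$ changes column $k$ and moves the old column $k$ to $k-1$
(or to the border for $k=0$). Hence the columns of the indices allowed next have central entries,
and the SIP says exactly that each letter is allowed when it comes. Both claims are needed in one
induction. -/
theorem wprod_sip {t : List (Bool × ℕ × 𝓐)} (hm : ∀ p ∈ t, p.2.1 < m) (ht : SIP (widx t)) :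
    (wprod m t).transpose = wprod m t.reverse ∧
      ∀ j, j < m → LastOK j (widx t) → ∀ i, Cen (wprod m t i (lv m j)) := by
  induction t using List.reverseRecOn with
  | nil =>
    simp only [wprod_nil, Matrix.transpose_one, List.reverse_nil, true_and]
    intro j _ _ i; exact cen_one_apply _ _
  | append_singleton t p ih =>
    obtain ⟨b, k, X⟩ := p
    have hk : k < m := hm (b, k, X) (by simp)
    simp only [widx, List.map_append, List.map_cons, List.map_nil] at ht ⊢
    rw [sip_concat] at ht
    obtain ⟨ih1, ih2⟩ := ih (fun p hp => hm p (by simp [hp])) ht.1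
    have hc := ih2 k hk ht.2
    have e : wprod m (t ++ [(b, k, X)]) = wprod m t * glet m b k X := by
      rw [wprod_append, wprod_cons, wprod_nil, mul_one]
    rw [e]
    refine ⟨?_, ?_⟩
    · rw [mul_glet_transpose hk X hc, ih1, List.reverse_append]
      simp [wprod_cons]
    · intro j hj hl i
      rw [lastOK_concat] at hl
      have hkj : k ≠ j := by have := hl.1; omega
      have hne : lv m j ≠ lv m k := lv_ne hj (Ne.symm hkj)
      by_cases h1 : k = 0
      · have hl' : LastOK j (widx t) := by
          refine hl.2.resolve_left ?_; omega
        subst h1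
        cases b
        · simp only [glet, if_true, if_false, Bool.false_eq_true]
          rw [mul_diagM, if_neg hne]
          exact ih2 j hj hl' i
        · simp only [glet, if_true]
          rw [mul_swapM _ _ (lv_ne_inr hk), if_neg hne, if_neg (lv_ne_inr hj)]
          exact ih2 j hj hl' i
      · rw [glet_of_pos h1, mul_swapM _ _ (lv_ne hk (by omega)), if_neg hne]
        split_ifs with h2
        · exact hc i
        · rw [lv_inj hj (by omega)] at h2
          exact ih2 j hj (hl.2.resolve_left (by omega)) i

/-- Reading the word from the left, row $p$ is unaffected by the letters other than $p$ and $p+1$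
and becomes row $p+1$ of the remaining product at the letter $p+1$. The letter $p$, the only one
that would bring in its matrix, is excluded by the SIP before $p+1$ has come. This is the greedy
search. -/
theorem wprod_row {s : List (Bool × ℕ × 𝓐)} (hm : ∀ p ∈ s, p.1 = false ∧ p.2.1 < m) {p : ℕ}
    (hp : p < m) (ht : SIP ((p : ℤ) :: widx s)) :
    ∃ q : ℕ, q < m ∧ (q : ℤ) = (widx s).foldl greedyStep p ∧ (q = p ∨ ∃ x ∈ s, x.2.1 = q) ∧
      ∀ j, wprod m s (lv m p) j = (1 : Matrix (Ix m) (Ix m) 𝓐) (lv m q) j := by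
  induction s generalizing p with
  | nil => exact ⟨p, hp, rfl, Or.inl rfl, fun j => rfl⟩
  | cons x s ih =>
    obtain ⟨b, k, X⟩ := x
    obtain ⟨hb, hk⟩ := hm (b, k, X) (by simp)
    simp only at hb hk
    subst hb
    have hm' : ∀ p ∈ s, p.1 = false ∧ p.2.1 < m := fun p hp => hm p (by simp [hp])
    have ht' : SIP ((k : ℤ) :: widx s) := sip_infix ⟨[(p : ℤ)], [], by simp [widx]⟩ ht
    have hkp : k ≠ p := by
      rintro rfl
      have := (sip_iff _).1 ht k [] [] (widx s) (by simp [widx])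
      simp at this
    simp only [widx, List.map_cons, List.foldl_cons] at ht ⊢
    by_cases h1 : k = p + 1
    · subst h1
      obtain ⟨q, hq, e, h2, h3⟩ := ih hm' hk ht'
      refine ⟨q, hq, by rw [e, greedyStep, if_pos (by push_cast; rfl)]; rfl, ?_, ?_⟩
      · right
        rcases h2 with rfl | ⟨x, hx, rfl⟩
        · exact ⟨_, List.mem_cons_self, rfl⟩
        · exact ⟨x, by simp [hx], rfl⟩
      · intro j
        rw [wprod_cons, glet_succ, swapM_mul _ _ (lv_ne hk (by omega)),
          if_neg (lv_ne hp (by omega)), if_pos rfl, h3]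
    · have ht2 : SIP ((p : ℤ) :: widx s) := by
        rw [sip_iff] at ht ⊢
        intro j l₁ l₂ l₃ e
        rcases l₁ with _ | ⟨y, l₁⟩
        · simp only [List.nil_append, List.cons.injEq] at e
          obtain ⟨rfl, e⟩ := e
          have := ht p [] (k :: l₂) l₃ (by rw [← widx, e]; simp)
          simp only [List.mem_cons] at this
          exact this.resolve_left (by omega)
        · simp only [List.cons_append, List.cons.injEq] at e
          exact ht j (p :: k :: l₁) l₂ l₃ (by rw [← widx, e.2]; simp)
      obtain ⟨q, hq, e, h2, h3⟩ := ih hm' hp ht2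
      refine ⟨q, hq, by rw [e, greedyStep, if_neg (by omega)]; rfl, ?_, ?_⟩
      · rcases h2 with h2 | ⟨x, hx, rfl⟩
        · exact Or.inl h2
        · exact Or.inr ⟨x, by simp [hx], rfl⟩
      · intro j
        rw [wprod_cons, ← h3]
        by_cases h4 : k = 0
        · subst h4
          simp only [glet, if_true, if_false, Bool.false_eq_true]
          rw [diagM_mul, if_neg (lv_ne hp (by omega))]
        · simp only
          rw [glet_of_pos h4, swapM_mul _ _ (lv_ne hk (by omega)), if_neg (lv_ne hp (by omega)),
            if_neg (lv_ne hp (by omega))]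

end Levels

/-! ## The structure of the two coefficients of a GFPR -/

section Triv

variable {ι : Type} [Fintype ι] [DecidableEq ι] {𝓐 : Type} [Ring 𝓐]

/-- The row and the column `i` of `A` are those of the identity. -/
def Triv (A : Matrix ι ι 𝓐) (i : ι) : Prop :=
  ∀ j, A i j = (1 : Matrix ι ι 𝓐) i j ∧ A j i = (1 : Matrix ι ι 𝓐) j i

theorem triv_one (i : ι) : Triv (1 : Matrix ι ι 𝓐) i := fun _ => ⟨rfl, rfl⟩

theorem Triv.mul {A B : Matrix ι ι 𝓐} {i : ι} (hA : Triv A i) (hB : Triv B i) : Triv (A * B) i := by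
  intro j
  constructor
  · rw [Matrix.mul_apply]
    simp only [fun c => (hA c).1, Matrix.one_apply, ite_mul, one_mul, zero_mul, Finset.sum_ite_eq,
      Finset.mem_univ, if_true, (hB j).1]
  · rw [Matrix.mul_apply]
    simp only [fun c => (hB c).2, Matrix.one_apply, mul_ite, mul_one, mul_zero, Finset.sum_ite_eq',
      Finset.mem_univ, if_true, (hA j).2]

theorem Triv.transpose {A : Matrix ι ι 𝓐} {i : ι} (hA : Triv A i) : Triv A.transpose i := by
  intro j
  simp only [Matrix.transpose_apply, (hA j).1, (hA j).2, Matrix.one_apply, eq_comm, and_self]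

theorem commute_of_triv {A B : Matrix ι ι 𝓐} (h : ∀ i, Triv A i ∨ Triv B i) : Commute A B := by
  refine commute_of_supp (fun i => ¬ Triv A i) ?_ ?_
  · rintro a b (h | h)
    · rw [not_not] at h; exact (h b).1
    · rw [not_not] at h; exact (h a).2
  · rintro a b (h' | h')
    · exact ((h a).resolve_left h' b).1
    · exact ((h b).resolve_left h' a).2

end Triv

/-! ### Peeling off the largest index of a pair of SIP words -/

section Gen

variable {m : ℕ} {𝓐 : Type} [Ring 𝓐]

theorem triv_glet {b : Bool} {k : ℕ} {X : 𝓐} {i : Ix m} (h : ¬ gsupp m b k i) :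
    Triv (glet m b k X) i :=
  fun _ => ⟨glet_apply_of_not _ _ _ (Or.inl h), glet_apply_of_not _ _ _ (Or.inr h)⟩

theorem triv_glet_lv {b : Bool} {k l : ℕ} {X : 𝓐} (hl : l < m) (h : l ≠ k) (h' : l + 1 ≠ k) :
    Triv (glet m b k X) (lv m l) := by
  apply triv_glet
  rintro (e | ⟨h0, e⟩ | ⟨-, -, e⟩)
  · exact lv_ne hl h e
  · exact lv_ne hl (by omega) e
  · exact lv_ne_inr hl e

theorem triv_glet_inr {b : Bool} {k : ℕ} {X : 𝓐} (hk : k < m) (h : b = false ∨ k ≠ 0) :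
    Triv (glet m b k X) (Sum.inr ()) := by
  apply triv_glet
  rintro (e | ⟨h0, e⟩ | ⟨h1, h2, -⟩)
  · exact lv_ne_inr hk e.symm
  · exact lv_ne_inr (by omega) e.symm
  · simp [h1, h2] at h

/-- The product of the letters `k - 1, …, c` with the matrices `Z`. -/
def descL (m c : ℕ) (Z : ℕ → 𝓐) : ℕ → Matrix (Ix m) (Ix m) 𝓐
  | 0 => 1
  | k + 1 => if c ≤ k then glet m false k (Z k) * descL m c Z k else 1

/-- The product of the letters `c, …, k - 1` with the matrices `Z`. -/
def ascL (m c : ℕ) (Z : ℕ → 𝓐) : ℕ → Matrix (Ix m) (Ix m) 𝓐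
  | 0 => 1
  | k + 1 => if c ≤ k then ascL m c Z k * glet m false k (Z k) else 1

theorem descL_self (c : ℕ) (Z : ℕ → 𝓐) {k : ℕ} (h : k ≤ c) : descL m c Z k = 1 := by
  cases k with
  | zero => rfl
  | succ k => rw [descL, if_neg (by omega)]

theorem ascL_self (c : ℕ) (Z : ℕ → 𝓐) {k : ℕ} (h : k ≤ c) : ascL m c Z k = 1 := by
  cases k with
  | zero => rfl
  | succ k => rw [ascL, if_neg (by omega)]

theorem descL_extend (c : ℕ) (Z : ℕ → 𝓐) (X : 𝓐) {k : ℕ} (h : c < k) :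
    descL m (c + 1) Z k * glet m false c X = descL m c (Function.update Z c X) k := by
  induction k with
  | zero => omega
  | succ k ih =>
    rcases (show c ≤ k by omega).eq_or_lt with rfl | hc
    · rw [descL_self _ _ le_rfl, descL, if_pos le_rfl, descL_self _ _ le_rfl]; simp
    · rw [descL, if_pos (show c + 1 ≤ k from hc), descL, if_pos hc.le, mul_assoc, ih hc,
        Function.update_of_ne (by omega)]

theorem ascL_extend (c : ℕ) (Z : ℕ → 𝓐) (X : 𝓐) {k : ℕ} (h : c < k) :
    glet m false c X * ascL m (c + 1) Z k = ascL m c (Function.update Z c X) k := by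
  induction k with
  | zero => omega
  | succ k ih =>
    rcases (show c ≤ k by omega).eq_or_lt with rfl | hc
    · rw [ascL_self _ _ le_rfl, ascL, if_pos le_rfl, ascL_self _ _ le_rfl]; simp
    · rw [ascL, if_pos (show c + 1 ≤ k from hc), ascL, if_pos hc.le, ← mul_assoc, ih hc,
        Function.update_of_ne (by omega)]

theorem descL_commute {c k l : ℕ} (Z : ℕ → 𝓐) (X : 𝓐) (hl : l + 2 ≤ c) (hk : k ≤ m) :
    Commute (descL m c Z k) (glet m false l X) := by
  induction k with
  | zero => exact Commute.one_left _
  | succ k ih =>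
    rw [descL]; split_ifs with h
    · exact ((glet_commute (by omega) (by omega) (by omega) X (Z k)).symm).mul_left (ih (by omega))
    · exact Commute.one_left _

theorem ascL_commute {c k l : ℕ} (Z : ℕ → 𝓐) (X : 𝓐) (hl : l + 2 ≤ c) (hk : k ≤ m) :
    Commute (ascL m c Z k) (glet m false l X) := by
  induction k with
  | zero => exact Commute.one_left _
  | succ k ih =>
    rw [ascL]; split_ifs with h
    · exact (ih (by omega)).mul_left (glet_commute (by omega) (by omega) (by omega) X (Z k)).symm
    · exact Commute.one_left _

/-- The letter at `k` of the tuple that carries the coefficients `a`. -/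
def mk (m : ℕ) (b : Bool) (a : ℕ → 𝓐) (k : ℕ) : Matrix (Ix m) (Ix m) 𝓐 := glet m b k (a k)

/-- The pairs of matrices `M_{σ₁} M_σ M_{σ₂}` and `M_{σ₁} M_{σ₂}`, built up along the largest
index, with the letters that may be added on the left and on the right. The predicate `N` restricts
the matrices assigned to the index `0`. -/
inductive Gen (m : ℕ) (b : Bool) (a : ℕ → 𝓐) (N : 𝓐 → Prop) :
    ℕ → Matrix (Ix m) (Ix m) 𝓐 → Matrix (Ix m) (Ix m) 𝓐 → (ℕ → Prop) → (ℕ → Prop) → Prop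
  | zero : Gen m b a N 0 (mk m b a 0) 1 (fun _ => False) (fun _ => False)
  | right {h : ℕ} {R Q : Matrix (Ix m) (Ix m) 𝓐} {AL AR : ℕ → Prop} (c : ℕ) (Z : ℕ → 𝓐)
      (hc : c ≤ h + 1) (hN : c = 0 → N (Z 0)) (hG : Gen m b a N h R Q AL AR) :
      Gen m b a N (h + 1) (R * mk m b a (h + 1) * descL m c Z (h + 1)) (Q * descL m c Z (h + 1))
        (fun j => AL j ∧ j < h) (fun j => j + 1 = c ∨ (j + 1 < c ∧ AR j))
  | left {h : ℕ} {R Q : Matrix (Ix m) (Ix m) 𝓐} {AL AR : ℕ → Prop} (c : ℕ) (Z : ℕ → 𝓐)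
      (hc : c ≤ h + 1) (hN : c = 0 → N (Z 0)) (hG : Gen m b a N h R Q AL AR) :
      Gen m b a N (h + 1) (ascL m c Z (h + 1) * mk m b a (h + 1) * R) (ascL m c Z (h + 1) * Q)
        (fun j => j + 1 = c ∨ (j + 1 < c ∧ AL j)) (fun j => AR j ∧ j < h)

variable {b : Bool} {a : ℕ → 𝓐} {N : 𝓐 → Prop}

/-- After a right step, an admissible letter either prolongs the string at its end, or is at
distance at least two from every letter of the step, commutes past it and enters the inner pair.
After a left step it enters the inner pair directly. The last clause records that the letter $k$
blocks only $k$ and releases $k-1$. -/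
theorem Gen.mul_right {h : ℕ} {R Q : Matrix (Ix m) (Ix m) 𝓐} {AL AR : ℕ → Prop}
    (hG : Gen m b a N h R Q AL AR) (hm : h < m) {k : ℕ} (hk : AR k) (X : 𝓐) (hX : k = 0 → N X) :
    ∃ AR' : ℕ → Prop, Gen m b a N h (R * glet m false k X) (Q * glet m false k X) AL AR' ∧
      ∀ j, j ≠ k → (j + 1 = k ∨ AR j) → AR' j := by
  induction hG with
  | zero => exact hk.elim
  | @right h R Q AL AR c Z hc hN hG ih =>
    rcases hk with rfl | ⟨hkc, hk⟩
    · refine ⟨fun j => j + 1 = k ∨ (j + 1 < k ∧ AR j), ?_, ?_⟩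
      · rw [mul_assoc, mul_assoc Q, descL_extend _ _ _ (by omega)]
        exact Gen.right k _ (by omega) (fun h0 => by subst h0; simpa using hX rfl) hG
      · rintro j hj (h1 | h1 | ⟨h1, h2⟩)
        · exact Or.inl h1
        · omega
        · rcases (show j + 1 ≤ k by omega).eq_or_lt with h3 | h3
          · exact Or.inl h3
          · exact Or.inr ⟨h3, h2⟩
    · obtain ⟨AR', h1, h2⟩ := ih (by omega) hk
      refine ⟨fun j => j + 1 = c ∨ (j + 1 < c ∧ AR' j), ?_, ?_⟩
      · have e := (descL_commute (m := m) (k := h + 1) Z X (show k + 2 ≤ c by omega) (by omega)).eq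
        have e2 : Commute (mk m b a (h + 1)) (glet m false k X) :=
          (glet_commute (by omega) (by omega) (by omega) X (a (h + 1))).symm
        have := Gen.right c Z hc hN h1
        rwa [mul_assoc R, ← e2.eq, ← mul_assoc, mul_assoc (R * _), ← e, ← mul_assoc,
          mul_assoc Q, ← e, ← mul_assoc] at this
      · rintro j hj (h3 | h3 | ⟨h3, h4⟩)
        · exact Or.inr ⟨by omega, h2 j hj (Or.inl h3)⟩
        · exact Or.inl h3
        · exact Or.inr ⟨h3, h2 j hj (Or.inr h4)⟩
  | @left h R Q AL AR c Z hc hN hG ih =>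
    obtain ⟨hk, hkh⟩ := hk
    obtain ⟨AR', h1, h2⟩ := ih (by omega) hk
    refine ⟨fun j => AR' j ∧ j < h, ?_, ?_⟩
    · have := Gen.left c Z hc hN h1
      rwa [← mul_assoc, ← mul_assoc] at this
    · rintro j hj (h3 | ⟨h3, h4⟩)
      · exact ⟨h2 j hj (Or.inl h3), by omega⟩
      · exact ⟨h2 j hj (Or.inr h3), h4⟩

theorem Gen.mul_left {h : ℕ} {R Q : Matrix (Ix m) (Ix m) 𝓐} {AL AR : ℕ → Prop}
    (hG : Gen m b a N h R Q AL AR) (hm : h < m) {k : ℕ} (hk : AL k) (X : 𝓐) (hX : k = 0 → N X) :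
    ∃ AL' : ℕ → Prop, Gen m b a N h (glet m false k X * R) (glet m false k X * Q) AL' AR ∧
      ∀ j, j ≠ k → (j + 1 = k ∨ AL j) → AL' j := by
  induction hG with
  | zero => exact hk.elim
  | @left h R Q AL AR c Z hc hN hG ih =>
    rcases hk with rfl | ⟨hkc, hk⟩
    · refine ⟨fun j => j + 1 = k ∨ (j + 1 < k ∧ AL j), ?_, ?_⟩
      · rw [← mul_assoc, ← mul_assoc, ← mul_assoc, ascL_extend _ _ _ (by omega)]
        exact Gen.left k _ (by omega) (fun h0 => by subst h0; simpa using hX rfl) hG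
      · rintro j hj (h1 | h1 | ⟨h1, h2⟩)
        · exact Or.inl h1
        · omega
        · rcases (show j + 1 ≤ k by omega).eq_or_lt with h3 | h3
          · exact Or.inl h3
          · exact Or.inr ⟨h3, h2⟩
    · obtain ⟨AL', h1, h2⟩ := ih (by omega) hk
      refine ⟨fun j => j + 1 = c ∨ (j + 1 < c ∧ AL' j), ?_, ?_⟩
      · have e := (ascL_commute (m := m) (k := h + 1) Z X (show k + 2 ≤ c by omega) (by omega)).eq
        have e2 : Commute (mk m b a (h + 1)) (glet m false k X) :=
          (glet_commute (by omega) (by omega) (by omega) X (a (h + 1))).symm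
        have := Gen.left c Z hc hN h1
        rwa [← mul_assoc, mul_assoc (ascL m c Z (h + 1)), e2.eq, ← mul_assoc, e, ← mul_assoc, e,
          mul_assoc, mul_assoc, ← mul_assoc (ascL m c Z (h + 1)), mul_assoc (glet m false k X) _ Q] at this
      · rintro j hj (h3 | h3 | ⟨h3, h4⟩)
        · exact Or.inr ⟨by omega, h2 j hj (Or.inl h3)⟩
        · exact Or.inl h3
        · exact Or.inr ⟨h3, h2 j hj (Or.inr h4)⟩
  | @right h R Q AL AR c Z hc hN hG ih =>
    obtain ⟨hk, hkh⟩ := hk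
    obtain ⟨AL', h1, h2⟩ := ih (by omega) hk
    refine ⟨fun j => AL' j ∧ j < h, ?_, ?_⟩
    · have := Gen.right c Z hc hN h1
      rwa [mul_assoc, mul_assoc, mul_assoc, ← mul_assoc R] at this
    · rintro j hj (h3 | ⟨h3, h4⟩)
      · exact ⟨h2 j hj (Or.inl h3), by omega⟩
      · exact ⟨h2 j hj (Or.inr h3), h4⟩

theorem lastOK_delete {j x : ℤ} (s₁ s₂ : List ℤ) (h1 : x ≠ j) (h2 : x ≠ j + 1) :
    LastOK j (s₁ ++ x :: s₂) ↔ LastOK j (s₁ ++ s₂) := by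
  induction s₂ using List.reverseRecOn with
  | nil => rw [lastOK_concat]; simp [h1, h2]
  | append_singleton s k ih =>
    rw [show s₁ ++ x :: (s ++ [k]) = (s₁ ++ x :: s) ++ [k] by simp, ← List.append_assoc,
      lastOK_concat, lastOK_concat, ih]

/-- In a permutation the largest letter commutes with every letter except the one below it, so it
moves to the right end or to the left end, depending on the side on which that letter stands. The
string of the step is empty, since its lower end is taken above its upper end. -/
theorem gen_perm {h : ℕ} (hm : h < m) {σ : List ℕ} (hσ : σ.Perm (List.range (h + 1))) :
    ∃ AL AR : ℕ → Prop, Gen m b a N h (σ.map (mk m b a)).prod 1 AL AR ∧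
      (∀ j : ℕ, j < h → LastOK j (σ.map Nat.cast).reverse → AL j) ∧
      (∀ j : ℕ, j < h → LastOK j (σ.map Nat.cast) → AR j) := by
  induction h generalizing σ with
  | zero =>
    have : σ = [0] := by simpa using hσ
    subst this
    refine ⟨_, _, by simpa using Gen.zero, ?_, ?_⟩ <;> intro j hj <;> omega
  | succ h ih =>
    have hmem : h + 1 ∈ σ := hσ.mem_iff.2 (by simp)
    obtain ⟨s₁, s₂, rfl⟩ := List.append_of_mem hmem
    have hp : (s₁ ++ s₂).Perm (List.range (h + 1)) := by
      have e : ((h + 1) :: (s₁ ++ s₂)).Perm ((h + 1) :: List.range (h + 1)) := by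
        refine List.perm_middle.symm.trans (hσ.trans ?_)
        rw [List.range_succ (n := h + 1)]
        exact List.perm_append_comm
      exact e.cons_inv
    have hnd : (s₁ ++ s₂).Nodup := hp.nodup_iff.2 List.nodup_range
    have hle : ∀ k ∈ s₁ ++ s₂, k ≤ h := fun k hk => by
      have := hp.mem_iff.1 hk; simp at this; omega
    obtain ⟨AL, AR, hG, hL, hR⟩ := ih (by omega) hp
    have key : ∀ (u v : List ℕ) (j : ℕ), j < h →
        LastOK (j : ℤ) ((u.map Nat.cast : List ℤ) ++ ((h + 1 : ℕ) : ℤ) :: v.map Nat.cast) →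
        LastOK (j : ℤ) ((u ++ v).map Nat.cast) := by
      intro u v j hj hl
      rw [lastOK_delete _ _ (by push_cast; omega) (by push_cast; omega)] at hl
      simpa using hl
    have keyR : ∀ j : ℕ, j < h → LastOK (j : ℤ) ((s₁ ++ (h + 1) :: s₂).map Nat.cast) → AR j :=
      fun j hj hl => hR j hj (key s₁ s₂ j hj (by simpa using hl))
    have keyL : ∀ j : ℕ, j < h → LastOK (j : ℤ) ((s₁ ++ (h + 1) :: s₂).map Nat.cast).reverse → AL j := by
      intro j hj hl
      have := key s₂.reverse s₁.reverse j hj (by simpa [List.map_reverse] using hl)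
      exact hL j hj (by simpa [List.map_reverse] using this)
    have comm : ∀ s : List ℕ, (∀ k ∈ s, k < h) →
        Commute (mk m b a (h + 1)) (s.map (mk m b a)).prod := by
      intro s hs
      refine Commute.list_prod_right _ _ fun x hx => ?_
      obtain ⟨k, hk, rfl⟩ := List.mem_map.1 hx
      exact (glet_commute (by have := hs k hk; omega) hm (by have := hs k hk; omega) _ _).symm
    have notboth : ∀ u v : List ℕ, (u ++ v).Nodup → (∀ k ∈ u ++ v, k ≤ h) → h ∈ v →
        ¬ LastOK (h : ℤ) ((u ++ (h + 1) :: v).map Nat.cast) := by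
      intro u v _ hle hh hl
      obtain ⟨p, q, rfl⟩ := List.append_of_mem hh
      have := hl ((u ++ (h + 1) :: p).map Nat.cast) (q.map Nat.cast) (by simp)
      simp only [List.mem_map] at this
      obtain ⟨y, hy, hy'⟩ := this
      have := hle y (by simp [hy])
      omega
    have hh : h ∈ s₁ ++ s₂ := hp.mem_iff.2 (by simp)
    rcases List.mem_append.1 hh with hh | hh
    · have hs2 : ∀ k ∈ s₂, k < h := by
        intro k hk
        have h1 := hle k (by simp [hk])
        rcases h1.eq_or_lt with rfl | h1
        · exact absurd hk ((List.nodup_append.1 hnd).2.2 k hh k · rfl)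
        · exact h1
      refine ⟨fun j => AL j ∧ j < h, fun j => j + 1 = h + 1 ∨ (j + 1 < h + 1 ∧ AR j), ?_, ?_, ?_⟩
      · have := Gen.right (h + 1) (fun _ => 0) le_rfl (by omega) hG
        rw [descL_self _ _ le_rfl, mul_one, mul_one] at this
        convert this using 1
        simp only [List.map_append, List.prod_append, List.map_cons, List.prod_cons]
        rw [(comm s₂ hs2).eq, mul_assoc]
      · intro j hj hl
        rcases (show j ≤ h by omega).eq_or_lt with rfl | hj
        · exfalso
          refine notboth s₂.reverse s₁.reverse ?_ ?_ (by simpa using hh) ?_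
          · rw [← List.reverse_append]; exact List.nodup_reverse.2 hnd
          · intro k hk; rw [← List.reverse_append] at hk; exact hle k (List.mem_reverse.1 hk)
          · simpa [List.map_reverse] using hl
        · exact ⟨keyL j hj hl, hj⟩
      · intro j hj hl
        rcases (show j ≤ h by omega).eq_or_lt with rfl | hj
        · exact Or.inl rfl
        · exact Or.inr ⟨by omega, keyR j hj hl⟩
    · have hs1 : ∀ k ∈ s₁, k < h := by
        intro k hk
        have h1 := hle k (by simp [hk])
        rcases h1.eq_or_lt with rfl | h1
        · exact absurd hk ((List.nodup_append.1 hnd).2.2 k · k hh rfl)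
        · exact h1
      refine ⟨fun j => j + 1 = h + 1 ∨ (j + 1 < h + 1 ∧ AL j), fun j => AR j ∧ j < h, ?_, ?_, ?_⟩
      · have := Gen.left (h + 1) (fun _ => 0) le_rfl (by omega) hG
        rw [ascL_self _ _ le_rfl, one_mul, mul_one] at this
        convert this using 1
        simp only [List.map_append, List.prod_append, List.map_cons, List.prod_cons]
        rw [← mul_assoc, ← (comm s₁ hs1).eq, mul_assoc]
      · intro j hj hl
        rcases (show j ≤ h by omega).eq_or_lt with rfl | hj
        · exact Or.inl rfl
        · exact Or.inr ⟨by omega, keyL j hj hl⟩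
      · intro j hj hl
        rcases (show j ≤ h by omega).eq_or_lt with rfl | hj
        · exact absurd hl (notboth s₁ s₂ hnd hle hh)
        · exact ⟨keyR j hj hl, hj⟩

theorem Gen.mul_word_right {h : ℕ} {R Q : Matrix (Ix m) (Ix m) 𝓐} {AL AR : ℕ → Prop}
    (hG : Gen m b a N h R Q AL AR) (hm : h < m) {t : List ℤ}
    (hR : ∀ j : ℕ, j < h → LastOK j t → AR j) {s : List (Bool × ℕ × 𝓐)}
    (hs : ∀ p ∈ s, p.1 = false ∧ p.2.1 < h ∧ (p.2.1 = 0 → N p.2.2)) (ht : SIP (t ++ widx s)) :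
    ∃ AR', Gen m b a N h (R * wprod m s) (Q * wprod m s) AL AR' := by
  induction s generalizing t R Q AR with
  | nil => exact ⟨AR, by simpa [wprod_nil] using hG⟩
  | cons p s ih =>
    obtain ⟨f, k, X⟩ := p
    obtain ⟨h1, h2, h3⟩ := hs (f, k, X) (by simp)
    simp only at h1 h2 h3
    subst h1
    have e : t ++ widx ((false, k, X) :: s) = (t ++ [(k : ℤ)]) ++ widx s := by simp [widx]
    rw [e] at ht
    have hk := ((sip_concat t k).1 (sip_infix ⟨[], widx s, by simp⟩ ht)).2
    obtain ⟨AR', g1, g2⟩ := hG.mul_right hm (hR k h2 hk) X h3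
    rw [wprod_cons, ← mul_assoc, ← mul_assoc]
    refine ih g1 ?_ (fun p hp => hs p (by simp [hp])) ht
    intro j hj hl
    rw [lastOK_concat] at hl
    refine g2 j (by have := hl.1; omega) ?_
    rcases hl.2 with h | h
    · left; omega
    · exact Or.inr (hR j hj h)

theorem Gen.mul_word_left {h : ℕ} {R Q : Matrix (Ix m) (Ix m) 𝓐} {AL AR : ℕ → Prop}
    (hG : Gen m b a N h R Q AL AR) (hm : h < m) {t : List ℤ}
    (hL : ∀ j : ℕ, j < h → LastOK j t.reverse → AL j) {s : List (Bool × ℕ × 𝓐)}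
    (hs : ∀ p ∈ s, p.1 = false ∧ p.2.1 < h ∧ (p.2.1 = 0 → N p.2.2)) (ht : SIP (widx s ++ t)) :
    ∃ AL', Gen m b a N h (wprod m s * R) (wprod m s * Q) AL' AR := by
  induction s using List.reverseRecOn generalizing t R Q AL with
  | nil => exact ⟨AL, by simpa [wprod_nil] using hG⟩
  | append_singleton s p ih =>
    obtain ⟨f, k, X⟩ := p
    obtain ⟨h1, h2, h3⟩ := hs (f, k, X) (by simp)
    simp only at h1 h2 h3
    subst h1
    have e : widx (s ++ [(false, k, X)]) ++ t = widx s ++ ((k : ℤ) :: t) := by simp [widx]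
    rw [e] at ht
    have hk : LastOK k t.reverse := by
      have := sip_reverse (sip_infix (s := (k : ℤ) :: t) ⟨widx s, [], by simp⟩ ht)
      rw [List.reverse_cons] at this
      exact ((sip_concat _ _).1 this).2
    obtain ⟨AL', g1, g2⟩ := hG.mul_left hm (hL k h2 hk) X h3
    rw [wprod_append, wprod_cons, wprod_nil, mul_one, mul_assoc, mul_assoc]
    refine ih g1 ?_ (fun p hp => hs p (by simp [hp])) ht
    intro j hj hl
    rw [List.reverse_cons, lastOK_concat] at hl
    refine g2 j (by have := hl.1; omega) ?_
    rcases hl.2 with h | h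
    · left; omega
    · exact Or.inr (hL j hj h)

/-- The data of a GFPR give a pair of matrices of the class `Gen`. -/
theorem gen_of_words {h : ℕ} (hm : h < m) {σ : List ℕ} (hσ : σ.Perm (List.range (h + 1)))
    {s₁ s₂ : List (Bool × ℕ × 𝓐)}
    (h₁ : ∀ p ∈ s₁, p.1 = false ∧ p.2.1 < h ∧ (p.2.1 = 0 → N p.2.2))
    (h₂ : ∀ p ∈ s₂, p.1 = false ∧ p.2.1 < h ∧ (p.2.1 = 0 → N p.2.2))
    (hsip : SIP (widx s₁ ++ σ.map Nat.cast ++ widx s₂)) :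
    ∃ AL AR, Gen m b a N h (wprod m s₁ * (σ.map (mk m b a)).prod * wprod m s₂)
      (wprod m s₁ * wprod m s₂) AL AR := by
  obtain ⟨AL, AR, hG, hL, hR⟩ := gen_perm (b := b) (a := a) (N := N) hm hσ
  obtain ⟨AR', g1⟩ := hG.mul_word_right hm hR h₂
    (sip_infix ⟨widx s₁, [], by simp⟩ hsip)
  obtain ⟨AL', g2⟩ := g1.mul_word_left hm hL h₁ (sip_infix ⟨[], widx s₂, by simp⟩ hsip)
  exact ⟨_, _, by rw [mul_assoc]; simpa using g2⟩

end Gen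

/-! ### Descending strings and their rows -/

section Chains

variable {m : ℕ} {𝓐 : Type} [Ring 𝓐]

/-- The data of a descending string of letters ending with `c ≥ 1`, followed by the letter `0`
with the matrix `x` (where `x = 1` unless `c = 1`). -/
structure Chain (𝓐 : Type) where
  c : ℕ
  x : 𝓐
  Z : ℕ → 𝓐

/-- The conditions on a string that starts with the letter `k`. -/
def Chain.Ok (N : 𝓐 → Prop) (s : Chain 𝓐) (k : ℕ) : Prop :=
  1 ≤ s.c ∧ s.c ≤ k + 1 ∧ (s.c ≠ 1 → s.x = 1) ∧ (s.x = 1 ∨ N s.x)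

/-- The product of the letters of the string. -/
def Chain.desc (m : ℕ) (s : Chain 𝓐) (k : ℕ) : Matrix (Ix m) (Ix m) 𝓐 :=
  descL m s.c s.Z (k + 1) * glet m false 0 s.x

/-- The product of the letters of the reversed string. -/
def Chain.asc (m : ℕ) (s : Chain 𝓐) (k : ℕ) : Matrix (Ix m) (Ix m) 𝓐 :=
  glet m false 0 s.x * ascL m s.c s.Z (k + 1)

theorem Chain.Ok.mono {N : 𝓐 → Prop} {s : Chain 𝓐} {k l : ℕ} (h : s.Ok N k) (hl : s.c ≤ l + 1) :
    s.Ok N l := ⟨h.1, hl, h.2.2⟩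

/-- Each letter multiplies the current column by its matrix and hands the original column $k$ on to
the next lower position, where the next letter finds it. So column $k$ is spread over the columns
$k,\dots,c$ and finally arrives at $c-1$, while the columns $c-1,\dots,k-1$ move up by one. -/
theorem mul_descL (A : Matrix (Ix m) (Ix m) 𝓐) {c k : ℕ} (Z : ℕ → 𝓐) (hc : 1 ≤ c) (hk : c ≤ k + 1)
    (hm : k < m) (i : Ix m) :
    (A * descL m c Z (k + 1)) i (Sum.inr ()) = A i (Sum.inr ()) ∧
    ∀ l, l < m → (A * descL m c Z (k + 1)) i (lv m l) =
      if k < l then A i (lv m l)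
      else if c ≤ l then A i (lv m k) * Z l + A i (lv m (l - 1))
      else if l + 1 = c then A i (lv m k) else A i (lv m l) := by
  induction k generalizing A with
  | zero =>
    obtain rfl : c = 1 := by omega
    rw [descL_self _ _ le_rfl, mul_one]
    refine ⟨rfl, fun l hl => ?_⟩
    rcases Nat.eq_zero_or_pos l with rfl | hl0
    · simp
    · rw [if_pos hl0]
  | succ k ih =>
    rcases hk.eq_or_lt with rfl | hk
    · rw [descL_self _ _ le_rfl, mul_one]
      refine ⟨rfl, fun l hl => ?_⟩
      split_ifs with h1 h2 h3
      · rfl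
      · omega
      · rw [show l = k + 1 by omega]
      · rfl
    · rw [descL, if_pos (by omega), ← mul_assoc]
      obtain ⟨h1, h2⟩ := ih (A * glet m false (k + 1) (Z (k + 1))) (by omega) (by omega)
      have hne : lv m (k + 1) ≠ lv m k := lv_ne hm (by omega)
      rw [glet_succ] at h1 h2 ⊢
      refine ⟨?_, fun l hl => ?_⟩
      · rw [h1, mul_swapM _ _ hne, if_neg (lv_ne_inr hm).symm,
          if_neg (lv_ne_inr (show k < m by omega)).symm]
      · rw [h2 l hl]
        simp only [mul_swapM _ _ hne, lv_inj hl hm, lv_inj hl (show k < m by omega),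
          lv_inj (show k < m by omega) hm, if_true, if_neg (show k ≠ k + 1 by omega),
          lv_inj (show l - 1 < m by omega) hm, lv_inj (show l - 1 < m by omega) (show k < m by omega)]
        rcases lt_trichotomy l (k + 1) with h | rfl | h
        · rw [if_neg (by omega : ¬ k < l), if_neg (by omega : ¬ k + 1 < l)]
          split_ifs with h3 h4 h5 h6
          · omega
          · omega
          · rfl
          · rfl
          · omega
          · omega
          · rfl
        · rw [if_pos (by omega), if_pos rfl, if_neg (by omega), if_pos (by omega)]
          simp
        · rw [if_pos (by omega), if_neg (by omega), if_neg (by omega), if_pos h]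

variable {N : 𝓐 → Prop}

theorem mul_desc (A : Matrix (Ix m) (Ix m) 𝓐) {s : Chain 𝓐} {k : ℕ} (hs : s.Ok N k)
    (hm : k < m) (i : Ix m) :
    (A * s.desc m k) i (Sum.inr ()) = A i (Sum.inr ()) ∧
    ∀ l, l < m → (A * s.desc m k) i (lv m l) =
      if k < l then A i (lv m l)
      else if s.c ≤ l then A i (lv m k) * s.Z l + A i (lv m (l - 1))
      else if l + 1 = s.c then A i (lv m k) * s.x else A i (lv m l) := by
  obtain ⟨h1, h2, h3, -⟩ := hs
  obtain ⟨e1, e2⟩ := mul_descL A s.Z h1 h2 hm i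
  rw [Chain.desc, ← mul_assoc]
  simp only [glet, if_true, if_false, Bool.false_eq_true, mul_diagM]
  refine ⟨?_, fun l hl => ?_⟩
  · rw [if_neg (lv_ne_inr (by omega)).symm, e1]
  · rw [e2 l hl, e2 0 (by omega)]
    by_cases hl0 : l = 0
    · subst hl0
      by_cases hc : s.c = 1
      · simp [hc]
      · simp [Ne.symm hc, h3 hc, show s.c ≠ 0 by omega]
    · rw [if_neg (lv_ne hl hl0)]
      split_ifs with h4 h5 h6
      · rfl
      · rfl
      · rw [h3 (by omega), mul_one]
      · rfl

theorem desc_succ {s : Chain 𝓐} {k : ℕ} (h : s.c ≤ k + 1) :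
    s.desc m (k + 1) = glet m false (k + 1) (s.Z (k + 1)) * s.desc m k := by
  rw [Chain.desc, descL, if_pos h, mul_assoc, Chain.desc]

theorem asc_succ {s : Chain 𝓐} {k : ℕ} (h : s.c ≤ k + 1) :
    s.asc m (k + 1) = s.asc m k * glet m false (k + 1) (s.Z (k + 1)) := by
  rw [Chain.asc, ascL, if_pos h, ← mul_assoc, Chain.asc]

theorem descL_congr {c k : ℕ} {Z Z' : ℕ → 𝓐} (h : ∀ l, c ≤ l → l < k → Z l = Z' l) :
    descL m c Z k = descL m c Z' k ∧ ascL m c Z k = ascL m c Z' k := by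
  induction k with
  | zero => exact ⟨rfl, rfl⟩
  | succ k ih =>
    obtain ⟨h1, h2⟩ := ih fun l hl hl' => h l hl (by omega)
    simp only [descL, ascL, h1, h2]
    split_ifs with hc
    · rw [h k hc (by omega)]; exact ⟨rfl, rfl⟩
    · exact ⟨rfl, rfl⟩

theorem descL_triv {c k l : ℕ} (Z : ℕ → 𝓐) (hl : l < m) (hk : k ≤ l) : Triv (descL m c Z k) (lv m l) := by
  induction k with
  | zero => exact triv_one _
  | succ k ih =>
    rw [descL]; split_ifs
    · exact (triv_glet_lv hl (by omega) (by omega)).mul (ih (by omega))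
    · exact triv_one _

theorem descL_triv_inr {c k : ℕ} (Z : ℕ → 𝓐) (hk : k ≤ m) : Triv (descL m c Z k) (Sum.inr ()) := by
  induction k with
  | zero => exact triv_one _
  | succ k ih =>
    rw [descL]; split_ifs
    · exact (triv_glet_inr (by omega) (Or.inl rfl)).mul (ih (by omega))
    · exact triv_one _

theorem desc_triv {s : Chain 𝓐} {k l : ℕ} (hl : l < m) (hk : k < l) : Triv (s.desc m k) (lv m l) :=
  (descL_triv _ hl hk).mul (triv_glet_lv hl (by omega) (by omega))

theorem desc_triv_inr {s : Chain 𝓐} {k : ℕ} (hk : k < m) : Triv (s.desc m k) (Sum.inr ()) :=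
  (descL_triv_inr _ hk).mul (triv_glet_inr (by omega) (Or.inl rfl))

theorem descL_transpose {A : Matrix (Ix m) (Ix m) 𝓐} {c k : ℕ} (Z : ℕ → 𝓐) (hm : k < m)
    (hA : ∀ i, Cen (A i (lv m k))) :
    (A * descL m c Z (k + 1)).transpose = ascL m c Z (k + 1) * A.transpose ∧
      (c ≤ 1 → ∀ i, Cen ((A * descL m (max c 1) Z (k + 1)) i (lv m 0))) := by
  induction k generalizing A with
  | zero =>
    constructor
    · rw [descL, ascL]
      split_ifs with h
      · simp only [descL, ascL, mul_one, one_mul]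
        exact mul_glet_transpose hm _ hA
      · simp
    · intro h i
      rw [max_eq_right h, descL_self _ _ le_rfl, mul_one]; exact hA i
  | succ k ih =>
    have hne : lv m (k + 1) ≠ lv m k := lv_ne hm (by omega)
    have key : ∀ i, Cen ((A * glet m false (k + 1) (Z (k + 1))) i (lv m k)) := by
      intro i
      rw [glet_succ, mul_swapM _ _ hne, if_neg hne.symm, if_pos rfl]
      exact hA i
    obtain ⟨h1, h2⟩ := ih (by omega) key
    constructor
    · rw [descL, ascL]
      split_ifs with h
      · rw [← mul_assoc, h1, mul_glet_transpose hm _ hA, mul_assoc]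
      · simp
    · intro h i
      rw [max_eq_right h, descL, if_pos (by omega), ← mul_assoc]
      have := h2 h i
      rwa [max_eq_right h] at this

theorem mul_desc_transpose {A : Matrix (Ix m) (Ix m) 𝓐} {s : Chain 𝓐} {k : ℕ} (hs : s.Ok N k)
    (hm : k < m) (hA : ∀ i, Cen (A i (lv m k))) :
    (A * s.desc m k).transpose = s.asc m k * A.transpose := by
  obtain ⟨h1, h2, h3, -⟩ := hs
  obtain ⟨e1, e2⟩ := descL_transpose (c := s.c) s.Z hm hA
  rw [Chain.desc, Chain.asc, ← mul_assoc, mul_assoc _ _ A.transpose, ← e1]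
  by_cases hc : s.c = 1
  · refine mul_glet_transpose (by omega) _ fun i => ?_
    have := e2 (by omega) i
    rw [hc, max_self] at this
    rw [hc]; exact this
  · rw [h3 hc, glet_zero_one, mul_one, one_mul]

theorem asc_eq_transpose {s : Chain 𝓐} {k : ℕ} (hs : s.Ok N k) (hm : k < m) :
    s.asc m k = (s.desc m k).transpose := by
  have := mul_desc_transpose (A := 1) hs hm fun i => cen_one_apply _ _
  simpa using this.symm

theorem asc_triv {s : Chain 𝓐} {k l : ℕ} (hs : s.Ok N k) (hl : l < m) (hk : k < l) :
    Triv (s.asc m k) (lv m l) := by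
  rw [asc_eq_transpose hs (by omega)]; exact (desc_triv hl hk).transpose

theorem asc_triv_inr {s : Chain 𝓐} {k : ℕ} (hs : s.Ok N k) (hk : k < m) :
    Triv (s.asc m k) (Sum.inr ()) := by
  rw [asc_eq_transpose hs hk]; exact (desc_triv_inr hk).transpose

theorem desc_row {s : Chain 𝓐} {k : ℕ} (hs : s.Ok N k) (hm : k < m) :
    s.desc m k (lv m k) (Sum.inr ()) = 0 ∧ ∀ l, l < m → s.desc m k (lv m k) (lv m l) =
      if k < l then 0 else if s.c ≤ l then s.Z l else if l + 1 = s.c then s.x else 0 := by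
  obtain ⟨e1, e2⟩ := mul_desc (1 : Matrix (Ix m) (Ix m) 𝓐) hs hm (lv m k)
  rw [one_mul] at e1 e2
  have hs2 := hs.2.1
  refine ⟨by rw [e1, Matrix.one_apply_ne (lv_ne_inr hm)], fun l hl => ?_⟩
  rw [e2 l hl, Matrix.one_apply_eq]
  split_ifs with h1 h2 h3
  · rw [Matrix.one_apply_ne (lv_ne hm (by omega))]
  · rw [Matrix.one_apply_ne (lv_ne hm (by have := hs.1; omega)), one_mul, add_zero]
  · rw [one_mul]
  · rw [Matrix.one_apply_ne (lv_ne hm (by omega))]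

theorem desc_row_succ {s : Chain 𝓐} {k : ℕ} (h : s.c ≤ k + 1) (hm : k + 1 < m) (i : Ix m) :
    s.desc m (k + 1) (lv m (k + 1)) i =
      (1 : Matrix (Ix m) (Ix m) 𝓐) i (lv m (k + 1)) * s.Z (k + 1) + s.desc m k (lv m k) i := by
  rw [desc_succ h, glet_succ, swapM_mul _ _ (lv_ne hm (by omega)), if_pos rfl,
    (desc_triv hm (by omega) i).1, ← (cen_one_apply (lv m (k + 1)) i _).eq, Matrix.one_apply,
    Matrix.one_apply]
  simp only [eq_comm]

theorem desc_row_top {s : Chain 𝓐} {k : ℕ} (hs : s.Ok N (k + 1)) (h : s.c = k + 2) :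
    s.desc m (k + 1) = 1 := by
  rw [Chain.desc, h, descL_self _ _ le_rfl, hs.2.2.1 (by omega), glet_zero_one, mul_one]

/-- Row $k$ of a string shows $Z_l$ for $c\le l\le k$, then $x$ at $c-1$, and zeros below. As
$x\ne0$, the lowest nonzero position determines $c$, and then the row determines $x$ and all
matrices that occur. -/
theorem chain_rigid {s s' : Chain 𝓐} {k : ℕ} [Nontrivial 𝓐] (hN : ∀ X, N X → X ≠ 0)
    (hs : s.Ok N k) (hs' : s'.Ok N k) (hm : k < m)
    (h : ∀ i, s.desc m k (lv m k) i = s'.desc m k (lv m k) i) :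
    s.asc m k = s'.asc m k := by
  have nz : ∀ t : Chain 𝓐, t.Ok N k → t.x ≠ 0 := by
    rintro t ⟨-, -, -, h | h⟩
    · rw [h]; exact one_ne_zero
    · exact hN _ h
  have aux : ∀ t t' : Chain 𝓐, t.Ok N k → t'.Ok N k →
      (∀ i, t.desc m k (lv m k) i = t'.desc m k (lv m k) i) → ¬ t.c < t'.c := by
    intro t t' ht ht' h hlt
    have h1 := ht.1
    have h2 := ht.2.1
    have h3 := ht'.2.1
    have := h (lv m (t.c - 1))
    rw [(desc_row ht hm).2 _ (by omega), (desc_row ht' hm).2 _ (by omega), if_neg (by omega),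
      if_neg (by omega), if_pos (by omega), if_neg (by omega), if_neg (by omega),
      if_neg (by omega)] at this
    exact nz t ht this
  have hc : s.c = s'.c := le_antisymm (not_lt.1 (aux s' s hs' hs fun i => (h i).symm))
    (not_lt.1 (aux s s' hs hs' h))
  have h1 := hs.1
  have h2 := hs.2.1
  have hx : s.x = s'.x := by
    have := h (lv m (s.c - 1))
    rwa [(desc_row hs hm).2 _ (by omega), (desc_row hs' hm).2 _ (by omega), if_neg (by omega),
      if_neg (by omega), if_pos (by omega), if_neg (by omega), if_neg (by omega),
      if_pos (by omega)] at this
  have hZ : ∀ l, s.c ≤ l → l < k + 1 → s.Z l = s'.Z l := by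
    intro l hl hl'
    have := h (lv m l)
    rwa [(desc_row hs hm).2 _ (by omega), (desc_row hs' hm).2 _ (by omega), if_neg (by omega),
      if_pos hl, if_neg (by omega), if_pos (by omega)] at this
  rw [Chain.asc, Chain.asc, hx, (descL_congr hZ).2, hc]

end Chains

/-! ### Pairs built from strings, and their transposes -/

section Cls

variable {m : ℕ} {𝓐 : Type} [Ring 𝓐]

/-- A version of `Gen` in terms of strings, without the bookkeeping of the admissible letters. -/
inductive Cls (m : ℕ) (b : Bool) (a : ℕ → 𝓐) (N : 𝓐 → Prop) :
    ℕ → Matrix (Ix m) (Ix m) 𝓐 → Matrix (Ix m) (Ix m) 𝓐 → Prop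
  | zero : Cls m b a N 0 (mk m b a 0) 1
  | right {h : ℕ} {R Q : Matrix (Ix m) (Ix m) 𝓐} (s : Chain 𝓐) (hs : s.Ok N h)
      (hC : Cls m b a N h R Q) :
      Cls m b a N (h + 1) (R * mk m b a (h + 1) * s.desc m h) (Q * s.desc m h)
  | left {h : ℕ} {R Q : Matrix (Ix m) (Ix m) 𝓐} (s : Chain 𝓐) (hs : s.Ok N h)
      (hC : Cls m b a N h R Q) :
      Cls m b a N (h + 1) (s.asc m h * mk m b a (h + 1) * R) (s.asc m h * Q)

variable {b : Bool} {a : ℕ → 𝓐} {N : 𝓐 → Prop}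

/-- A string that runs down to $0$ is stored as one that runs down to $1$, followed by the letter
$0$ with matrix $x=Z_0$. All other strings take $x=1$, whose letter $0$ is the identity. In this
form the end of a string always carries a nonzero matrix. -/
theorem exists_chain {h c : ℕ} {Z : ℕ → 𝓐} (hc : c ≤ h + 1) (hN : c = 0 → N (Z 0)) :
    ∃ s : Chain 𝓐, s.Ok N h ∧ descL m c Z (h + 1) = s.desc m h ∧ ascL m c Z (h + 1) = s.asc m h := by
  rcases Nat.eq_zero_or_pos c with rfl | h0
  · refine ⟨⟨1, Z 0, Z⟩, ⟨le_rfl, by simp, by simp, Or.inr (hN rfl)⟩, ?_, ?_⟩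
    · rw [Chain.desc, descL_extend _ _ _ (by omega), Function.update_eq_self]
    · rw [Chain.asc, ascL_extend _ _ _ (by omega), Function.update_eq_self]
  · exact ⟨⟨c, 1, Z⟩, ⟨h0, hc, fun _ => rfl, Or.inl rfl⟩, by simp [Chain.desc, glet_zero_one],
      by simp [Chain.asc, glet_zero_one]⟩

theorem Gen.cls {h : ℕ} {R Q : Matrix (Ix m) (Ix m) 𝓐} {AL AR : ℕ → Prop}
    (hG : Gen m b a N h R Q AL AR) : Cls m b a N h R Q := by
  induction hG with
  | zero => exact Cls.zero
  | right c Z hc hN _ ih =>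
    obtain ⟨s, hs, h1, h2⟩ := exists_chain (m := m) hc hN
    rw [h1]; exact Cls.right s hs ih
  | left c Z hc hN _ ih =>
    obtain ⟨s, hs, h1, h2⟩ := exists_chain (m := m) hc hN
    rw [h2]; exact Cls.left s hs ih

theorem Cls.triv {h : ℕ} {R Q : Matrix (Ix m) (Ix m) 𝓐} (hC : Cls m b a N h R Q) (hm : h < m) :
    (∀ l, h < l → l < m → Triv R (lv m l)) ∧ (∀ l, h ≤ l → l < m → Triv Q (lv m l)) ∧
      Triv Q (Sum.inr ()) := by
  induction hC with
  | zero => exact ⟨fun l hl hl' => triv_glet_lv hl' (by omega) (by omega), fun _ _ _ => triv_one _,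
      triv_one _⟩
  | right s hs hC ih =>
    obtain ⟨h1, h2, h3⟩ := ih (by omega)
    exact ⟨fun l hl hl' => ((h1 l (by omega) hl').mul (triv_glet_lv hl' (by omega) (by omega))).mul
      (desc_triv hl' (by omega)), fun l hl hl' => (h2 l (by omega) hl').mul (desc_triv hl' (by omega)),
      h3.mul (desc_triv_inr (by omega))⟩
  | left s hs hC ih =>
    obtain ⟨h1, h2, h3⟩ := ih (by omega)
    exact ⟨fun l hl hl' => ((asc_triv hs hl' (by omega)).mul
      (triv_glet_lv hl' (by omega) (by omega))).mul (h1 l (by omega) hl'),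
      fun l hl hl' => (asc_triv hs hl' (by omega)).mul (h2 l (by omega) hl'),
      (asc_triv_inr hs (by omega)).mul h3⟩

theorem Triv.cen {ι : Type} [Fintype ι] [DecidableEq ι] {A : Matrix ι ι 𝓐} {i : ι} (h : Triv A i)
    (j : ι) : Cen (A j i) := by
  rw [(h j).2]; exact cen_one_apply _ _

theorem mul_mk_desc_transpose {h : ℕ} {R : Matrix (Ix m) (Ix m) 𝓐} {s : Chain 𝓐} (hs : s.Ok N h)
    (hm : h + 1 < m) (hR : Triv R (lv m (h + 1))) :
    (R * mk m b a (h + 1) * s.desc m h).transpose =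
      s.asc m h * mk m b a (h + 1) * R.transpose := by
  rw [mul_desc_transpose hs (by omega), mk, mul_glet_transpose hm _ hR.cen, mul_assoc]
  intro i
  rw [mk, glet_succ, mul_swapM _ _ (lv_ne hm (by omega)), if_neg (lv_ne (by omega) (by omega)),
    if_pos rfl]
  exact hR.cen i

/-- Transposition interchanges right and left steps. It reverses the products because the smaller
pair is trivial at the new levels, so the entries met there are central. -/
theorem Cls.transpose {h : ℕ} {R Q : Matrix (Ix m) (Ix m) 𝓐} (hC : Cls m b a N h R Q) (hm : h < m) :
    Cls m b a N h R.transpose Q.transpose := by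
  induction hC with
  | zero =>
    rw [mk, glet_transpose, Matrix.transpose_one]; exact Cls.zero
  | @right h R Q s hs hC ih =>
    obtain ⟨h1, h2, h3⟩ := hC.triv (by omega)
    rw [mul_mk_desc_transpose hs hm (h1 _ (by omega) hm),
      mul_desc_transpose hs (by omega) (h2 h le_rfl (by omega)).cen]
    exact Cls.left s hs (ih (by omega))
  | @left h R Q s hs hC ih =>
    obtain ⟨h1, h2, h3⟩ := hC.triv (by omega)
    have e1 := mul_mk_desc_transpose (b := b) (a := a) hs hm (h1 _ (by omega) hm).transpose
    have e2 := mul_desc_transpose hs (show h < m by omega) (h2 h le_rfl (by omega)).transpose.cen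
    rw [Matrix.transpose_transpose] at e1 e2
    rw [← e1, ← e2, Matrix.transpose_transpose, Matrix.transpose_transpose]
    exact Cls.right s hs (ih (by omega))

/-- The last column of the product that starts the step `right`. -/
theorem right_col {h : ℕ} {R : Matrix (Ix m) (Ix m) 𝓐} {s : Chain 𝓐} (hs : s.Ok N h)
    (hm : h + 1 < m) (hR : Triv R (lv m (h + 1))) (i : Ix m) :
    (R * mk m b a (h + 1) * s.desc m h) i (lv m (h + 1)) =
      (1 : Matrix (Ix m) (Ix m) 𝓐) i (lv m (h + 1)) * a (h + 1) + R i (lv m h) := by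
  rw [(mul_desc _ hs (by omega) i).2 _ hm, if_pos (by omega), mk, glet_succ,
    mul_swapM _ _ (lv_ne hm (by omega)), if_pos rfl, (hR i).2]

theorem left_col {h : ℕ} {R : Matrix (Ix m) (Ix m) 𝓐} {s : Chain 𝓐} (hs : s.Ok N h)
    (hm : h + 1 < m) (hR : Triv R (lv m (h + 1))) (i : Ix m) :
    (s.asc m h * mk m b a (h + 1) * R) i (lv m (h + 1)) =
      (1 : Matrix (Ix m) (Ix m) 𝓐) i (lv m (h + 1)) * a (h + 1) + s.desc m h (lv m h) i := by
  have e : (s.asc m h * mk m b a (h + 1) * R) i (lv m (h + 1)) =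
      (s.asc m h * mk m b a (h + 1)) i (lv m (h + 1)) := by
    rw [Matrix.mul_apply]
    simp only [(hR _).2, Matrix.one_apply, mul_ite, mul_one, mul_zero, Finset.sum_ite_eq',
      Finset.mem_univ, if_true]
  rw [e, mk, glet_succ, mul_swapM _ _ (lv_ne hm (by omega)), if_pos rfl,
    asc_eq_transpose hs (by omega), Matrix.transpose_apply, Matrix.transpose_apply,
    (desc_triv hm (by omega) i).1, Matrix.one_apply, Matrix.one_apply]
  simp only [eq_comm]

/-- For $h\ge1$ this prevents column $h$ from being the $h$-th unit column, and so rules out empty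
strings below. A right step copies the preceding last column of $R$; a left step shows the end
matrix $x\ne0$ of its string. At $h=0$ the nonzero entry is the $1$ at the border or $a_0$ itself.
-/
theorem Cls.col_ne_zero [Nontrivial 𝓐] (hN : ∀ X, N X → X ≠ 0) (hb : b = true ∨ a 0 ≠ 0) {h : ℕ}
    {R Q : Matrix (Ix m) (Ix m) 𝓐} (hC : Cls m b a N h R Q) (hm : h < m) :
    ∃ i, R i (lv m h) ≠ 0 ∧ (h = 0 ∨ i ≠ lv m h) := by
  induction hC with
  | zero =>
    rcases hb with rfl | hb
    · refine ⟨Sum.inr (), ?_, Or.inl rfl⟩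
      simp [mk, glet, swapM, (lv_ne_inr hm).symm]
    · refine ⟨lv m 0, ?_, Or.inl rfl⟩
      cases b <;> simp [mk, glet, swapM, diagM, hb]
  | @right h R Q s hs hC ih =>
    obtain ⟨h1, h2, h3⟩ := hC.triv (by omega)
    obtain ⟨i, hi, -⟩ := ih (by omega)
    have hne : i ≠ lv m (h + 1) := by
      rintro rfl
      rw [(h1 _ (by omega) hm _).1, Matrix.one_apply_ne (lv_ne hm (by omega))] at hi
      exact hi rfl
    refine ⟨i, ?_, Or.inr hne⟩
    rw [right_col hs hm (h1 _ (by omega) hm), Matrix.one_apply_ne hne, zero_mul, zero_add]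
    exact hi
  | @left h R Q s hs hC ih =>
    obtain ⟨h1, h2, h3⟩ := hC.triv (by omega)
    obtain ⟨c1, c2, c3, c4⟩ := id hs
    refine ⟨lv m (s.c - 1), ?_, Or.inr (lv_ne (by omega) (by omega))⟩
    rw [left_col hs hm (h1 _ (by omega) hm), Matrix.one_apply_ne (lv_ne (by omega) (by omega)),
      zero_mul, zero_add, (desc_row hs (by omega)).2 _ (by omega), if_neg (by omega),
      if_neg (by omega), if_pos (by omega)]
    rcases c4 with h | h
    · rw [h]; exact one_ne_zero
    · exact hN _ h

end Cls

/-! ### Moving a string to the other side of a pair -/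

section Swap

variable {m : ℕ} {𝓐 : Type} [Ring 𝓐] {b : Bool} {a : ℕ → 𝓐} {N : 𝓐 → Prop}

theorem mk_succ (k : ℕ) : glet m false (k + 1) (a (k + 1)) = mk m b a (k + 1) := rfl

theorem Chain.Ok.x_ne_zero [Nontrivial 𝓐] (hN : ∀ X, N X → X ≠ 0) {s : Chain 𝓐} {k : ℕ}
    (hs : s.Ok N k) : s.x ≠ 0 := by
  obtain ⟨-, -, -, h | h⟩ := hs
  · rw [h]; exact one_ne_zero
  · exact hN _ h

theorem desc_zero {s : Chain 𝓐} (hs : s.Ok N 0) : s.desc m 0 = glet m false 0 s.x := by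
  obtain ⟨h1, h2, -⟩ := hs
  rw [Chain.desc, descL_self _ _ (by omega), one_mul]

theorem asc_zero {s : Chain 𝓐} (hs : s.Ok N 0) : s.asc m 0 = glet m false 0 s.x := by
  obtain ⟨h1, h2, -⟩ := hs
  rw [Chain.asc, ascL_self _ _ (by omega), mul_one]

theorem glet_false_zero (X : 𝓐) (i : Ix m) :
    glet m false 0 X (lv m 0) i = if i = lv m 0 then X else 0 := by
  simp only [glet, diagM, if_true, Bool.false_eq_true, if_false, Matrix.diagonal_apply]
  split_ifs with h1 h2 h2
  · rfl
  · exact absurd h1.symm h2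
  · exact absurd h2.symm h1
  · rfl

/-- A letter $0$ coupled to the border has an entry $1$ there, and a letter $0$ without border has
none. This is what excludes odd $h$ on the side of the nonnegative indices. -/
theorem mk_zero_eq [Nontrivial 𝓐] (hm : 0 < m) {x : 𝓐}
    (h : ∀ i, mk m b a 0 i (lv m 0) = glet m false 0 x (lv m 0) i) : b = false ∧ a 0 = x := by
  cases b with
  | true =>
    have := h (Sum.inr ())
    rw [glet_false_zero, if_neg (lv_ne_inr hm).symm] at this
    simp [mk, glet, swapM, (lv_ne_inr hm).symm] at this
  | false =>
    refine ⟨rfl, ?_⟩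
    have := h (lv m 0)
    rwa [mk, glet_false_zero, glet_false_zero, if_pos rfl, if_pos rfl] at this

theorem triv_mk_commute {k j : ℕ} {R : Matrix (Ix m) (Ix m) 𝓐} (hm : k + 1 < m) (hj : j ≤ k)
    (hR : ∀ l, j ≤ l → l < m → Triv R (lv m l)) : Commute R (mk m b a (k + 1)) := by
  refine commute_of_triv fun i => ?_
  rcases lv_cases i with ⟨l, hl, rfl⟩ | rfl
  · rcases Nat.lt_or_ge l k with h | h
    · exact Or.inr (triv_glet_lv hl (by omega) (by omega))
    · exact Or.inl (hR l (by omega) hl)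
  · exact Or.inr (triv_glet_inr hm (Or.inr (by omega)))

theorem not_desc_col [Nontrivial 𝓐] (hN : ∀ X, N X → X ≠ 0) {s : Chain 𝓐} {j : ℕ} (hm : j + 1 < m)
    (hs : s.Ok N (j + 1)) (hc : s.c ≤ j + 1) :
    ∃ i, i ≠ lv m (j + 1) ∧ s.desc m (j + 1) (lv m (j + 1)) i ≠ 0 := by
  have h1 := hs.1
  refine ⟨lv m (s.c - 1), lv_ne (by omega) (by omega), ?_⟩
  rw [(desc_row hs hm).2 _ (by omega), if_neg (by omega), if_neg (by omega), if_pos (by omega)]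
  exact hs.x_ne_zero hN

theorem one_lv_of_triv {R : Matrix (Ix m) (Ix m) 𝓐} {l j : ℕ} (hl : l < m) (h : l ≠ j)
    (hR : Triv R (lv m l)) : R (lv m l) (lv m j) = 0 := by
  rw [(hR _).1, Matrix.one_apply_ne (lv_ne hl h)]

/-- If the last step of the pair is a left step, its last column displays its own string, which
equals $s$ by rigidity. If it is a right step, the last column displays a column of the inner pair,
so the hypotheses descend to that pair; induction extracts the shortened reversed string on its
left, and the step is then reassembled. -/
theorem Cls.swap [Nontrivial 𝓐] (hN : ∀ X, N X → X ≠ 0) (hb : b = true ∨ a 0 ≠ 0) {j : ℕ}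
    {R₀ Q₀ : Matrix (Ix m) (Ix m) 𝓐} {s : Chain 𝓐} (hC : Cls m b a N (j + 1) R₀ Q₀)
    (hm : j + 1 < m) (hs : s.Ok N (j + 1)) (hc : s.c ≤ j + 1)
    (hR : ∀ i, R₀ i (lv m (j + 1)) = s.desc m (j + 1) (lv m (j + 1)) i)
    (hQ : ∀ i, Q₀ i (lv m j) = s.desc m j (lv m j) i) :
    s.Z (j + 1) = a (j + 1) ∧ ∃ R' Q', Cls m b a N j R' Q' ∧
      R₀ = s.asc m j * mk m b a (j + 1) * R' ∧ Q₀ = s.asc m j * Q' := by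
  induction j generalizing R₀ Q₀ with
  | zero =>
    have hs0 : s.Ok N 0 := hs.mono hc
    have hd := desc_row hs0 (show 0 < m by omega)
    have z : s.desc m 0 (lv m 0) (lv m (0 + 1)) = 0 := by rw [hd.2 _ hm, if_pos (by omega)]
    cases hC with
    | left s' hs' hC' =>
      have ht := hC'.triv (by omega)
      have e : ∀ i, (1 : Matrix (Ix m) (Ix m) 𝓐) i (lv m (0 + 1)) * a (0 + 1) + s'.desc m 0 (lv m 0) i =
          (1 : Matrix (Ix m) (Ix m) 𝓐) i (lv m (0 + 1)) * s.Z (0 + 1) + s.desc m 0 (lv m 0) i := by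
        intro i
        rw [← left_col hs' hm (ht.1 _ (by omega) hm), hR, desc_row_succ hc hm]
      have ea := e (lv m (0 + 1))
      rw [z, (desc_row hs' (by omega)).2 _ hm, if_pos (by omega), Matrix.one_apply_eq, one_mul, add_zero, one_mul,
        add_zero] at ea
      refine ⟨ea.symm, _, _, hC', ?_, ?_⟩ <;>
      rw [chain_rigid hN hs' hs0 (by omega) fun i => by simpa [ea] using e i]
    | right s' hs' hC' =>
      have ht := hC'.triv (by omega)
      rename_i R Q
      have e : ∀ i, (1 : Matrix (Ix m) (Ix m) 𝓐) i (lv m (0 + 1)) * a (0 + 1) + R i (lv m 0) =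
          (1 : Matrix (Ix m) (Ix m) 𝓐) i (lv m (0 + 1)) * s.Z (0 + 1) + s.desc m 0 (lv m 0) i := by
        intro i
        rw [← right_col hs' hm (ht.1 _ (by omega) hm), hR, desc_row_succ hc hm]
      have ea := e (lv m (0 + 1))
      rw [z, one_lv_of_triv hm (by omega) (ht.1 _ (by omega) hm), Matrix.one_apply_eq, one_mul,
        add_zero, one_mul, add_zero] at ea
      have e' : ∀ i, R i (lv m 0) = s.desc m 0 (lv m 0) i := fun i => by simpa [ea] using e i
      -- The inner pair is the letter $0$ alone. It coincides with the string of `s`, and the string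
      -- of `s'` is a letter $0$ with the same matrix, so the two letters can exchange their roles.
      cases hC' with
      | zero =>
        rw [desc_zero hs0] at e' hQ
        obtain ⟨rfl, h0⟩ := mk_zero_eq (by omega) e'
        have hx := hQ (lv m 0)
        rw [desc_zero hs', one_mul, glet_false_zero, glet_false_zero, if_pos rfl, if_pos rfl] at hx
        refine ⟨ea.symm, _, _, Cls.zero, ?_, ?_⟩
        · rw [desc_zero hs', asc_zero hs0, mk, hx, ← h0]
        · rw [desc_zero hs', asc_zero hs0, hx, one_mul, mul_one]
  | succ j ih =>
    have hs0 : s.Ok N (j + 1) := hs.mono hc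
    have hd := desc_row hs0 (show j + 1 < m by omega)
    have z : s.desc m (j + 1) (lv m (j + 1)) (lv m (j + 1 + 1)) = 0 := by
      rw [hd.2 _ hm, if_pos (by omega)]
    cases hC with
    | left s' hs' hC' =>
      have ht := hC'.triv (by omega)
      have e : ∀ i, (1 : Matrix (Ix m) (Ix m) 𝓐) i (lv m (j + 1 + 1)) * a (j + 1 + 1) +
          s'.desc m (j + 1) (lv m (j + 1)) i =
          (1 : Matrix (Ix m) (Ix m) 𝓐) i (lv m (j + 1 + 1)) * s.Z (j + 1 + 1) +
            s.desc m (j + 1) (lv m (j + 1)) i := by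
        intro i
        rw [← left_col hs' hm (ht.1 _ (by omega) hm), hR, desc_row_succ hc hm]
      have ea := e (lv m (j + 1 + 1))
      rw [z, (desc_row hs' (by omega)).2 _ hm, if_pos (by omega), Matrix.one_apply_eq, one_mul,
        add_zero, one_mul, add_zero] at ea
      refine ⟨ea.symm, _, _, hC', ?_, ?_⟩ <;>
      rw [chain_rigid hN hs' hs0 (by omega) fun i => by simpa [ea] using e i]
    | @right _ R Q s' hs' hC' =>
      have ht := hC'.triv (by omega)
      have e : ∀ i, (1 : Matrix (Ix m) (Ix m) 𝓐) i (lv m (j + 1 + 1)) * a (j + 1 + 1) +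
          R i (lv m (j + 1)) =
          (1 : Matrix (Ix m) (Ix m) 𝓐) i (lv m (j + 1 + 1)) * s.Z (j + 1 + 1) +
            s.desc m (j + 1) (lv m (j + 1)) i := by
        intro i
        rw [← right_col hs' hm (ht.1 _ (by omega) hm), hR, desc_row_succ hc hm]
      have ea := e (lv m (j + 1 + 1))
      rw [z, one_lv_of_triv hm (by omega) (ht.1 _ (by omega) hm), Matrix.one_apply_eq, one_mul,
        add_zero, one_mul, add_zero] at ea
      have e' : ∀ i, R i (lv m (j + 1)) = s.desc m (j + 1) (lv m (j + 1)) i :=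
        fun i => by simpa [ea] using e i
      -- Otherwise the string of `s` up to `j + 1` is empty, and column `j + 1` of the inner matrix
      -- is a unit column, contrary to `Cls.col_ne_zero`.
      have hc1 : s.c ≤ j + 1 := by
        by_contra h
        obtain ⟨i, h1, h2⟩ := hC'.col_ne_zero hN hb (by omega)
        rw [e', desc_row_top hs0 (by omega),
          Matrix.one_apply_ne (h2.resolve_left (by omega)).symm] at h1
        exact h1 rfl
      have hs1 : s.Ok N j := hs.mono hc1
      have q1 : ∀ i, (Q * s'.desc m (j + 1)) i (lv m (j + 1)) = _ :=
        fun i => (mul_desc Q hs' (by omega) i).2 (j + 1) (by omega)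
      have hQt := ht.2.1 (j + 1) le_rfl (by omega)
      obtain ⟨c1, c2, c3, c4⟩ := id hs'
      -- If the string of `s'` were empty, column `j + 1` of `Q₀` would vanish off the diagonal,
      -- whereas the row of `s` has a nonzero entry at its end.
      have hc' : s'.c ≤ j + 1 := by
        by_contra h
        obtain ⟨i, h1, h2⟩ := not_desc_col hN (by omega : j + 1 < m) hs0 hc1
        rw [← hQ, q1, if_neg (by omega), if_neg (by omega), if_pos (by omega), (hQt i).2,
          Matrix.one_apply_ne h1, zero_mul] at h2
        exact h2 rfl
      have q2 : ∀ i, (1 : Matrix (Ix m) (Ix m) 𝓐) i (lv m (j + 1)) * s'.Z (j + 1) + Q i (lv m j) =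
          (1 : Matrix (Ix m) (Ix m) 𝓐) i (lv m (j + 1)) * s.Z (j + 1) + s.desc m j (lv m j) i := by
        intro i
        rw [← desc_row_succ hc1 (by omega), ← hQ, q1, if_neg (by omega), if_pos hc', (hQt i).2]
        rfl
      have qa := q2 (lv m (j + 1))
      rw [one_lv_of_triv (by omega) (by omega) hQt, (desc_row hs1 (by omega)).2 _ (by omega),
        if_pos (by omega), Matrix.one_apply_eq, one_mul, add_zero, one_mul, add_zero] at qa
      obtain ⟨hZ, R₁, Q₁, hC₁, rfl, rfl⟩ := ih hC' (by omega) hs0 hc1 e'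
        fun i => by simpa [qa] using q2 i
      have t₁ := hC₁.triv (by omega)
      -- The first letter of `s'` carries `a (j + 1)`, so it becomes the coefficient letter of a
      -- right step on `R₁`, and the rest of `s'` becomes the string of that step.
      refine ⟨ea.symm, _, _, Cls.right s' (hs'.mono hc') hC₁, ?_, ?_⟩
      · have := triv_mk_commute (b := b) (a := a) (j := j + 1) hm le_rfl
          (fun l h1 h2 => t₁.1 l (by omega) h2)
        rw [desc_succ hc', asc_succ hc1, qa, hZ, mk_succ (b := b)]
        simp only [mul_assoc]
        rw [← mul_assoc R₁, this.eq]
        simp only [mul_assoc]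
      · have := triv_mk_commute (b := b) (a := a) (j := j) (by omega) le_rfl t₁.2.1
        rw [desc_succ hc', asc_succ hc1, qa, hZ, mk_succ (b := b)]
        simp only [mul_assoc]
        rw [← mul_assoc Q₁, this.eq]
        simp only [mul_assoc]

/-- The position at which the index `i` of the factor `X` is found in `asc * X * desc`. -/
def Chain.shift (m : ℕ) (s : Chain 𝓐) : Ix m → Ix m
  | Sum.inl l => lv m (if (l : ℕ) + 1 < s.c then l else l + 1)
  | Sum.inr _ => Sum.inr ()

theorem desc_shift {s : Chain 𝓐} {k : ℕ} (hs : s.Ok N k) (hm : k < m) {i : Ix m}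
    (hi : ∀ l, k ≤ l → l < m → i ≠ lv m l) :
    (∀ l, k < l → l < m → s.shift m i ≠ lv m l) ∧
    ∃ z, ∀ p, s.desc m k p (s.shift m i) =
      (1 : Matrix (Ix m) (Ix m) 𝓐) p i + (1 : Matrix (Ix m) (Ix m) 𝓐) p (lv m k) * z := by
  have e := fun p => mul_desc (1 : Matrix (Ix m) (Ix m) 𝓐) hs hm p
  simp only [one_mul] at e
  rcases lv_cases i with ⟨l, hl, rfl⟩ | rfl
  · have hlk : l < k := by
      by_contra h
      exact hi l (by omega) hl rfl
    have hsh : s.shift m (lv m l) = lv m (if l + 1 < s.c then l else l + 1) := by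
      simp [Chain.shift, lv, hl]
    rw [hsh]
    constructor
    · intro l' h1 h2
      split_ifs
      · exact lv_ne hl (by omega)
      · exact lv_ne (by omega) (by omega)
    · split_ifs with h
      · refine ⟨0, fun p => ?_⟩
        rw [(e p).2 l hl, if_neg (by omega), if_neg (by omega), if_neg (by omega), mul_zero,
          add_zero]
      · refine ⟨s.Z (l + 1), fun p => ?_⟩
        rw [(e p).2 (l + 1) (by omega), if_neg (by omega), if_pos (by omega), add_comm]
        rfl
  · exact ⟨fun l _ hl => (lv_ne_inr hl).symm, 0, fun p => by
      rw [mul_zero, add_zero]; exact (e p).1⟩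

/-- The two outer factors would be transposes of each other but for one more letter on the left.
Below level $k$ and at the border, an entry of $X$ reappears in the product at the positions given
by `Chain.shift`, which are the same for rows and columns. The further terms come from the levels
$k$ and $k+1$ and drop out because $X$ is trivial there. -/
theorem symm_of_chain {s : Chain 𝓐} {k : ℕ} {X : Matrix (Ix m) (Ix m) 𝓐} (hs : s.Ok N k)
    (hm : k + 1 < m) (hX : ∀ l, k ≤ l → l < m → Triv X (lv m l))
    (h : (s.asc m (k + 1) * X * s.desc m k).transpose = s.asc m (k + 1) * X * s.desc m k) :
    X.transpose = X := by
  have hs' : s.Ok N (k + 1) := ⟨hs.1, by have := hs.2.1; omega, hs.2.2⟩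
  have key : ∀ i j : Ix m, (∀ l, k ≤ l → l < m → i ≠ lv m l) → (∀ l, k ≤ l → l < m → j ≠ lv m l) →
      (s.asc m (k + 1) * X * s.desc m k) (s.shift m i) (s.shift m j) = X i j := by
    intro i j hi hj
    obtain ⟨h1, z, hz⟩ := desc_shift hs (show k < m by omega) hj
    obtain ⟨-, z', hz'⟩ := desc_shift hs' hm fun l hl hl' => hi l (by omega) hl'
    have y : ∀ p, (X * s.desc m k) p (s.shift m j) =
        X p j + (1 : Matrix (Ix m) (Ix m) 𝓐) p (lv m k) * z := by
      intro p
      rw [Matrix.mul_apply]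
      simp only [hz, mul_add, Finset.sum_add_distrib, Matrix.one_apply, mul_ite, ite_mul, mul_one, one_mul, zero_mul,
        mul_zero, Finset.sum_ite_eq', Finset.mem_univ, if_true]
      rw [(hX k le_rfl (by omega) p).2, Matrix.one_apply]
      simp
    rw [mul_assoc, Matrix.mul_apply]
    simp only [asc_eq_transpose hs' hm, Matrix.transpose_apply, hz', y]
    simp only [add_mul, Finset.sum_add_distrib, Matrix.one_apply, ite_mul, one_mul, zero_mul,
      Finset.sum_ite_eq', Finset.mem_univ, if_true]
    rw [(hX (k + 1) (by omega) hm j).1, Matrix.one_apply_ne (hj (k + 1) (by omega) hm).symm,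
      if_neg (hi k le_rfl (by omega)), if_neg (lv_ne hm (by omega))]
    simp
  ext i j
  rw [Matrix.transpose_apply]
  by_cases hi : ∃ l, k ≤ l ∧ l < m ∧ i = lv m l
  · obtain ⟨l, h1, h2, rfl⟩ := hi
    rw [(hX l h1 h2 j).1, (hX l h1 h2 j).2, Matrix.one_apply, Matrix.one_apply]
    simp only [eq_comm]
  by_cases hj : ∃ l, k ≤ l ∧ l < m ∧ j = lv m l
  · obtain ⟨l, h1, h2, rfl⟩ := hj
    rw [(hX l h1 h2 i).1, (hX l h1 h2 i).2, Matrix.one_apply, Matrix.one_apply]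
    simp only [eq_comm]
  push Not at hi hj
  rw [← key j i hj hi, ← key i j hi hj, ← Matrix.transpose_apply (M := s.asc m (k + 1) * X * s.desc m k), h]

end Swap

/-- This does not follow from `sip_symm`, since deleting letters may destroy the SIP; the same
induction has to be repeated. It serves the factor $M_{\sigma_1}M_{\sigma_2}$ of the leading or
constant coefficient. -/
theorem sip_complement {h : ℕ} {t : List ℤ} (ht : IsCanonical h t) :
    SIP (t ++ simpleComplement h ++ t.reverse) := by
  induction h using Nat.twoStepInduction generalizing t with
  | zero =>
    rw [isCanonical_of_le_one (by omega)] at ht; subst ht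
    simpa [simpleComplement_zero] using sip_nil
  | one =>
    rw [isCanonical_of_le_one (by omega)] at ht; subst ht
    rw [sip_iff_run]; intro j
    simp only [simpleComplement_one, List.nil_append,
      List.reverse_nil, List.append_nil, List.foldl_cons, List.foldl_nil, sipStep]
    split_ifs <;> simp
  | more h ih _ =>
    obtain ⟨a, t', ht', rfl⟩ := isCanonical_add_two.1 ht
    have IH := ih ht'
    rw [sip_iff_run] at IH ⊢
    intro j
    rw [simpleComplement_add_two]
    have mx : ∀ k ∈ str a h, k ≤ h := fun k hk => (mem_str.1 hk).2
    have mx' : ∀ k ∈ (str a h).reverse, k ≤ h := fun k hk => mx k (by simpa using hk)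
    have mt : ∀ k ∈ t', k ≤ (h : ℤ) - 2 := fun k hk => (mem_of_isCanonical ht' hk).2
    have mt' : ∀ k ∈ t'.reverse, k ≤ (h : ℤ) - 2 := fun k hk => mt k (by simpa using hk)
    have mc : ∀ k ∈ simpleComplement h, k ≤ (h : ℤ) - 1 := fun k hk => (mem_simpleComplement hk).2.1
    have irr : ∀ (l : List ℤ) (b : ℤ), (∀ k ∈ l, k ≤ b) → b < j → ∀ s, l.foldl (sipStep j) s = s := by
      intro l b hl hb s
      exact sipRun_of_forall_ne _ _ _ fun k hk => by have := hl k hk; omega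
    have IHj := IH j
    simp only [List.reverse_append, List.foldl_append, List.foldl_cons, List.foldl_nil,
      List.append_assoc, List.cons_append] at IHj ⊢
    rcases lt_or_ge j h with hj | hj
    · have s1 : ∀ s, sipStep j s ((h : ℤ) + 1) = s := fun s => by
        simp [sipStep, show (h : ℤ) + 1 ≠ j by omega, show (h : ℤ) ≠ j by omega]
      rw [(sipRun_str hj).1, s1]
      obtain ⟨v, hv⟩ := Option.ne_none_iff_exists'.1 IHj
      rw [hv]
      exact (sipRun_str hj).2 v
    · rw [irr t' _ mt (by omega), irr t'.reverse _ mt' (by omega), irr _ _ mc (by omega)]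
      rcases hj.eq_or_lt with hj | hj
      · subst hj
        have nd := str_nodup a h
        have hx : ∃ v, (str a h).foldl (sipStep h) (some true) = some v := by
          have := (sip_iff_run _).1 (sip_infix ⟨[], _, by simp; rfl⟩ (sip_symm ht)) h
          simpa [Option.ne_none_iff_exists', List.foldl_append, irr t' _ mt (by omega)] using this
        have hx' : (str a h).reverse.foldl (sipStep h) (some true) ≠ none := by
          have : SIP (str a h).reverse :=
            sip_reverse (sip_infix (t := str a h ++ t')
              ⟨[], t', by simp⟩ (sip_infix ⟨[], _, by simp; rfl⟩ (sip_symm ht)))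
          exact (sip_iff_run _).1 this h
        obtain ⟨v, hv⟩ := hx
        rw [hv]
        have e1 : ∀ u, sipStep (h : ℤ) (some u) ((h : ℤ) + 1) = some true := fun u => by simp [sipStep]
        rw [e1]
        exact hx'
      · rw [irr _ _ mx hj, irr _ _ mx' hj]
        simp only [sipStep]
        split_ifs <;> simp

/-! ### Symmetric words and the classification of symmetric pairs -/

section SymmetricWords

variable {m : ℕ} {𝓐 : Type} [Ring 𝓐] {b : Bool} {a : ℕ → 𝓐} {N : 𝓐 → Prop}

/-- The word with the indices `l` that carries the coefficients `a`. -/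
def coeffWord (b : Bool) (a : ℕ → 𝓐) (l : List ℤ) : List (Bool × ℕ × 𝓐) :=
  l.map fun k => (b, k.toNat, a k.toNat)

/-- The word `(x, w, c, rev x)` for the simple admissible tuple `w` of `{0 : h}` with symmetric
complement `c`. -/
def symmWord (b : Bool) (a : ℕ → 𝓐) (h : ℕ) (x : List (Bool × ℕ × 𝓐)) : List (Bool × ℕ × 𝓐) :=
  x ++ coeffWord b a (simpleTuple h) ++ coeffWord false a (simpleComplement h) ++ x.reverse

/-- The word `(x, c, rev x)` for the symmetric complement `c` of the simple admissible tuple. -/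
def symmWord' (a : ℕ → 𝓐) (h : ℕ) (x : List (Bool × ℕ × 𝓐)) : List (Bool × ℕ × 𝓐) :=
  x ++ coeffWord false a (simpleComplement h) ++ x.reverse

theorem coeffWord_cons (b : Bool) (a : ℕ → 𝓐) (k : ℤ) (l : List ℤ) :
    coeffWord b a (k :: l) = (b, k.toNat, a k.toNat) :: coeffWord b a l := rfl

theorem widx_coeffWord (b : Bool) (a : ℕ → 𝓐) {l : List ℤ} (hl : ∀ k ∈ l, 0 ≤ k) :
    widx (coeffWord b a l) = l := by
  rw [widx, coeffWord, List.map_map]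
  conv_rhs => rw [← List.map_id l]
  exact List.map_congr_left fun k hk => by simp [hl k hk]

theorem widx_append (s t : List (Bool × ℕ × 𝓐)) : widx (s ++ t) = widx s ++ widx t :=
  List.map_append

theorem widx_reverse (s : List (Bool × ℕ × 𝓐)) : widx s.reverse = (widx s).reverse :=
  List.map_reverse

theorem wprod_triv {t : List (Bool × ℕ × 𝓐)} {l : ℕ} (hl : l < m) (ht : ∀ p ∈ t, p.2.1 < l) :
    Triv (wprod m t) (lv m l) := by
  induction t with
  | nil => exact triv_one _
  | cons p t ih =>
    rw [wprod_cons]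
    have := ht p (by simp)
    exact (triv_glet_lv hl (by omega) (by omega)).mul (ih fun q hq => ht q (by simp [hq]))

theorem wprod_triv_inr {t : List (Bool × ℕ × 𝓐)} (ht : ∀ p ∈ t, p.1 = false ∧ p.2.1 < m) :
    Triv (wprod m t) (Sum.inr ()) := by
  induction t with
  | nil => exact triv_one _
  | cons p t ih =>
    rw [wprod_cons]
    have := ht p (by simp)
    exact (triv_glet_inr this.2 (Or.inl this.1)).mul (ih fun q hq => ht q (by simp [hq]))

theorem wprod_commute_mk {t : List (Bool × ℕ × 𝓐)} {k : ℕ} (hm : k + 1 < m)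
    (ht : ∀ p ∈ t, p.2.1 < k) : Commute (wprod m t) (mk m b a (k + 1)) :=
  triv_mk_commute hm le_rfl fun _ h1 h2 => wprod_triv h2 fun p hp => by have := ht p hp; omega

theorem exists_word_of_chain {s : Chain 𝓐} {k : ℕ} (hs : s.Ok N k) :
    ∃ x : List (Bool × ℕ × 𝓐), (∀ p ∈ x, p.1 = false ∧ (p.2.1 = 0 → N p.2.2)) ∧
      (∃ c : ℕ, widx x = str c k) ∧ wprod m x = s.asc m k ∧ wprod m x.reverse = s.desc m k := by
  obtain ⟨h1, h2, h3, h4⟩ := hs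
  have base : ∀ k, s.c ≤ k + 1 → ∃ x : List (Bool × ℕ × 𝓐),
      (∀ p ∈ x, p.1 = false ∧ (p.2.1 = 0 → N p.2.2)) ∧
      widx x = str s.c k ∧ wprod m x = ascL m s.c s.Z (k + 1) ∧
        wprod m x.reverse = descL m s.c s.Z (k + 1) := by
    intro k hk
    induction k with
    | zero =>
      refine ⟨[], by simp, ?_, ?_, ?_⟩
      · rw [str_of_lt (by push_cast; omega)]; rfl
      · rw [ascL_self _ _ (by omega)]; rfl
      · rw [descL_self _ _ (by omega)]; rfl
    | succ k ih =>
      rcases hk.eq_or_lt with hk | hk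
      · refine ⟨[], by simp, ?_, ?_, ?_⟩
        · rw [str_of_lt (by push_cast; omega)]; rfl
        · rw [ascL_self _ _ (by omega)]; rfl
        · rw [descL_self _ _ (by omega)]; rfl
      · obtain ⟨x, e1, e2, e3, e4⟩ := ih (by omega)
        refine ⟨x ++ [(false, k + 1, s.Z (k + 1))], ?_, ?_, ?_, ?_⟩
        · intro p hp
          rcases List.mem_append.1 hp with hp | hp
          · exact e1 p hp
          · rw [List.mem_singleton] at hp; subst hp; simp
        · rw [widx_append, e2, Nat.cast_succ, str_succ (by omega)]; simp [widx]
        · rw [wprod_append, e3, ascL.eq_def m s.c s.Z (k + 1 + 1)]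
          simp only [if_pos (show s.c ≤ k + 1 by omega)]
          rw [wprod_cons, wprod_nil, mul_one]
        · rw [List.reverse_append, wprod_append, e4, descL.eq_def m s.c s.Z (k + 1 + 1)]
          simp only [if_pos (show s.c ≤ k + 1 by omega)]
          simp [wprod]
  obtain ⟨x, e1, e2, e3, e4⟩ := base k h2
  by_cases hx : s.x = 1
  · refine ⟨x, e1, ⟨s.c, e2⟩, ?_, ?_⟩
    · rw [Chain.asc, hx, glet_zero_one, one_mul, e3]
    · rw [Chain.desc, hx, glet_zero_one, mul_one, e4]
  · have hc : s.c = 1 := by by_contra h; exact hx (h3 h)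
    refine ⟨(false, 0, s.x) :: x, ?_, ⟨0, ?_⟩, ?_, ?_⟩
    · intro p hp
      rcases List.mem_cons.1 hp with rfl | hp
      · exact ⟨rfl, fun _ => h4.resolve_left hx⟩
      · exact e1 p hp
    · rw [Nat.cast_zero, str_cons (by omega), zero_add]
      rw [hc] at e2; simp only [Nat.cast_one] at e2; rw [← e2]; simp [widx]
    · rw [wprod_cons, e3, Chain.asc]
    · rw [List.reverse_cons, wprod_append, e4, Chain.desc]; simp [wprod]

/-- Transposition turns a left step into a right step and fixes a symmetric pair. -/
theorem Cls.exists_right {h : ℕ} {R Q : Matrix (Ix m) (Ix m) 𝓐} (hC : Cls m b a N (h + 1) R Q)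
    (hm : h + 1 < m) (hR : R.transpose = R) (hQ : Q.transpose = Q) :
    ∃ (s : Chain 𝓐) (R₀ Q₀ : Matrix (Ix m) (Ix m) 𝓐), s.Ok N h ∧ Cls m b a N h R₀ Q₀ ∧
      R = R₀ * mk m b a (h + 1) * s.desc m h ∧ Q = Q₀ * s.desc m h := by
  cases hC with
  | right s hs hC => exact ⟨s, _, _, hs, hC, rfl, rfl⟩
  | left s hs hC =>
    obtain ⟨h1, h2, h3⟩ := hC.triv (by omega)
    have e1 := mul_mk_desc_transpose (b := b) (a := a) hs hm (h1 _ (by omega) hm).transpose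
    have e2 := mul_desc_transpose hs (show h < m by omega) (h2 h le_rfl (by omega)).transpose.cen
    rw [Matrix.transpose_transpose] at e1 e2
    refine ⟨s, _, _, hs, hC.transpose (by omega), ?_, ?_⟩
    · rw [← hR, ← e1, Matrix.transpose_transpose]
    · rw [← hQ, ← e2, Matrix.transpose_transpose]

/-- The letters $h+1$ and $h+2$ commute with `x` and with the complement for $h$, all of whose
indices are below $h$. The outcome is the layer that `Cls.exists_word` peels off a symmetric pair.
-/
theorem symmWord_add_two {h : ℕ} (hm : h + 2 < m) {x x₁ : List (Bool × ℕ × 𝓐)}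
    (hx : ∀ p ∈ x, p.2.1 < h) :
    wprod m (symmWord b a (h + 2) (x₁ ++ x)) = wprod m x₁ * mk m b a (h + 1) *
      mk m b a (h + 2) * wprod m (symmWord b a h x) * mk m b a (h + 1) * wprod m x₁.reverse ∧
    wprod m (symmWord' a (h + 2) (x₁ ++ x)) = wprod m x₁ * mk m b a (h + 1) *
      wprod m (symmWord' a h x) * wprod m x₁.reverse := by
  have hc : ∀ p ∈ coeffWord false a (simpleComplement h), p.2.1 < h := by
    intro p hp
    obtain ⟨k, hk, rfl⟩ := List.mem_map.1 hp
    have := mem_simpleComplement hk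
    simp only; omega
  have hxr : ∀ p ∈ x.reverse, p.2.1 < h := fun p hp => hx p (List.mem_reverse.1 hp)
  have c1 := wprod_commute_mk (b := b) (a := a) (show h + 1 < m by omega) hx
  have c2 := wprod_commute_mk (b := b) (a := a) (show h + 1 + 1 < m by omega)
    (fun p hp => (hx p hp).trans (by omega))
  have c3 := wprod_commute_mk (b := b) (a := a) (show h + 1 < m by omega) hc
  have c4 := wprod_commute_mk (b := b) (a := a) (show h + 1 < m by omega) hxr
  have e1 : ∀ k : ℕ, glet m b (((h : ℤ) + (k + 1 : ℕ)).toNat) (a ((h : ℤ) + (k + 1 : ℕ)).toNat) =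
      mk m b a (h + k + 1) := by
    intro k
    rw [show (((h : ℤ) + (k + 1 : ℕ)).toNat) = h + k + 1 by omega]; rfl
  have e2 : ∀ k : ℕ, glet m false (((h : ℤ) + (k + 1 : ℕ)).toNat) (a ((h : ℤ) + (k + 1 : ℕ)).toNat) =
      mk m b a (h + k + 1) := by
    intro k
    rw [show (((h : ℤ) + (k + 1 : ℕ)).toNat) = h + k + 1 by omega]; rfl
  have e10 := e1 0
  have e11 := e1 1
  have e20 := e2 0
  simp only [zero_add, Nat.cast_one, add_zero, Nat.cast_ofNat] at e10 e11 e20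
  constructor
  · simp only [symmWord, simpleTuple_add_two, simpleComplement_add_two, coeffWord_cons,
      wprod_append, wprod_cons, List.reverse_append]
    simp only [Nat.reduceAdd, Nat.cast_ofNat] at e11
    rw [e10, e11, e20]
    simp only [mul_assoc]
    congr 1
    rw [← mul_assoc (wprod m x.reverse), c4.eq, mul_assoc (mk m b a (h + 1)),
      ← mul_assoc (wprod m (coeffWord false a (simpleComplement h))) (mk m b a (h + 1)), c3.eq,
      mul_assoc (mk m b a (h + 1)), ← mul_assoc (wprod m x), c1.eq, mul_assoc, ← mul_assoc (wprod m x), c2.eq, mul_assoc]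
  · simp only [symmWord', simpleComplement_add_two, coeffWord_cons,
      wprod_append, wprod_cons, List.reverse_append]
    rw [e20]
    simp only [mul_assoc]
    congr 1
    rw [← mul_assoc (wprod m x), c1.eq, mul_assoc]

theorem lt_of_isCanonical {h : ℕ} {x : List (Bool × ℕ × 𝓐)} (hx : IsCanonical h (widx x)) :
    ∀ p ∈ x, p.2.1 + 2 ≤ h := fun p hp => by
  have := mem_of_isCanonical hx (List.mem_map_of_mem hp)
  omega

/-- A symmetric pair of matrices of the class `Cls` has the form of the theorem. -/
theorem Cls.exists_word [Nontrivial 𝓐] (hN : ∀ X, N X → X ≠ 0) (hb : b = true ∨ a 0 ≠ 0) {h : ℕ}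
    {R Q : Matrix (Ix m) (Ix m) 𝓐} (hC : Cls m b a N h R Q) (hm : h < m)
    (hR : R.transpose = R) (hQ : Q.transpose = Q) :
    (b = true → Even h) ∧ ∃ x : List (Bool × ℕ × 𝓐),
      (∀ p ∈ x, p.1 = false ∧ (p.2.1 = 0 → N p.2.2)) ∧ IsCanonical h (widx x) ∧
      R = wprod m (symmWord b a h x) ∧ Q = wprod m (symmWord' a h x) := by
  -- The last column of `R` contains column `h` of `R₀` and its last row contains the string `s`,
  -- with the same diagonal term. Symmetry therefore equates the two.
  have cond : ∀ {h : ℕ} {R R₀ : Matrix (Ix m) (Ix m) 𝓐} {s : Chain 𝓐} (hm : h + 1 < m),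
      s.Ok N h → Triv R₀ (lv m (h + 1)) → R.transpose = R →
      R = R₀ * mk m b a (h + 1) * s.desc m h → ∀ i, R₀ i (lv m h) = s.desc m h (lv m h) i := by
    intro h R R₀ s hm hs h1 hR e i
    have e1 := right_col (b := b) (a := a) hs hm h1 i
    have e2 := left_col (b := b) (a := a) hs hm h1.transpose i
    rw [← mul_mk_desc_transpose hs hm h1, ← e, hR] at e2
    rw [← e, e2] at e1
    exact (add_left_cancel e1).symm
  induction h using Nat.twoStepInduction generalizing R Q with
  | zero =>
    cases hC with
    | zero =>
      refine ⟨fun _ => ⟨0, rfl⟩, [], by simp, (isCanonical_of_le_one (by omega)).2 rfl, ?_, ?_⟩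
      · simp [symmWord, simpleTuple_zero, simpleComplement_zero, coeffWord, wprod, mk]
      · simp [symmWord', simpleComplement_zero, coeffWord, wprod]
  | one =>
    obtain ⟨s, R₀, Q₀, hs, hC₀, e1, e2⟩ := hC.exists_right hm hR hQ
    have h1 := cond hm hs ((hC₀.triv (by omega)).1 _ (by omega) hm) hR e1
    cases hC₀ with
    | zero =>
      rw [desc_zero hs] at h1 e1 e2
      obtain ⟨rfl, h0⟩ := mk_zero_eq (by omega) h1
      refine ⟨by simp, [], by simp, (isCanonical_of_le_one (by omega)).2 rfl, ?_, ?_⟩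
      · rw [e1]
        simp [symmWord, simpleTuple_one, simpleComplement_one, coeffWord, wprod, mk, mul_assoc, h0]
      · rw [e2]
        simp [symmWord', simpleComplement_one, coeffWord, wprod, h0]
  | more h ih _ =>
    obtain ⟨s, R₀, Q₀, hs, hC₀, e1, e2⟩ := hC.exists_right hm hR hQ
    have ht := hC₀.triv (by omega)
    have h1 := cond hm hs (ht.1 _ (by omega) hm) hR e1
    have hc : s.c ≤ h + 1 := by
      by_contra hc
      obtain ⟨i, g1, g2⟩ := hC₀.col_ne_zero hN hb (by omega)
      rw [h1, desc_row_top hs (by have := hs.2.1; omega),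
        Matrix.one_apply_ne (g2.resolve_left (by omega)).symm] at g1
      exact g1 rfl
    have hQt := ht.2.1 (h + 1) le_rfl (by omega)
    -- The same comparison for `Q`, between its column and its row at `h + 1`.
    have h2 : ∀ i, Q₀ i (lv m h) = s.desc m h (lv m h) i := by
      intro i
      have q1 : Q i (lv m (h + 1)) = (1 : Matrix (Ix m) (Ix m) 𝓐) i (lv m (h + 1)) * s.Z (h + 1) +
          Q₀ i (lv m h) := by
        rw [e2, (mul_desc Q₀ hs (by omega) i).2 _ (by omega), if_neg (by omega), if_pos hc,
          (hQt i).2]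
        rfl
      have q2 : Q i (lv m (h + 1)) = s.desc m (h + 1) (lv m (h + 1)) i := by
        rw [← hQ, e2, mul_desc_transpose hs (by omega) hQt.cen, asc_eq_transpose hs (by omega),
          Matrix.mul_apply]
        simp only [(hQt.transpose _).2, Matrix.one_apply, mul_ite, mul_one, mul_zero,
          Finset.sum_ite_eq', Finset.mem_univ, if_true, Matrix.transpose_apply]
      rw [q2, desc_row_succ hc (by omega)] at q1
      exact (add_left_cancel q1).symm
    obtain ⟨hZ, R', Q', hC', rfl, rfl⟩ := hC₀.swap hN hb (by omega) hs hc h1 h2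
    have ht' := hC'.triv (by omega)
    have hs' : s.Ok N h := hs.mono hc
    have k1 : Commute R' (mk m b a (h + 1 + 1)) := triv_mk_commute (j := h + 1) hm le_rfl
      fun l g1 g2 => ht'.1 l (by omega) g2
    have k2 : Commute Q' (mk m b a (h + 1)) := triv_mk_commute (j := h) (by omega) le_rfl ht'.2.1
    have f1 : R = s.asc m h * mk m b a (h + 1) * mk m b a (h + 2) * R' * mk m b a (h + 1) *
        s.desc m h := by
      rw [e1, desc_succ hc, hZ, mk_succ (b := b)]
      simp only [mul_assoc]
      rw [← mul_assoc R', k1.eq, mul_assoc]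
    have f2 : Q = s.asc m h * mk m b a (h + 1) * Q' * s.desc m h := by
      rw [e2, desc_succ hc, hZ, mk_succ (b := b)]
      simp only [mul_assoc]
      rw [← mul_assoc Q', k2.eq, mul_assoc]
    have hR' : R'.transpose = R' := by
      -- The string is prolonged by the letter `h + 2` with its coefficient, so that `R` takes the
      -- form in which `symm_of_chain` applies. For `Q` the string `s` itself suffices.
      let s₂ : Chain 𝓐 := ⟨s.c, s.x, Function.update s.Z (h + 2) (a (h + 2))⟩
      have hs₂ : s₂.Ok N (h + 1) := hs
      have g1 : ∀ k, k ≤ h + 1 → s₂.asc m k = s.asc m k ∧ s₂.desc m k = s.desc m k := by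
        intro k hk
        have := descL_congr (m := m) (c := s.c) (k := k + 1)
          (Z := Function.update s.Z (h + 2) (a (h + 2)))
          (Z' := s.Z) fun l _ hl => Function.update_of_ne (by omega) _ _
        simp only [Chain.asc, Chain.desc, s₂, this.1, this.2, and_self]
      refine symm_of_chain hs₂ hm (fun l g1 g2 => ht'.1 l (by omega) g2) ?_
      have : s₂.asc m (h + 1 + 1) * R' * s₂.desc m (h + 1) = R := by
        rw [asc_succ (show s₂.c ≤ h + 1 + 1 from by show s.c ≤ _; omega), (g1 _ le_rfl).1, (g1 _ le_rfl).2, asc_succ hc,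
          desc_succ hc, hZ, f1, show s₂.Z (h + 1 + 1) = a (h + 1 + 1) from Function.update_self ..,
          mk_succ (b := b), mk_succ (b := b)]
        simp only [mul_assoc]
      rw [this, hR]
    have hQ' : Q'.transpose = Q' := by
      refine symm_of_chain hs' (by omega) ht'.2.1 ?_
      have : s.asc m (h + 1) * Q' * s.desc m h = Q := by
        rw [asc_succ hc, hZ, f2, mk_succ (b := b)]
      rw [this, hQ]
    obtain ⟨he, x, hx, hxc, rfl, rfl⟩ := ih hC' (by omega) hR' hQ'
    obtain ⟨x₁, y1, ⟨c, y2⟩, y3, y4⟩ := exists_word_of_chain (m := m) hs'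
    have hxlt := lt_of_isCanonical hxc
    obtain ⟨z1, z2⟩ := symmWord_add_two (b := b) (a := a) hm (x₁ := x₁) fun p hp => by have := hxlt p hp; omega
    refine ⟨fun hb' => (he hb').add even_two, x₁ ++ x, ?_, ?_, ?_, ?_⟩
    · intro p hp
      rcases List.mem_append.1 hp with hp | hp
      · exact y1 p hp
      · exact hx p hp
    · rw [isCanonical_add_two]
      exact ⟨c, widx x, hxc, by rw [widx_append, y2]⟩
    · rw [z1, f1, y3, y4]
    · rw [z2, f2, y3, y4]

theorem coeffWord_eq {h : ℕ} {l : List ℤ} (b : Bool) (a : ℕ → 𝓐) (hl : ∀ k ∈ l, 0 ≤ k ∧ k ≤ (h : ℤ)) :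
    widx (coeffWord b a l) = l ∧ ∀ p ∈ coeffWord b a l, p.2.1 ≤ h := by
  refine ⟨widx_coeffWord _ _ fun k hk => (hl k hk).1, fun p hp => ?_⟩
  obtain ⟨k, hk, rfl⟩ := List.mem_map.1 hp
  have := hl k hk
  simp only; omega

theorem widx_symmWord (b : Bool) (a : ℕ → 𝓐) (h : ℕ) (x : List (Bool × ℕ × 𝓐)) :
    widx (symmWord b a h x) =
      widx x ++ simpleTuple h ++ simpleComplement h ++ (widx x).reverse := by
  rw [symmWord, widx_append, widx_append, widx_append, widx_reverse,
    widx_coeffWord _ _ fun k hk => (mem_simpleTuple hk).1,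
    widx_coeffWord _ _ fun k hk => (mem_simpleComplement hk).1]

theorem widx_symmWord' (a : ℕ → 𝓐) (h : ℕ) (x : List (Bool × ℕ × 𝓐)) :
    widx (symmWord' a h x) = widx x ++ simpleComplement h ++ (widx x).reverse := by
  rw [symmWord', widx_append, widx_append, widx_reverse,
    widx_coeffWord _ _ fun k hk => (mem_simpleComplement hk).1]

theorem symmWord_lt {h : ℕ} (hm : h < m) {x : List (Bool × ℕ × 𝓐)} (hx : IsCanonical h (widx x)) :
    (∀ p ∈ symmWord b a h x, p.2.1 < m) ∧ ∀ p ∈ symmWord' a h x, p.2.1 < m := by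
  have h1 := (coeffWord_eq b a fun k hk => mem_simpleTuple (h := h) hk).2
  have h2 := (coeffWord_eq false a (h := h) fun k hk => by
    have := mem_simpleComplement (h := h) hk; exact ⟨this.1, by omega⟩).2
  have h3 := lt_of_isCanonical hx
  constructor
  · intro p hp
    simp only [symmWord, List.mem_append, List.mem_reverse] at hp
    rcases hp with ((hp | hp) | hp) | hp
    · have := h3 p hp; omega
    · exact (h1 p hp).trans_lt hm
    · exact (h2 p hp).trans_lt hm
    · have := h3 p hp; omega
  · intro p hp
    simp only [symmWord', List.mem_append, List.mem_reverse] at hp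
    rcases hp with (hp | hp) | hp
    · have := h3 p hp; omega
    · exact (h2 p hp).trans_lt hm
    · have := h3 p hp; omega

/-- The letters of the complement are at mutual distance at least two, so they commute, and the
remaining letters can be moved into reversed order two levels at a time. For odd $h$ the innermost
word is $(0,1,0)$, which is a palindrome only if both letters $0$ are of the same kind; with the
border they are not. -/
theorem coeffWord_complement_commute {h : ℕ} (hm : h < m) (hbh : b = true → Even h) :
    wprod m (coeffWord false a (simpleComplement h)).reverse *
      wprod m (coeffWord b a (simpleTuple h)).reverse =
    wprod m (coeffWord b a (simpleTuple h)) * wprod m (coeffWord false a (simpleComplement h)) ∧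
    wprod m (coeffWord false a (simpleComplement h)).reverse =
      wprod m (coeffWord false a (simpleComplement h)) := by
  induction h using Nat.twoStepInduction with
  | zero => simp [simpleTuple_zero, simpleComplement_zero, coeffWord, wprod]
  | one =>
    have : b = false := by
      cases b
      · rfl
      · exact absurd (hbh rfl) (by decide)
    subst this
    simp [simpleTuple_one, simpleComplement_one, coeffWord, wprod, mul_assoc]
  | more h ih _ =>
    have hc : ∀ p ∈ coeffWord false a (simpleComplement h), p.2.1 < h := by
      intro p hp
      obtain ⟨k, hk, rfl⟩ := List.mem_map.1 hp
      have := mem_simpleComplement hk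
      simp only; omega
    have hw : ∀ p ∈ (coeffWord b a (simpleTuple h)).reverse, p.2.1 < h + 1 := by
      intro p hp
      obtain ⟨k, hk, rfl⟩ := List.mem_map.1 (List.mem_reverse.1 hp)
      have := mem_simpleTuple hk
      simp only; omega
    obtain ⟨i1, i2⟩ := ih (by omega) fun hb => by have := hbh hb; rwa [Nat.even_add, iff_true_right even_two] at this
    have c1 := wprod_commute_mk (b := b) (a := a) (show h + 1 < m by omega) hc
    have c2 := wprod_commute_mk (b := b) (a := a) (show h + 1 + 1 < m by omega) hw
    have c3 := wprod_commute_mk (b := b) (a := a) (show h + 1 + 1 < m by omega)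
      (fun p hp => (hc p hp).trans (Nat.lt_succ_self _))
    have e1 : ((h : ℤ) + 1).toNat = h + 1 := by omega
    have e2 : ((h : ℤ) + 2).toNat = h + 1 + 1 := by omega
    have e3 : glet m false (h + 1) (a (h + 1)) = mk m b a (h + 1) := rfl
    have e4 : ∀ k, glet m b k (a k) = mk m b a k := fun _ => rfl
    simp only [simpleTuple_add_two, simpleComplement_add_two, coeffWord_cons, List.reverse_cons,
      wprod_append, wprod_cons, wprod_nil, mul_one, e1, e2, e3, e4]
    rw [i2] at i1 ⊢
    refine ⟨?_, c1.eq⟩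
    rw [mul_assoc _ _ (mk m b a (h + 1)), c1.eq]
    simp only [mul_assoc]
    congr 1
    rw [← mul_assoc _ _ (mk m b a (h + 1)), c2.eq, ← mul_assoc, ← mul_assoc, c3.eq,
      mul_assoc (mk m b a (h + 1 + 1)), i1, ← c1.eq]
    simp only [mul_assoc]

/-- The matrices of the theorem are symmetric. -/
theorem symmWord_transpose {h : ℕ} (hm : h < m) (hbh : b = true → Even h)
    {x : List (Bool × ℕ × 𝓐)} (hx : IsCanonical h (widx x)) :
    (wprod m (symmWord b a h x)).transpose = wprod m (symmWord b a h x) ∧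
      (wprod m (symmWord' a h x)).transpose = wprod m (symmWord' a h x) := by
  obtain ⟨h1, h2⟩ := symmWord_lt (b := b) (a := a) hm hx
  have hs := sip_symm hx
  obtain ⟨c1, c2⟩ := coeffWord_complement_commute (b := b) (a := a) hm hbh
  constructor
  · rw [(wprod_sip h1 (by rw [widx_symmWord]; exact hs)).1]
    simp only [symmWord, List.reverse_append, List.reverse_reverse, wprod_append]
    simp only [mul_assoc]
    congr 1
    rw [← mul_assoc, c1, mul_assoc]
  · rw [(wprod_sip h2 (by rw [widx_symmWord']; exact sip_complement hx)).1]
    simp only [symmWord', List.reverse_append, List.reverse_reverse, wprod_append, c2, mul_assoc]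

end SymmetricWords

/-! ## From block matrices to matrices -/

section Conv

variable {m n r : ℕ} {K : Type} [CommRing K]

/-- The bordered matrix that belongs to a block matrix, in which the last column of blocks is
multiplied by `C`, the last row is multiplied by `B`, and the corner is `Z`. -/
def conv (C : Matrix (Fin n) (Fin r) K) (B : Matrix (Fin r) (Fin n) K) (Z : Matrix (Fin r) (Fin r) K)
    (M : Matrix (Ix m) (Ix m) (Matrix (Fin n) (Fin n) K)) :
    Matrix ((Fin m × Fin n) ⊕ Fin r) ((Fin m × Fin n) ⊕ Fin r) K :=
  Matrix.fromBlocks (Matrix.of fun p q => M (Sum.inl p.1) (Sum.inl q.1) p.2 q.2)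
    (Matrix.of fun p k => (M (Sum.inl p.1) (Sum.inr ()) * C) p.2 k)
    (Matrix.of fun k p => (B * M (Sum.inr ()) (Sum.inl p.1)) k p.2) Z

variable {C : Matrix (Fin n) (Fin r) K} {B : Matrix (Fin r) (Fin n) K} {Z : Matrix (Fin r) (Fin r) K}

theorem conv_one : conv (m := m) (0 : Matrix (Fin n) (Fin r) K) 0 1 1 = 1 := by
  refine Eq.trans ?_ Matrix.fromBlocks_one
  rw [conv, Matrix.fromBlocks_inj]
  refine ⟨?_, ?_, ?_, rfl⟩
  · ext p q
    simp only [Matrix.of_apply, Matrix.one_apply, Sum.inl.injEq, Prod.ext_iff]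
    by_cases h : p.1 = q.1 <;> simp [h, Matrix.one_apply]
  · ext p k; simp
  · ext p k; simp

/-- The rectangular matrices $C$ and $B$ live outside the ring of blocks. A factor that is trivial
at the border never meets them, so it acts as $\mathrm{diag}(\cdot,I_r)$. -/
theorem conv_mul (M : Matrix (Ix m) (Ix m) (Matrix (Fin n) (Fin n) K))
    {L : Matrix (Ix m) (Ix m) (Matrix (Fin n) (Fin n) K)} (hL : Triv L (Sum.inr ())) :
    conv C B Z M * conv 0 0 1 L = conv C B Z (M * L) := by
  simp only [conv, Matrix.fromBlocks_multiply]
  congr 1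
  · ext p q
    simp [Matrix.mul_apply, Matrix.sum_apply, Fintype.sum_prod_type, (hL (Sum.inl q.1)).1]
  · ext p k
    simp [Matrix.mul_apply, (hL _).2]
  · ext k p
    have : (M * L) (Sum.inr ()) (Sum.inl p.1) =
        ∑ x, M (Sum.inr ()) (Sum.inl x) * L (Sum.inl x) (Sum.inl p.1) := by
      rw [Matrix.mul_apply, Fintype.sum_sum_type]
      simp [(hL (Sum.inl p.1)).1]
    simp only [Matrix.add_apply, Matrix.mul_zero, Matrix.zero_apply, add_zero, Matrix.of_apply, this,
      Matrix.mul_sum, Matrix.sum_apply, ← Matrix.mul_assoc, zero_add, Matrix.zero_mul]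
    rw [Matrix.mul_apply, Fintype.sum_prod_type]
    simp [Matrix.mul_apply (M := B * M (Sum.inr ()) (Sum.inl _)), Matrix.mul_apply (M := Z)]
  · ext k l; simp [Matrix.mul_apply]

theorem conv_mul_left (M : Matrix (Ix m) (Ix m) (Matrix (Fin n) (Fin n) K))
    {L : Matrix (Ix m) (Ix m) (Matrix (Fin n) (Fin n) K)} (hL : Triv L (Sum.inr ())) :
    conv 0 0 1 L * conv C B Z M = conv C B Z (L * M) := by
  simp only [conv, Matrix.fromBlocks_multiply]
  congr 1
  · ext p q
    simp [Matrix.mul_apply, Matrix.sum_apply, Fintype.sum_prod_type, (hL (Sum.inl p.1)).2]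
  · ext p k
    have : (L * M) (Sum.inl p.1) (Sum.inr ()) =
        ∑ x, L (Sum.inl p.1) (Sum.inl x) * M (Sum.inl x) (Sum.inr ()) := by
      rw [Matrix.mul_apply, Fintype.sum_sum_type]
      simp [(hL (Sum.inl p.1)).2]
    simp only [Matrix.add_apply, Matrix.mul_zero, Matrix.zero_apply, add_zero, Matrix.of_apply, this,
      Matrix.sum_mul, Matrix.sum_apply, Matrix.mul_assoc, zero_add, Matrix.zero_mul]
    rw [Matrix.mul_apply, Fintype.sum_prod_type]
    simp [Matrix.mul_apply (M := L (Sum.inl _) (Sum.inl _)), Matrix.mul_apply]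
  · ext k p
    simp [Matrix.mul_apply, (hL _).1]
  · ext k l; simp [Matrix.mul_apply]

theorem conv_eq_border {M : Matrix (Ix m) (Ix m) (Matrix (Fin n) (Fin n) ℂ)} :
    conv 0 0 1 M = border r (Matrix.of fun p q => M (Sum.inl p.1) (Sum.inl q.1) p.2 q.2) := by
  rw [conv, border]
  congr 1
  · ext p k; simp
  · ext p k; simp

end Conv

/-! ### Reversal of the levels -/

section Reverse

variable {m : ℕ} {𝓐 : Type} [Ring 𝓐]

/-- The reversal of the levels. -/
def revIx (m : ℕ) : Ix m ≃ Ix m := Equiv.sumCongr Fin.revPerm (Equiv.refl _)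

/-- The matrix with the levels in reversed order. -/
def rv (M : Matrix (Ix m) (Ix m) 𝓐) : Matrix (Ix m) (Ix m) 𝓐 := M.submatrix (revIx m) (revIx m)

theorem revIx_lv {k : ℕ} (hk : k < m) : revIx m (lv m k) = lv m (m - 1 - k) := by
  simp only [lv, hk, dite_true, show m - 1 - k < m by omega, revIx, Equiv.sumCongr_apply, Sum.map_inl]
  congr 1
  ext
  simp [Fin.rev]; omega

theorem revIx_inr : revIx m (Sum.inr ()) = Sum.inr () := rfl

theorem revIx_revIx (i : Ix m) : revIx m (revIx m i) = i := by
  rcases i with i | i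
  · simp [revIx]
  · rfl

theorem rv_mul (A B : Matrix (Ix m) (Ix m) 𝓐) : rv (A * B) = rv A * rv B :=
  (Matrix.submatrix_mul_equiv A B _ _ _).symm

theorem rv_one : rv (1 : Matrix (Ix m) (Ix m) 𝓐) = 1 := Matrix.submatrix_one_equiv _

theorem rv_rv (A : Matrix (Ix m) (Ix m) 𝓐) : rv (rv A) = A := by
  ext i j; simp [rv, revIx_revIx]

theorem rv_transpose (A : Matrix (Ix m) (Ix m) 𝓐) : (rv A).transpose = rv A.transpose := rfl

theorem Triv.rv {A : Matrix (Ix m) (Ix m) 𝓐} {i : Ix m} (h : Triv A (revIx m i)) : Triv (rv A) i := by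
  intro j
  simp only [GFPR.rv, Matrix.submatrix_apply, (h _).1, (h _).2]
  simp [Matrix.one_apply]

theorem rv_swapM (i j : Ix m) (X : 𝓐) : rv (swapM i j X) = swapM (revIx m i) (revIx m j) X := by
  have e : ∀ a b : Ix m, revIx m a = b ↔ a = revIx m b := fun a b => by
    constructor
    · rintro rfl; rw [revIx_revIx]
    · rintro rfl; rw [revIx_revIx]
  ext a b
  simp only [rv, swapM, Matrix.submatrix_apply, Matrix.of_apply, e, revIx_revIx]

/-- In terms of elementary matrices this is $M_i(X)^{-1}=M_{-i}(-X)$. -/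
theorem swapM_mul_swapM {i j : Ix m} (hij : i ≠ j) (X : 𝓐) :
    swapM j i (-X) * swapM i j X = 1 := by
  ext a b
  rw [mul_swapM _ _ hij]
  simp only [swapM, Matrix.of_apply, Matrix.one_apply, if_true, if_neg hij, if_neg hij.symm]
  by_cases h1 : b = i
  · subst h1
    by_cases h2 : a = j
    · subst h2; simp [hij, hij.symm]
    · by_cases h3 : a = b
      · subst h3; simp [h2]
      · simp [h2, h3]
  · by_cases h4 : b = j
    · subst h4
      by_cases h2 : a = b
      · subst h2; simp [hij.symm]
      · by_cases h3 : a = i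
        · subst h3; simp [h2, h1]
        · simp [h2, h3]
    · by_cases h2 : a = j
      · subst h2; simp [h1, h4, Ne.symm h4]
      · by_cases h3 : a = i
        · subst h3; simp [h1, h4, h2, Ne.symm h1]
        · simp [h1, h4, h2, h3]

end Reverse

/-! ### Elementary and Fiedler matrices as letters -/

section Elementary

variable {m n r : ℕ}

/-- $M_k(X)$ carries $X$ in block $m-k$, which is level $k$ counted from the end; this is the reason
for the reversal. $M_{k-m}(X)$ carries $X$ in block $k+1$, which is level $k$ counted from the
start, so `elem_of_neg` needs none. -/
theorem elem_of_nonneg {k : ℕ} (hk : k < m) (X : Matrix (Fin n) (Fin n) ℂ) :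
    elem m k X = Matrix.of fun p q => rv (glet m false k X) (Sum.inl p.1) (Sum.inl q.1) p.2 q.2 := by
  ext ⟨a, i⟩ ⟨b, j⟩
  simp only [elem, Matrix.of_apply, rv, Matrix.submatrix_apply]
  have ha := a.2
  have hb := b.2
  have e : ∀ a : Fin m, revIx m (Sum.inl a) = lv m (m - 1 - a) := fun a => by
    rw [← revIx_lv a.2]; simp [lv]
  rw [e, e]
  rcases Nat.eq_zero_or_pos k with rfl | h0
  · simp only [elemBlock, Nat.cast_zero, if_true, glet, Bool.false_eq_true, if_false, diagM,
      Matrix.diagonal_apply, lv_inj (show m - 1 - a < m by omega) (show m - 1 - b < m by omega),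
      lv_inj (show m - 1 - a < m by omega) hk]
    split_ifs <;> first | rfl | omega
  · rw [glet_of_pos (by omega)]
    simp only [elemBlock, swapM, Matrix.of_apply, Nat.abs_cast, Matrix.one_apply,
      lv_inj (show m - 1 - a < m by omega) (show m - 1 - b < m by omega),
      lv_inj (show m - 1 - a < m by omega) hk, lv_inj (show m - 1 - b < m by omega) hk,
      lv_inj (show m - 1 - a < m by omega) (show k - 1 < m by omega),
      lv_inj (show m - 1 - b < m by omega) (show k - 1 < m by omega)]
    split_ifs <;> first | rfl | omega

theorem elem_of_neg {k : ℕ} (hk : k < m) (X : Matrix (Fin n) (Fin n) ℂ) :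
    elem m ((k : ℤ) - m) X =
      Matrix.of fun p q => glet m false k X (Sum.inl p.1) (Sum.inl q.1) p.2 q.2 := by
  ext ⟨a, i⟩ ⟨b, j⟩
  simp only [elem, Matrix.of_apply]
  have ha := a.2
  have hb := b.2
  have e : ∀ a : Fin m, (Sum.inl a : Ix m) = lv m a := fun a => by simp [lv]
  rw [e, e]
  rcases Nat.eq_zero_or_pos k with rfl | h0
  · simp only [elemBlock, glet, Bool.false_eq_true, if_false, if_true, diagM,
      Matrix.diagonal_apply, lv_inj ha hb, lv_inj ha hk]
    split_ifs <;> first | rfl | omega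
  · rw [glet_of_pos (by omega)]
    have habs : |(k : ℤ) - m| = m - k := by rw [abs_of_neg (by omega)]; ring
    simp only [elemBlock, swapM, Matrix.of_apply, habs, Matrix.one_apply,
      lv_inj ha hb, lv_inj ha hk, lv_inj hb hk, lv_inj ha (show k - 1 < m by omega),
      lv_inj hb (show k - 1 < m by omega)]
    split_ifs <;> first | rfl | omega

variable {S : Realization (Fin n) r}

theorem border_elem_of_nonneg {k : ℕ} (hk : k < m) (X : Matrix (Fin n) (Fin n) ℂ) :
    border r (elem m k X) = conv 0 0 1 (rv (glet m false k X)) := by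
  rw [conv_eq_border, elem_of_nonneg hk]

theorem border_elem_of_neg {k : ℕ} (hk : k < m) (X : Matrix (Fin n) (Fin n) ℂ) :
    border r (elem m ((k : ℤ) - m) X) = conv 0 0 1 (glet m false k X) := by
  rw [conv_eq_border, elem_of_neg hk]

theorem fiedlerS_of_pos {k : ℕ} (h0 : 0 < k) : 
    fiedlerS S m k = border r (elem m k (trivialCoeff S k)) := by
  rw [fiedlerS, if_neg (by omega), if_neg (by omega), if_pos (by omega)]; rfl

theorem border_mul (A B : Matrix (Fin m × Fin n) (Fin m × Fin n) ℂ) :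
    border r A * border r B = border r (A * B) := by
  simp [border, Matrix.fromBlocks_multiply]

theorem border_one : border r (1 : Matrix (Fin m × Fin n) (Fin m × Fin n) ℂ) = 1 := by
  simp [border]

/-- By definition this Fiedler matrix is the inverse of the letter $m-k$ with matrix $-A_{m-k}$.
Inverting changes the sign and exchanges the two levels, which gives the letter $k-m$ with matrix
$A_{m-k}$. -/
theorem fiedlerS_of_neg {k : ℕ} (h0 : 0 < k) (hk : k < m) :
    fiedlerS S m ((k : ℤ) - m) = border r (elem m ((k : ℤ) - m) (trivialCoeff S ((k : ℤ) - m))) := by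
  rw [fiedlerS, if_neg (by omega), if_neg (by omega), if_neg (by omega)]
  apply Matrix.inv_eq_right_inv
  rw [border_elem_of_neg hk, fiedlerP, show -((k : ℤ) - m) = ((m - k : ℕ) : ℤ) by omega,
    border_elem_of_nonneg (by omega), conv_mul _ (triv_glet_inr hk (Or.inl rfl)), ← conv_one]
  congr 1
  rw [glet_of_pos (by omega), glet_of_pos (by omega), rv_swapM, revIx_lv (by omega),
    revIx_lv (by omega), show m - 1 - (m - k) = k - 1 by omega,
    show m - 1 - (m - k - 1) = k by omega]
  have : trivialCoeff S ((m - k : ℕ) : ℤ) = - trivialCoeff S ((k : ℤ) - m) := by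
    rw [trivialCoeff, trivialCoeff, if_pos (by omega), if_neg (by omega),
      show ((k : ℤ) - m).natAbs = m - k by omega, Int.natAbs_natCast]
  rw [this, swapM_mul_swapM (lv_ne hk (by omega))]

end Elementary

/-! ### Separation of the two sides, and the border row and column -/

section Words

variable {m : ℕ} {𝓐 : Type} [Ring 𝓐]

theorem rv_wprod_triv_or {s t : List (Bool × ℕ × 𝓐)} {k l : ℕ} (hs : ∀ p ∈ s, p.2.1 < k)
    (ht : ∀ p ∈ t, p.1 = false ∧ p.2.1 < l) (h : k + l ≤ m) (i : Ix m) :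
    Triv (rv (wprod m s)) i ∨ Triv (wprod m t) i := by
  rcases lv_cases i with ⟨j, hj, rfl⟩ | rfl
  · rcases Nat.lt_or_ge j l with h1 | h1
    · left
      refine Triv.rv ?_
      rw [revIx_lv hj]
      exact wprod_triv (by omega) fun p hp => by have := hs p hp; omega
    · exact Or.inr (wprod_triv hj fun p hp => by have := (ht p hp).2; omega)
  · exact Or.inr (wprod_triv_inr fun p hp => ⟨(ht p hp).1, by have := (ht p hp).2; omega⟩)

theorem rv_wprod_commute {s t : List (Bool × ℕ × 𝓐)} {k l : ℕ} (hs : ∀ p ∈ s, p.2.1 < k)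
    (ht : ∀ p ∈ t, p.1 = false ∧ p.2.1 < l) (h : k + l ≤ m) :
    Commute (rv (wprod m s)) (wprod m t) :=
  commute_of_triv (rv_wprod_triv_or hs ht h)

/-- The product shows the rows of $A$ where $A$ is not trivial and the rows of $B$ elsewhere, so
each factor can be read off from it. -/
theorem symm_mul_iff {ι : Type} [Fintype ι] [DecidableEq ι] {A B : Matrix ι ι 𝓐}
    (h : ∀ i, Triv A i ∨ Triv B i) :
    (A * B).transpose = A * B ↔ A.transpose = A ∧ B.transpose = B := by
  classical
  have e : ∀ a b, (A * B) a b = if ¬ Triv A a then A a b else B a b := by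
    refine fun a b => (mul_of_supp (fun i => ¬ Triv A i) ?_ ?_ a b).1
    · rintro a b (h' | h')
      · rw [not_not] at h'; exact (h' b).1
      · rw [not_not] at h'; exact (h' a).2
    · rintro a b (h' | h')
      · exact ((h a).resolve_left h' b).1
      · exact ((h b).resolve_left h' a).2
  have comm : ∀ (M : Matrix ι ι 𝓐) a b, Triv M a → M a b = M b a := fun M a b hM => by
    rw [(hM b).1, (hM b).2, Matrix.one_apply, Matrix.one_apply]; simp only [eq_comm]
  constructor
  · intro hs
    have hs' : ∀ a b, (A * B) b a = (A * B) a b := fun a b => congrFun (congrFun hs a) b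
    constructor
    · ext a b
      rw [Matrix.transpose_apply]
      by_cases ha : Triv A a
      · exact (comm A a b ha).symm
      by_cases hb : Triv A b
      · exact comm A b a hb
      have := hs' a b
      rwa [e, e, if_pos ha, if_pos hb] at this
    · ext a b
      rw [Matrix.transpose_apply]
      by_cases ha : Triv B a
      · exact (comm B a b ha).symm
      by_cases hb : Triv B b
      · exact comm B b a hb
      have := hs' a b
      rwa [e, e, if_neg (not_not.2 ((h a).resolve_right ha)),
        if_neg (not_not.2 ((h b).resolve_right hb))] at this
  · rintro ⟨hA, hB⟩
    ext a b
    have hA' : A b a = A a b := congrFun (congrFun hA a) b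
    have hB' : B b a = B a b := congrFun (congrFun hB a) b
    rw [Matrix.transpose_apply, e, e]
    by_cases ha : Triv A a <;> by_cases hb : Triv A b
    · simp [ha, hb, hB']
    · simp only [ha, hb, not_true, not_false_iff, if_true, if_false, hA']
      rw [(ha b).1, (((h b).resolve_left hb) a).2]
    · simp only [ha, hb, not_true, not_false_iff, if_true, if_false, hB']
      rw [(hb a).2, (((h a).resolve_left ha) b).1]
    · simp [ha, hb, hA']

/-- The letters before the border letter leave the border row alone, and the border letter replaces
it by row $0$ of the rest of the word, to which `wprod_row` applies. -/
theorem wprod_border_row (hm : 0 < m) {l₁ l₂ : List (Bool × ℕ × 𝓐)} (x : 𝓐)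
    (h₁ : ∀ p ∈ l₁, p.1 = false ∧ p.2.1 < m) (h₂ : ∀ p ∈ l₂, p.1 = false ∧ p.2.1 < m)
    (hs : SIP (widx l₁ ++ 0 :: widx l₂)) :
    ∃ q : ℕ, q < m ∧ (q : ℤ) = (widx l₂).foldl greedyStep 0 ∧ (q = 0 ∨ ∃ x ∈ l₂, x.2.1 = q) ∧
      ∀ j, wprod m (l₁ ++ (true, 0, x) :: l₂) (Sum.inr ()) j =
        (1 : Matrix (Ix m) (Ix m) 𝓐) (lv m q) j := by
  obtain ⟨q, e1, e2, e3, e4⟩ := wprod_row h₂ hm (sip_infix ⟨widx l₁, [], by simp⟩ hs)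
  refine ⟨q, e1, e2, e3, fun j => ?_⟩
  rw [← e4, wprod_append, wprod_cons, Matrix.mul_apply]
  simp only [(wprod_triv_inr h₁ _).1, Matrix.one_apply, ite_mul, one_mul, zero_mul,
    Finset.sum_ite_eq, Finset.mem_univ, if_true]
  simp only [glet, if_true]
  rw [swapM_mul _ _ (lv_ne_inr hm), if_neg (lv_ne_inr hm).symm, if_pos rfl]

theorem wprod_border_col (hm : 0 < m) {l₁ l₂ : List (Bool × ℕ × 𝓐)} (x : 𝓐)
    (h₁ : ∀ p ∈ l₁, p.1 = false ∧ p.2.1 < m) (h₂ : ∀ p ∈ l₂, p.1 = false ∧ p.2.1 < m)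
    (hs : SIP (widx l₁ ++ 0 :: widx l₂)) :
    ∃ q : ℕ, q < m ∧ (q : ℤ) = (widx l₁).reverse.foldl greedyStep 0 ∧
      (q = 0 ∨ ∃ x ∈ l₁, x.2.1 = q) ∧
      ∀ j, wprod m (l₁ ++ (true, 0, x) :: l₂) j (Sum.inr ()) =
        (1 : Matrix (Ix m) (Ix m) 𝓐) j (lv m q) := by
  have h₁' : ∀ p ∈ l₁.reverse, p.1 = false ∧ p.2.1 < m := fun p hp => h₁ p (List.mem_reverse.1 hp)
  have hs' : SIP (widx l₁ ++ [0]) := sip_infix ⟨[], widx l₂, by simp⟩ hs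
  have hs'' : SIP (((0 : ℕ) : ℤ) :: widx l₁.reverse) := by
    simpa [widx_reverse] using sip_reverse hs'
  obtain ⟨q, e1, e2, e3, e4⟩ := wprod_row h₁' hm hs''
  refine ⟨q, e1, by rw [e2, widx_reverse]; rfl, by simpa using e3, fun j => ?_⟩
  have ht := (wprod_sip (fun p hp => (h₁ p hp).2) (sip_infix ⟨[], [0], by simp⟩ hs')).1
  rw [wprod_append, wprod_cons, ← mul_assoc, Matrix.mul_apply]
  simp only [(wprod_triv_inr h₂ _).2, Matrix.one_apply, mul_ite, mul_one, mul_zero,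
    Finset.sum_ite_eq', Finset.mem_univ, if_true]
  simp only [glet, if_true]
  rw [mul_swapM _ _ (lv_ne_inr hm), if_neg (lv_ne_inr hm).symm, if_pos rfl,
    ← Matrix.transpose_apply (M := wprod m l₁), ht, e4, Matrix.one_apply]
  simp only [eq_comm]

end Words

/-! ### Products of elementary and Fiedler matrices as words -/

section Pencil

variable {m n r : ℕ}

/-- The word on the levels of the indices `0, 1, …`. -/
def sigmaWord (x : List (ℤ × Matrix (Fin n) (Fin n) ℂ)) :
    List (Bool × ℕ × Matrix (Fin n) (Fin n) ℂ) := x.map fun p => (false, p.1.toNat, p.2)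

/-- The word on the levels of the indices `-m, -m + 1, …`. -/
def tauWord (m : ℕ) (x : List (ℤ × Matrix (Fin n) (Fin n) ℂ)) :
    List (Bool × ℕ × Matrix (Fin n) (Fin n) ℂ) := x.map fun p => (false, (p.1 + (m : ℤ)).toNat, p.2)

theorem sigmaWord_append (x y : List (ℤ × Matrix (Fin n) (Fin n) ℂ)) :
    sigmaWord (x ++ y) = sigmaWord x ++ sigmaWord y := List.map_append

theorem tauWord_append (x y : List (ℤ × Matrix (Fin n) (Fin n) ℂ)) :
    tauWord m (x ++ y) = tauWord m x ++ tauWord m y := List.map_append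

theorem sigmaWord_reverse (x : List (ℤ × Matrix (Fin n) (Fin n) ℂ)) :
    sigmaWord x.reverse = (sigmaWord x).reverse := List.map_reverse

theorem tauWord_reverse (x : List (ℤ × Matrix (Fin n) (Fin n) ℂ)) :
    tauWord m x.reverse = (tauWord m x).reverse := List.map_reverse

theorem widx_sigmaWord {x : List (ℤ × Matrix (Fin n) (Fin n) ℂ)} (hx : ∀ i ∈ indices x, 0 ≤ i) :
    widx (sigmaWord x) = indices x := by
  rw [widx, sigmaWord, List.map_map, indices]
  exact List.map_congr_left fun p hp => by simp [hx p.1 (List.mem_map_of_mem hp)]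

theorem widx_tauWord {x : List (ℤ × Matrix (Fin n) (Fin n) ℂ)}
    (hx : ∀ i ∈ indices x, -(m : ℤ) ≤ i) :
    widx (tauWord m x) = (indices x).map (· + (m : ℤ)) := by
  rw [widx, tauWord, List.map_map, indices, List.map_map]
  refine List.map_congr_left fun p hp => ?_
  have := hx p.1 (List.mem_map_of_mem hp)
  simp; omega

theorem sigmaWord_lt {x : List (ℤ × Matrix (Fin n) (Fin n) ℂ)} {k : ℕ}
    (hx : ∀ i ∈ indices x, 0 ≤ i ∧ i < (k : ℤ)) : ∀ p ∈ sigmaWord x, p.1 = false ∧ p.2.1 < k := by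
  intro p hp
  obtain ⟨q, hq, rfl⟩ := List.mem_map.1 hp
  have := hx q.1 (List.mem_map_of_mem hq)
  exact ⟨rfl, by simp only; omega⟩

theorem tauWord_lt {x : List (ℤ × Matrix (Fin n) (Fin n) ℂ)} {k : ℕ}
    (hx : ∀ i ∈ indices x, -(m : ℤ) ≤ i ∧ i + m < (k : ℤ)) :
    ∀ p ∈ tauWord m x, p.1 = false ∧ p.2.1 < k := by
  intro p hp
  obtain ⟨q, hq, rfl⟩ := List.mem_map.1 hp
  have := hx q.1 (List.mem_map_of_mem hq)
  exact ⟨rfl, by simp only; omega⟩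

theorem triv_rv_wprod {s : List (Bool × ℕ × Matrix (Fin n) (Fin n) ℂ)}
    (hs : ∀ p ∈ s, p.1 = false ∧ p.2.1 < m) : Triv (rv (wprod m s)) (Sum.inr ()) :=
  Triv.rv (wprod_triv_inr hs)

theorem assignProdS_sigma {x : List (ℤ × Matrix (Fin n) (Fin n) ℂ)}
    (hx : ∀ i ∈ indices x, 0 ≤ i ∧ i < (m : ℤ)) :
    assignProdS m r x = conv 0 0 1 (rv (wprod m (sigmaWord x))) := by
  induction x with
  | nil =>
    rw [sigmaWord, List.map_nil, wprod_nil, rv_one, conv_one]; rfl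
  | cons p x ih =>
    have hx' : ∀ i ∈ indices x, 0 ≤ i ∧ i < (m : ℤ) := fun i hi => hx i (by
      rw [indices, List.map_cons]; exact List.mem_cons_of_mem _ hi)
    have hp := hx p.1 (by simp [indices])
    have hp' : ((p.1.toNat : ℕ) : ℤ) = p.1 := by omega
    have e : assignProdS m r (p :: x) = border r (elem m p.1 p.2) * assignProdS m r x := by
      simp [assignProdS]
    rw [e, ih hx', ← hp', border_elem_of_nonneg (by omega),
      conv_mul _ (triv_rv_wprod (sigmaWord_lt hx')), ← rv_mul]
    congr 2

theorem assignProdS_tau {x : List (ℤ × Matrix (Fin n) (Fin n) ℂ)}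
    (hx : ∀ i ∈ indices x, -(m : ℤ) ≤ i ∧ i < 0) :
    assignProdS m r x = conv 0 0 1 (wprod m (tauWord m x)) := by
  induction x with
  | nil =>
    rw [tauWord, List.map_nil, wprod_nil, conv_one]; rfl
  | cons p x ih =>
    have hx' : ∀ i ∈ indices x, -(m : ℤ) ≤ i ∧ i < 0 := fun i hi => hx i (by
      rw [indices, List.map_cons]; exact List.mem_cons_of_mem _ hi)
    have hp := hx p.1 (by simp [indices])
    have hp' : (((p.1 + m).toNat : ℕ) : ℤ) - m = p.1 := by omega
    have e : assignProdS m r (p :: x) = border r (elem m p.1 p.2) * assignProdS m r x := by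
      simp [assignProdS]
    rw [e, ih hx', ← hp', border_elem_of_neg (by omega),
      conv_mul _ (wprod_triv_inr (tauWord_lt (k := m) fun i hi => by have := hx' i hi; omega))]
    congr 1

/-- The coefficients on the levels of the indices `0, 1, …`. -/
def sigmaCoeff (S : Realization (Fin n) r) (k : ℕ) : Matrix (Fin n) (Fin n) ℂ := trivialCoeff S k

/-- The coefficients on the levels of the indices `-m, -m + 1, …`. -/
def tauCoeff (S : Realization (Fin n) r) (m k : ℕ) : Matrix (Fin n) (Fin n) ℂ :=
  trivialCoeff S ((k : ℤ) - m)

variable (S : Realization (Fin n) r)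

theorem coeffWord_pos {l : List ℤ} (hl : ∀ i ∈ l, 0 < i) (b b' : Bool)
    (a : ℕ → Matrix (Fin n) (Fin n) ℂ) :
    wprod m (coeffWord b a l) = wprod m (coeffWord b' a l) := by
  rw [wprod, wprod, coeffWord, coeffWord, List.map_map, List.map_map]
  congr 1
  refine List.map_congr_left fun i hi => ?_
  have := hl i hi
  simp only [Function.comp]
  rw [glet_of_pos (by omega), glet_of_pos (by omega)]

theorem sigmaWord_trivialAssign {l : List ℤ} (hl : ∀ i ∈ l, 0 ≤ i) :
    sigmaWord (trivialAssign S l) = coeffWord false (sigmaCoeff S) l := by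
  rw [sigmaWord, trivialAssign, List.map_map, coeffWord]
  refine List.map_congr_left fun i hi => ?_
  have := hl i hi
  simp only [Function.comp, sigmaCoeff, Int.toNat_of_nonneg this]

theorem tauWord_trivialAssign {l : List ℤ} (hl : ∀ i ∈ l, -(m : ℤ) ≤ i) :
    tauWord m (trivialAssign S l) = coeffWord false (tauCoeff S m) (l.map (· + (m : ℤ))) := by
  rw [tauWord, trivialAssign, List.map_map, coeffWord, List.map_map]
  refine List.map_congr_left fun i hi => ?_
  have := hl i hi
  simp only [Function.comp, tauCoeff]
  rw [Int.toNat_of_nonneg (by omega), add_sub_cancel_right]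

theorem indices_trivialAssign (l : List ℤ) : indices (trivialAssign S l) = l := by
  simp [indices, trivialAssign, Function.comp_def]

theorem fiedlerS_prod_pos {l : List ℤ} (hl : ∀ i ∈ l, 0 < i ∧ i < (m : ℤ)) :
    (l.map (fiedlerS S m)).prod = conv 0 0 1 (rv (wprod m (coeffWord false (sigmaCoeff S) l))) := by
  rw [← sigmaWord_trivialAssign S fun i hi => (hl i hi).1.le,
    ← assignProdS_sigma (x := trivialAssign S l) (by
      rw [indices_trivialAssign]; exact fun i hi => ⟨(hl i hi).1.le, (hl i hi).2⟩),
    assignProdS, trivialAssign, List.map_map]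
  congr 1
  refine List.map_congr_left fun i hi => ?_
  obtain ⟨h1, h2⟩ := hl i hi
  have e : ((i.toNat : ℕ) : ℤ) = i := by omega
  rw [← e, fiedlerS_of_pos (by omega)]
  rfl

theorem fiedlerS_prod_neg {l : List ℤ} (hl : ∀ i ∈ l, -(m : ℤ) < i ∧ i < 0) :
    (l.map (fiedlerS S m)).prod =
      conv 0 0 1 (wprod m (coeffWord false (tauCoeff S m) (l.map (· + (m : ℤ))))) := by
  rw [← tauWord_trivialAssign S fun i hi => (hl i hi).1.le,
    ← assignProdS_tau (x := trivialAssign S l) (by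
      rw [indices_trivialAssign]; exact fun i hi => ⟨(hl i hi).1.le, (hl i hi).2⟩),
    assignProdS, trivialAssign, List.map_map]
  congr 1
  refine List.map_congr_left fun i hi => ?_
  obtain ⟨h1, h2⟩ := hl i hi
  have e : (((i + m).toNat : ℕ) : ℤ) - m = i := by omega
  rw [← e, fiedlerS_of_neg (by omega) (by omega)]
  rfl

theorem fiedlerS_zero (hm : 0 < m) :
    fiedlerS S m 0 = conv (-S.C) (-S.B) (-S.A) (rv (glet m true 0 (sigmaCoeff S 0))) := by
  have e : ∀ a : Fin m, revIx m (Sum.inl a) = lv m (m - 1 - a) := fun a => by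
    rw [← revIx_lv a.2]; simp [lv]
  rw [fiedlerS, if_pos rfl, conv, Matrix.fromBlocks_inj]
  refine ⟨?_, ?_, ?_, rfl⟩
  · have h0 := elem_of_nonneg (n := n) hm (sigmaCoeff S 0)
    rw [Nat.cast_zero] at h0
    rw [fiedlerP, show trivialCoeff S 0 = sigmaCoeff S 0 from rfl, h0]
    ext p q
    simp only [Matrix.of_apply, rv, Matrix.submatrix_apply, e, glet, if_true, Bool.false_eq_true,
      if_false, swapM, diagM, Matrix.diagonal_apply, lv_ne_inr (show m - 1 - (p.1 : ℕ) < m by omega),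
      lv_ne_inr (show m - 1 - (q.1 : ℕ) < m by omega)]
    by_cases h1 : lv m (m - 1 - p.1) = lv m 0 <;> by_cases h2 : lv m (m - 1 - q.1) = lv m 0 <;>
      simp [h1, h2]
    rw [if_neg (Ne.symm h2)]
    rfl
  · ext p k
    simp only [Matrix.neg_apply, colBlock, Matrix.of_apply, rv, Matrix.submatrix_apply, e, revIx_inr,
      glet, if_true, swapM, lv_ne_inr (show m - 1 - (p.1 : ℕ) < m by omega), if_false,
      (lv_ne_inr hm).symm, stdCol, lv_inj (show m - 1 - (p.1 : ℕ) < m by omega) hm]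
    have := p.1.2
    by_cases h : (p.1 : ℕ) + 1 = m
    · rw [if_pos (by omega), if_pos (by omega)]; simp
    · rw [if_neg (by omega), if_neg (by omega)]; simp
  · ext k p
    simp only [Matrix.neg_apply, rowBlock, Matrix.of_apply, rv, Matrix.submatrix_apply, e, revIx_inr,
      glet, if_true, swapM, if_false, (lv_ne_inr hm).symm, stdCol,
      lv_inj (show m - 1 - (p.1 : ℕ) < m by omega) hm]
    have := p.1.2
    by_cases h : (p.1 : ℕ) + 1 = m
    · rw [if_pos (by omega), if_pos (by omega)]; simp
    · rw [if_neg (by omega), if_neg (by omega)]; simp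

theorem fiedlerS_neg_m (hm : 0 < m) :
    fiedlerS S m (-(m : ℤ)) = conv 0 0 (-S.E) (glet m false 0 (tauCoeff S m 0)) := by
  have h0 := elem_of_neg (n := n) hm (tauCoeff S m 0)
  rw [Nat.cast_zero, zero_sub] at h0
  rw [fiedlerS, if_neg (by omega), if_pos rfl, conv, Matrix.fromBlocks_inj, fiedlerP, ← h0]
  refine ⟨by simp [tauCoeff], ?_, ?_, rfl⟩
  · ext p k; simp
  · ext p k; simp

theorem fiedlerS_prod_sigma (hm : 0 < m) {l₁ l₂ : List ℤ} (h₁ : ∀ i ∈ l₁, 0 < i ∧ i < (m : ℤ))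
    (h₂ : ∀ i ∈ l₂, 0 < i ∧ i < (m : ℤ)) :
    ((l₁ ++ 0 :: l₂).map (fiedlerS S m)).prod =
      conv (-S.C) (-S.B) (-S.A) (rv (wprod m (coeffWord true (sigmaCoeff S) (l₁ ++ 0 :: l₂)))) := by
  have t : ∀ l : List ℤ, (∀ i ∈ l, 0 < i ∧ i < (m : ℤ)) →
      Triv (rv (wprod m (coeffWord false (sigmaCoeff S) l))) (Sum.inr ()) := by
    intro l hl
    refine triv_rv_wprod fun p hp => ?_
    obtain ⟨i, hi, rfl⟩ := List.mem_map.1 hp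
    have := hl i hi
    exact ⟨rfl, by simp only; omega⟩
  rw [List.map_append, List.prod_append, List.map_cons, List.prod_cons, fiedlerS_prod_pos S h₁,
    fiedlerS_prod_pos S h₂, fiedlerS_zero S hm, conv_mul _ (t _ h₂), conv_mul_left _ (t _ h₁),
    ← rv_mul, ← rv_mul]
  congr 2
  rw [coeffWord_pos (fun i hi => (h₁ i hi).1) false true, coeffWord_pos (fun i hi => (h₂ i hi).1) false true]
  simp [coeffWord, wprod]

theorem fiedlerS_prod_tau (hm : 0 < m) {l₁ l₂ : List ℤ} (h₁ : ∀ i ∈ l₁, -(m : ℤ) < i ∧ i < 0)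
    (h₂ : ∀ i ∈ l₂, -(m : ℤ) < i ∧ i < 0) :
    ((l₁ ++ (-(m : ℤ)) :: l₂).map (fiedlerS S m)).prod =
      conv 0 0 (-S.E) (wprod m (coeffWord false (tauCoeff S m)
        ((l₁ ++ (-(m : ℤ)) :: l₂).map (· + (m : ℤ))))) := by
  have t : ∀ l : List ℤ, (∀ i ∈ l, -(m : ℤ) < i ∧ i < 0) →
      Triv (wprod m (coeffWord false (tauCoeff S m) (l.map (· + (m : ℤ))))) (Sum.inr ()) := by
    intro l hl
    refine wprod_triv_inr fun p hp => ?_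
    obtain ⟨i, hi, rfl⟩ := List.mem_map.1 hp
    obtain ⟨j, hj, rfl⟩ := List.mem_map.1 hi
    have := hl j hj
    exact ⟨rfl, by simp only; omega⟩
  rw [List.map_append, List.prod_append, List.map_cons, List.prod_cons, fiedlerS_prod_neg S h₁,
    fiedlerS_prod_neg S h₂, fiedlerS_neg_m S hm, conv_mul _ (t _ h₂), conv_mul_left _ (t _ h₁)]
  congr 1
  simp [coeffWord, wprod]

theorem pencil_mul_mul {κ : Type} [Fintype κ] (P K H Q : Matrix κ κ ℂ) :
    P.map Polynomial.C * pencil K H * Q.map Polynomial.C = pencil (P * K * Q) (P * H * Q) := by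
  rw [pencil, pencil, Matrix.mul_sub, Matrix.sub_mul, Matrix.mul_smul, Matrix.smul_mul,
    Matrix.map_mul, Matrix.map_mul, Matrix.map_mul, Matrix.map_mul]

theorem map_mul_map {κ : Type} [Fintype κ] (P Q : Matrix κ κ ℂ) :
    P.map (Polynomial.C : ℂ →+* ℂ[X]) * Q.map Polynomial.C = (P * Q).map Polynomial.C :=
  (Matrix.map_mul).symm

end Pencil

/-! ### A GFPR as a pencil of two block matrices -/

section Gfpr

variable {m n r : ℕ}

/-- The word of `M_{σ₁} M_σ M_{σ₂}`. -/
def Data.wordσ (D : Data m n) (S : Realization (Fin n) r) :=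
  sigmaWord D.σ₁ ++ coeffWord true (sigmaCoeff S) D.σ ++ sigmaWord D.σ₂

/-- The word of `M_{σ₁} M_{σ₂}`. -/
def Data.wordσ' (D : Data m n) := sigmaWord D.σ₁ ++ sigmaWord D.σ₂

/-- The word of `M_{τ₁} M_τ M_{τ₂}`. -/
def Data.wordτ (D : Data m n) (S : Realization (Fin n) r) :=
  tauWord m D.τ₁ ++ coeffWord false (tauCoeff S m) (D.τ.map (· + (m : ℤ))) ++ tauWord m D.τ₂

/-- The word of `M_{τ₁} M_{τ₂}`. -/
def Data.wordτ' (D : Data m n) := tauWord m D.τ₁ ++ tauWord m D.τ₂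

/-- The coefficient of `λ` of a GFPR as a block matrix. -/
def Data.lead (D : Data m n) (S : Realization (Fin n) r) :
    Matrix (Ix m) (Ix m) (Matrix (Fin n) (Fin n) ℂ) :=
  wprod m (D.wordτ S) * rv (wprod m D.wordσ')

/-- The constant term of a GFPR, up to the sign, as a block matrix. -/
def Data.const (D : Data m n) (S : Realization (Fin n) r) :
    Matrix (Ix m) (Ix m) (Matrix (Fin n) (Fin n) ℂ) :=
  wprod m D.wordτ' * rv (wprod m (D.wordσ S))

variable (D : Data m n) (S : Realization (Fin n) r)

theorem Data.sigma_split : ∃ l₁ l₂, D.σ = l₁ ++ 0 :: l₂ ∧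
    (∀ i ∈ l₁, 0 < i ∧ i ≤ (D.h : ℤ)) ∧ (∀ i ∈ l₂, 0 < i ∧ i ≤ (D.h : ℤ)) := by
  obtain ⟨l₁, l₂, e⟩ := List.append_of_mem (D.σ_perm.mem_iff.2 (mem_str.2 ⟨le_rfl, by omega⟩))
  have nd : D.σ.Nodup := D.σ_perm.nodup_iff.2 (str_nodup _ _)
  have hm : ∀ i ∈ D.σ, 0 ≤ i ∧ i ≤ (D.h : ℤ) := fun i hi => mem_str.1 (D.σ_perm.mem_iff.1 hi)
  rw [e] at nd hm
  rw [List.nodup_middle, List.nodup_cons] at nd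
  have : ∀ i ∈ l₁ ++ l₂, 0 < i ∧ i ≤ (D.h : ℤ) := by
    intro i hi
    have h0 : i ≠ 0 := by rintro rfl; exact nd.1 hi
    have := hm i (by rcases List.mem_append.1 hi with h | h <;> simp [h])
    omega
  exact ⟨l₁, l₂, e, fun i hi => this i (by simp [hi]), fun i hi => this i (by simp [hi])⟩

theorem Data.tau_split : ∃ l₁ l₂, D.τ = l₁ ++ (-(m : ℤ)) :: l₂ ∧
    (∀ i ∈ l₁, -(m : ℤ) < i ∧ i ≤ -(D.h : ℤ) - 1) ∧
    (∀ i ∈ l₂, -(m : ℤ) < i ∧ i ≤ -(D.h : ℤ) - 1) := by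
  have hlt := D.h_lt
  obtain ⟨l₁, l₂, e⟩ := List.append_of_mem (D.τ_perm.mem_iff.2 (mem_str.2 ⟨le_rfl, by omega⟩))
  have nd : D.τ.Nodup := D.τ_perm.nodup_iff.2 (str_nodup _ _)
  have hm : ∀ i ∈ D.τ, -(m : ℤ) ≤ i ∧ i ≤ -(D.h : ℤ) - 1 :=
    fun i hi => mem_str.1 (D.τ_perm.mem_iff.1 hi)
  rw [e] at nd hm
  rw [List.nodup_middle, List.nodup_cons] at nd
  have : ∀ i ∈ l₁ ++ l₂, -(m : ℤ) < i ∧ i ≤ -(D.h : ℤ) - 1 := by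
    intro i hi
    have h0 : i ≠ -(m : ℤ) := by rintro rfl; exact nd.1 hi
    have := hm i (by rcases List.mem_append.1 hi with h | h <;> simp [h])
    omega
  exact ⟨l₁, l₂, e, fun i hi => this i (by simp [hi]), fun i hi => this i (by simp [hi])⟩

theorem Data.sigmaWord_lt : (∀ p ∈ sigmaWord D.σ₁, p.1 = false ∧ p.2.1 < D.h) ∧
    ∀ p ∈ sigmaWord D.σ₂, p.1 = false ∧ p.2.1 < D.h :=
  ⟨GFPR.sigmaWord_lt fun i hi => by have := D.σ₁_mem i hi; omega,
    GFPR.sigmaWord_lt fun i hi => by have := D.σ₂_mem i hi; omega⟩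

theorem Data.tauWord_lt : (∀ p ∈ tauWord m D.τ₁, p.1 = false ∧ p.2.1 < m - D.h - 1) ∧
    ∀ p ∈ tauWord m D.τ₂, p.1 = false ∧ p.2.1 < m - D.h - 1 :=
  ⟨GFPR.tauWord_lt fun i hi => by have := D.τ₁_mem i hi; have := D.h_lt; omega,
    GFPR.tauWord_lt fun i hi => by have := D.τ₂_mem i hi; have := D.h_lt; omega⟩

theorem Data.coeffWord_sigma_lt : ∀ p ∈ coeffWord true (sigmaCoeff S) D.σ, p.2.1 < D.h + 1 := by
  intro p hp
  obtain ⟨i, hi, rfl⟩ := List.mem_map.1 hp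
  have := mem_str.1 (D.σ_perm.mem_iff.1 hi)
  simp only; omega

theorem Data.coeffWord_tau_lt :
    ∀ p ∈ coeffWord false (tauCoeff S m) (D.τ.map (· + (m : ℤ))), p.1 = false ∧ p.2.1 < m - D.h := by
  intro p hp
  obtain ⟨i, hi, rfl⟩ := List.mem_map.1 hp
  obtain ⟨j, hj, rfl⟩ := List.mem_map.1 hi
  have := mem_str.1 (D.τ_perm.mem_iff.1 hj)
  have := D.h_lt
  exact ⟨rfl, by simp only; omega⟩

theorem Data.wordσ'_lt : ∀ p ∈ D.wordσ', p.1 = false ∧ p.2.1 < D.h := by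
  intro p hp
  rcases List.mem_append.1 hp with hp | hp
  exacts [D.sigmaWord_lt.1 p hp, D.sigmaWord_lt.2 p hp]

theorem Data.wordτ'_lt : ∀ p ∈ D.wordτ', p.1 = false ∧ p.2.1 < m - D.h - 1 := by
  intro p hp
  rcases List.mem_append.1 hp with hp | hp
  exacts [D.tauWord_lt.1 p hp, D.tauWord_lt.2 p hp]

theorem Data.wordσ_lt : ∀ p ∈ D.wordσ S, p.2.1 < D.h + 1 := by
  intro p hp
  simp only [Data.wordσ, List.mem_append] at hp
  rcases hp with (hp | hp) | hp
  · exact (D.sigmaWord_lt.1 p hp).2.trans (Nat.lt_succ_self _)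
  · exact D.coeffWord_sigma_lt S p hp
  · exact (D.sigmaWord_lt.2 p hp).2.trans (Nat.lt_succ_self _)

theorem Data.wordτ_lt : ∀ p ∈ D.wordτ S, p.1 = false ∧ p.2.1 < m - D.h := by
  intro p hp
  have := D.h_lt
  simp only [Data.wordτ, List.mem_append] at hp
  rcases hp with (hp | hp) | hp
  · have := D.tauWord_lt.1 p hp; exact ⟨this.1, by omega⟩
  · exact D.coeffWord_tau_lt S p hp
  · have := D.tauWord_lt.2 p hp; exact ⟨this.1, by omega⟩

theorem Data.lead_triv_or (i : Ix m) :
    Triv (rv (wprod m D.wordσ')) i ∨ Triv (wprod m (D.wordτ S)) i :=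
  rv_wprod_triv_or (fun p hp => (D.wordσ'_lt p hp).2) (D.wordτ_lt S) (by have := D.h_lt; omega) i

theorem Data.const_triv_or (i : Ix m) :
    Triv (rv (wprod m (D.wordσ S))) i ∨ Triv (wprod m D.wordτ') i :=
  rv_wprod_triv_or (D.wordσ_lt S) D.wordτ'_lt (by have := D.h_lt; omega) i

theorem Data.lead_triv : Triv (D.lead S) (Sum.inr ()) := by
  have := D.h_lt
  exact (wprod_triv_inr fun p hp => by have := D.wordτ_lt S p hp; exact ⟨this.1, by omega⟩).mul
    (triv_rv_wprod fun p hp => by have := D.wordσ'_lt p hp; exact ⟨this.1, by omega⟩)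

theorem regroup_lead {G : Type} [Monoid G] {t₁ t t₂ s₁ s₂ : G} (h₁ : s₁ * t = t * s₁)
    (h₂ : s₁ * t₂ = t₂ * s₁) (h₃ : s₂ * t₂ = t₂ * s₂) :
    t₁ * s₁ * t * (s₂ * t₂) = t₁ * t * t₂ * (s₁ * s₂) := by
  rw [h₃, mul_assoc t₁, h₁]
  simp only [mul_assoc]
  rw [← mul_assoc s₁, h₂, mul_assoc]

theorem regroup_const {G : Type} [Monoid G] {t₁ t₂ s₁ s s₂ : G} (h₁ : s₁ * t₂ = t₂ * s₁)
    (h₂ : s₂ * t₂ = t₂ * s₂) (h₃ : s * t₂ = t₂ * s) :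
    t₁ * s₁ * s * (s₂ * t₂) = t₁ * t₂ * (s₁ * s * s₂) := by
  rw [h₂]
  simp only [mul_assoc]
  rw [← mul_assoc s, h₃, mul_assoc t₂, ← mul_assoc s₁, h₁, mul_assoc]

/-- A GFPR as a pencil of block matrices. -/
theorem Data.gfpr_eq :
    D.gfpr S = pencil (conv 0 0 (-S.E) (D.lead S)) (conv (-S.C) (-S.B) (-S.A) (D.const S)) := by
  have hlt := D.h_lt
  obtain ⟨s1, s2, es, hs1, hs2⟩ := D.sigma_split
  obtain ⟨t1, t2, et, ht1, ht2⟩ := D.tau_split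
  have eσ := fiedlerS_prod_sigma S (m := m) (by omega) (l₁ := s1) (l₂ := s2)
    (fun i hi => by have := hs1 i hi; omega) (fun i hi => by have := hs2 i hi; omega)
  have eτ := fiedlerS_prod_tau S (m := m) (by omega) (l₁ := t1) (l₂ := t2)
    (fun i hi => by have := ht1 i hi; omega) (fun i hi => by have := ht2 i hi; omega)
  rw [← es] at eσ
  rw [← et] at eτ
  have aσ1 := assignProdS_sigma (m := m) (r := r) (x := D.σ₁)
    fun i hi => by have := D.σ₁_mem i hi; omega
  have aσ2 := assignProdS_sigma (m := m) (r := r) (x := D.σ₂)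
    fun i hi => by have := D.σ₂_mem i hi; omega
  have aτ1 := assignProdS_tau (m := m) (r := r) (x := D.τ₁)
    fun i hi => by have := D.τ₁_mem i hi; omega
  have aτ2 := assignProdS_tau (m := m) (r := r) (x := D.τ₂)
    fun i hi => by have := D.τ₂_mem i hi; omega
  have w1 := D.sigmaWord_lt
  have w2 := D.tauWord_lt
  have tσ1 : Triv (rv (wprod m (sigmaWord D.σ₁))) (Sum.inr ()) :=
    triv_rv_wprod fun p hp => by have := w1.1 p hp; exact ⟨this.1, by omega⟩
  have tσ2 : Triv (rv (wprod m (sigmaWord D.σ₂))) (Sum.inr ()) :=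
    triv_rv_wprod fun p hp => by have := w1.2 p hp; exact ⟨this.1, by omega⟩
  have tτ1 : Triv (wprod m (tauWord m D.τ₁)) (Sum.inr ()) :=
    wprod_triv_inr fun p hp => by have := w2.1 p hp; exact ⟨this.1, by omega⟩
  have tτ2 : Triv (wprod m (tauWord m D.τ₂)) (Sum.inr ()) :=
    wprod_triv_inr fun p hp => by have := w2.2 p hp; exact ⟨this.1, by omega⟩
  rw [Data.gfpr, map_mul_map, mul_assoc, map_mul_map, pencil_mul_mul, eσ, eτ, aσ1, aσ2, aτ1, aτ2]
  simp only [conv_mul_left _ (tτ1.mul tσ1), conv_mul_left _ tτ1, conv_mul _ (tσ2.mul tτ2),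
    conv_mul _ tτ2]
  have c1 : Commute (rv (wprod m (sigmaWord D.σ₁)))
      (wprod m (coeffWord false (tauCoeff S m) (D.τ.map (· + (m : ℤ))))) :=
    rv_wprod_commute (fun p hp => (w1.1 p hp).2) (D.coeffWord_tau_lt S) (by omega)
  have c2 : Commute (rv (wprod m (sigmaWord D.σ₁))) (wprod m (tauWord m D.τ₂)) :=
    rv_wprod_commute (fun p hp => (w1.1 p hp).2) w2.2 (by omega)
  have c3 : Commute (rv (wprod m (sigmaWord D.σ₂))) (wprod m (tauWord m D.τ₂)) :=
    rv_wprod_commute (fun p hp => (w1.2 p hp).2) w2.2 (by omega)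
  have c4 : Commute (rv (wprod m (coeffWord true (sigmaCoeff S) D.σ))) (wprod m (tauWord m D.τ₂)) :=
    rv_wprod_commute (D.coeffWord_sigma_lt S) w2.2 (by omega)
  have e1 := regroup_lead (t₁ := wprod m (tauWord m D.τ₁)) c1.eq c2.eq c3.eq
  have e2 := regroup_const (t₁ := wprod m (tauWord m D.τ₁)) c2.eq c3.eq c4.eq
  rw [e1, e2, Data.lead, Data.const, Data.wordτ, Data.wordσ', Data.wordτ', Data.wordσ,
    wprod_append, wprod_append, wprod_append, wprod_append, wprod_append, wprod_append,
    rv_mul, rv_mul, rv_mul]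

theorem Data.gfpr_inl_inl (a b : Fin m) (i j : Fin n) :
    D.gfpr S (Sum.inl (a, i)) (Sum.inl (b, j)) =
      Polynomial.X * Polynomial.C (D.lead S (Sum.inl a) (Sum.inl b) i j) -
        Polynomial.C (D.const S (Sum.inl a) (Sum.inl b) i j) := by
  rw [D.gfpr_eq]; rfl

theorem Data.gfpr_inl_inr (a : Fin m) (i : Fin n) (k : Fin r) :
    D.gfpr S (Sum.inl (a, i)) (Sum.inr k) =
      Polynomial.C ((D.const S (Sum.inl a) (Sum.inr ()) * S.C) i k) := by
  rw [D.gfpr_eq]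
  simp [pencil, conv]

theorem Data.gfpr_inr_inl (a : Fin m) (i : Fin n) (k : Fin r) :
    D.gfpr S (Sum.inr k) (Sum.inl (a, i)) =
      Polynomial.C ((S.B * D.const S (Sum.inr ()) (Sum.inl a)) k i) := by
  rw [D.gfpr_eq]
  simp [pencil, conv]

theorem Data.gfpr_inr_inr (k l : Fin r) :
    D.gfpr S (Sum.inr k) (Sum.inr l) = (-pencil S.E S.A) k l := by
  rw [D.gfpr_eq]
  simp [pencil, conv]
  ring

/-- The position of the blocks of a GFPR in the last block row and the last block column. -/
theorem Data.const_border : ∃ (l₁ l₂ : List ℤ) (p q : ℕ), D.σ = l₁ ++ 0 :: l₂ ∧ p < m ∧ q < m ∧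
    (p : ℤ) = (l₁.reverse ++ (indices D.σ₁).reverse).foldl greedyStep 0 ∧
    (q : ℤ) = (l₂ ++ indices D.σ₂).foldl greedyStep 0 ∧ (∀ i ∈ l₁ ++ l₂, 0 < i) ∧
    (∀ i, D.const S i (Sum.inr ()) = (1 : Matrix (Ix m) (Ix m) (Matrix (Fin n) (Fin n) ℂ)) i
      (lv m (m - 1 - p))) ∧
    ∀ i, D.const S (Sum.inr ()) i = (1 : Matrix (Ix m) (Ix m) (Matrix (Fin n) (Fin n) ℂ))
      (lv m (m - 1 - q)) i := by
  have hlt := D.h_lt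
  obtain ⟨s1, s2, es, hs1, hs2⟩ := D.sigma_split
  have w1 := D.sigmaWord_lt
  set L := sigmaWord D.σ₁ ++ coeffWord false (sigmaCoeff S) s1 with hL
  set L' := coeffWord false (sigmaCoeff S) s2 ++ sigmaWord D.σ₂ with hL'
  have cw : ∀ s : List ℤ, (∀ i ∈ s, 0 < i ∧ i ≤ (D.h : ℤ)) →
      ∀ p ∈ coeffWord false (sigmaCoeff S) s, p.1 = false ∧ p.2.1 ≤ D.h := by
    intro s hs p hp
    obtain ⟨i, hi, rfl⟩ := List.mem_map.1 hp
    have := hs i hi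
    exact ⟨rfl, by simp only; omega⟩
  have bL : ∀ p ∈ L, p.1 = false ∧ p.2.1 ≤ D.h := by
    intro p hp
    rcases List.mem_append.1 hp with hp | hp
    · have := w1.1 p hp; exact ⟨this.1, by omega⟩
    · exact cw _ hs1 p hp
  have bL' : ∀ p ∈ L', p.1 = false ∧ p.2.1 ≤ D.h := by
    intro p hp
    rcases List.mem_append.1 hp with hp | hp
    · exact cw _ hs2 p hp
    · have := w1.2 p hp; exact ⟨this.1, by omega⟩
  have i1 : widx L = indices D.σ₁ ++ s1 := by
    rw [hL, widx_append, widx_sigmaWord fun i hi => (D.σ₁_mem i hi).1,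
      widx_coeffWord _ _ fun i hi => (hs1 i hi).1.le]
  have i2 : widx L' = s2 ++ indices D.σ₂ := by
    rw [hL', widx_append, widx_sigmaWord fun i hi => (D.σ₂_mem i hi).1,
      widx_coeffWord _ _ fun i hi => (hs2 i hi).1.le]
  have sip : SIP (widx L ++ 0 :: widx L') := by
    have := D.sip_σ
    rw [i1, i2]
    rw [es] at this
    simpa using this
  have ew : wprod m (D.wordσ S) = wprod m (L ++ (true, 0, sigmaCoeff S 0) :: L') := by
    rw [Data.wordσ, es, hL, hL']
    have : coeffWord true (sigmaCoeff S) (s1 ++ 0 :: s2) = coeffWord true (sigmaCoeff S) s1 ++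
        (true, 0, sigmaCoeff S 0) :: coeffWord true (sigmaCoeff S) s2 := by simp [coeffWord]
    rw [this]
    simp only [wprod_append, wprod_cons]
    rw [coeffWord_pos (fun i hi => (hs1 i hi).1) true false,
      coeffWord_pos (fun i hi => (hs2 i hi).1) true false]
    simp only [mul_assoc]
  obtain ⟨q, q1, q2, q3, q4⟩ := wprod_border_row (m := m) (by omega) (sigmaCoeff S 0)
    (fun p hp => ⟨(bL p hp).1, by have := (bL p hp).2; omega⟩)
    (fun p hp => ⟨(bL' p hp).1, by have := (bL' p hp).2; omega⟩) sip
  obtain ⟨p, p1, p2, p3, p4⟩ := wprod_border_col (m := m) (by omega) (sigmaCoeff S 0)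
    (fun p hp => ⟨(bL p hp).1, by have := (bL p hp).2; omega⟩)
    (fun p hp => ⟨(bL' p hp).1, by have := (bL' p hp).2; omega⟩) sip
  have hp : p ≤ D.h := by
    rcases p3 with rfl | ⟨x, hx, rfl⟩
    · omega
    · exact (bL x hx).2
  have rI : ∀ (i : Ix m) (k : ℕ), k < m → ((1 : Matrix (Ix m) (Ix m) (Matrix (Fin n) (Fin n) ℂ))
      (lv m k) (revIx m i) = (1 : Matrix (Ix m) (Ix m) (Matrix (Fin n) (Fin n) ℂ)) (lv m (m - 1 - k)) i ∧
      (1 : Matrix (Ix m) (Ix m) (Matrix (Fin n) (Fin n) ℂ)) (revIx m i) (lv m k) =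
      (1 : Matrix (Ix m) (Ix m) (Matrix (Fin n) (Fin n) ℂ)) i (lv m (m - 1 - k))) := by
    intro i k hk
    have : revIx m (lv m (m - 1 - k)) = lv m k := by
      rw [← revIx_lv hk, revIx_revIx]
    rw [← this]
    simp [Matrix.one_apply]
  refine ⟨s1, s2, p, q, es, p1, q1, ?_, ?_, ?_, fun i => ?_, fun i => ?_⟩
  · rw [p2, i1, List.reverse_append]
  · rw [q2, i2]
  · intro i hi
    rcases List.mem_append.1 hi with hi | hi
    exacts [(hs1 i hi).1, (hs2 i hi).1]
  · rw [Data.const, Matrix.mul_apply]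
    simp only [rv, Matrix.submatrix_apply, revIx_inr, ew, p4, fun j => (rI j p p1).2]
    simp only [Matrix.one_apply, mul_ite, mul_one, mul_zero, Finset.sum_ite_eq', Finset.mem_univ,
      if_true]
    rw [((wprod_triv (by omega) fun x hx => by have := (D.wordτ'_lt x hx).2; omega) i).2,
      Matrix.one_apply]
  · have ht : Triv (wprod m D.wordτ') (Sum.inr ()) := wprod_triv_inr fun x hx => by
      have := D.wordτ'_lt x hx; exact ⟨this.1, by omega⟩
    rw [Data.const, Matrix.mul_apply]
    simp only [(ht _).1, Matrix.one_apply, ite_mul, one_mul, zero_mul, Finset.sum_ite_eq,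
      Finset.mem_univ, if_true]
    rw [rv, Matrix.submatrix_apply, revIx_inr, ew, q4, (rI i q q1).1, Matrix.one_apply]

end Gfpr

/-! ### The pencils of the theorem as GFPRs -/

section Canonical

variable {m n r : ℕ} (S : Realization (Fin n) r)

theorem IsCanonicalPair.mem {h : ℕ} (hh : h < m) {x y : List (ℤ × Matrix (Fin n) (Fin n) ℂ)}
    (hxy : IsCanonicalPair m h x y) :
    (∀ i ∈ indices x, 0 ≤ i ∧ i ≤ (h : ℤ) - 2) ∧
      ∀ i ∈ indices y, -(m : ℤ) ≤ i ∧ i ≤ -(h : ℤ) - 3 := by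
  refine ⟨fun i hi => mem_of_isCanonical hxy.1 hi, fun i hi => ?_⟩
  have := mem_of_isCanonical hxy.2 (List.mem_map_of_mem hi)
  omega

theorem mem_vComplement {h : ℕ} (hh : h < m) {i : ℤ} (hi : i ∈ vComplement m h) :
    -(m : ℤ) ≤ i ∧ i ≤ -(h : ℤ) - 2 := by
  obtain ⟨j, hj, rfl⟩ := List.mem_map.1 hi
  have := mem_simpleComplement hj
  omega

theorem vTuple_add (m h : ℕ) : (vTuple m h).map (· + (m : ℤ)) = simpleTuple (m - h - 1) := by
  rw [vTuple, List.map_map]; simp [Function.comp_def]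

theorem vComplement_add (m h : ℕ) :
    (vComplement m h).map (· + (m : ℤ)) = simpleComplement (m - h - 1) := by
  rw [vComplement, List.map_map]; simp [Function.comp_def]

theorem indices_append (x y : List (ℤ × Matrix (Fin n) (Fin n) ℂ)) :
    indices (x ++ y) = indices x ++ indices y := List.map_append

theorem indices_reverse (x : List (ℤ × Matrix (Fin n) (Fin n) ℂ)) :
    indices x.reverse = (indices x).reverse := List.map_reverse

/-- The data of the pencil `𝕃_S(h, t_w, t_v, 𝒳, 𝒴)` as a GFPR. -/
def symmData {h : ℕ} (hh : h < m) {x y : List (ℤ × Matrix (Fin n) (Fin n) ℂ)}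
    (hxy : IsCanonicalPair m h x y) : Data m n where
  h := h
  h_lt := hh
  σ := simpleTuple h
  τ := vTuple m h
  σ₁ := x
  σ₂ := trivialAssign S (simpleComplement h) ++ x.reverse
  τ₁ := y
  τ₂ := trivialAssign S (vComplement m h) ++ y.reverse
  σ_perm := simpleTuple_perm h
  τ_perm := by
    have := (simpleTuple_perm (m - h - 1)).map (· + (-(m : ℤ)))
    rw [str_map_add] at this
    rw [show -(h : ℤ) - 1 = ((m - h - 1 : ℕ) : ℤ) + -(m : ℤ) by omega]
    simpa [vTuple, sub_eq_add_neg] using this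
  σ₁_mem := fun i hi => by have := (hxy.mem hh).1 i hi; omega
  σ₂_mem := fun i hi => by
    rw [indices_append, indices_trivialAssign, indices_reverse, List.mem_append,
      List.mem_reverse] at hi
    rcases hi with hi | hi
    · have := mem_simpleComplement hi; omega
    · have := (hxy.mem hh).1 i hi; omega
  τ₁_mem := fun i hi => by have := (hxy.mem hh).2 i hi; omega
  τ₂_mem := fun i hi => by
    rw [indices_append, indices_trivialAssign, indices_reverse, List.mem_append,
      List.mem_reverse] at hi
    rcases hi with hi | hi
    · have := mem_vComplement hh hi; omega
    · have := (hxy.mem hh).2 i hi; omega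
  sip_σ := by
    have := sip_symm hxy.1
    simpa [indices_append, indices_trivialAssign, indices_reverse] using this
  sip_τ := by
    have := sip_map_add (-(m : ℤ)) (sip_symm hxy.2)
    simpa [indices_append, indices_trivialAssign, indices_reverse, vTuple, vComplement,
      sub_eq_add_neg, Function.comp_def] using this

variable {h : ℕ} (hh : h < m) {x y : List (ℤ × Matrix (Fin n) (Fin n) ℂ)}
    (hxy : IsCanonicalPair m h x y)

theorem symmData_words :
    (symmData S hh hxy).wordσ S = symmWord true (sigmaCoeff S) h (sigmaWord x) ∧
    (symmData S hh hxy).wordσ' = symmWord' (sigmaCoeff S) h (sigmaWord x) ∧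
    (symmData S hh hxy).wordτ S = symmWord false (tauCoeff S m) (m - h - 1) (tauWord m y) ∧
    (symmData S hh hxy).wordτ' = symmWord' (tauCoeff S m) (m - h - 1) (tauWord m y) := by
  have e1 := sigmaWord_trivialAssign S (l := simpleComplement h)
    fun i hi => (mem_simpleComplement hi).1
  have e2 := tauWord_trivialAssign (m := m) S (l := vComplement m h)
    fun i hi => (mem_vComplement hh hi).1
  rw [vComplement_add] at e2
  have e3 := vTuple_add m h
  refine ⟨?_, ?_, ?_, ?_⟩ <;>
  simp only [symmData, Data.wordσ, Data.wordσ', Data.wordτ, Data.wordτ', symmWord, symmWord',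
    sigmaWord_append, tauWord_append, sigmaWord_reverse, tauWord_reverse, e1, e2, e3,
    List.append_assoc]

theorem assignProdS_append (x y : List (ℤ × Matrix (Fin n) (Fin n) ℂ)) :
    assignProdS m r (x ++ y) = assignProdS m r x * assignProdS m r y := by
  simp [assignProdS]

theorem regroup_symm {G : Type} [Monoid G] (y x p c v x' y' : G) (h : v * x' = x' * v) :
    y * x * p * (c * v) * (x' * y') = y * x * p * (c * x') * (v * y') := by
  simp only [mul_assoc]
  rw [← mul_assoc v, h, mul_assoc x']

/-- The two products differ only in the order of $\mathbf c_{v_h}$ and $\mathrm{rev}(\mathbf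
t_{w_h})$, whose matrices commute because they act on different levels. -/
theorem symmPencilS_eq_gfpr : symmPencilS S m h x y = (symmData S hh hxy).gfpr S := by
  have hc : ∀ i ∈ indices (trivialAssign S (vComplement m h)), -(m : ℤ) ≤ i ∧ i ≤ -(h : ℤ) - 2 := by
    rw [indices_trivialAssign]; exact fun i hi => mem_vComplement hh hi
  have hx : ∀ i ∈ indices x.reverse, 0 ≤ i ∧ i ≤ (h : ℤ) - 2 := fun i hi =>
    (hxy.mem hh).1 i (by rwa [indices_reverse, List.mem_reverse] at hi)
  have w1 := tauWord_lt (m := m) (k := m - h - 1) fun i hi => by have := hc i hi; omega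
  have w2 := sigmaWord_lt (k := h) fun i hi => by have := hx i hi; omega
  have t1 : Triv _ (Sum.inr ()) := wprod_triv_inr (m := m) fun p hp => by
    have := w1 p hp; exact ⟨this.1, by omega⟩
  have t2 : Triv _ (Sum.inr ()) := triv_rv_wprod (m := m) fun p hp => by
    have := w2 p hp; exact ⟨this.1, by omega⟩
  have comm : assignProdS m r (trivialAssign S (vComplement m h)) * assignProdS m r x.reverse =
      assignProdS m r x.reverse * assignProdS m r (trivialAssign S (vComplement m h)) := by
    rw [assignProdS_sigma (m := m) (r := r) (x := x.reverse) fun i hi => by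
        have := hx i hi; omega,
      assignProdS_tau (m := m) (r := r) fun i hi => by have := hc i hi; omega,
      conv_mul _ t1, conv_mul _ t2, (rv_wprod_commute (fun p hp => (w2 p hp).2) w1 (by omega)).eq]
  have ht : trivialAssign S (simpleComplement h ++ vComplement m h) =
      trivialAssign S (simpleComplement h) ++ trivialAssign S (vComplement m h) := List.map_append
  rw [symmPencilS, Data.gfpr]
  simp only [symmData, ht, assignProdS_append, ← map_mul_map]
  refine regroup_symm _ _ _ _ _ _ _ ?_
  rw [map_mul_map, comm, map_mul_map]

end Canonical

/-! ### Block symmetry as symmetry of the two block matrices -/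

section BlockSymmetry

variable {m n r : ℕ} (D : Data m n) (S : Realization (Fin n) r)

theorem Data.isBlockSymmetric (h1 : (D.lead S).transpose = D.lead S)
    (h2 : (D.const S).transpose = D.const S) : IsBlockSymmetric (D.gfpr S) := by
  obtain ⟨-, -, p, q, -, hp, hq, -, -, -, ep, eq⟩ := D.const_border S
  have hC : ∀ i, D.const S (Sum.inr ()) i = D.const S i (Sum.inr ()) := fun i =>
    congrFun (congrFun h2 i) (Sum.inr ())
  have e : ∀ (a : Fin m) (k : ℕ), k < m → (Sum.inl a = lv m k ↔ (a : ℕ) = k) := by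
    intro a k hk
    rw [show (Sum.inl a : Ix m) = lv m a by simp [lv], lv_inj a.2 hk]
  have hcol : ∀ (a : Fin m), D.const S (Sum.inl a) (Sum.inr ()) = if (a : ℕ) = m - 1 - p then 1 else 0 := by
    intro a
    rw [ep, Matrix.one_apply]
    simp only [e a _ (show m - 1 - p < m by omega)]
  refine ⟨Matrix.of fun p q => D.gfpr S (Sum.inl p) (Sum.inl q), fun a => if (a : ℕ) = m - 1 - p then 1 else 0,
    fun a => if (a : ℕ) = m - 1 - p then 1 else 0, S.C, S.B, -pencil S.E S.A, ?_, ?_⟩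
  · ext (⟨a, i⟩ | k) (⟨b, j⟩ | l)
    · rfl
    · rw [D.gfpr_inl_inr, hcol]
      simp only [Matrix.fromBlocks_apply₁₂, Matrix.map_apply, colBlock, Matrix.of_apply]
      split_ifs <;> simp
    · rw [D.gfpr_inr_inl, hC, hcol]
      simp only [Matrix.fromBlocks_apply₂₁, Matrix.map_apply, rowBlock, Matrix.of_apply]
      split_ifs <;> simp
    · rw [D.gfpr_inr_inr]; rfl
  · ext (⟨a, i⟩ | k) (⟨b, j⟩ | l)
    · simp only [Matrix.fromBlocks_apply₁₁, blockTranspose, Matrix.of_apply, D.gfpr_inl_inl]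
      rw [← Matrix.transpose_apply (M := D.lead S), h1, ← Matrix.transpose_apply (M := D.const S), h2]
    · rw [D.gfpr_inl_inr, hcol]
      simp only [Matrix.fromBlocks_apply₁₂, Matrix.map_apply, colBlock, Matrix.of_apply]
      split_ifs <;> simp
    · rw [D.gfpr_inr_inl, hC, hcol]
      simp only [Matrix.fromBlocks_apply₂₁, Matrix.map_apply, rowBlock, Matrix.of_apply]
      split_ifs <;> simp
    · rw [D.gfpr_inr_inr]; rfl

/-- If $B$ or $C$ vanished, the transfer function would be $P$, which has a realization of state
dimension $0$. -/
theorem isMinimal_ne_zero (hr : 0 < r) (hmin : S.IsMinimal) : S.B ≠ 0 ∧ S.C ≠ 0 := by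
  have key : S.transfer ≠ S.P.map (algebraMap ℂ[X] (RatFunc ℂ)) := by
    intro h
    have := hmin 0 ⟨S.P, 0, 0, 0, 0, by simp⟩ (by rw [h]; ext i j; simp [Realization.transfer])
    omega
  constructor
  · intro h; apply key; simp [Realization.transfer, h]
  · intro h; apply key; simp [Realization.transfer, h]

/-- The inner blocks are compared coefficient by coefficient in $\lambda$. At the border, nonzero
entries of $C$ and $B$ force the unit vectors of the last block column and of the last block row to
stand at the same position. -/
theorem Data.symm_of_isBlockSymmetric (hr : 0 < r) (hmin : S.IsMinimal)
    (hs : IsBlockSymmetric (D.gfpr S)) :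
    (D.lead S).transpose = D.lead S ∧ (D.const S).transpose = D.const S := by
  obtain ⟨hB, hC⟩ := isMinimal_ne_zero S hr hmin
  obtain ⟨l₁, l₂, p, q, -, hp, hq, -, -, -, ep, eq⟩ := D.const_border S
  obtain ⟨H, u, v, X, Y, Z, e1, e2⟩ := hs
  have sym : ∀ (a b : Fin m) (i j : Fin n), D.gfpr S (Sum.inl (a, i)) (Sum.inl (b, j)) =
      D.gfpr S (Sum.inl (b, i)) (Sum.inl (a, j)) := by
    intro a b i j
    rw [congrFun (congrFun e1 (Sum.inl (a, i))) (Sum.inl (b, j)),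
      congrFun (congrFun e2 (Sum.inl (b, i))) (Sum.inl (a, j))]
    rfl
  have s1 : ∀ (a b : Fin m), D.lead S (Sum.inl a) (Sum.inl b) = D.lead S (Sum.inl b) (Sum.inl a) := by
    intro a b
    ext i j
    have := congrArg (fun f => Polynomial.coeff f 1) (sym a b i j)
    simpa [D.gfpr_inl_inl, Polynomial.coeff_C] using this
  have s0 : ∀ (a b : Fin m), D.const S (Sum.inl a) (Sum.inl b) = D.const S (Sum.inl b) (Sum.inl a) := by
    intro a b
    ext i j
    have := congrArg (fun f => Polynomial.coeff f 0) (sym a b i j)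
    simpa [D.gfpr_inl_inl, Polynomial.coeff_C] using this
  have e : ∀ (a : Fin m) (k : ℕ), k < m → (Sum.inl a = lv m k ↔ (a : ℕ) = k) := by
    intro a k hk
    rw [show (Sum.inl a : Ix m) = lv m a by simp [lv], lv_inj a.2 hk]
  have hcol : ∀ (a : Fin m), D.const S (Sum.inl a) (Sum.inr ()) =
      if (a : ℕ) = m - 1 - p then 1 else 0 := by
    intro a
    rw [ep, Matrix.one_apply]
    simp only [e a _ (show m - 1 - p < m by omega)]
  have hrow : ∀ (a : Fin m), D.const S (Sum.inr ()) (Sum.inl a) =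
      if (a : ℕ) = m - 1 - q then 1 else 0 := by
    intro a
    rw [eq, Matrix.one_apply]
    simp only [eq_comm.trans (e a _ (show m - 1 - q < m by omega))]
  obtain ⟨i₀, k₀, hC0⟩ : ∃ i k, S.C i k ≠ 0 := by
    by_contra h; push Not at h; exact hC (by ext i k; exact h i k)
  obtain ⟨k₁, i₁, hB0⟩ : ∃ k i, S.B k i ≠ 0 := by
    by_contra h; push Not at h; exact hB (by ext k i; exact h k i)
  have c1 : ∀ a : Fin m, (if (a : ℕ) = m - 1 - p then S.C i₀ k₀ else 0) = u a * X i₀ k₀ ∧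
      u a * X i₀ k₀ = v a * X i₀ k₀ := by
    intro a
    have f1 := congrFun (congrFun e1 (Sum.inl (a, i₀))) (Sum.inr k₀)
    have f2 := congrFun (congrFun e2 (Sum.inl (a, i₀))) (Sum.inr k₀)
    rw [D.gfpr_inl_inr, hcol] at f1 f2
    simp only [Matrix.fromBlocks_apply₁₂, Matrix.map_apply, colBlock, Matrix.of_apply] at f1 f2
    have g1 := Polynomial.C_injective f1
    have g2 := Polynomial.C_injective f2
    refine ⟨?_, g1.symm.trans g2⟩
    rw [← g1]; split_ifs <;> simp
  have c2 : ∀ a : Fin m, (if (a : ℕ) = m - 1 - q then S.B k₁ i₁ else 0) = v a * Y k₁ i₁ := by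
    intro a
    have f1 := congrFun (congrFun e1 (Sum.inr k₁)) (Sum.inl (a, i₁))
    rw [D.gfpr_inr_inl, hrow] at f1
    simp only [Matrix.fromBlocks_apply₂₁, Matrix.map_apply, rowBlock, Matrix.of_apply] at f1
    have g1 := Polynomial.C_injective f1
    rw [← g1]; split_ifs <;> simp
  have hpq : m - 1 - p = m - 1 - q := by
    have d1 := c1 ⟨m - 1 - p, by omega⟩
    rw [if_pos rfl] at d1
    have hv : v ⟨m - 1 - p, by omega⟩ ≠ 0 := by
      intro h0
      rw [h0, zero_mul] at d1
      exact hC0 (d1.1.trans d1.2)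
    have hY : Y k₁ i₁ ≠ 0 := by
      intro h0
      have := c2 ⟨m - 1 - q, by omega⟩
      rw [if_pos rfl, h0, mul_zero] at this
      exact hB0 this
    by_contra hne
    have := c2 ⟨m - 1 - p, by omega⟩
    rw [if_neg hne] at this
    exact mul_ne_zero hv hY this.symm
  constructor
  · ext1 i j
    have ht := D.lead_triv S
    rw [Matrix.transpose_apply]
    rcases i with i | i
    · rcases j with j | j
      · exact s1 j i
      · rw [(ht _).1, (ht _).2, Matrix.one_apply, Matrix.one_apply]; simp
    · rw [(ht _).1, (ht _).2, Matrix.one_apply, Matrix.one_apply]; simp only [eq_comm]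
  · ext1 i j
    rw [Matrix.transpose_apply]
    rcases i with i | i <;> rcases j with j | j
    · exact s0 j i
    · rw [hrow, hcol, hpq]
    · rw [hrow, hcol, hpq]
    · rfl

end BlockSymmetry

/-! ### The symmetry of the pencils and the converse -/

section PartA

variable {m n r : ℕ} (S : Realization (Fin n) r)

theorem isBlockSymmetric_symmData {h : ℕ} (hh : h < m) (he : Even h)
    {x y : List (ℤ × Matrix (Fin n) (Fin n) ℂ)} (hxy : IsCanonicalPair m h x y) :
    (((symmData S hh hxy).lead S).transpose = (symmData S hh hxy).lead S) ∧
      (((symmData S hh hxy).const S).transpose = (symmData S hh hxy).const S) := by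
  obtain ⟨e1, e2, e3, e4⟩ := symmData_words S hh hxy
  have hx : IsCanonical h (widx (sigmaWord x)) := by
    rw [widx_sigmaWord fun i hi => ((hxy.mem hh).1 i hi).1]; exact hxy.1
  have hy : IsCanonical (m - h - 1) (widx (tauWord m y)) := by
    rw [widx_tauWord fun i hi => ((hxy.mem hh).2 i hi).1]; exact hxy.2
  have f1 := symmWord_transpose (m := m) (b := true) (a := sigmaCoeff S) hh (fun _ => he) hx
  have f2 := symmWord_transpose (m := m) (b := false) (a := tauCoeff S m) (h := m - h - 1)
    (by omega) (by simp) hy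
  constructor
  · have t := (symmData S hh hxy).lead_triv_or S
    rw [Data.lead, symm_mul_iff fun i => (t i).symm, e2, e3]
    exact ⟨f2.1, by rw [rv_transpose, f1.2]⟩
  · have t := (symmData S hh hxy).const_triv_or S
    rw [Data.const, symm_mul_iff fun i => (t i).symm, e1, e4]
    exact ⟨f2.2, by rw [rv_transpose, f1.1]⟩

theorem sigmaWord_map {x : List (Bool × ℕ × Matrix (Fin n) (Fin n) ℂ)}
    (hx : ∀ p ∈ x, p.1 = false) :
    sigmaWord (x.map fun p => ((p.2.1 : ℤ), p.2.2)) = x := by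
  rw [sigmaWord, List.map_map]
  conv_rhs => rw [← List.map_id x]
  refine List.map_congr_left fun p hp => ?_
  simp [← hx p hp]

theorem tauWord_map {x : List (Bool × ℕ × Matrix (Fin n) (Fin n) ℂ)}
    (hx : ∀ p ∈ x, p.1 = false) :
    tauWord m (x.map fun p => ((p.2.1 : ℤ) - (m : ℤ), p.2.2)) = x := by
  rw [tauWord, List.map_map]
  conv_rhs => rw [← List.map_id x]
  refine List.map_congr_left fun p hp => ?_
  simp [← hx p hp]

theorem rv_injective {𝓐 : Type} [Ring 𝓐] {A B : Matrix (Ix m) (Ix m) 𝓐} (h : rv A = rv B) : A = B := by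
  rw [← rv_rv A, h, rv_rv]

/-- The converse of the block symmetry, for nonzero matrices at the indices `0` and `-m` of a
class `N`. -/
theorem Data.exists_symmPencilS (D : Data m n) (hlead : S.coeff m ≠ 0)
    (N : Matrix (Fin n) (Fin n) ℂ → Prop) (hN : ∀ X, N X → X ≠ 0)
    (hD : ∀ p ∈ D.σ₁ ++ D.σ₂ ++ (D.τ₁ ++ D.τ₂), p.1 = 0 ∨ p.1 = -(m : ℤ) → N p.2)
    (h1 : (D.lead S).transpose = D.lead S) (h2 : (D.const S).transpose = D.const S) :
    ∃ x y : List (ℤ × Matrix (Fin n) (Fin n) ℂ), Even D.h ∧ IsCanonicalPair m D.h x y ∧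
      D.gfpr S = symmPencilS S m D.h x y ∧
      ∀ p ∈ x ++ y, p.1 = 0 ∨ p.1 = -(m : ℤ) → N p.2 := by
  have hlt := D.h_lt
  have : Nontrivial (Matrix (Fin n) (Fin n) ℂ) := ⟨_, _, hlead⟩
  have w1 := D.sigmaWord_lt
  have w2 := D.tauWord_lt
  rw [Data.lead, symm_mul_iff fun i => (D.lead_triv_or S i).symm, rv_transpose] at h1
  rw [Data.const, symm_mul_iff fun i => (D.const_triv_or S i).symm, rv_transpose] at h2
  obtain ⟨T1, Q1⟩ := h1
  obtain ⟨T2, Q2⟩ := h2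
  have Q1 := rv_injective Q1
  have Q2 := rv_injective Q2
  have zσ : ∀ l : List (ℤ × Matrix (Fin n) (Fin n) ℂ), (∀ i ∈ indices l, 0 ≤ i) →
      (∀ p ∈ l, p.1 = 0 ∨ p.1 = -(m : ℤ) → N p.2) → ∀ p ∈ sigmaWord l, p.2.1 = 0 → N p.2.2 := by
    intro l h0 hl p hp hp0
    obtain ⟨q, hq, rfl⟩ := List.mem_map.1 hp
    have := h0 q.1 (List.mem_map_of_mem hq)
    simp only at hp0
    exact hl q hq (Or.inl (by omega))
  have zτ : ∀ l : List (ℤ × Matrix (Fin n) (Fin n) ℂ), (∀ i ∈ indices l, -(m : ℤ) ≤ i) →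
      (∀ p ∈ l, p.1 = 0 ∨ p.1 = -(m : ℤ) → N p.2) → ∀ p ∈ tauWord m l, p.2.1 = 0 → N p.2.2 := by
    intro l h0 hl p hp hp0
    obtain ⟨q, hq, rfl⟩ := List.mem_map.1 hp
    have := h0 q.1 (List.mem_map_of_mem hq)
    simp only at hp0
    exact hl q hq (Or.inr (by omega))
  -- the part on the indices `0, …, h`
  obtain ⟨AL, AR, G1⟩ := gen_of_words (m := m) (b := true) (a := sigmaCoeff S) (N := N) hlt
    (σ := D.σ.map Int.toNat) (s₁ := sigmaWord D.σ₁) (s₂ := sigmaWord D.σ₂)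
    (by
      have := D.σ_perm.map Int.toNat
      refine this.trans (List.Perm.of_eq ?_)
      rw [str_eq, List.map_map, show ((D.h : ℤ) + 1 - 0).toNat = D.h + 1 by omega]
      conv_rhs => rw [← List.map_id (List.range (D.h + 1))]
      exact List.map_congr_left fun i _ => by simp)
    (fun p hp => ⟨(w1.1 p hp).1, (w1.1 p hp).2, zσ _ (fun i hi => (D.σ₁_mem i hi).1)
      (fun p hp => hD p (by simp [hp])) p hp⟩)
    (fun p hp => ⟨(w1.2 p hp).1, (w1.2 p hp).2, zσ _ (fun i hi => (D.σ₂_mem i hi).1)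
      (fun p hp => hD p (by simp [hp])) p hp⟩)
    (by
      have := D.sip_σ
      rw [widx_sigmaWord fun i hi => (D.σ₁_mem i hi).1, widx_sigmaWord fun i hi => (D.σ₂_mem i hi).1,
        List.map_map]
      have e : D.σ.map (Nat.cast ∘ Int.toNat : ℤ → ℤ) = D.σ := by
        conv_rhs => rw [← List.map_id D.σ]
        refine List.map_congr_left fun i hi => ?_
        have := mem_str.1 (D.σ_perm.mem_iff.1 hi)
        simp [this.1]
      rwa [e])
  have eR : wprod m (sigmaWord D.σ₁) * ((D.σ.map Int.toNat).map (GFPR.mk m true (sigmaCoeff S))).prod *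
      wprod m (sigmaWord D.σ₂) = wprod m (D.wordσ S) := by
    rw [Data.wordσ, wprod_append, wprod_append]
    congr 2
    rw [wprod, coeffWord, List.map_map, List.map_map]
    rfl
  have eQ : wprod m (sigmaWord D.σ₁) * wprod m (sigmaWord D.σ₂) = wprod m D.wordσ' := by
    rw [Data.wordσ', wprod_append]
  rw [eR, eQ] at G1
  obtain ⟨he, x, x1, x2, x3, x4⟩ := G1.cls.exists_word hN (Or.inl rfl) hlt Q2 Q1
  -- the part on the indices `-m, …, -h - 1`
  obtain ⟨AL', AR', G2⟩ := gen_of_words (m := m) (b := false) (a := tauCoeff S m) (N := N)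
    (h := m - D.h - 1) (by omega)
    (σ := D.τ.map fun i => (i + (m : ℤ)).toNat) (s₁ := tauWord m D.τ₁) (s₂ := tauWord m D.τ₂)
    (by
      have := D.τ_perm.map fun i => (i + (m : ℤ)).toNat
      refine this.trans (List.Perm.of_eq ?_)
      rw [str_eq, List.map_map,
        show (-(D.h : ℤ) - 1 + 1 - -(m : ℤ)).toNat = m - D.h - 1 + 1 by omega]
      conv_rhs => rw [← List.map_id (List.range (m - D.h - 1 + 1))]
      exact List.map_congr_left fun i _ => by simp)
    (fun p hp => ⟨(w2.1 p hp).1, (w2.1 p hp).2, zτ _ (fun i hi => (D.τ₁_mem i hi).1)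
      (fun p hp => hD p (by simp [hp])) p hp⟩)
    (fun p hp => ⟨(w2.2 p hp).1, (w2.2 p hp).2, zτ _ (fun i hi => (D.τ₂_mem i hi).1)
      (fun p hp => hD p (by simp [hp])) p hp⟩)
    (by
      have := sip_map_add (m : ℤ) D.sip_τ
      rw [List.map_append, List.map_append] at this
      rw [widx_tauWord fun i hi => (D.τ₁_mem i hi).1, widx_tauWord fun i hi => (D.τ₂_mem i hi).1,
        List.map_map]
      have e : D.τ.map ((Nat.cast : ℕ → ℤ) ∘ fun i => (i + (m : ℤ)).toNat) =
          D.τ.map (· + (m : ℤ)) := by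
        refine List.map_congr_left fun i hi => ?_
        have := mem_str.1 (D.τ_perm.mem_iff.1 hi)
        simp only [Function.comp]; omega
      rwa [e])
  have eT : wprod m (tauWord m D.τ₁) *
      ((D.τ.map fun i => (i + (m : ℤ)).toNat).map (GFPR.mk m false (tauCoeff S m))).prod *
      wprod m (tauWord m D.τ₂) = wprod m (D.wordτ S) := by
    rw [Data.wordτ, wprod_append, wprod_append]
    congr 2
    rw [wprod, coeffWord, List.map_map, List.map_map, List.map_map]
    rfl
  have eQ' : wprod m (tauWord m D.τ₁) * wprod m (tauWord m D.τ₂) = wprod m D.wordτ' := by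
    rw [Data.wordτ', wprod_append]
  rw [eT, eQ'] at G2
  -- There is no border on the side of the negative indices. The nonzero entry that starts the
  -- induction in `Cls.col_ne_zero` is here the leading coefficient $A_m$.
  have hz : tauCoeff S m 0 ≠ 0 := by
    rw [tauCoeff, trivialCoeff, if_neg (by omega)]
    simpa using hlead
  obtain ⟨-, y, y1, y2, y3, y4⟩ := G2.cls.exists_word hN (Or.inr hz) (by omega) T1 T2
  have ex := sigmaWord_map fun p hp => (x1 p hp).1
  have ey := tauWord_map (m := m) fun p hp => (y1 p hp).1
  have hxy : IsCanonicalPair m D.h (x.map fun p => ((p.2.1 : ℤ), p.2.2))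
      (y.map fun p => ((p.2.1 : ℤ) - (m : ℤ), p.2.2)) := by
    constructor
    · rw [indices, List.map_map]; exact x2
    · rw [indices, List.map_map, List.map_map]
      simpa [Function.comp_def, widx] using y2
  refine ⟨_, _, he rfl, hxy, ?_, ?_⟩
  · obtain ⟨e1, e2, e3, e4⟩ := symmData_words S hlt hxy
    rw [symmPencilS_eq_gfpr S hlt hxy, Data.gfpr_eq, Data.gfpr_eq, Data.lead, Data.const, Data.lead,
      Data.const, e1, e2, e3, e4, ex, ey, x3, x4, y3, y4]
  · intro p hp hp0
    rcases List.mem_append.1 hp with hp | hp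
    · obtain ⟨q, hq, rfl⟩ := List.mem_map.1 hp
      exact (x1 q hq).2 (by simp only at hp0; omega)
    · obtain ⟨q, hq, rfl⟩ := List.mem_map.1 hp
      have := lt_of_isCanonical y2 q hq
      exact (y1 q hq).2 (by simp only at hp0; omega)

end PartA

/-! ### The block form of the pencils -/

section Form

variable {m n r : ℕ} (S : Realization (Fin n) r)

theorem foldl_greedy_split {l₁ l₂ : List ℤ} (h : ∀ i ∈ l₁, 0 < i) :
    (l₁ ++ 0 :: l₂).foldl greedyStep (-1) = l₂.foldl greedyStep 0 := by
  rw [List.foldl_append, greedy_neg_one fun h0 => by simpa using h 0 h0, List.foldl_cons]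
  rfl

theorem assignProdS_eq_border (x : List (ℤ × Matrix (Fin n) (Fin n) ℂ)) :
    assignProdS m r x = border r (assignProd m x) := by
  induction x with
  | nil => exact border_one.symm
  | cons p x ih =>
    rw [assignProdS, List.map_cons, List.prod_cons, ← assignProdS, ih, border_mul, assignProd,
      assignProd, List.map_cons, List.prod_cons]

theorem fiedlerS_prod_border {l : List ℤ} (hl : ∀ i ∈ l, -(m : ℤ) < i ∧ i ≠ 0) :
    (l.map (fiedlerS S m)).prod = border r (l.map (fiedlerP S m)).prod := by
  induction l with
  | nil => exact border_one.symm
  | cons i l ih =>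
    have hi := hl i (by simp)
    rw [List.map_cons, List.prod_cons, ih fun j hj => hl j (by simp [hj]), List.map_cons,
      List.prod_cons, ← border_mul]
    congr 1
    rcases lt_or_gt_of_ne hi.2 with h | h
    · have e : i = (((i + m).toNat : ℕ) : ℤ) - m := by omega
      rw [e, fiedlerS_of_neg (by omega) (by omega)]; rfl
    · have e : i = ((i.toNat : ℕ) : ℤ) := by omega
      rw [e, fiedlerS_of_pos (by omega)]; rfl

theorem toBlocks_border_mul (A B : Matrix (Fin m × Fin n) (Fin m × Fin n) ℂ)
    (M : Matrix ((Fin m × Fin n) ⊕ Fin r) ((Fin m × Fin n) ⊕ Fin r) ℂ) :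
    (border r A * M * border r B).toBlocks₁₁ = A * M.toBlocks₁₁ * B := by
  conv_lhs => rw [← Matrix.fromBlocks_toBlocks M, border, border, Matrix.fromBlocks_multiply,
    Matrix.fromBlocks_multiply, Matrix.toBlocks_fromBlocks₁₁]
  simp

theorem fiedlerS_prod_toBlocks (hm : 0 < m) (D : Data m n) :
    ((D.σ.map (fiedlerS S m)).prod).toBlocks₁₁ = (D.σ.map (fiedlerP S m)).prod ∧
    ((D.τ.map (fiedlerS S m)).prod).toBlocks₁₁ = (D.τ.map (fiedlerP S m)).prod := by
  constructor
  · obtain ⟨l₁, l₂, e, h1, h2⟩ := D.sigma_split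
    have e0 : (fiedlerS S m 0).toBlocks₁₁ = fiedlerP S m 0 := by
      rw [fiedlerS, if_pos rfl, Matrix.toBlocks_fromBlocks₁₁]
    rw [e, List.map_append, List.map_cons, List.prod_append, List.prod_cons, ← mul_assoc,
      fiedlerS_prod_border S fun i hi => by have := h1 i hi; omega,
      fiedlerS_prod_border S fun i hi => by have := h2 i hi; omega, toBlocks_border_mul, e0]
    simp [mul_assoc]
  · obtain ⟨l₁, l₂, e, h1, h2⟩ := D.tau_split
    have e0 : (fiedlerS S m (-(m : ℤ))).toBlocks₁₁ = fiedlerP S m (-(m : ℤ)) := by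
      rw [fiedlerS, if_neg (by omega), if_pos rfl, Matrix.toBlocks_fromBlocks₁₁]
    rw [e, List.map_append, List.map_cons, List.prod_append, List.prod_cons, ← mul_assoc,
      fiedlerS_prod_border S fun i hi => by have := h1 i hi; omega,
      fiedlerS_prod_border S fun i hi => by have := h2 i hi; omega, toBlocks_border_mul, e0]
    simp [mul_assoc]

theorem symmPencilS_toBlocks {h : ℕ} (hh : h < m) {x y : List (ℤ × Matrix (Fin n) (Fin n) ℂ)}
    (hxy : IsCanonicalPair m h x y) :
    (symmPencilS S m h x y).toBlocks₁₁ = symmPencilP S m h x y := by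
  obtain ⟨e1, e2⟩ := fiedlerS_prod_toBlocks S (by omega) (symmData S hh hxy)
  have key : ∀ (A B : Matrix (Fin m × Fin n) (Fin m × Fin n) ℂ)
      (K H : Matrix ((Fin m × Fin n) ⊕ Fin r) ((Fin m × Fin n) ⊕ Fin r) ℂ),
      ((border r A).map Polynomial.C * pencil K H * (border r B).map Polynomial.C).toBlocks₁₁ =
        A.map Polynomial.C * pencil K.toBlocks₁₁ H.toBlocks₁₁ * B.map Polynomial.C := by
    intro A B K H
    rw [pencil_mul_mul, pencil_mul_mul, ← toBlocks_border_mul, ← toBlocks_border_mul]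
    rfl
  rw [symmPencilS, mul_assoc, map_mul_map, assignProdS_eq_border, assignProdS_eq_border,
    assignProdS_eq_border, border_mul, key, symmPencilP, mul_assoc _ (Matrix.map _ _) (Matrix.map _ _), map_mul_map]
  congr 3

theorem symmPencilS_eq {h : ℕ} (hh : h < m) {x y : List (ℤ × Matrix (Fin n) (Fin n) ℂ)}
    (hxy : IsCanonicalPair m h x y) :
      symmPencilS S m h x y =
        Matrix.fromBlocks (symmPencilP S m h x y)
          ((colBlock (stdCol m (m - invers (indices x ++ simpleTuple h) 0)) S.C).map Polynomial.C)
          ((rowBlock (stdCol m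
            (m - consec (simpleTuple h ++ simpleComplement h ++ (indices x).reverse) 0))
              S.B).map Polynomial.C)
          (-pencil S.E S.A) := by
  have hb := symmPencilS_toBlocks S hh hxy
  have eg := symmPencilS_eq_gfpr S hh hxy
  obtain ⟨l₁, l₂, p, q, es, hp, hq, hp', hq', hl, ep, eq⟩ := (symmData S hh hxy).const_border S
  have i0 : invers (indices x ++ simpleTuple h) 0 = p := by
    rw [hp', invers_zero, consec_zero, show simpleTuple h = l₁ ++ 0 :: l₂ from es,
      show (indices x ++ (l₁ ++ 0 :: l₂)).reverse =
        l₂.reverse ++ 0 :: (l₁.reverse ++ (indices x).reverse) by simp,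
      foldl_greedy_split fun i hi => hl i (by simp at hi; simp [hi])]
    rfl
  have c0 : consec (simpleTuple h ++ simpleComplement h ++ (indices x).reverse) 0 = q := by
    rw [hq', consec_zero, show simpleTuple h = l₁ ++ 0 :: l₂ from es,
      show (l₁ ++ 0 :: l₂) ++ simpleComplement h ++ (indices x).reverse =
        l₁ ++ 0 :: (l₂ ++ (simpleComplement h ++ (indices x).reverse)) by simp,
      foldl_greedy_split fun i hi => hl i (by simp [hi])]
    simp only [symmData, indices_append, indices_trivialAssign, indices_reverse]
  have e : ∀ (a : Fin m) (k : ℕ), k < m → (Sum.inl a = lv m (m - 1 - k) ↔ (a : ℤ) + 1 = m - k) := by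
    intro a k hk
    rw [show (Sum.inl a : Ix m) = lv m a by simp [lv], lv_inj a.2 (by omega)]
    omega
  rw [i0, c0]
  ext1 (⟨a, i⟩ | k) (⟨b, j⟩ | l)
  · rw [Matrix.fromBlocks_apply₁₁, ← hb]; rfl
  · rw [eg, Data.gfpr_inl_inr, ep, Matrix.one_apply]
    simp only [Matrix.fromBlocks_apply₁₂, Matrix.map_apply, colBlock, Matrix.of_apply, stdCol,
      e a p hp]
    split_ifs <;> simp
  · rw [eg, Data.gfpr_inr_inl, eq, Matrix.one_apply]
    simp only [Matrix.fromBlocks_apply₂₁, Matrix.map_apply, rowBlock, Matrix.of_apply, stdCol,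
      eq_comm.trans (e b q hq)]
    split_ifs <;> simp
  · rw [eg, Data.gfpr_inr_inr]; rfl

end Form

theorem symmPencilS_isBlockSymmetric {m n r : ℕ} (S : Realization (Fin n) r) {h : ℕ} (hh : h < m)
    (he : Even h) {x y : List (ℤ × Matrix (Fin n) (Fin n) ℂ)} (hxy : IsCanonicalPair m h x y) :
    IsBlockSymmetric (symmPencilS S m h x y) := by
  rw [symmPencilS_eq_gfpr S hh hxy]
  obtain ⟨h1, h2⟩ := isBlockSymmetric_symmData S hh he hxy
  exact Data.isBlockSymmetric _ S h1 h2

/-- The class of admissible matrices is carried through the whole classification. Taking the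
invertible matrices for nonsingular data, and the nonzero matrices otherwise, gives the additional
claim about nonsingular assignments. -/
theorem exists_symmPencilS_of_isBlockSymmetric {m n r : ℕ} (S : Realization (Fin n) r)
    (hlead : S.coeff m ≠ 0) (hmin : S.IsMinimal) (hr : 0 < r) (D : Data m n) (hD : D.Nonzero)
    (hs : IsBlockSymmetric (D.gfpr S)) :
    ∃ (h : ℕ) (x y : List (ℤ × Matrix (Fin n) (Fin n) ℂ)),
        h < m ∧ Even h ∧ IsCanonicalPair m h x y ∧ D.gfpr S = symmPencilS S m h x y ∧
        (D.Nonsingular → IsNonsingular m x ∧ IsNonsingular m y) := by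
  obtain ⟨h1, h2⟩ := D.symm_of_isBlockSymmetric S hr hmin hs
  -- For $n=0$ the zero matrix has determinant $1$, and invertible matrices could be zero.
  have : Nonempty (Fin n) := by
    by_contra hn
    rw [not_nonempty_iff] at hn
    exact hlead (Subsingleton.elim _ _)
  by_cases hN : D.Nonsingular
  · obtain ⟨x, y, he, hxy, e, hz⟩ := D.exists_symmPencilS S hlead (fun X => IsUnit X.det)
      (by rintro X hX rfl; simp [Matrix.det_zero] at hX)
      (by
        obtain ⟨n1, n2, n3, n4⟩ := hN
        intro p hp
        simp only [List.mem_append] at hp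
        rcases hp with (hp | hp) | hp | hp
        exacts [n1 p hp, n2 p hp, n3 p hp, n4 p hp]) h1 h2
    exact ⟨D.h, x, y, D.h_lt, he, hxy, e, fun _ =>
      ⟨fun p hp => hz p (by simp [hp]), fun p hp => hz p (by simp [hp])⟩⟩
  · obtain ⟨x, y, he, hxy, e, -⟩ := D.exists_symmPencilS S hlead (fun X => X ≠ 0) (fun _ h => h)
      (by
        obtain ⟨n1, n2, n3, n4⟩ := hD
        intro p hp
        simp only [List.mem_append] at hp
        rcases hp with (hp | hp) | hp | hp
        exacts [n1 p hp, n2 p hp, n3 p hp, n4 p hp]) h1 h2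
    exact ⟨D.h, x, y, D.h_lt, he, hxy, e, fun h => absurd h hN⟩

/-! ## The reduction of Fiedler pencils -/

section Step

variable {ι : Type} [Fintype ι] [DecidableEq ι] {𝓐 : Type} [Ring 𝓐]

/-- One step of Horner's rule $P=-a+tP'$ in matrix form: a shear and a letter with matrix $-P$
absorb the top letter, and $tP$ appears one level lower. Since $R$ is trivial at $i_1$, the identity
can be checked on the two levels involved. -/
theorem sub_mul_swapM {i₁ i₀ : ι} (hne : i₁ ≠ i₀) {t a P P' : 𝓐} {d d' : ι → 𝓐}
    (h1 : d i₁ = t * P') (h0 : d i₀ = t) (h1' : d' i₁ = 0) (h0' : d' i₀ = t * P)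
    (hd : ∀ i, i ≠ i₁ → i ≠ i₀ → d i = d' i) (hP : P = -a + t * P') {R : Matrix ι ι 𝓐}
    (hR : Triv R i₁) :
    Matrix.diagonal d - R * swapM i₁ i₀ a =
      (1 - Matrix.single i₀ i₁ t) * (Matrix.diagonal d' - R) * swapM i₁ i₀ (-P) := by
  have hs : ∀ (A : Matrix ι ι 𝓐) i j, ((1 - Matrix.single i₀ i₁ t) * A) i j =
      A i j - if i = i₀ then t * A i₁ j else 0 := by
    intro A i j
    rw [sub_mul, one_mul, Matrix.sub_apply]
    congr 1
    split_ifs with h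
    · subst h; rw [Matrix.single_mul_apply_same]
    · rw [Matrix.single_mul_apply_of_ne _ _ _ _ _ h]
  have hr1 : ∀ j, R i₁ j = if i₁ = j then 1 else 0 := fun j => by rw [(hR j).1, Matrix.one_apply]
  have hr2 : ∀ j, R j i₁ = if j = i₁ then 1 else 0 := fun j => by rw [(hR j).2, Matrix.one_apply]
  ext i j
  rw [mul_assoc, hs, Matrix.sub_apply, mul_swapM _ _ hne, mul_swapM _ _ hne, mul_swapM _ _ hne]
  simp only [Matrix.sub_apply, Matrix.diagonal_apply, hr1, hr2, if_true, h1', if_neg hne]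
  by_cases hj1 : j = i₁
  · subst hj1
    by_cases hi1 : i = j
    · subst hi1; simp [hne, h1, h1', hP]; abel
    · by_cases hi0 : i = i₀
      · subst hi0; simp [hi1, h0', mul_neg]
      · simp [hi1, hi0]
  · by_cases hj0 : j = i₀
    · subst hj0
      by_cases hi1 : i = i₁
      · subst hi1; simp [hne, hj1, h1', hP]
      · by_cases hi0 : i = j
        · subst hi0; simp [hi1, h0]
        · simp [hi1, hi0, hj1]
    · by_cases hi1 : i = i₁
      · subst hi1; simp [hne, hj1, hj0, Ne.symm hj1]
      · by_cases hi0 : i = i₀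
        · subst hi0; simp [hj1, hj0, Ne.symm hj1, Ne.symm hj0]
        · by_cases hij : i = j
          · subst hij; simp [hi0, hi1, hd i hi1 hi0]
          · simp [hi1, hi0, hj1, hj0, hij]

/-- The mirror image, for a top letter that stands on the left. Here $t$ arrives on the right of
$P$, hence the centrality of $t$. -/
theorem sub_swapM_mul {i₁ i₀ : ι} (hne : i₁ ≠ i₀) {t a P P' : 𝓐} (ht : Cen t) {d d' : ι → 𝓐}
    (h1 : d i₁ = t * P') (h0 : d i₀ = t) (h1' : d' i₁ = 0) (h0' : d' i₀ = t * P)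
    (hd : ∀ i, i ≠ i₁ → i ≠ i₀ → d i = d' i) (hP : P = -a + t * P') {R : Matrix ι ι 𝓐}
    (hR : Triv R i₁) :
    Matrix.diagonal d - swapM i₁ i₀ a * R =
      swapM i₁ i₀ (-P) * (Matrix.diagonal d' - R) * (1 - Matrix.single i₁ i₀ t) := by
  have hs : ∀ (A : Matrix ι ι 𝓐) i j, (A * (1 - Matrix.single i₁ i₀ t)) i j =
      A i j - if j = i₀ then A i i₁ * t else 0 := by
    intro A i j
    rw [mul_sub, mul_one, Matrix.sub_apply]
    congr 1
    split_ifs with h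
    · subst h; rw [Matrix.mul_single_apply_same]
    · rw [Matrix.mul_single_apply_of_ne _ _ _ _ _ h]
  have hr1 : ∀ j, R i₁ j = if i₁ = j then 1 else 0 := fun j => by rw [(hR j).1, Matrix.one_apply]
  have hr2 : ∀ j, R j i₁ = if j = i₁ then 1 else 0 := fun j => by rw [(hR j).2, Matrix.one_apply]
  ext i j
  rw [hs, Matrix.sub_apply, swapM_mul _ _ hne, swapM_mul _ _ hne, swapM_mul _ _ hne]
  simp only [Matrix.sub_apply, Matrix.diagonal_apply, hr1, hr2, if_true, h1', if_neg hne.symm]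
  by_cases hj1 : i = i₁
  · subst hj1
    by_cases hi1 : j = i
    · subst hi1; simp [hne, hne.symm, h1, hP]; abel
    · by_cases hi0 : j = i₀
      · subst hi0; simp [hi1, hne, h0', mul_neg, (ht _).eq]
      · simp [hi1, hi0, Ne.symm hi1, Ne.symm hi0]
  · by_cases hj0 : i = i₀
    · subst hj0
      by_cases hi1 : j = i₁
      · subst hi1; simp [hne, hne.symm]
      · by_cases hi0 : j = i
        · subst hi0; simp [hi1, h0, hne]
        · simp [hi1, hi0, Ne.symm hi1, Ne.symm hi0, hj1]
    · by_cases hi1 : j = i₁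
      · subst hi1; simp [hne, hj1, hj0]
      · by_cases hi0 : j = i₀
        · subst hi0; simp [hj1, hj0, hi1]
        · by_cases hij : j = i
          · subst hij; simp [hi0, hi1, hd j hi1 hi0]
          · simp [hi0, hj1, hj0, Ne.symm hij]

end Step

/-! ### Invertible matrices away from the border -/

section BorderUnit

variable {m : ℕ} {𝓐 : Type} [Ring 𝓐]

/-- Invertible matrices that do not involve the border. -/
def BorderUnit (U : Matrix (Ix m) (Ix m) 𝓐) : Prop :=
  Triv U (Sum.inr ()) ∧ ∃ U', Triv U' (Sum.inr ()) ∧ U * U' = 1 ∧ U' * U = 1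

theorem BorderUnit.one : BorderUnit (1 : Matrix (Ix m) (Ix m) 𝓐) :=
  ⟨triv_one _, 1, triv_one _, mul_one _, mul_one _⟩

theorem BorderUnit.mul {U V : Matrix (Ix m) (Ix m) 𝓐} (hU : BorderUnit U) (hV : BorderUnit V) :
    BorderUnit (U * V) := by
  obtain ⟨u, U', u', u1, u2⟩ := hU
  obtain ⟨v, V', v', v1, v2⟩ := hV
  refine ⟨u.mul v, V' * U', v'.mul u', ?_, ?_⟩
  · rw [mul_assoc, ← mul_assoc V, v1, one_mul, u1]
  · rw [mul_assoc, ← mul_assoc U', u2, one_mul, v2]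

theorem BorderUnit.exists_inv {U : Matrix (Ix m) (Ix m) 𝓐} (hU : BorderUnit U) :
    ∃ U', BorderUnit U' ∧ U * U' = 1 ∧ U' * U = 1 := by
  obtain ⟨u, U', u', u1, u2⟩ := hU
  exact ⟨U', ⟨u', U, u, u2, u1⟩, u1, u2⟩

theorem BorderUnit.rv {U : Matrix (Ix m) (Ix m) 𝓐} (hU : BorderUnit U) : BorderUnit (rv U) := by
  obtain ⟨u, U', u', u1, u2⟩ := hU
  exact ⟨Triv.rv u, GFPR.rv U', Triv.rv u', by rw [← rv_mul, u1, rv_one],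
    by rw [← rv_mul, u2, rv_one]⟩

theorem BorderUnit.map {𝓑 : Type} [Ring 𝓑] (f : 𝓐 →+* 𝓑) {U : Matrix (Ix m) (Ix m) 𝓐}
    (hU : BorderUnit U) : BorderUnit (U.map f) := by
  have ht : ∀ A : Matrix (Ix m) (Ix m) 𝓐, Triv A (Sum.inr ()) → Triv (A.map f) (Sum.inr ()) := by
    intro A hA j
    simp only [Matrix.map_apply, (hA j).1, (hA j).2, Matrix.one_apply]
    constructor <;> split_ifs <;> simp
  have h1 : (1 : Matrix (Ix m) (Ix m) 𝓐).map f = 1 := Matrix.map_one f f.map_zero f.map_one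
  obtain ⟨u, U', u', u1, u2⟩ := hU
  exact ⟨ht _ u, U'.map f, ht _ u', by rw [← Matrix.map_mul, u1, h1],
    by rw [← Matrix.map_mul, u2, h1]⟩

theorem BorderUnit.list_prod {l : List (Matrix (Ix m) (Ix m) 𝓐)} (hl : ∀ U ∈ l, BorderUnit U) :
    BorderUnit l.prod := by
  induction l with
  | nil => exact BorderUnit.one
  | cons U l ih =>
    rw [List.prod_cons]
    exact (hl U (by simp)).mul (ih fun V hV => hl V (by simp [hV]))

theorem borderUnit_glet {b : Bool} {k : ℕ} (h0 : k ≠ 0) (hk : k < m) (X : 𝓐) :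
    BorderUnit (glet m b k X) := by
  have hne : lv m k ≠ lv m (k - 1) := lv_ne hk (by omega)
  rw [glet_of_pos h0]
  have ht : ∀ (i j : Ix m) (X : 𝓐), Sum.inr () ≠ i → Sum.inr () ≠ j →
      Triv (swapM i j X) (Sum.inr ()) := fun i j X hi hj l =>
    ⟨swapM_apply_of_ne _ (Or.inl ⟨hi, hj⟩), swapM_apply_of_ne _ (Or.inr ⟨hi, hj⟩)⟩
  have n1 : Sum.inr () ≠ lv m k := (lv_ne_inr hk).symm
  have n2 : Sum.inr () ≠ lv m (k - 1) := (lv_ne_inr (by omega)).symm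
  refine ⟨ht _ _ _ n1 n2, swapM (lv m (k - 1)) (lv m k) (-X), ht _ _ _ n2 n1, ?_,
    swapM_mul_swapM hne X⟩
  have := swapM_mul_swapM hne.symm (-X)
  rwa [neg_neg] at this

theorem borderUnit_glet_zero (hm : 0 < m) {X : 𝓐} (hX : IsUnit X) :
    BorderUnit (glet m false 0 X) := by
  obtain ⟨u, rfl⟩ := hX
  have e : ∀ X Y : 𝓐, X * Y = 1 → glet m false 0 X * glet m false 0 Y = 1 := by
    intro X Y h
    simp only [glet, if_true, Bool.false_eq_true, if_false, diagM, Matrix.diagonal_mul_diagonal]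
    rw [← Matrix.diagonal_one]
    congr 1
    funext i
    split_ifs <;> simp [h]
  exact ⟨triv_glet_inr hm (Or.inl rfl), glet m false 0 ((u⁻¹ : 𝓐ˣ) : 𝓐),
    triv_glet_inr hm (Or.inl rfl), e _ _ (by simp), e _ _ (by simp)⟩

theorem borderUnit_wprod {t : List (Bool × ℕ × 𝓐)}
    (ht : ∀ p ∈ t, p.1 = false ∧ p.2.1 < m ∧ (p.2.1 = 0 → IsUnit p.2.2)) :
    BorderUnit (wprod m t) := by
  refine BorderUnit.list_prod fun U hU => ?_
  obtain ⟨p, hp, rfl⟩ := List.mem_map.1 hU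
  obtain ⟨h1, h2, h3⟩ := ht p hp
  by_cases h0 : p.2.1 = 0
  · rw [h0, h1]; exact borderUnit_glet_zero (by omega) (h3 h0)
  · exact borderUnit_glet h0 h2 _

theorem borderUnit_shear {i j : Ix m} (hij : i ≠ j) (hi : i ≠ Sum.inr ()) (hj : j ≠ Sum.inr ())
    (t : 𝓐) : BorderUnit (1 - Matrix.single i j t) := by
  have ht : ∀ t : 𝓐, Triv (1 - Matrix.single i j t) (Sum.inr ()) := by
    intro t l
    simp [Matrix.single_apply, hi, hj]
  have e : ∀ t : 𝓐, (1 - Matrix.single i j t) * (1 - Matrix.single i j (-t)) = 1 := by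
    intro t
    have : Matrix.single i j (-t) = - Matrix.single i j t := by
      ext a b; simp only [Matrix.neg_apply, Matrix.single_apply]; split_ifs <;> simp
    rw [this, sub_neg_eq_add, sub_mul, one_mul, mul_add, mul_one,
      Matrix.single_mul_single_of_ne _ _ _ _ hij.symm]
    simp
  refine ⟨ht t, _, ht (-t), e t, ?_⟩
  have := e (-t)
  rwa [neg_neg] at this

end BorderUnit

/-! ### Horner reduction of Fiedler pencils -/

section Reduction

variable {m : ℕ} {𝓐 : Type} [Ring 𝓐]

/-- The diagonal matrix with `t` at the border and below the level `k`, with `t * P` at the level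
`k`, and with zeros above. -/
def topDiag (m : ℕ) (t P : 𝓐) (k : ℕ) : Matrix (Ix m) (Ix m) 𝓐 :=
  Matrix.diagonal (Sum.elim (fun l : Fin m => if (l : ℕ) < k then t else if (l : ℕ) = k then t * P else 0)
    fun _ => t)

variable {b : Bool} {a : ℕ → 𝓐}

theorem prod_mk_triv {σ : List ℕ} {k : ℕ} (hk : k < m) (hσ : ∀ j ∈ σ, j < k) :
    Triv (σ.map (mk m b a)).prod (lv m k) := by
  have : (σ.map (mk m b a)).prod = wprod m (σ.map fun j => (b, j, a j)) := by
    rw [wprod, List.map_map]; rfl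
  rw [this]
  exact wprod_triv hk fun p hp => by obtain ⟨j, hj, rfl⟩ := List.mem_map.1 hp; exact hσ j hj

theorem exists_perm_prod {h : ℕ} (hm : h + 1 < m) {σ : List ℕ} (hσ : σ.Perm (List.range (h + 2))) :
    ∃ σ' : List ℕ, σ'.Perm (List.range (h + 1)) ∧
      ((σ.map (mk m b a)).prod = (σ'.map (mk m b a)).prod * mk m b a (h + 1) ∨
        (σ.map (mk m b a)).prod = mk m b a (h + 1) * (σ'.map (mk m b a)).prod) := by
  have hmem : h + 1 ∈ σ := hσ.mem_iff.2 (by simp)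
  obtain ⟨s₁, s₂, rfl⟩ := List.append_of_mem hmem
  have hp : (s₁ ++ s₂).Perm (List.range (h + 1)) := by
    have e : ((h + 1) :: (s₁ ++ s₂)).Perm ((h + 1) :: List.range (h + 1)) := by
      refine List.perm_middle.symm.trans (hσ.trans ?_)
      rw [List.range_succ (n := h + 1)]
      exact List.perm_append_comm
    exact e.cons_inv
  have hnd : (s₁ ++ s₂).Nodup := hp.nodup_iff.2 List.nodup_range
  have hle : ∀ k ∈ s₁ ++ s₂, k ≤ h := fun k hk => by
    have := hp.mem_iff.1 hk; simp at this; omega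
  have comm : ∀ s : List ℕ, (∀ k ∈ s, k < h) →
      Commute (mk m b a (h + 1)) (s.map (mk m b a)).prod := by
    intro s hs
    refine Commute.list_prod_right _ _ fun x hx => ?_
    obtain ⟨k, hk, rfl⟩ := List.mem_map.1 hx
    exact (glet_commute (by have := hs k hk; omega) hm (by have := hs k hk; omega) _ _).symm
  refine ⟨s₁ ++ s₂, hp, ?_⟩
  simp only [List.map_append, List.prod_append, List.map_cons, List.prod_cons]
  have hh : h ∈ s₁ ++ s₂ := hp.mem_iff.2 (by simp)
  rcases List.mem_append.1 hh with hh | hh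
  · left
    rw [(comm s₂ fun k hk => ?_).eq, mul_assoc]
    exact lt_of_le_of_ne (hle k (by simp [hk])) fun e =>
      (List.nodup_append.1 hnd).2.2 h hh k hk e.symm
  · right
    rw [← mul_assoc, ← (comm s₁ fun k hk => ?_).eq, mul_assoc]
    exact lt_of_le_of_ne (hle k (by simp [hk])) fun e =>
      (List.nodup_append.1 hnd).2.2 k hk h hh e

/-- The reduction of a Fiedler pencil. -/
theorem topDiag_sub_prod {t : 𝓐} (ht : Cen t) {P : ℕ → 𝓐} {h : ℕ} (hm : h < m)
    (hP : ∀ k, 1 ≤ k → k ≤ h → P k = -a k + t * P (k + 1)) {σ : List ℕ}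
    (hσ : σ.Perm (List.range (h + 1))) :
    ∃ U V : Matrix (Ix m) (Ix m) 𝓐, BorderUnit U ∧ BorderUnit V ∧
      topDiag m t (P (h + 1)) h - (σ.map (mk m b a)).prod =
        U * (topDiag m t (P 1) 0 - mk m b a 0) * V := by
  induction h generalizing σ with
  | zero =>
    have : σ = [0] := by simpa using hσ
    subst this
    exact ⟨1, 1, BorderUnit.one, BorderUnit.one, by simp⟩
  | succ h ih =>
    obtain ⟨σ', hσ', e⟩ := exists_perm_prod (b := b) (a := a) hm hσ
    obtain ⟨U, V, hU, hV, hUV⟩ := ih (by omega) (fun k h1 h2 => hP k h1 (by omega)) hσ'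
    have hne : lv m (h + 1) ≠ lv m h := lv_ne hm (by omega)
    have hR : Triv (σ'.map (mk m b a)).prod (lv m (h + 1)) := prod_mk_triv hm fun j hj => by
      have := hσ'.mem_iff.1 hj; simpa using this
    have n1 : lv m (h + 1) ≠ Sum.inr () := lv_ne_inr hm
    have n0 : lv m h ≠ Sum.inr () := lv_ne_inr (by omega)
    have d : ∀ (k j : ℕ) (Q : 𝓐) (hj : j < m), (Sum.elim (fun l : Fin m => if (l : ℕ) < k then t else
        if (l : ℕ) = k then t * Q else 0) fun _ => t : Ix m → 𝓐) (lv m j) =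
        if j < k then t else if j = k then t * Q else 0 := by
      intro k j Q hj; simp [lv, hj]
    have d1 := d (h + 1) (h + 1) (P (h + 1 + 1)) hm
    have d2 := d (h + 1) h (P (h + 1 + 1)) (by omega)
    have d3 := d h (h + 1) (P (h + 1)) hm
    have d4 := d h h (P (h + 1)) (by omega)
    rw [if_neg (by omega), if_pos rfl] at d1 d4
    rw [if_pos (by omega)] at d2
    rw [if_neg (by omega), if_neg (by omega)] at d3
    have d5 : ∀ i : Ix m, i ≠ lv m (h + 1) → i ≠ lv m h →
        (Sum.elim (fun l : Fin m => if (l : ℕ) < h + 1 then t else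
          if (l : ℕ) = h + 1 then t * P (h + 1 + 1) else 0) fun _ => t : Ix m → 𝓐) i =
        (Sum.elim (fun l : Fin m => if (l : ℕ) < h then t else
          if (l : ℕ) = h then t * P (h + 1) else 0) fun _ => t : Ix m → 𝓐) i := by
      intro i i1 i0
      rcases lv_cases i with ⟨l, hl, rfl⟩ | rfl
      · have e1 : l ≠ h + 1 := by rintro rfl; exact i1 rfl
        have e0 : l ≠ h := by rintro rfl; exact i0 rfl
        rw [d _ _ _ hl, d _ _ _ hl]
        by_cases hl' : l < h
        · rw [if_pos (by omega), if_pos hl']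
        · rw [if_neg (by omega), if_neg e1, if_neg hl', if_neg e0]
      · rfl
    have hP1 := hP (h + 1) (by omega) le_rfl
    have n10 := borderUnit_glet (b := b) (k := h + 1) (by omega) hm (-P (h + 1))
    rw [glet_succ] at n10
    -- The top letter can be brought to one end of the product. Depending on the end, the shear goes
    -- to the left factor and the letter to the right factor, or conversely.
    rcases e with e | e
    · refine ⟨(1 - Matrix.single (lv m h) (lv m (h + 1)) t) * U, V * swapM (lv m (h + 1)) (lv m h)
        (-P (h + 1)), (borderUnit_shear hne.symm n0 n1 t).mul hU, hV.mul n10, ?_⟩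
      rw [e, mk, glet_succ]
      refine (sub_mul_swapM hne d1 d2 d3 d4 d5 hP1 hR).trans ?_
      change _ * (topDiag m t (P (h + 1)) h - _) * _ = _
      rw [hUV]
      simp only [mul_assoc]
    · refine ⟨swapM (lv m (h + 1)) (lv m h) (-P (h + 1)) * U, V * (1 - Matrix.single (lv m (h + 1))
        (lv m h) t), n10.mul hU, hV.mul (borderUnit_shear hne n1 n0 t), ?_⟩
      rw [e, mk, glet_succ]
      refine (sub_swapM_mul hne ht d1 d2 d3 d4 d5 hP1 hR).trans ?_
      change _ * (topDiag m t (P (h + 1)) h - _) * _ = _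
      rw [hUV]
      simp only [mul_assoc]

end Reduction

/-! ### Proper generalized Fiedler pencils -/

section Pencil

variable {m : ℕ} {𝓐 : Type} [Ring 𝓐] {b : Bool} {a α : ℕ → 𝓐}

theorem glet_mul_rv_glet {k : ℕ} (h0 : 0 < k) (hk : k < m) (X : 𝓐) :
    glet m false k (-X) * rv (glet m b (m - k) X) = 1 ∧
      rv (glet m b (m - k) X) * glet m false k (-X) = 1 := by
  rw [glet_of_pos (by omega), glet_of_pos (by omega), rv_swapM, revIx_lv (by omega),
    revIx_lv (by omega), show m - 1 - (m - k) = k - 1 by omega,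
    show m - 1 - (m - k - 1) = k by omega]
  have hne : lv m (k - 1) ≠ lv m k := lv_ne (by omega) (by omega)
  refine ⟨swapM_mul_swapM hne X, ?_⟩
  have := swapM_mul_swapM hne.symm (-X)
  rwa [neg_neg] at this

/-- The letter $k$ of one side and the letter $m-k$ of the other, with opposite matrices, are
inverse to each other: $M^P_{-i}=(M^P_i)^{-1}$. -/
theorem prod_mk_mul_rv {l : List ℕ} (hl : ∀ k ∈ l, 0 < k ∧ k < m)
    (hα : ∀ k ∈ l, α k = -a (m - k)) :
    (l.map (mk m false α)).prod * rv ((l.reverse.map (m - ·)).map (mk m b a)).prod = 1 ∧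
      rv ((l.reverse.map (m - ·)).map (mk m b a)).prod * (l.map (mk m false α)).prod = 1 := by
  induction l with
  | nil => simp [rv_one]
  | cons k l ih =>
    obtain ⟨i1, i2⟩ := ih (fun j hj => hl j (by simp [hj])) (fun j hj => hα j (by simp [hj]))
    obtain ⟨j1, j2⟩ := glet_mul_rv_glet (b := b) (hl k (by simp)).1 (hl k (by simp)).2 (a (m - k))
    have e : mk m false α k = glet m false k (-a (m - k)) := by rw [mk, hα k (by simp)]
    simp only [List.map_cons, List.prod_cons, List.reverse_cons, List.map_append, List.prod_append,
      List.map_nil, List.prod_nil, mul_one, rv_mul]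
    rw [e]
    change _ * _ * (_ * rv (glet m b (m - k) (a (m - k)))) = 1 ∧
      _ * rv (glet m b (m - k) (a (m - k))) * _ = 1
    constructor
    · rw [mul_assoc, ← mul_assoc (List.prod _), i1, one_mul, j1]
    · rw [mul_assoc, ← mul_assoc (rv (glet _ _ _ _)), j2, one_mul, i2]

theorem mul_smul_of_cen {t : 𝓐} (ht : Cen t) {ι : Type} [Fintype ι] (A B : Matrix ι ι 𝓐) :
    A * (t • B) = t • (A * B) := by
  ext i j
  simp only [Matrix.mul_apply, Matrix.smul_apply, smul_eq_mul, Finset.mul_sum]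
  exact Finset.sum_congr rfl fun k _ => by rw [← mul_assoc, ← (ht _).eq, mul_assoc]

/-- For the largest possible $h$, namely $m-1$, the diagonal matrix at which the Horner reduction
starts is the leading term $\lambda M_{-m}$ with the levels reversed. -/
theorem rv_topDiag (hm : 0 < m) (t X : 𝓐) : rv (topDiag m t X (m - 1)) = t • glet m false 0 X := by
  have e : glet m false 0 X = diagM (lv m 0) X := by simp [glet]
  rw [e, diagM, topDiag, rv, Matrix.submatrix_diagonal_equiv, ← Matrix.diagonal_smul]
  congr 1
  funext i
  rcases lv_cases i with ⟨k, hk, rfl⟩ | rfl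
  · simp only [Function.comp_apply, revIx_lv hk, Pi.smul_apply, smul_eq_mul, lv_inj hk hm]
    simp only [lv, show m - 1 - k < m by omega, dite_true, Sum.elim_inl]
    by_cases h : k = 0
    · simp [h]
    · rw [if_pos (by omega), if_neg h, mul_one]
  · simp [revIx_inr, (lv_ne_inr hm).symm]

/-- Inverting the letters of negative index other than $-m$ supplies exactly the indices
$h+1,\dots,m-1$ that are missing from $\sigma$. -/
theorem perm_complement {h : ℕ} (hm : h < m) {σ υ₁ υ₂ : List ℕ} (hσ : σ.Perm (List.range (h + 1)))
    (hυ : (υ₁ ++ 0 :: υ₂).Perm (List.range (m - h))) :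
    (υ₁.reverse.map (m - ·) ++ σ ++ υ₂.reverse.map (m - ·)).Perm (List.range m) := by
  have nd : (0 :: (υ₁ ++ υ₂)).Nodup := by
    rw [← List.nodup_middle]; exact hυ.nodup_iff.2 List.nodup_range
  have hmem : ∀ k, k ∈ υ₁ ++ υ₂ ↔ 0 < k ∧ k < m - h := by
    intro k
    have : k ∈ 0 :: (υ₁ ++ υ₂) ↔ k < m - h := by
      rw [← List.mem_range, ← hυ.mem_iff, List.perm_middle.mem_iff]
    rw [List.mem_cons] at this
    constructor
    · intro hk
      have h0 : k ≠ 0 := by rintro rfl; exact (List.nodup_cons.1 nd).1 hk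
      exact ⟨by omega, this.1 (Or.inr hk)⟩
    · rintro ⟨h1, h2⟩
      exact (this.2 h2).resolve_left (by omega)
  have p : (υ₁.reverse.map (m - ·) ++ σ ++ υ₂.reverse.map (m - ·)).Perm
      (σ ++ (υ₁ ++ υ₂).map (m - ·)) := by
    rw [List.map_append]
    refine (List.perm_append_comm.append_right _).trans ?_
    rw [List.append_assoc]
    exact List.Perm.append_left _
      (((List.reverse_perm _).map _).append ((List.reverse_perm _).map _))
  refine p.trans ((List.perm_ext_iff_of_nodup ?_ List.nodup_range).2 fun k => ?_)
  · refine (List.nodup_append).2 ⟨hσ.nodup_iff.2 List.nodup_range, ?_, ?_⟩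
    · refine (List.nodup_cons.1 nd).2.map_on fun x hx y hy e => ?_
      have := (hmem x).1 hx
      have := (hmem y).1 hy
      omega
    · intro x hx y hy e
      obtain ⟨k, hk, rfl⟩ := List.mem_map.1 hy
      have := (hmem k).1 hk
      have := List.mem_range.1 (hσ.mem_iff.1 hx)
      omega
  · rw [List.mem_append, hσ.mem_iff, List.mem_range, List.mem_range, List.mem_map]
    constructor
    · rintro (hk | ⟨j, hj, rfl⟩)
      · omega
      · have := (hmem j).1 hj; omega
    · intro hk
      by_cases h1 : k < h + 1
      · exact Or.inl h1
      · exact Or.inr ⟨m - k, (hmem _).2 (by omega), by omega⟩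

/-- The reduction of a proper generalized Fiedler pencil. -/
theorem smul_prod_sub_rv_prod {t : 𝓐} (ht : Cen t) {P : ℕ → 𝓐} {h : ℕ} (hm : h < m)
    (hP : ∀ k, 1 ≤ k → k < m → P k = -a k + t * P (k + 1)) (hPm : P m = α 0)
    (hα : ∀ k, 0 < k → k < m - h → α k = -a (m - k)) {σ υ : List ℕ}
    (hσ : σ.Perm (List.range (h + 1))) (hυ : υ.Perm (List.range (m - h))) :
    ∃ U V : Matrix (Ix m) (Ix m) 𝓐, BorderUnit U ∧ BorderUnit V ∧
      t • (υ.map (mk m false α)).prod - rv (σ.map (mk m b a)).prod =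
        U * rv (topDiag m t (P 1) 0 - mk m b a 0) * V := by
  have hmem : 0 ∈ υ := hυ.mem_iff.2 (by simp; omega)
  obtain ⟨υ₁, υ₂, rfl⟩ := List.append_of_mem hmem
  have nd : (0 :: (υ₁ ++ υ₂)).Nodup := by
    rw [← List.nodup_middle]; exact hυ.nodup_iff.2 List.nodup_range
  have hm0 : ∀ k, k ∈ υ₁ ++ υ₂ → 0 < k ∧ k < m - h := by
    intro k hk
    have h0 : k ≠ 0 := by rintro rfl; exact (List.nodup_cons.1 nd).1 hk
    have : k < m - h := List.mem_range.1 (hυ.mem_iff.1 (by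
      rcases List.mem_append.1 hk with h | h <;> simp [h]))
    exact ⟨by omega, this⟩
  have inv : ∀ l : List ℕ, (∀ k ∈ l, k ∈ υ₁ ++ υ₂) → _ := fun l hl =>
    prod_mk_mul_rv (m := m) (b := b) (a := a) (α := α) (l := l)
      (fun k hk => by have := hm0 k (hl k hk); omega)
      (fun k hk => hα k (hm0 k (hl k hk)).1 (hm0 k (hl k hk)).2)
  obtain ⟨i1, -⟩ := inv υ₁ fun k hk => by simp [hk]
  obtain ⟨-, i2⟩ := inv υ₂ fun k hk => by simp [hk]
  have unit : ∀ l : List ℕ, (∀ k ∈ l, k ∈ υ₁ ++ υ₂) → BorderUnit (l.map (mk m false α)).prod := by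
    intro l hl
    refine BorderUnit.list_prod fun U hU => ?_
    obtain ⟨k, hk, rfl⟩ := List.mem_map.1 hU
    have := hm0 k (hl k hk)
    exact borderUnit_glet (by omega) (by omega) _
  have hp := perm_complement hm hσ hυ
  -- The letters of `υ` other than `0` are moved as inverses to the other term. This leaves a
  -- Fiedler pencil with all the indices `0, …, m - 1`, so the reduction is used with `m - 1` for
  -- its height.
  obtain ⟨U, V, hU, hV, hUV⟩ := topDiag_sub_prod (m := m) (b := b) (a := a) (P := P) ht
    (h := m - 1) (by omega) (fun k h1 h2 => hP k h1 (by omega))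
    (σ := υ₁.reverse.map (m - ·) ++ σ ++ υ₂.reverse.map (m - ·))
    (hp.trans (by rw [show m - 1 + 1 = m by omega]))
  refine ⟨(υ₁.map (mk m false α)).prod * rv U, rv V * (υ₂.map (mk m false α)).prod,
    (unit υ₁ fun k hk => by simp [hk]).mul hU.rv, hV.rv.mul (unit υ₂ fun k hk => by simp [hk]), ?_⟩
  have e : rv (topDiag m t (P (m - 1 + 1)) (m - 1) - (List.map (mk m b a)
      (List.map (m - ·) υ₁.reverse ++ σ ++ List.map (m - ·) υ₂.reverse)).prod) =
      rv U * rv (topDiag m t (P 1) 0 - mk m b a 0) * rv V := by rw [hUV, rv_mul, rv_mul]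
  have sub : ∀ A B : Matrix (Ix m) (Ix m) 𝓐, rv (A - B) = rv A - rv B := fun _ _ => rfl
  rw [sub, show m - 1 + 1 = m by omega, hPm, rv_topDiag (by omega), List.map_append,
    List.map_append, List.prod_append, List.prod_append, rv_mul, rv_mul] at e
  have e' := congrArg (fun M => (υ₁.map (mk m false α)).prod * M * (υ₂.map (mk m false α)).prod) e
  simp only [mul_sub, sub_mul] at e'
  rw [List.map_append, List.prod_append, List.map_cons, List.prod_cons]
  have r : (υ₁.map (mk m false α)).prod * (rv ((υ₁.reverse.map (m - ·)).map (mk m b a)).prod *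
      rv (σ.map (mk m b a)).prod * rv ((υ₂.reverse.map (m - ·)).map (mk m b a)).prod) *
      (υ₂.map (mk m false α)).prod = rv (σ.map (mk m b a)).prod := by
    rw [mul_assoc, mul_assoc (_ * _), i2, mul_one, ← mul_assoc, i1, one_mul]
  rw [r, mul_smul_of_cen ht, Matrix.smul_mul] at e'
  rw [← mul_assoc]
  refine e'.trans ?_
  simp only [mul_assoc]

end Pencil

/-! ### Factorization through proper generalized Fiedler pencils -/

section Factor

variable {m n r : ℕ} (S : Realization (Fin n) r)

/-- The levels of the simple admissible tuple of `{0 : h}`. -/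
def simpleLevels (h : ℕ) : List ℕ := (simpleTuple h).map Int.toNat

theorem simpleLevels_perm (h : ℕ) : (simpleLevels h).Perm (List.range (h + 1)) := by
  refine ((simpleTuple_perm h).map _).trans (List.Perm.of_eq ?_)
  rw [str_eq, List.map_map, show ((h : ℤ) + 1 - 0).toNat = h + 1 by omega]
  conv_rhs => rw [← List.map_id (List.range (h + 1))]
  exact List.map_congr_left fun k _ => by simp

theorem wprod_coeffWord_simpleTuple {𝓐 : Type} [Ring 𝓐] (b : Bool) (a : ℕ → 𝓐) (h : ℕ) :
    wprod m (coeffWord b a (simpleTuple h)) = ((simpleLevels h).map (mk m b a)).prod := by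
  rw [wprod, coeffWord, simpleLevels, List.map_map, List.map_map]; rfl

theorem regroup_lead_symm {G : Type} [Monoid G] {y v c y' x d x' : G} (x1 : x * v = v * x)
    (x2 : x * c = c * x) (x3 : x * y' = y' * x) :
    y * v * c * y' * (x * d * x') = y * x * v * (c * y' * (d * x')) := by
  have e : v * c * y' * x = x * (v * c * y') := by
    rw [mul_assoc, ← x3, ← mul_assoc, mul_assoc v, ← x2, ← mul_assoc, ← x1]
    simp only [mul_assoc]
  calc y * v * c * y' * (x * d * x') = y * (v * c * y' * x) * (d * x') := by simp only [mul_assoc]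
    _ = _ := by rw [e]; simp only [mul_assoc]

theorem regroup_const_symm {G : Type} [Monoid G] {y c y' x w d x' : G}
    (x2 : x * c = c * x) (x3 : x * y' = y' * x) (w2 : w * c = c * w) (w3 : w * y' = y' * w) :
    y * c * y' * (x * w * d * x') = y * x * w * (c * y' * (d * x')) := by
  have e : c * y' * (x * w) = x * w * (c * y') := by
    rw [← mul_assoc, mul_assoc c, ← x3, ← mul_assoc, ← x2, mul_assoc, mul_assoc, ← w3,
      ← mul_assoc c, ← w2]
    simp only [mul_assoc]
  calc y * c * y' * (x * w * d * x') = y * (c * y' * (x * w)) * (d * x') := by simp only [mul_assoc]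
    _ = _ := by rw [e]; simp only [mul_assoc]

/-- The reduction of the block symmetric pencils to proper generalized Fiedler pencils. -/
theorem symmData_eq_mul {h : ℕ} (hh : h < m) (he : Even h)
    {x y : List (ℤ × Matrix (Fin n) (Fin n) ℂ)} (hxy : IsCanonicalPair m h x y)
    (hx : IsNonsingular m x) (hy : IsNonsingular m y) (hm : Odd m ∨ IsUnit (S.coeff m).det) :
    ∃ A B : Matrix (Ix m) (Ix m) (Matrix (Fin n) (Fin n) ℂ), BorderUnit A ∧ BorderUnit B ∧
      (symmData S hh hxy).lead S =
        A * ((simpleLevels (m - h - 1)).map (mk m false (tauCoeff S m))).prod * B ∧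
      (symmData S hh hxy).const S =
        A * rv ((simpleLevels h).map (mk m true (sigmaCoeff S))).prod * B := by
  obtain ⟨e1, e2, e3, e4⟩ := symmData_words S hh hxy
  obtain ⟨mx, my⟩ := hxy.mem hh
  rw [Data.lead, Data.const, e1, e2, e3, e4]
  simp only [symmWord, symmWord', wprod_append, rv_mul]
  rw [← wprod_coeffWord_simpleTuple, ← wprod_coeffWord_simpleTuple]
  have lx : ∀ p ∈ sigmaWord x, p.1 = false ∧ p.2.1 < h := sigmaWord_lt fun i hi => by
    have := mx i hi; omega
  have ly : ∀ p ∈ tauWord m y, p.1 = false ∧ p.2.1 < m - h - 1 := tauWord_lt fun i hi => by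
    have := my i hi; omega
  have ly' : ∀ p ∈ (tauWord m y).reverse, p.1 = false ∧ p.2.1 < m - h - 1 := fun p hp =>
    ly p (List.mem_reverse.1 hp)
  have lw : ∀ p ∈ coeffWord true (sigmaCoeff S) (simpleTuple h), p.2.1 < h + 1 := by
    intro p hp
    obtain ⟨i, hi, rfl⟩ := List.mem_map.1 hp
    have := mem_simpleTuple hi
    simp only; omega
  have lv : ∀ p ∈ coeffWord false (tauCoeff S m) (simpleTuple (m - h - 1)),
      p.1 = false ∧ p.2.1 < m - h := by
    intro p hp
    obtain ⟨i, hi, rfl⟩ := List.mem_map.1 hp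
    have := mem_simpleTuple hi
    exact ⟨rfl, by simp only; omega⟩
  have lc : ∀ p ∈ coeffWord false (tauCoeff S m) (simpleComplement (m - h - 1)),
      p.1 = false ∧ p.2.1 < m - h - 1 := by
    intro p hp
    obtain ⟨i, hi, rfl⟩ := List.mem_map.1 hp
    have := mem_simpleComplement hi
    exact ⟨rfl, by simp only; omega⟩
  have uX : BorderUnit (rv (wprod m (sigmaWord x))) := by
    refine (borderUnit_wprod fun p hp => ⟨(lx p hp).1, by have := lx p hp; omega, fun h0 => ?_⟩).rv
    obtain ⟨q, hq, rfl⟩ := List.mem_map.1 hp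
    have := (mx q.1 (List.mem_map_of_mem hq)).1
    simp only at h0
    exact (Matrix.isUnit_iff_isUnit_det _).2 (hx q hq (Or.inl (by omega)))
  have uX' : BorderUnit (rv (wprod m (sigmaWord x).reverse)) := by
    refine (borderUnit_wprod fun p hp => ?_).rv
    rw [List.mem_reverse] at hp
    refine ⟨(lx p hp).1, by have := lx p hp; omega, fun h0 => ?_⟩
    obtain ⟨q, hq, rfl⟩ := List.mem_map.1 hp
    have := (mx q.1 (List.mem_map_of_mem hq)).1
    simp only at h0
    exact (Matrix.isUnit_iff_isUnit_det _).2 (hx q hq (Or.inl (by omega)))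
  have uY' : BorderUnit (wprod m (tauWord m y).reverse) := by
    refine borderUnit_wprod fun p hp => ?_
    rw [List.mem_reverse] at hp
    refine ⟨(ly p hp).1, by have := ly p hp; omega, fun h0 => ?_⟩
    obtain ⟨q, hq, rfl⟩ := List.mem_map.1 hp
    have := (my q.1 (List.mem_map_of_mem hq)).1
    simp only at h0
    exact (Matrix.isUnit_iff_isUnit_det _).2 (hy q hq (Or.inr (by omega)))
  have uY : BorderUnit (wprod m (tauWord m y)) := by
    refine borderUnit_wprod fun p hp => ⟨(ly p hp).1, by have := ly p hp; omega, fun h0 => ?_⟩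
    obtain ⟨q, hq, rfl⟩ := List.mem_map.1 hp
    have := (my q.1 (List.mem_map_of_mem hq)).1
    simp only at h0
    exact (Matrix.isUnit_iff_isUnit_det _).2 (hy q hq (Or.inr (by omega)))
  -- As `h` is even, the complement avoids the index `0`, and every other letter is invertible
  -- whatever its matrix is.
  have uw : BorderUnit (rv (wprod m (coeffWord false (sigmaCoeff S) (simpleComplement h)))) := by
    refine (borderUnit_wprod fun p hp => ?_).rv
    obtain ⟨i, hi, rfl⟩ := List.mem_map.1 hp
    have := mem_simpleComplement hi
    have h0 := this.2.2 he
    exact ⟨rfl, by simp only; omega, fun h => by simp only at h; omega⟩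
  have uv : BorderUnit (wprod m (coeffWord false (tauCoeff S m) (simpleComplement (m - h - 1)))) := by
    refine borderUnit_wprod fun p hp => ?_
    obtain ⟨i, hi, rfl⟩ := List.mem_map.1 hp
    have hc := mem_simpleComplement hi
    refine ⟨rfl, by simp only; omega, fun h => ?_⟩
    simp only at h
    rw [h, tauCoeff, trivialCoeff, if_neg (by push_cast; omega),
      show (((0 : ℕ) : ℤ) - m).natAbs = m by omega, Matrix.isUnit_iff_isUnit_det]
    -- The index $-m$, which brings in $A_m$, occurs in $\mathbf c_{v_h}$ only if $m-h-1$ is odd.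
    -- With even $h$ this cannot happen for odd $m$.
    refine hm.resolve_left fun hodd => ?_
    refine hc.2.2 ?_ (by omega)
    obtain ⟨s, rfl⟩ := he
    obtain ⟨s', rfl⟩ := hodd
    exact ⟨s' - s, by omega⟩
  have cx : ∀ t : List (Bool × ℕ × Matrix (Fin n) (Fin n) ℂ),
      (∀ p ∈ t, p.1 = false ∧ p.2.1 < m - h) →
      Commute (rv (wprod m (sigmaWord x))) (wprod m t) := fun t ht =>
    rv_wprod_commute (k := h) (l := m - h) (fun p hp => (lx p hp).2) ht (by omega)
  have cw : ∀ t : List (Bool × ℕ × Matrix (Fin n) (Fin n) ℂ),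
      (∀ p ∈ t, p.1 = false ∧ p.2.1 < m - h - 1) →
      Commute (rv (wprod m (coeffWord true (sigmaCoeff S) (simpleTuple h)))) (wprod m t) :=
    fun t ht => rv_wprod_commute (k := h + 1) (l := m - h - 1) lw ht (by omega)
  have up : ∀ t : List (Bool × ℕ × Matrix (Fin n) (Fin n) ℂ),
      (∀ p ∈ t, p.1 = false ∧ p.2.1 < m - h - 1) → ∀ p ∈ t, p.1 = false ∧ p.2.1 < m - h :=
    fun t ht p hp => ⟨(ht p hp).1, by have := (ht p hp).2; omega⟩
  have x1 := (cx _ lv).eq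
  have x2 := (cx _ (up _ lc)).eq
  have x3 := (cx _ (up _ ly')).eq
  have w2 := (cw _ lc).eq
  have w3 := (cw _ ly').eq
  exact ⟨_, _, uY.mul uX, (uv.mul uY').mul (uw.mul uX'), regroup_lead_symm x1 x2 x3,
    regroup_const_symm x2 x3 w2 w3⟩

end Factor

/-! ### Block matrices without the border -/

section Flat

variable {m n r : ℕ} {K : Type} [CommRing K]

/-- A block matrix without its border as a matrix. -/
def flat (M : Matrix (Ix m) (Ix m) (Matrix (Fin n) (Fin n) K)) :
    Matrix (Fin m × Fin n) (Fin m × Fin n) K :=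
  Matrix.of fun p q => M (Sum.inl p.1) (Sum.inl q.1) p.2 q.2

theorem conv_eq_flat (M : Matrix (Ix m) (Ix m) (Matrix (Fin n) (Fin n) K)) :
    conv 0 0 1 M = Matrix.fromBlocks (flat M) 0 0 (1 : Matrix (Fin r) (Fin r) K) := by
  rw [conv]
  congr 1
  · ext p k; simp
  · ext p k; simp

theorem flat_mul (M : Matrix (Ix m) (Ix m) (Matrix (Fin n) (Fin n) K))
    {L : Matrix (Ix m) (Ix m) (Matrix (Fin n) (Fin n) K)} (hL : Triv L (Sum.inr ())) :
    flat (M * L) = flat M * flat L := by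
  ext p q
  simp [flat, Matrix.mul_apply, Matrix.sum_apply, Fintype.sum_prod_type, (hL (Sum.inl q.1)).1]

theorem flat_mul_left (M : Matrix (Ix m) (Ix m) (Matrix (Fin n) (Fin n) K))
    {L : Matrix (Ix m) (Ix m) (Matrix (Fin n) (Fin n) K)} (hL : Triv L (Sum.inr ())) :
    flat (L * M) = flat L * flat M := by
  ext p q
  simp [flat, Matrix.mul_apply, Matrix.sum_apply, Fintype.sum_prod_type, (hL (Sum.inl p.1)).2]

theorem flat_one : flat (1 : Matrix (Ix m) (Ix m) (Matrix (Fin n) (Fin n) K)) = 1 := by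
  ext p q
  simp only [flat, Matrix.of_apply, Matrix.one_apply, Sum.inl.injEq, Prod.ext_iff]
  by_cases h : p.1 = q.1 <;> simp [h, Matrix.one_apply]

theorem BorderUnit.exists_flat_inv {U : Matrix (Ix m) (Ix m) (Matrix (Fin n) (Fin n) K)}
    (hU : BorderUnit U) : ∃ V, BorderUnit V ∧ V * U = 1 ∧ U * V = 1 ∧ flat V * flat U = 1 ∧
      flat U * flat V = 1 := by
  obtain ⟨V, hV, h1, h2⟩ := hU.exists_inv
  exact ⟨V, hV, h2, h1, by rw [← flat_mul _ hU.1, h2, flat_one],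
    by rw [← flat_mul _ hV.1, h1, flat_one]⟩

theorem BorderUnit.isUnit_det_flat {U : Matrix (Ix m) (Ix m) (Matrix (Fin n) (Fin n) K)}
    (hU : BorderUnit U) : IsUnit (flat U).det := by
  obtain ⟨V, -, -, -, h, -⟩ := hU.exists_flat_inv
  exact (Matrix.isUnit_iff_isUnit_det _).1 (IsUnit.of_mul_eq_one_right _ h)

theorem glet_map {𝓐 𝓑 : Type} [Ring 𝓐] [Ring 𝓑] (f : 𝓐 →+* 𝓑) (b : Bool) (k : ℕ) (X : 𝓐) :
    (glet m b k X).map f = glet m b k (f X) := by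
  have s : ∀ (i j : Ix m), (swapM i j X).map f = swapM i j (f X) := by
    intro i j
    ext u v
    simp only [swapM, Matrix.map_apply, Matrix.of_apply, Matrix.one_apply]
    split_ifs <;> simp
  have d : ∀ i : Ix m, (diagM i X).map f = diagM i (f X) := by
    intro i
    ext u v
    simp only [diagM, Matrix.map_apply, Matrix.diagonal_apply]
    split_ifs <;> simp
  unfold glet
  split_ifs
  exacts [s _ _, d _, s _ _]

theorem prod_mk_map {𝓐 𝓑 : Type} [Ring 𝓐] [Ring 𝓑] (f : 𝓐 →+* 𝓑) (b : Bool) (a : ℕ → 𝓐)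
    (l : List ℕ) : ((l.map (mk m b a)).prod).map f = (l.map (mk m b fun k => f (a k))).prod := by
  induction l with
  | nil => exact Matrix.map_one f f.map_zero f.map_one
  | cons k l ih =>
    rw [List.map_cons, List.prod_cons, Matrix.map_mul, ih, mk, glet_map]; rfl

end Flat

/-! ### The reduction over the polynomials -/

section Finite

variable {m n r : ℕ}

/-- Constant matrices as matrix polynomials. -/
abbrev polyC (n : ℕ) : Matrix (Fin n) (Fin n) ℂ →+* Matrix (Fin n) (Fin n) ℂ[X] :=
  (Polynomial.C : ℂ →+* ℂ[X]).mapMatrix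

theorem cen_scalar {K : Type} [CommRing K] (x : K) : Cen (Matrix.scalar (Fin n) x) := fun y =>
  Matrix.scalar_commute x (fun y => Commute.all x y) y

theorem scalar_mul_apply {K : Type} [CommRing K] (x : K) (M : Matrix (Fin n) (Fin n) K) :
    Matrix.scalar (Fin n) x * M = x • M := by
  ext i j; simp

/-- The Horner shifts of a matrix polynomial. -/
def hornerShift (P : Matrix (Fin n) (Fin n) ℂ[X]) (k : ℕ) : Matrix (Fin n) (Fin n) ℂ[X] :=
  P.map fun p => Polynomial.divX^[k] p

theorem coeff_divX_iterate (p : ℂ[X]) (k j : ℕ) :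
    (Polynomial.divX^[k] p).coeff j = p.coeff (j + k) := by
  induction k generalizing j with
  | zero => rfl
  | succ k ih => rw [Function.iterate_succ_apply', Polynomial.coeff_divX, ih]; congr 1; omega

variable (S : Realization (Fin n) r)

theorem sigmaCoeff_eq (k : ℕ) : sigmaCoeff S k = -S.coeff k := by
  rw [sigmaCoeff, trivialCoeff, if_pos (by omega), Int.natAbs_natCast]

theorem tauCoeff_eq {k : ℕ} (hk : k < m) : tauCoeff S m k = S.coeff (m - k) := by
  rw [tauCoeff, trivialCoeff, if_neg (by omega), show ((k : ℤ) - m).natAbs = m - k by omega]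

theorem hornerShift_eq (k : ℕ) : hornerShift S.P k = -polyC n (sigmaCoeff S k) +
    Matrix.scalar (Fin n) Polynomial.X * hornerShift S.P (k + 1) := by
  rw [sigmaCoeff_eq, scalar_mul_apply]
  ext1 i j
  simp only [hornerShift, Matrix.map_apply, Realization.coeff, Matrix.add_apply, Matrix.neg_apply,
    map_neg, neg_neg, Matrix.smul_apply, RingHom.mapMatrix_apply, Function.iterate_succ_apply',
    smul_eq_mul]
  conv_lhs => rw [← Polynomial.divX_mul_X_add (Polynomial.divX^[k] (S.P i j))]
  rw [coeff_divX_iterate, zero_add]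
  ring

theorem hornerShift_top (hdeg : ∀ i j, (S.P i j).natDegree ≤ m) :
    hornerShift S.P m = polyC n (S.coeff m) := by
  ext i j k
  simp only [hornerShift, Matrix.map_apply, Realization.coeff, RingHom.mapMatrix_apply,
    coeff_divX_iterate, Polynomial.coeff_C]
  split_ifs with h
  · rw [h, zero_add]
  · exact Polynomial.coeff_eq_zero_of_natDegree_lt (by have := hdeg i j; omega)

variable {h : ℕ} (hh : h < m) {x y : List (ℤ × Matrix (Fin n) (Fin n) ℂ)}
    (hxy : IsCanonicalPair m h x y)

/-- A block symmetric pencil as a pencil of block matrices. -/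
theorem symmPencilS_eq_conv : symmPencilS S m h x y =
    conv (-S.C.map Polynomial.C) (-S.B.map Polynomial.C) (-pencil S.E S.A)
      (Matrix.scalar (Fin n) (Polynomial.X : ℂ[X]) • ((symmData S hh hxy).lead S).map (polyC n) -
        ((symmData S hh hxy).const S).map (polyC n)) := by
  rw [symmPencilS_eq_gfpr S hh hxy]
  have ht := (symmData S hh hxy).lead_triv S
  ext1 (⟨a, i⟩ | k) (⟨b, j⟩ | l)
  · rw [Data.gfpr_inl_inl]
    simp [conv]
  · rw [Data.gfpr_inl_inr]
    simp [conv, (ht _).2, Matrix.map_mul, Matrix.mul_apply]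
  · rw [Data.gfpr_inr_inl]
    simp [conv, (ht _).1, Matrix.map_mul, Matrix.mul_apply]
  · rw [Data.gfpr_inr_inr]; rfl

theorem exists_reduction (he : Even h) (hx : IsNonsingular m x) (hy : IsNonsingular m y)
    (hm : Odd m ∨ IsUnit (S.coeff m).det) (hdeg : ∀ i j, (S.P i j).natDegree ≤ m) :
    ∃ U V : Matrix (Ix m) (Ix m) (Matrix (Fin n) (Fin n) ℂ[X]), BorderUnit U ∧ BorderUnit V ∧
      Matrix.scalar (Fin n) (Polynomial.X : ℂ[X]) • ((symmData S hh hxy).lead S).map (polyC n) -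
        ((symmData S hh hxy).const S).map (polyC n) =
      U * rv (topDiag m (Matrix.scalar (Fin n) Polynomial.X) (hornerShift S.P 1) 0 -
        mk m true (fun k => polyC n (sigmaCoeff S k)) 0) * V := by
  obtain ⟨A, B, hA, hB, e1, e2⟩ := symmData_eq_mul S hh he hxy hx hy hm
  have hυ := simpleLevels_perm (m - h - 1)
  rw [show m - h - 1 + 1 = m - h by omega] at hυ
  obtain ⟨U, V, hU, hV, e⟩ := smul_prod_sub_rv_prod (m := m) (b := true)
    (a := fun k => polyC n (sigmaCoeff S k)) (α := fun k => polyC n (tauCoeff S m k))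
    (cen_scalar (n := n) (Polynomial.X : ℂ[X])) (P := hornerShift S.P) hh
    (fun k _ _ => hornerShift_eq S k)
    (by rw [hornerShift_top S hdeg, tauCoeff_eq S (by omega), Nat.sub_zero])
    (fun k h0 hk => by rw [tauCoeff_eq S (by omega), sigmaCoeff_eq, map_neg, neg_neg])
    (simpleLevels_perm h) hυ
  refine ⟨A.map (polyC n) * U, V * B.map (polyC n), (hA.map _).mul hU, hV.mul (hB.map _), ?_⟩
  have r1 : ∀ M : Matrix (Ix m) (Ix m) (Matrix (Fin n) (Fin n) ℂ),
    (rv M).map (polyC n) = rv (M.map (polyC n)) := fun _ => rfl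
  rw [e1, e2, Matrix.map_mul, Matrix.map_mul, Matrix.map_mul, Matrix.map_mul, r1, prod_mk_map,
    prod_mk_map, ← Matrix.smul_mul, ← mul_smul_of_cen (cen_scalar _), ← sub_mul, ← mul_sub, e]
  simp only [mul_assoc]

/-- The signs in a reduced pencil. -/
def signM (m n : ℕ) (K : Type) [CommRing K] : Matrix (Ix m) (Ix m) (Matrix (Fin n) (Fin n) K) :=
  Matrix.diagonal fun i => if i = lv m (m - 1) ∨ i = Sum.inr () then 1 else -1

theorem borderUnit_signM {K : Type} [CommRing K] : BorderUnit (signM m n K) := by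
  have e : signM m n K * signM m n K = 1 := by
    rw [signM, Matrix.diagonal_mul_diagonal, ← Matrix.diagonal_one]
    congr 1
    funext i
    split_ifs <;> simp
  have t : Triv (signM m n K) (Sum.inr ()) := by
    intro j
    simp only [signM, ← Matrix.diagonal_one, Matrix.diagonal_apply]
    constructor
    · simp
    · split_ifs with h1 h2 <;> simp_all
  exact ⟨t, _, t, e, e⟩

/-- After the reduction, level $0$ carries $\lambda P_1-a_0$, which is $P$ by Horner's rule since
$a_0=-A_0$. Its two couplings to the border are $-1$ and turn $-C,-B$ into $C,B$. All other levels
carry $-1$, which `signM` corrects; the corner of the block matrix plays no role. -/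
theorem conv_reduced (hm : 0 < m) : conv (-S.C.map Polynomial.C) (-S.B.map Polynomial.C)
      (-pencil S.E S.A) (rv (topDiag m (Matrix.scalar (Fin n) Polynomial.X) (hornerShift S.P 1) 0 -
        mk m true (fun k => polyC n (sigmaCoeff S k)) 0) * signM m n ℂ[X]) =
      Matrix.fromBlocks (diagLast m S.P)
          ((colBlock (stdCol m m) S.C).map Polynomial.C)
          ((rowBlock (stdCol m m) S.B).map Polynomial.C) (-pencil S.E S.A) := by
  have lvr : ∀ a : Fin m, revIx m (Sum.inl a) = lv m (m - 1 - a) := fun a => by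
    rw [← revIx_lv a.2]; simp [lv]
  have P0 := hornerShift_eq S 0
  have P0' : hornerShift S.P 0 = S.P := rfl
  rw [P0'] at P0
  have td : ∀ (a : Fin m) (Y : Matrix (Fin n) (Fin n) ℂ[X]) (t : Matrix (Fin n) (Fin n) ℂ[X]),
      (Sum.elim (fun l : Fin m => if (l : ℕ) < 0 then t else
        if (l : ℕ) = 0 then t * Y else 0) fun _ => t : Ix m → _) (lv m (m - 1 - a)) =
        if (a : ℕ) + 1 = m then t * Y else 0 := by
    intro a Y t
    have := a.2
    simp only [lv, show m - 1 - (a : ℕ) < m by omega, dite_true, Sum.elim_inl, Nat.not_lt_zero,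
      if_false]
    by_cases h : (a : ℕ) + 1 = m
    · rw [if_pos h, if_pos (by omega)]
    · rw [if_neg h, if_neg (by omega)]
  have ninr : ∀ a : Fin m, (Sum.inl a : Ix m) ≠ Sum.inr () := by simp
  have ninr' : ∀ a : Fin m, lv m (m - 1 - a) ≠ Sum.inr () := fun a => lv_ne_inr (by have := a.2; omega)
  have l0 : ∀ a : Fin m, lv m (m - 1 - a) = lv m 0 ↔ (a : ℕ) + 1 = m := fun a => by
    have := a.2
    rw [lv_inj (by omega) (by omega)]; omega
  have l1 : ∀ a : Fin m, (Sum.inl a : Ix m) = lv m (m - 1) ↔ (a : ℕ) + 1 = m := fun a => by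
    have := a.2
    rw [show (Sum.inl a : Ix m) = lv m a by simp [lv], lv_inj (by omega) (by omega)]; omega
  have l2 : ∀ a b : Fin m, lv m (m - 1 - a) = lv m (m - 1 - b) ↔ a = b := fun a b => by
    have := a.2; have := b.2
    rw [lv_inj (by omega) (by omega), Fin.ext_iff]; omega
  have s : ∀ a : Fin m, (((a : ℕ) : ℤ) + 1 = m) ↔ (a : ℕ) + 1 = m := fun a => by omega
  have n0 : (Sum.inr () : Ix m) ≠ lv m 0 := (lv_ne_inr hm).symm
  rw [conv]
  congr 1
  · ext1 ⟨a, i⟩ ⟨b, j⟩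
    simp only [Matrix.of_apply, diagLast, signM, Matrix.mul_diagonal, rv, Matrix.submatrix_apply,
      Matrix.sub_apply, mk, glet, if_true, lvr, topDiag, Matrix.diagonal_apply, swapM, td, ninr, l2,
      l0, l1, ninr', false_or, or_false, false_and, and_false, if_false, Matrix.one_apply]
    by_cases hab : a = b
    · subst hab
      by_cases hl : (a : ℕ) + 1 = m
      · simp only [hl, if_true, true_and]
        conv_rhs => rw [P0]
        simp [sub_eq_add_neg, add_comm]
      · simp [hl, Matrix.one_apply]
    · have : ¬ ((a : ℕ) + 1 = m ∧ (b : ℕ) + 1 = m) := fun h => hab (Fin.ext (by omega))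
      simp only [if_neg hab, this, if_false]
      by_cases ha : (a : ℕ) + 1 = m
      · have hb : ¬ (b : ℕ) + 1 = m := fun h => this ⟨ha, h⟩
        simp [ha, hb]
      · simp [ha]
  · ext1 ⟨a, i⟩ k
    simp only [Matrix.of_apply, signM, Matrix.mul_diagonal, rv, Matrix.submatrix_apply,
      Matrix.sub_apply, mk, glet, if_true, lvr, topDiag, Matrix.diagonal_apply, swapM, revIx_inr,
      n0, l0, ninr', and_false, false_and, if_false, Matrix.map_apply, colBlock, stdCol, s,
      or_true, and_true, true_and, false_or, or_false, Matrix.one_apply]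
    split_ifs <;> simp
  · ext1 k ⟨a, i⟩
    simp only [Matrix.of_apply, signM, Matrix.mul_diagonal, rv, Matrix.submatrix_apply,
      Matrix.sub_apply, mk, glet, if_true, lvr, topDiag, Matrix.diagonal_apply, swapM, revIx_inr,
      n0, n0.symm, l0, l1, ninr, (ninr' _).symm, ninr', and_false, false_and, if_false, Matrix.map_apply, rowBlock, stdCol, s,
      or_true, and_true, true_and, false_or, or_false, Matrix.one_apply]
    split_ifs <;> simp

end Finite

/-! ### Transfer functions and minimality -/

section Transfer

variable {ι κ : Type} [Fintype ι] [DecidableEq ι] [Fintype κ] [DecidableEq κ] {r : ℕ}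

/-- Matrix polynomials as matrices of rational functions. -/
abbrev toRat {μ ν : Type} (M : Matrix μ ν ℂ[X]) : Matrix μ ν (RatFunc ℂ) :=
  M.map (algebraMap ℂ[X] (RatFunc ℂ))

theorem toRat_mul {μ ν ο : Type} [Fintype ν] (M : Matrix μ ν ℂ[X]) (N : Matrix ν ο ℂ[X]) :
    toRat (M * N) = toRat M * toRat N := Matrix.map_mul

theorem toRat_map_C {μ ν : Type} (M : Matrix μ ν ℂ) :
    toRat (M.map Polynomial.C) = M.map RatFunc.C := by
  ext i j; simp

theorem toRat_pencil (E A : Matrix κ κ ℂ) :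
    toRat (pencil E A) = (RatFunc.X : RatFunc ℂ) • E.map RatFunc.C - A.map RatFunc.C := by
  ext i j
  simp only [toRat, Matrix.map_apply, pencil, Matrix.sub_apply, Matrix.smul_apply, smul_eq_mul,
    map_sub, map_mul, RatFunc.algebraMap_X, RatFunc.algebraMap_C]

/-- Up to the unit $\det E$ this is the characteristic polynomial of $E^{-1}A$. -/
theorem det_pencil_ne_zero {E : Matrix κ κ ℂ} (hE : IsUnit E.det) (A : Matrix κ κ ℂ) :
    (pencil E A).det ≠ 0 := by
  have e : pencil E A = E.map Polynomial.C * Matrix.charmatrix (E⁻¹ * A) := by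
    rw [Matrix.charmatrix, RingHom.mapMatrix_apply, Matrix.map_mul, mul_sub, ← mul_assoc,
      ← Matrix.map_mul (f := Polynomial.C), Matrix.mul_nonsing_inv _ hE,
      Matrix.map_one _ (map_zero _) (map_one _), one_mul,
      ← (Matrix.scalar_commute (Polynomial.X : ℂ[X]) (fun y => Commute.all _ y) _).eq, pencil]
    congr 1
    ext i j; simp
  rw [e, Matrix.det_mul]
  refine mul_ne_zero ?_ (Matrix.charpoly_monic _).ne_zero
  rw [← RingHom.mapMatrix_apply, ← RingHom.map_det]
  simpa using hE.ne_zero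

theorem isUnit_det_toRat_pencil {E : Matrix κ κ ℂ} (hE : IsUnit E.det) (A : Matrix κ κ ℂ) :
    IsUnit (toRat (pencil E A)).det := by
  rw [show toRat (pencil E A) = (algebraMap ℂ[X] (RatFunc ℂ)).mapMatrix (pencil E A) from rfl,
    ← RingHom.map_det, isUnit_iff_ne_zero]
  simpa using det_pencil_ne_zero hE A

theorem Realization.transfer_eq (S : Realization ι r) : S.transfer = toRat S.P +
    toRat (S.C.map Polynomial.C) * (toRat (pencil S.E S.A))⁻¹ * toRat (S.B.map Polynomial.C) := by
  rw [toRat_pencil, toRat_map_C, toRat_map_C]; rfl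

theorem matrix_poly_induction {μ : Type} [Fintype μ] {p : Matrix μ κ ℂ[X] → Prop}
    (h : ∀ (N : Matrix μ κ ℂ[X]) (C : Matrix μ κ ℂ), p N →
      p ((Polynomial.X : ℂ[X]) • N + C.map Polynomial.C))
    (h0 : ∀ C : Matrix μ κ ℂ, p (C.map Polynomial.C)) (N : Matrix μ κ ℂ[X]) : p N := by
  have key : ∀ (d : ℕ) (N : Matrix μ κ ℂ[X]), (∀ i j, (N i j).natDegree ≤ d) → p N := by
    intro d
    induction d with
    | zero =>
      intro N hN
      have : N = (N.map fun q => q.coeff 0).map Polynomial.C := by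
        ext1 i j
        exact Polynomial.eq_C_of_natDegree_eq_zero (Nat.le_zero.1 (hN i j))
      rw [this]; exact h0 _
    | succ d ih =>
      intro N hN
      have : N = (Polynomial.X : ℂ[X]) • (N.map Polynomial.divX) +
          (N.map fun q => q.coeff 0).map Polynomial.C := by
        ext1 i j
        simp [Polynomial.X_mul_divX_add]
      rw [this]
      refine h _ _ (ih _ fun i j => ?_)
      rw [Matrix.map_apply, Polynomial.natDegree_divX_eq_natDegree_tsub_one]
      have := hN i j
      omega
  refine key (Finset.univ.sup fun q : μ × κ => (N q.1 q.2).natDegree) N fun i j => ?_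
  exact Finset.le_sup (f := fun q : μ × κ => (N q.1 q.2).natDegree) (Finset.mem_univ (i, j))

/-- Division with remainder: $\lambda C=CE^{-1}(\lambda E-A)+CE^{-1}A$ lowers the degree by one,
which is possible because $E$ is invertible. -/
theorem exists_div_pencil {E : Matrix κ κ ℂ} (hE : IsUnit E.det) (A : Matrix κ κ ℂ)
    (N : Matrix ι κ ℂ[X]) :
    ∃ (Q : Matrix ι κ ℂ[X]) (C : Matrix ι κ ℂ), N = Q * pencil E A + C.map Polynomial.C := by
  induction N using matrix_poly_induction with
  | h0 C => exact ⟨0, C, by simp⟩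
  | h N C₁ ih =>
    obtain ⟨Q, C, rfl⟩ := ih
    refine ⟨(Polynomial.X : ℂ[X]) • Q + (C * E⁻¹).map Polynomial.C, C * E⁻¹ * A + C₁, ?_⟩
    have e1 : (C * E⁻¹).map Polynomial.C * E.map Polynomial.C = C.map Polynomial.C := by
      rw [← Matrix.map_mul, Matrix.mul_assoc, Matrix.nonsing_inv_mul _ hE, Matrix.mul_one]
    have e2 : (C * E⁻¹).map Polynomial.C * A.map Polynomial.C =
      (C * E⁻¹ * A).map Polynomial.C := Matrix.map_mul.symm
    have e3 : (C * E⁻¹ * A + C₁).map (Polynomial.C : ℂ → ℂ[X]) =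
      (C * E⁻¹ * A).map Polynomial.C + C₁.map Polynomial.C := by
      ext1 i j; simp only [Matrix.map_apply, Matrix.add_apply, map_add]
    rw [Matrix.add_mul, e3, Matrix.smul_mul, smul_add]
    conv_rhs => rw [pencil, Matrix.mul_sub ((C * E⁻¹).map _), Matrix.mul_smul, e1, e2]
    rw [← pencil]
    abel

theorem exists_div_pencil_left {E : Matrix κ κ ℂ} (hE : IsUnit E.det) (A : Matrix κ κ ℂ)
    (N : Matrix κ ι ℂ[X]) :
    ∃ (Q : Matrix κ ι ℂ[X]) (B : Matrix κ ι ℂ), N = pencil E A * Q + B.map Polynomial.C := by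
  obtain ⟨Q, C, h⟩ := exists_div_pencil (E := E.transpose) (by rwa [Matrix.det_transpose])
    A.transpose N.transpose
  refine ⟨Q.transpose, C.transpose, ?_⟩
  have := congrArg Matrix.transpose h
  rw [Matrix.transpose_transpose, Matrix.transpose_add, Matrix.transpose_mul] at this
  exact this

/-- Multiplication by matrix polynomials does not increase the state dimension. -/
theorem Realization.exists_transfer_eq_mul_mul (T : Realization κ r) (N : Matrix ι κ ℂ[X])
    (M : Matrix κ ι ℂ[X]) :
    ∃ S : Realization ι r, S.transfer = toRat N * T.transfer * toRat M := by
  obtain ⟨Q, C, hC⟩ := exists_div_pencil T.E_nonsing T.A (N * T.C.map Polynomial.C)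
  obtain ⟨R, B, hB⟩ := exists_div_pencil_left T.E_nonsing T.A (T.B.map Polynomial.C * M)
  have hu := isUnit_det_toRat_pencil T.E_nonsing T.A
  -- Put $\Lambda=\lambda E-A$ and write $C_T,B_T$ for the matrices of `T`. With $NC_T=Q\Lambda+C$
  -- and $B_TM=\Lambda R+B$, one has $NC_T\Lambda^{-1}B_TM=QB_TM+CR+C\Lambda^{-1}B$. The first two
  -- terms are polynomial and join $NPM$.
  refine ⟨⟨N * T.P * M + Q * (T.B.map Polynomial.C * M) + C.map Polynomial.C * R, T.A, T.E, B, C,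
    T.E_nonsing⟩, ?_⟩
  rw [Realization.transfer_eq, Realization.transfer_eq]
  simp only
  set Λ := toRat (pencil T.E T.A)
  have add : ∀ {μ ν : Type} (A B : Matrix μ ν ℂ[X]), toRat (A + B) = toRat A + toRat B := by
    intro μ ν A B; ext i j; simp
  have hC' : toRat N * toRat (T.C.map Polynomial.C) = toRat Q * Λ + toRat (C.map Polynomial.C) := by
    rw [← toRat_mul, hC, add, toRat_mul]
  have hB' : toRat (T.B.map Polynomial.C) * toRat M = Λ * toRat R + toRat (B.map Polynomial.C) := by
    rw [← toRat_mul, hB, add, toRat_mul]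
  rw [add, add, toRat_mul, toRat_mul, toRat_mul, toRat_mul, toRat_mul, Matrix.mul_add,
    Matrix.add_mul]
  have e : toRat N * (toRat (T.C.map Polynomial.C) * Λ⁻¹ * toRat (T.B.map Polynomial.C)) * toRat M =
      (toRat N * toRat (T.C.map Polynomial.C)) * Λ⁻¹ * (toRat (T.B.map Polynomial.C) * toRat M) := by
    simp only [Matrix.mul_assoc]
  have e2 : toRat (C.map Polynomial.C) * Λ⁻¹ * (toRat (T.B.map Polynomial.C) * toRat M) =
      toRat (C.map Polynomial.C) * toRat R +
      toRat (C.map Polynomial.C) * Λ⁻¹ * toRat (B.map Polynomial.C) := by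
    rw [hB', Matrix.mul_add, ← Matrix.mul_assoc, Matrix.mul_assoc _ Λ⁻¹ Λ,
      Matrix.nonsing_inv_mul _ hu, Matrix.mul_one]
  rw [e, hC', Matrix.add_mul, Matrix.mul_assoc _ Λ, Matrix.mul_nonsing_inv _ hu, Matrix.mul_one,
    Matrix.add_mul, e2]
  abel

/-- Minimality is inherited by a realization whose transfer function can be multiplied by matrix
polynomials to the given one. -/
theorem Realization.IsMinimal.of_mul_mul {S : Realization ι r} (hS : S.IsMinimal)
    {T : Realization κ r} {N : Matrix ι κ ℂ[X]} {M : Matrix κ ι ℂ[X]}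
    (h : toRat N * T.transfer * toRat M = S.transfer) : T.IsMinimal := by
  intro r' T' hT'
  obtain ⟨S', hS'⟩ := T'.exists_transfer_eq_mul_mul N M
  exact hS r' S' (by rw [hS', hT', h])

end Transfer

/-! ### Unimodular equivalence and minimality of the pencils -/

section Linearization

variable {m n r : ℕ} (S : Realization (Fin n) r)

/-- A block symmetric pencil as a system matrix. -/
def symmRealization (m h : ℕ) (x y : List (ℤ × Matrix (Fin n) (Fin n) ℂ)) :
    Realization (Fin m × Fin n) r where
  P := symmPencilP S m h x y
  A := S.A
  E := S.E
  B := rowBlock (stdCol m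
    (m - consec (simpleTuple h ++ simpleComplement h ++ (indices x).reverse) 0)) S.B
  C := colBlock (stdCol m (m - invers (indices x ++ simpleTuple h) 0)) S.C
  E_nonsing := S.E_nonsing

variable {h : ℕ} {x y : List (ℤ × Matrix (Fin n) (Fin n) ℂ)}

theorem natDegree_symmPencilP_le (i j : Fin m × Fin n) :
    (symmPencilP S m h x y i j).natDegree ≤ 1 := by
  have e : ∀ (P K H Q : Matrix (Fin m × Fin n) (Fin m × Fin n) ℂ),
      ((P.map Polynomial.C * pencil K H * Q.map Polynomial.C) i j).natDegree ≤ 1 := by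
    intro P K H Q
    rw [pencil_mul_mul, pencil]
    simp only [Matrix.sub_apply, Matrix.smul_apply, Matrix.map_apply, smul_eq_mul]
    refine (Polynomial.natDegree_sub_le _ _).trans (max_le ?_ (by simp))
    exact (Polynomial.natDegree_mul_C_le _ _).trans Polynomial.natDegree_X_le
  rw [symmPencilP, mul_assoc _ (Matrix.map _ _) (Matrix.map _ _), map_mul_map]
  exact e _ _ _ _

theorem cancel_mul_mul {G : Type} [Monoid G] {U U' V V' : G} (u : U' * U = 1) (v : V * V' = 1)
    (N s : G) : U' * (U * N * V) * (V' * s) = N * s := by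
  rw [mul_assoc U N, ← mul_assoc U', u, one_mul, mul_assoc N, ← mul_assoc V, v, one_mul]

theorem exists_unimodular (hh : h < m) (hxy : IsCanonicalPair m h x y) (he : Even h) (hx : IsNonsingular m x) (hy : IsNonsingular m y)
    (hm : Odd m ∨ IsUnit (S.coeff m).det) (hdeg : ∀ i j, (S.P i j).natDegree ≤ m) :
    ∃ U V : Matrix (Fin m × Fin n) (Fin m × Fin n) ℂ[X], IsUnit U.det ∧ IsUnit V.det ∧
      Matrix.fromBlocks U 0 0 1 * symmPencilS S m h x y * Matrix.fromBlocks V 0 0 1 =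
        Matrix.fromBlocks (diagLast m S.P)
          ((colBlock (stdCol m m) S.C).map Polynomial.C)
          ((rowBlock (stdCol m m) S.B).map Polynomial.C) (-pencil S.E S.A) := by
  obtain ⟨U, V, hU, hV, e⟩ := exists_reduction S hh hxy he hx hy hm hdeg
  obtain ⟨U', hU', u, -⟩ := hU.exists_flat_inv
  obtain ⟨V', hV', -, v, -⟩ := hV.exists_flat_inv
  have hs : BorderUnit (signM m n ℂ[X]) := borderUnit_signM
  have hVs := hV'.mul hs
  refine ⟨flat U', flat (V' * signM m n ℂ[X]), hU'.isUnit_det_flat, hVs.isUnit_det_flat, ?_⟩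
  rw [symmPencilS_eq_conv S hh hxy, e, ← conv_reduced S (by omega), ← conv_eq_flat, ← conv_eq_flat]
  generalize rv (topDiag m (Matrix.scalar (Fin n) Polynomial.X) (hornerShift S.P 1) 0 -
        mk m true (fun k => polyC n (sigmaCoeff S k)) 0) = N
  generalize signM m n ℂ[X] = s at hVs
  rw [conv_mul_left _ hU'.1, conv_mul _ hVs.1, cancel_mul_mul u v]

theorem toRat_diagLast (Q : Matrix (Fin n) (Fin n) ℂ[X]) (F : Matrix (Fin n) (Fin n) (RatFunc ℂ))
    (C : Matrix (Fin n) (Fin r) ℂ) (B : Matrix (Fin r) (Fin n) ℂ)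
    (Ω : Matrix (Fin r) (Fin r) (RatFunc ℂ)) (hF : F = toRat Q +
      toRat (C.map Polynomial.C) * Ω * toRat (B.map Polynomial.C)) :
    toRat (diagLast m Q) + toRat ((colBlock (stdCol m m) C).map Polynomial.C) * Ω *
      toRat ((rowBlock (stdCol m m) B).map Polynomial.C) = diagLast m F := by
  subst hF
  have s : ∀ a : Fin m, (((a : ℕ) : ℤ) + 1 = m) ↔ (a : ℕ) + 1 = m := fun a => by omega
  ext ⟨a, i⟩ ⟨b, j⟩
  simp only [Matrix.add_apply, toRat, Matrix.map_apply, diagLast, Matrix.of_apply, Matrix.mul_apply,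
    colBlock, rowBlock, stdCol, s]
  by_cases ha : (a : ℕ) + 1 = m
  · by_cases hb : (b : ℕ) + 1 = m
    · have hab : a = b := Fin.ext (by omega)
      simp [hab, hb, Matrix.mul_apply]
    · have hab : a ≠ b := fun h => hb (h ▸ ha)
      simp [hab, hb]
  · by_cases hab : a = b
    · subst hab
      simp only [ha, if_true, if_false, Matrix.one_apply]
      split_ifs <;> simp
    · simp [hab, ha]

/-- The equivalence gives $U\,\mathbb G\,V=\mathrm{diag}(I,G)$ for the transfer functions. Its last
block writes $G$ as $N\mathbb GM$ with polynomial $N$ and $M$, so a smaller realization of $\mathbb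
G$ would yield one of $G$. -/
theorem isMinimal_symmRealization (hmin : S.IsMinimal) (hh : h < m)
    (hxy : IsCanonicalPair m h x y) (he : Even h) (hx : IsNonsingular m x)
    (hy : IsNonsingular m y)
    (hm : Odd m ∨ IsUnit (S.coeff m).det) (hdeg : ∀ i j, (S.P i j).natDegree ≤ m) :
    (symmRealization S m h x y).IsMinimal := by
  obtain ⟨U, V, -, -, e⟩ := exists_unimodular S hh hxy he hx hy hm hdeg
  rw [symmPencilS_eq S hh hxy, Matrix.fromBlocks_multiply, Matrix.fromBlocks_multiply,
    Matrix.fromBlocks_inj] at e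
  simp only [Matrix.zero_mul, Matrix.mul_zero, add_zero, zero_add, Matrix.one_mul,
    Matrix.mul_one] at e
  obtain ⟨e1, e2, e3, -⟩ := e
  have key : toRat U * (symmRealization S m h x y).transfer * toRat V = diagLast m S.transfer := by
    rw [← toRat_diagLast _ _ S.C S.B (toRat (pencil S.E S.A))⁻¹ (Realization.transfer_eq S), ← e1,
      ← e2, ← e3, Realization.transfer_eq]
    simp only [toRat_mul, Matrix.mul_add, Matrix.add_mul, Matrix.mul_assoc]
    rfl
  have hm0 : m - 1 < m := by omega
  refine hmin.of_mul_mul (N := Matrix.of fun i p => U (⟨m - 1, hm0⟩, i) p)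
    (M := Matrix.of fun p j => V p (⟨m - 1, hm0⟩, j)) ?_
  ext i j
  have := congrFun (congrFun key (⟨m - 1, hm0⟩, i)) (⟨m - 1, hm0⟩, j)
  rw [diagLast, Matrix.of_apply, if_pos rfl, if_pos (by simp only; omega)] at this
  rw [← this]
  rfl

end Linearization

/-! ## Rational functions with a limit at infinity -/

section Limit

/-- The rational function `f` tends to `c` at infinity. -/
def LimAt (f : RatFunc ℂ) (c : ℂ) : Prop :=
  Filter.Tendsto (fun z : ℂ => RatFunc.eval (RingHom.id ℂ) z f) (Filter.cocompact ℂ) (nhds c)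

theorem eventually_denom_ne_zero (f : RatFunc ℂ) :
    ∀ᶠ z in Filter.cocompact ℂ, Polynomial.eval₂ (RingHom.id ℂ) z f.denom ≠ 0 := by
  have hf : {z | f.denom.IsRoot z}.Finite := Polynomial.finite_setOfPred_isRoot f.denom_ne_zero
  filter_upwards [hf.isCompact.compl_mem_cocompact] with z hz h
  exact hz h

theorem LimAt.add {f g : RatFunc ℂ} {c d : ℂ} (hf : LimAt f c) (hg : LimAt g d) :
    LimAt (f + g) (c + d) := by
  refine (Filter.Tendsto.add hf hg).congr' ?_
  filter_upwards [eventually_denom_ne_zero f, eventually_denom_ne_zero g] with z h1 h2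
  rw [RatFunc.eval_add _ _ h1 h2]

theorem LimAt.mul {f g : RatFunc ℂ} {c d : ℂ} (hf : LimAt f c) (hg : LimAt g d) :
    LimAt (f * g) (c * d) := by
  refine (Filter.Tendsto.mul hf hg).congr' ?_
  filter_upwards [eventually_denom_ne_zero f, eventually_denom_ne_zero g] with z h1 h2
  rw [RatFunc.eval_mul _ _ h1 h2]

theorem limAt_C (c : ℂ) : LimAt (RatFunc.C c) c := by
  have : (fun z : ℂ => RatFunc.eval (RingHom.id ℂ) z (RatFunc.C c)) = fun _ => c := by
    funext z; rw [RatFunc.eval_C]; rfl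
  rw [LimAt, this]
  exact tendsto_const_nhds

theorem LimAt.neg {f : RatFunc ℂ} {c : ℂ} (hf : LimAt f c) : LimAt (-f) (-c) := by
  have := (limAt_C (-1)).mul hf
  simpa using this

theorem LimAt.unique {f : RatFunc ℂ} {c d : ℂ} (hf : LimAt f c) (hg : LimAt f d) : c = d :=
  tendsto_nhds_unique hf hg

theorem eventually_eval_inv {f : RatFunc ℂ} (hf : f ≠ 0) : ∀ᶠ z in Filter.cocompact ℂ,
    (RatFunc.eval (RingHom.id ℂ) z f)⁻¹ = RatFunc.eval (RingHom.id ℂ) z f⁻¹ := by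
  filter_upwards [eventually_denom_ne_zero f, eventually_denom_ne_zero f⁻¹] with z h1 h2
  have := RatFunc.eval_mul _ _ h1 h2
  rw [mul_inv_cancel₀ hf, RatFunc.eval_one] at this
  exact (eq_inv_of_mul_eq_one_right this.symm).symm

theorem LimAt.inv {f : RatFunc ℂ} {c : ℂ} (hf : LimAt f c) (hc : c ≠ 0) : f ≠ 0 ∧ LimAt f⁻¹ c⁻¹ := by
  have h0 : f ≠ 0 := by
    rintro rfl
    have := limAt_C 0
    rw [map_zero] at this
    exact hc (hf.unique this)
  exact ⟨h0, (Filter.Tendsto.inv₀ hf hc).congr' (eventually_eval_inv h0)⟩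

theorem limAt_X_inv : LimAt (RatFunc.X)⁻¹ 0 := by
  have h : Filter.Tendsto (fun z : ℂ => z⁻¹) (Filter.cocompact ℂ) (nhds 0) := by
    rw [← Metric.cobounded_eq_cocompact]; exact Filter.tendsto_inv₀_cobounded
  refine h.congr' ?_
  filter_upwards [eventually_eval_inv RatFunc.X_ne_zero] with z hz
  rw [← hz, RatFunc.eval_X]

/-- The ring of the rational functions that have a limit at infinity. -/
def limRing : Subring (RatFunc ℂ) where
  carrier := {f | ∃ c, LimAt f c}
  zero_mem' := ⟨0, by simpa using limAt_C 0⟩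
  one_mem' := ⟨1, by simpa using limAt_C 1⟩
  add_mem' := fun ⟨c, hc⟩ ⟨d, hd⟩ => ⟨c + d, hc.add hd⟩
  mul_mem' := fun ⟨c, hc⟩ ⟨d, hd⟩ => ⟨c * d, hc.mul hd⟩
  neg_mem' := fun ⟨c, hc⟩ => ⟨-c, hc.neg⟩

theorem limAt_choose (f : limRing) : LimAt f f.2.choose := f.2.choose_spec

/-- The limit at infinity. -/
def limHom : limRing →+* ℂ where
  toFun f := f.2.choose
  map_zero' := (limAt_choose 0).unique (by simpa using limAt_C 0)
  map_one' := (limAt_choose 1).unique (by simpa using limAt_C 1)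
  map_add' f g := (limAt_choose (f + g)).unique ((limAt_choose f).add (limAt_choose g))
  map_mul' f g := (limAt_choose (f * g)).unique ((limAt_choose f).mul (limAt_choose g))

theorem limAt_limHom (f : limRing) : LimAt f (limHom f) := limAt_choose f

theorem isUnit_of_limHom_ne_zero {f : limRing} (hf : limHom f ≠ 0) : IsUnit f := by
  obtain ⟨h0, h1⟩ := (limAt_limHom f).inv hf
  exact IsUnit.of_mul_eq_one ⟨(f : RatFunc ℂ)⁻¹, _, h1⟩ (Subtype.ext (mul_inv_cancel₀ h0))

/-- Constants as rational functions with a limit at infinity. -/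
def limC : ℂ →+* limRing where
  toFun c := ⟨RatFunc.C c, c, limAt_C c⟩
  map_zero' := Subtype.ext (map_zero _)
  map_one' := Subtype.ext (map_one _)
  map_add' a b := Subtype.ext (map_add RatFunc.C a b)
  map_mul' a b := Subtype.ext (map_mul RatFunc.C a b)

theorem limHom_limC (c : ℂ) : limHom (limC c) = c := (limAt_limHom _).unique (limAt_C c)

/-- The rational function `1 / λ`. -/
def limX : limRing := ⟨(RatFunc.X)⁻¹, 0, limAt_X_inv⟩

theorem limHom_limX : limHom limX = 0 := (limAt_limHom _).unique limAt_X_inv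

/-- The limit is a ring homomorphism, so a determinant that is a unit of `limRing` has a nonzero
limit. -/
theorem isBiproper_map {ι : Type} [Fintype ι] [DecidableEq ι] {M : Matrix ι ι limRing}
    (hM : IsUnit M.det) : IsBiproper (M.map limRing.subtype) := by
  refine ⟨M.map limHom, ?_, fun i j => limAt_limHom (M i j)⟩
  rw [← RingHom.mapMatrix_apply, ← RingHom.map_det]
  exact hM.map _

variable {r : ℕ}

/-- The inverse of `λE - A` as a matrix of rational functions with a limit at infinity. -/
def limResolvent (E A : Matrix (Fin r) (Fin r) ℂ) : Matrix (Fin r) (Fin r) limRing :=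
  limX • (E.map limC - limX • A.map limC)⁻¹

/-- $(\lambda E-A)^{-1}=\lambda^{-1}(E-\lambda^{-1}A)^{-1}$, and $E-\lambda^{-1}A$ is invertible
over `limRing` because it tends to the nonsingular matrix $E$. -/
theorem limResolvent_map {E : Matrix (Fin r) (Fin r) ℂ} (hE : IsUnit E.det)
    (A : Matrix (Fin r) (Fin r) ℂ) :
    (limResolvent E A).map limRing.subtype = (toRat (pencil E A))⁻¹ := by
  have hu : IsUnit (E.map limC - limX • A.map limC).det := by
    refine isUnit_of_limHom_ne_zero ?_
    rw [RingHom.map_det]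
    have : limHom.mapMatrix (E.map limC - limX • A.map limC) = E := by
      ext i j
      simp [limHom_limC, limHom_limX]
    rw [this]
    exact hE.ne_zero
  symm
  apply Matrix.inv_eq_right_inv
  have e : toRat (pencil E A) = (RatFunc.X : RatFunc ℂ) •
      (E.map limC - limX • A.map limC).map limRing.subtype := by
    rw [toRat_pencil]
    ext i j
    have hX : (RatFunc.X : RatFunc ℂ) ≠ 0 := RatFunc.X_ne_zero
    simp only [Matrix.sub_apply, Matrix.smul_apply, Matrix.map_apply, smul_eq_mul, limC, limX,
      RingHom.coe_mk, MonoidHom.coe_mk, OneHom.coe_mk, map_sub, map_mul, Subring.subtype_apply]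
    rw [mul_sub, ← mul_assoc, mul_inv_cancel₀ hX, one_mul]
  have e2 : (limResolvent E A).map limRing.subtype = (RatFunc.X : RatFunc ℂ)⁻¹ •
      ((E.map limC - limX • A.map limC)⁻¹).map limRing.subtype := by
    ext i j
    simp [limResolvent, limX]
  rw [e, e2, Matrix.smul_mul, Matrix.mul_smul, smul_smul, mul_inv_cancel₀ RatFunc.X_ne_zero,
    one_smul, ← Matrix.map_mul, Matrix.mul_nonsing_inv _ hu, Matrix.map_one _ (map_zero _) (map_one _)]

end Limit

/-! ## Schur complements -/

section Schur

variable {m n r : ℕ} {K : Type} [CommRing K]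

/-- The Schur complement of the corner of a bordered matrix; `Ω` is the inverse of the corner. -/
def schur (C : Matrix (Fin n) (Fin r) K) (B : Matrix (Fin r) (Fin n) K) (Ω : Matrix (Fin r) (Fin r) K)
    (M : Matrix (Ix m) (Ix m) (Matrix (Fin n) (Fin n) K)) :
    Matrix (Fin m × Fin n) (Fin m × Fin n) K :=
  flat M + Matrix.of (fun p k => (M (Sum.inl p.1) (Sum.inr ()) * C) p.2 k) * Ω *
    Matrix.of (fun k p => (B * M (Sum.inr ()) (Sum.inl p.1)) k p.2)

variable {C : Matrix (Fin n) (Fin r) K} {B : Matrix (Fin r) (Fin n) K} {Ω : Matrix (Fin r) (Fin r) K}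

theorem schur_mul (M : Matrix (Ix m) (Ix m) (Matrix (Fin n) (Fin n) K))
    {L : Matrix (Ix m) (Ix m) (Matrix (Fin n) (Fin n) K)} (hL : Triv L (Sum.inr ())) :
    schur C B Ω (M * L) = schur C B Ω M * flat L := by
  have h := conv_mul (C := C) (B := B) (Z := 0) M hL
  rw [conv_eq_flat, conv, conv, Matrix.fromBlocks_multiply, Matrix.fromBlocks_inj] at h
  simp only [Matrix.zero_mul, Matrix.mul_zero, add_zero, Matrix.mul_one, zero_add] at h
  obtain ⟨-, h2, h3, -⟩ := h
  rw [schur, schur, ← h2, ← h3, flat_mul _ hL, Matrix.add_mul]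
  simp only [Matrix.mul_assoc]

theorem schur_mul_left (M : Matrix (Ix m) (Ix m) (Matrix (Fin n) (Fin n) K))
    {L : Matrix (Ix m) (Ix m) (Matrix (Fin n) (Fin n) K)} (hL : Triv L (Sum.inr ())) :
    schur C B Ω (L * M) = flat L * schur C B Ω M := by
  have h := conv_mul_left (C := C) (B := B) (Z := 0) M hL
  rw [conv_eq_flat, conv, conv, Matrix.fromBlocks_multiply, Matrix.fromBlocks_inj] at h
  simp only [Matrix.zero_mul, Matrix.mul_zero, add_zero, Matrix.one_mul, zero_add] at h
  obtain ⟨-, h2, h3, -⟩ := h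
  rw [schur, schur, ← h2, ← h3, flat_mul_left _ hL, Matrix.mul_add]
  simp only [Matrix.mul_assoc]

theorem schur_sub {V : Matrix (Ix m) (Ix m) (Matrix (Fin n) (Fin n) K)}
    (hV : ∀ a : Fin m, V (Sum.inl a) (Sum.inr ()) = 0 ∧ V (Sum.inr ()) (Sum.inl a) = 0)
    (N : Matrix (Ix m) (Ix m) (Matrix (Fin n) (Fin n) K)) :
    schur (-C) (-B) Ω (V - N) = flat V - schur C (-B) Ω N := by
  ext p q
  simp [schur, flat, hV, Matrix.mul_apply, Matrix.sub_apply]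
  ring

/-- Eliminating the state turns the letter $0$ of the system into a letter without border. For
$X=-A_0$ and $\Omega=(\lambda E-A)^{-1}$ its matrix is $-(A_0+C(\lambda E-A)^{-1}B)$, so afterwards
the transfer function is treated like a polynomial with a modified constant coefficient. -/
theorem schur_glet_zero (hm : 0 < m) (X : Matrix (Fin n) (Fin n) K) :
    schur C (-B) Ω (rv (glet m true 0 X)) = flat (rv (glet m false 0 (X - C * Ω * B))) := by
  have lvr : ∀ a : Fin m, revIx m (Sum.inl a) = lv m (m - 1 - a) := fun a => by
    rw [← revIx_lv a.2]; simp [lv]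
  have l0 : ∀ a : Fin m, lv m (m - 1 - a) = lv m 0 ↔ (a : ℕ) + 1 = m := fun a => by
    have := a.2
    rw [lv_inj (by omega) (by omega)]; omega
  have l2 : ∀ a b : Fin m, lv m (m - 1 - a) = lv m (m - 1 - b) ↔ a = b := fun a b => by
    have := a.2; have := b.2
    rw [lv_inj (by omega) (by omega), Fin.ext_iff]; omega
  have ninr : ∀ a : Fin m, lv m (m - 1 - a) ≠ Sum.inr () := fun a => lv_ne_inr (by have := a.2; omega)
  have n0 : (Sum.inr () : Ix m) ≠ lv m 0 := (lv_ne_inr hm).symm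
  ext ⟨a, i⟩ ⟨b, j⟩
  simp only [schur, flat, rv, Matrix.submatrix_apply, Matrix.add_apply, Matrix.of_apply,
    Matrix.mul_apply (N := Matrix.of _), Matrix.mul_apply (N := Ω), glet, if_true, Bool.false_eq_true,
    if_false, swapM, diagM, Matrix.diagonal_apply, lvr, l0, l2, ninr, n0, revIx_inr, Matrix.one_apply,
    (ninr _).symm]
  by_cases ha : (a : ℕ) + 1 = m
  · by_cases hb : (b : ℕ) + 1 = m
    · have hab : a = b := Fin.ext (by omega)
      subst hab
      simp [ha, sub_eq_add_neg]
      simp [Matrix.mul_apply]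
    · have hab : a ≠ b := fun h => hb (h ▸ ha)
      simp [ha, hb, hab]
  · by_cases hab : a = b
    · subst hab
      simp [ha]
    · simp [ha, hab]

theorem schur_prod (hm : 0 < m) (a : ℕ → Matrix (Fin n) (Fin n) K) {σ : List ℕ} {h : ℕ} (hh : h < m)
    (hσ : σ.Perm (List.range (h + 1))) :
    schur C (-B) Ω (rv (σ.map (mk m true a)).prod) =
      flat (rv (σ.map (mk m false (Function.update a 0 (a 0 - C * Ω * B)))).prod) := by
  obtain ⟨σ₁, σ₂, rfl⟩ := List.append_of_mem (hσ.mem_iff.2 (show 0 ∈ List.range (h + 1) by simp))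
  have nd : (0 :: (σ₁ ++ σ₂)).Nodup := by
    rw [← List.nodup_middle]; exact hσ.nodup_iff.2 List.nodup_range
  have hpos : ∀ k ∈ σ₁ ++ σ₂, k ≠ 0 ∧ k < m := by
    intro k hk
    have h0 : k ≠ 0 := by rintro rfl; exact (List.nodup_cons.1 nd).1 hk
    have : k < h + 1 := List.mem_range.1 (hσ.mem_iff.1 (by
      rcases List.mem_append.1 hk with h | h <;> simp [h]))
    exact ⟨h0, by omega⟩
  have tr : ∀ l : List ℕ, (∀ k ∈ l, k ∈ σ₁ ++ σ₂) → BorderUnit (rv (l.map (mk m true a)).prod) := by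
    intro l hl
    refine (BorderUnit.list_prod fun U hU => ?_).rv
    obtain ⟨k, hk, rfl⟩ := List.mem_map.1 hU
    exact borderUnit_glet (hpos k (hl k hk)).1 (hpos k (hl k hk)).2 _
  have eq : ∀ l : List ℕ, (∀ k ∈ l, k ∈ σ₁ ++ σ₂) →
      l.map (mk m false (Function.update a 0 (a 0 - C * Ω * B))) = l.map (mk m true a) := by
    intro l hl
    refine List.map_congr_left fun k hk => ?_
    have := (hpos k (hl k hk)).1
    rw [mk, mk, Function.update_of_ne this, glet_of_pos this, glet_of_pos this]
  have t1 := (tr σ₁ fun k hk => by simp [hk]).1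
  have t2 := (tr σ₂ fun k hk => by simp [hk]).1
  simp only [List.map_append, List.map_cons, List.prod_append, List.prod_cons, rv_mul]
  rw [eq σ₁ fun k hk => by simp [hk], eq σ₂ fun k hk => by simp [hk], schur_mul_left _ t1,
    schur_mul _ t2, mk, schur_glet_zero hm, flat_mul_left _ t1, flat_mul _ t2, mk,
    Function.update_self]

end Schur

/-! ### Reversal as multiplication by a permutation matrix -/

section Permutation

variable {m n : ℕ} {𝓐 : Type} [Ring 𝓐]

/-- The permutation matrix that reverses the levels. -/
def revM (m : ℕ) (𝓐 : Type) [Ring 𝓐] : Matrix (Ix m) (Ix m) 𝓐 :=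
  (1 : Matrix (Ix m) (Ix m) 𝓐).submatrix (revIx m) id

theorem revM_mul (M : Matrix (Ix m) (Ix m) 𝓐) : revM m 𝓐 * M = M.submatrix (revIx m) id := by
  ext i j
  simp [revM, Matrix.mul_apply, Matrix.one_apply]

theorem mul_revM (M : Matrix (Ix m) (Ix m) 𝓐) : M * revM m 𝓐 = M.submatrix id (revIx m) := by
  ext i j
  have e : ∀ k, revIx m k = j ↔ k = revIx m j := fun k => by
    constructor
    · rintro rfl; rw [revIx_revIx]
    · rintro rfl; rw [revIx_revIx]
  simp [revM, Matrix.mul_apply, Matrix.one_apply, e]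

theorem borderUnit_revM : BorderUnit (revM m 𝓐) := by
  have e : revM m 𝓐 * revM m 𝓐 = 1 := by
    rw [revM_mul, revM]
    ext i j
    change (1 : Matrix (Ix m) (Ix m) 𝓐) (revIx m (revIx m i)) j = _
    rw [revIx_revIx]
  have t : Triv (revM m 𝓐) (Sum.inr ()) := by
    intro j
    have e : revIx m j = Sum.inr () ↔ j = Sum.inr () := by
      rcases j with j | j <;> simp [revIx]
    simp only [revM, Matrix.submatrix_apply, revIx_inr, Matrix.one_apply, e, id, and_true]
    congr
  exact ⟨t, _, t, e, e⟩

theorem eq_revM_mul_rv_mul (M : Matrix (Ix m) (Ix m) 𝓐) : M = revM m 𝓐 * rv M * revM m 𝓐 := by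
  rw [revM_mul, mul_revM]
  ext i j
  simp [rv, revIx_revIx]

end Permutation

/-! ### Biproper equivalence at infinity -/

section Infinity

variable {m n r : ℕ} (S : Realization (Fin n) r)

/-- Constant matrices as matrices over the ring of the rational functions with a limit at
infinity. -/
abbrev limCM (n : ℕ) : Matrix (Fin n) (Fin n) ℂ →+* Matrix (Fin n) (Fin n) limRing := limC.mapMatrix

/-- Matrices over the ring of the rational functions with a limit at infinity as matrices of
rational functions. -/
abbrev limSub (n : ℕ) : Matrix (Fin n) (Fin n) limRing →+* Matrix (Fin n) (Fin n) (RatFunc ℂ) :=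
  limRing.subtype.mapMatrix

/-- Constant matrices as matrices of rational functions. -/
abbrev ratC (n : ℕ) : Matrix (Fin n) (Fin n) ℂ →+* Matrix (Fin n) (Fin n) (RatFunc ℂ) :=
  (RatFunc.C : ℂ →+* RatFunc ℂ).mapMatrix

/-- The matrix `-(A_0 + C (λE - A)⁻¹ B)`. -/
def limConst : Matrix (Fin n) (Fin n) limRing :=
  limCM n (sigmaCoeff S 0) - S.C.map limC * limResolvent S.E S.A * S.B.map limC

/-- The Horner shifts for the reversed transfer function. -/
def limShift : ℕ → Matrix (Fin n) (Fin n) limRing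
  | 0 => limConst S
  | j + 1 => -limCM n (S.coeff (j + 1)) + Matrix.scalar (Fin n) limX * limShift j

theorem limConst_map : limSub n (limConst S) = ratC n (sigmaCoeff S 0) -
    S.C.map RatFunc.C * (toRat (pencil S.E S.A))⁻¹ * S.B.map RatFunc.C := by
  have e : limSub n (S.C.map limC * limResolvent S.E S.A * S.B.map limC) =
      S.C.map RatFunc.C * (toRat (pencil S.E S.A))⁻¹ * S.B.map RatFunc.C := by
    rw [RingHom.mapMatrix_apply, Matrix.map_mul, Matrix.map_mul, limResolvent_map S.E_nonsing]
    rfl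
  rw [limConst, map_sub, e]
  rfl

theorem limShift_map (j : ℕ) : (RatFunc.X : RatFunc ℂ) ^ j • limSub n (limShift S j) =
    -((S.C.map RatFunc.C * (toRat (pencil S.E S.A))⁻¹ * S.B.map RatFunc.C) +
      ∑ k ∈ Finset.range (j + 1), (RatFunc.X : RatFunc ℂ) ^ k • (S.coeff k).map RatFunc.C) := by
  have hX : (RatFunc.X : RatFunc ℂ) ≠ 0 := RatFunc.X_ne_zero
  have hc : ∀ M : Matrix (Fin n) (Fin n) ℂ, limSub n (limCM n M) = M.map RatFunc.C := fun _ => rfl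
  induction j with
  | zero =>
    rw [limShift, limConst_map, sigmaCoeff_eq]
    ext i j
    simp
    ring
  | succ j ih =>
    have hx : limSub n (Matrix.scalar (Fin n) limX * limShift S j) =
        (RatFunc.X : RatFunc ℂ)⁻¹ • limSub n (limShift S j) := by
      rw [scalar_mul_apply]
      ext1 i j
      rfl
    rw [limShift, map_add, map_neg, hc, hx, smul_add, smul_smul, pow_succ,
      mul_assoc, mul_inv_cancel₀ hX, mul_one, ih, Finset.sum_range_succ _ (j + 1), pow_succ, smul_neg]
    abel

/-- Horner's rule in $1/\lambda$, started with $A_0+C(\lambda E-A)^{-1}B$ in place of $A_0$, ends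
with $\lambda^{-m}G$ up to the sign. -/
theorem limShift_top (hdeg : ∀ i j, (S.P i j).natDegree ≤ m) :
    -limSub n (limShift S m) = ((RatFunc.X : RatFunc ℂ)⁻¹ ^ m) • S.transfer := by
  have hX : (RatFunc.X : RatFunc ℂ) ^ m ≠ 0 := pow_ne_zero _ RatFunc.X_ne_zero
  have e := limShift_map S m
  have hP : toRat S.P =
      ∑ k ∈ Finset.range (m + 1), (RatFunc.X : RatFunc ℂ) ^ k • (S.coeff k).map RatFunc.C := by
    ext1 i j
    rw [toRat, Matrix.map_apply,
      Polynomial.as_sum_range_C_mul_X_pow' (S.P i j) (Nat.lt_succ_of_le (hdeg i j)), map_sum,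
      Matrix.sum_apply]
    refine Finset.sum_congr rfl fun k _ => ?_
    rw [map_mul, map_pow, RatFunc.algebraMap_X, RatFunc.algebraMap_C, mul_comm]
    rfl
  have e2 : S.transfer = -((RatFunc.X : RatFunc ℂ) ^ m • limSub n (limShift S m)) := by
    rw [e, neg_neg, Realization.transfer_eq, toRat_map_C, toRat_map_C, hP, add_comm]
  rw [e2, smul_neg, smul_smul, inv_pow, inv_mul_cancel₀ hX, one_smul]

variable {h : ℕ} {x y : List (ℤ × Matrix (Fin n) (Fin n) ℂ)}

theorem transfer_symmRealization (hh : h < m) (hxy : IsCanonicalPair m h x y) :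
    (symmRealization S m h x y).transfer =
      schur (-S.C.map RatFunc.C) (-S.B.map RatFunc.C) (toRat (pencil S.E S.A))⁻¹
        (Matrix.scalar (Fin n) (RatFunc.X : RatFunc ℂ) •
          ((symmData S hh hxy).lead S).map (RatFunc.C : ℂ →+* RatFunc ℂ).mapMatrix -
        ((symmData S hh hxy).const S).map (RatFunc.C : ℂ →+* RatFunc ℂ).mapMatrix) := by
  have e := symmPencilS_eq S hh hxy
  rw [symmPencilS_eq_conv S hh hxy, conv, Matrix.fromBlocks_inj] at e
  obtain ⟨e1, e2, e3, -⟩ := e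
  have hM : ∀ L N : Matrix (Ix m) (Ix m) (Matrix (Fin n) (Fin n) ℂ),
      (Matrix.scalar (Fin n) (Polynomial.X : ℂ[X]) • L.map (polyC n) - N.map (polyC n)).map
        (algebraMap ℂ[X] (RatFunc ℂ)).mapMatrix = Matrix.scalar (Fin n) (RatFunc.X : RatFunc ℂ) •
          L.map (RatFunc.C : ℂ →+* RatFunc ℂ).mapMatrix -
        N.map (RatFunc.C : ℂ →+* RatFunc ℂ).mapMatrix := by
    intro L N
    ext i j k l
    simp only [Matrix.map_apply, Matrix.sub_apply, Matrix.smul_apply, smul_eq_mul, scalar_mul_apply,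
      RingHom.mapMatrix_apply, map_sub, map_mul, RatFunc.algebraMap_X, RatFunc.algebraMap_C]
  rw [← hM, Realization.transfer_eq, symmRealization]
  simp only
  rw [← e1, ← e2, ← e3, schur]
  generalize Matrix.scalar (Fin n) (Polynomial.X : ℂ[X]) • ((symmData S hh hxy).lead S).map (polyC n) -
    ((symmData S hh hxy).const S).map (polyC n) = M
  congr 1
  congr 1
  · congr 1
    ext p k
    simp [Matrix.mul_apply]
  · ext k p
    simp [Matrix.mul_apply]

/-- The matrix `diag(-Q, I)` up to the border. -/
theorem flat_rv_reduced (hm : 0 < m) {K : Type} [CommRing K] (t : K)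
    {Y Q : Matrix (Fin n) (Fin n) K} {a : ℕ → Matrix (Fin n) (Fin n) K}
    (hQ : Q = -a 0 + Matrix.scalar (Fin n) t * Y) :
    flat (rv (-(topDiag m (Matrix.scalar (Fin n) t) Y 0 - mk m false a 0))) = diagLast m (-Q) := by
  have lvr : ∀ a : Fin m, revIx m (Sum.inl a) = lv m (m - 1 - a) := fun a => by
    rw [← revIx_lv a.2]; simp [lv]
  have td : ∀ (a : Fin m) (Y : Matrix (Fin n) (Fin n) K) (t : Matrix (Fin n) (Fin n) K),
      (Sum.elim (fun l : Fin m => if (l : ℕ) < 0 then t else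
        if (l : ℕ) = 0 then t * Y else 0) fun _ => t : Ix m → _) (lv m (m - 1 - a)) =
        if (a : ℕ) + 1 = m then t * Y else 0 := by
    intro a Y t
    have := a.2
    simp only [lv, show m - 1 - (a : ℕ) < m by omega, dite_true, Sum.elim_inl, Nat.not_lt_zero,
      if_false]
    by_cases h : (a : ℕ) + 1 = m
    · rw [if_pos h, if_pos (by omega)]
    · rw [if_neg h, if_neg (by omega)]
  have l0 : ∀ a : Fin m, lv m (m - 1 - a) = lv m 0 ↔ (a : ℕ) + 1 = m := fun a => by
    have := a.2
    rw [lv_inj (by omega) (by omega)]; omega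
  have l2 : ∀ a b : Fin m, lv m (m - 1 - a) = lv m (m - 1 - b) ↔ a = b := fun a b => by
    have := a.2; have := b.2
    rw [lv_inj (by omega) (by omega), Fin.ext_iff]; omega
  subst hQ
  ext1 ⟨a, i⟩ ⟨b, j⟩
  simp only [flat, Matrix.of_apply, rv, Matrix.submatrix_apply, Matrix.neg_apply, Matrix.sub_apply,
    topDiag, mk, glet, if_true, Bool.false_eq_true, if_false, diagM, Matrix.diagonal_apply, lvr, l0,
    l2, td, diagLast]
  by_cases hab : a = b
  · subst hab
    by_cases ha : (a : ℕ) + 1 = m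
    · simp [ha]; ring
    · simp [ha]
  · simp [hab]

/-- After division by $\lambda$ and elimination of the state, the transfer function is, up to
invertible constant factors, a proper generalized Fiedler pencil in $t=1/\lambda$ over `limRing`
with the two sides exchanged. So `smul_prod_sub_rv_prod` applies once more, with $m-h-1$ in place of
$h$. Invertibility over `limRing` is what makes the transformations biproper. -/
theorem exists_biproper (hh : h < m) (hxy : IsCanonicalPair m h x y) (he : Even h)
    (hx : IsNonsingular m x) (hy : IsNonsingular m y)
    (hm : Odd m ∨ IsUnit (S.coeff m).det) (hdeg : ∀ i j, (S.P i j).natDegree ≤ m) :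
    ∃ Ol Or : Matrix (Fin m × Fin n) (Fin m × Fin n) (RatFunc ℂ),
      IsBiproper Ol ∧ IsBiproper Or ∧
      Ol * ((RatFunc.X : RatFunc ℂ)⁻¹ • (symmRealization S m h x y).transfer) * Or =
        diagLast m (((RatFunc.X : RatFunc ℂ)⁻¹ ^ m) • S.transfer) := by
  have hυ := simpleLevels_perm (m - h - 1)
  rw [show m - h - 1 + 1 = m - h by omega] at hυ
  obtain ⟨A, B, hA, hB, e1, e2⟩ := symmData_eq_mul S hh he hxy hx hy hm
  obtain ⟨U, V, hU, hV, e⟩ := smul_prod_sub_rv_prod (m := m) (b := false) (h := m - h - 1)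
    (a := fun k => limCM n (tauCoeff S m k))
    (α := Function.update (fun k => limCM n (sigmaCoeff S k)) 0 (limConst S))
    (cen_scalar (n := n) limX) (P := fun k => limShift S (m - k)) (by omega)
    (fun k h1 h2 => by
      rw [show m - k = m - (k + 1) + 1 by omega, limShift, tauCoeff_eq S h2,
        show m - (k + 1) + 1 = m - k by omega])
    (by rw [Nat.sub_self, Function.update_self]; rfl)
    (fun k h0 hk => by
      rw [tauCoeff_eq S (by omega), Function.update_of_ne (by omega), sigmaCoeff_eq, map_neg,
        show m - (m - k) = k by omega])
    (σ := simpleLevels (m - h - 1)) (υ := simpleLevels h) (simpleLevels_perm _)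
    (by rw [show m - (m - h - 1) = h + 1 by omega]; exact simpleLevels_perm h)
  set N := topDiag m (Matrix.scalar (Fin n) limX) (limShift S (m - 1)) 0 -
    mk m false (fun k => limCM n (tauCoeff S m k)) 0 with hN
  set W := ((simpleLevels h).map (mk m false
    (Function.update (fun k => limCM n (sigmaCoeff S k)) 0 (limConst S)))).prod with hW
  set Z := ((simpleLevels (m - h - 1)).map (mk m false fun k => limCM n (tauCoeff S m k))).prod
    with hZ
  -- Because the sides are exchanged, the reduced matrix has its distinguished block first. The
  -- reversal matrices bring it to the last place, where $\mathrm{diag}(I,\lambda^{-m}G)$ has it.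
  have hUl : BorderUnit (A.map (limCM n) * (rv U * revM m (Matrix (Fin n) (Fin n) limRing))) :=
    (hA.map _).mul (hU.rv.mul borderUnit_revM)
  have hUr : BorderUnit (revM m (Matrix (Fin n) (Fin n) limRing) * rv V * B.map (limCM n)) :=
    (borderUnit_revM.mul hV.rv).mul (hB.map _)
  have c1 : A.map (limCM n) * (rv U * revM m _) * rv (-N) * (revM m _ * rv V * B.map (limCM n)) =
      A.map (limCM n) * (-rv (Matrix.scalar (Fin n) limX • W - rv Z)) * B.map (limCM n) := by
    have : rv (-N) = -rv N := rfl
    rw [e, rv_mul, rv_mul, rv_rv, this, eq_revM_mul_rv_mul N, ← eq_revM_mul_rv_mul N]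
    conv_rhs => rw [eq_revM_mul_rv_mul N]
    simp only [mul_assoc, mul_neg, neg_mul]
  have hT : (RatFunc.X : RatFunc ℂ)⁻¹ • (symmRealization S m h x y).transfer =
      (flat (A.map (limCM n) * (rv U * revM m _) * rv (-N) *
        (revM m _ * rv V * B.map (limCM n)))).map limRing.subtype := by
    have hX : (RatFunc.X : RatFunc ℂ) ≠ 0 := RatFunc.X_ne_zero
    have hA0 := hA.map (limCM n)
    have hB0 := hB.map (limCM n)
    have hA1 := hA.map (ratC n)
    have hB1 := hB.map (ratC n)
    have eA : (flat (A.map (limCM n))).map limRing.subtype = flat (A.map (ratC n)) := rfl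
    have eB : (flat (B.map (limCM n))).map limRing.subtype = flat (B.map (ratC n)) := rfl
    have r1 : ∀ M : Matrix (Ix m) (Ix m) (Matrix (Fin n) (Fin n) ℂ),
      (rv M).map (ratC n) = rv (M.map (ratC n)) := fun _ => rfl
    have eW : ((simpleLevels h).map (mk m false (Function.update (fun k => ratC n (sigmaCoeff S k)) 0
        (ratC n (sigmaCoeff S 0) - S.C.map RatFunc.C * (toRat (pencil S.E S.A))⁻¹ *
          S.B.map RatFunc.C)))).prod = W.map (limSub n) := by
      rw [hW, prod_mk_map]
      congr 3
      funext k
      by_cases hk : k = 0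
      · subst hk
        rw [Function.update_self, Function.update_self, limConst_map]
      · rw [Function.update_of_ne hk, Function.update_of_ne hk]
        rfl
    have eZ : ((simpleLevels (m - h - 1)).map (mk m false fun k => ratC n (tauCoeff S m k))).prod =
        Z.map (limSub n) := by
      rw [hZ, prod_mk_map]
      rfl
    have hZt : Triv Z (Sum.inr ()) := by
      have : Z = wprod m ((simpleLevels (m - h - 1)).map fun k => (false, k,
          limCM n (tauCoeff S m k))) := by rw [hZ, wprod, List.map_map]; rfl
      rw [this]
      refine wprod_triv_inr fun p hp => ?_
      obtain ⟨k, hk, rfl⟩ := List.mem_map.1 hp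
      have := List.mem_range.1 (hυ.mem_iff.1 hk)
      exact ⟨rfl, by simp only; omega⟩
    have hZ0 : ∀ a : Fin m, (Matrix.scalar (Fin n) (RatFunc.X : RatFunc ℂ) • Z.map (limSub n))
        (Sum.inl a) (Sum.inr ()) = 0 ∧ (Matrix.scalar (Fin n) (RatFunc.X : RatFunc ℂ) •
          Z.map (limSub n)) (Sum.inr ()) (Sum.inl a) = 0 := by
      intro a
      rw [Matrix.smul_apply, Matrix.smul_apply, Matrix.map_apply, Matrix.map_apply,
        (hZt _).1, (hZt _).2, Matrix.one_apply_ne (by simp), Matrix.one_apply_ne (by simp), map_zero,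
        smul_zero]
      exact ⟨rfl, rfl⟩
    rw [c1, flat_mul _ hB0.1, flat_mul_left _ hA0.1, Matrix.map_mul, Matrix.map_mul, eA, eB,
      transfer_symmRealization S hh hxy, e1, e2, Matrix.map_mul, Matrix.map_mul, Matrix.map_mul,
      Matrix.map_mul, r1, prod_mk_map, prod_mk_map, ← Matrix.smul_mul,
      ← mul_smul_of_cen (cen_scalar _), ← sub_mul, ← mul_sub, schur_mul _ hB1.1,
      schur_mul_left _ hA1.1, ← Matrix.smul_mul, ← Matrix.mul_smul, eZ, schur_sub hZ0,
      schur_prod (by omega) _ hh (simpleLevels_perm h), eW]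
    congr 2
    have eE : -rv (Matrix.scalar (Fin n) limX • W - rv Z) = Z - Matrix.scalar (Fin n) limX • rv W := by
      rw [show rv (Matrix.scalar (Fin n) limX • W - rv Z) =
        Matrix.scalar (Fin n) limX • rv W - rv (rv Z) from rfl, rv_rv, neg_sub]
    rw [eE]
    ext1 p q
    simp only [flat, Matrix.of_apply, Matrix.smul_apply, Matrix.sub_apply, Matrix.map_apply,
      smul_eq_mul, scalar_mul_apply, map_sub, map_mul, RingHom.mapMatrix_apply]
    rw [mul_sub, ← mul_assoc, inv_mul_cancel₀ hX, one_mul]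
    rfl
  obtain ⟨Ul, hUl', u, -⟩ := hUl.exists_flat_inv
  obtain ⟨Ur, hUr', -, v, -⟩ := hUr.exists_flat_inv
  refine ⟨(flat Ul).map limRing.subtype, (flat Ur).map limRing.subtype,
    isBiproper_map hUl'.isUnit_det_flat, isBiproper_map hUr'.isUnit_det_flat, ?_⟩
  have key := cancel_mul_mul u v (rv (-N)) 1
  rw [mul_one, mul_one] at key
  rw [hT, ← Matrix.map_mul, ← Matrix.map_mul, ← flat_mul_left _ hUl'.1, ← flat_mul _ hUr'.1, key,
    ← limShift_top S hdeg, flat_rv_reduced (by omega) limX (Q := limShift S m)]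
  · ext1 p q
    simp only [diagLast, Matrix.map_apply, Matrix.of_apply]
    split_ifs
    · rfl
    · simp only [Matrix.one_apply]; split_ifs <;> rfl
    · rfl
  · rw [tauCoeff_eq S (by omega), Nat.sub_zero]
    conv_lhs => rw [show m = m - 1 + 1 by omega, limShift, show m - 1 + 1 = m by omega]

end Infinity

theorem isRosenbrockStrongLinearization_symmPencilS {m n r : ℕ} (S : Realization (Fin n) r)
    (hdeg : ∀ i j, (S.P i j).natDegree ≤ m) (hmin : S.IsMinimal) {h : ℕ}
    {x y : List (ℤ × Matrix (Fin n) (Fin n) ℂ)} (hh : h < m) (he : Even h)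
    (hxy : IsCanonicalPair m h x y) (hx : IsNonsingular m x) (hy : IsNonsingular m y)
    (hm : Odd m ∨ IsUnit (S.coeff m).det) :
    IsRosenbrockStrongLinearization m S (symmPencilS S m h x y) := by
  refine ⟨symmRealization S m h x y, natDegree_symmPencilP_le S, symmPencilS_eq S hh hxy,
    isMinimal_symmRealization S hmin hh hxy he hx hy hm hdeg, ?_,
    exists_biproper S hh hxy he hx hy hm hdeg⟩
  obtain ⟨U, V, hU, hV, e⟩ := exists_unimodular S hh hxy he hx hy hm hdeg
  refine ⟨U, V, 1, 1, hU, hV, by simp, by simp, ?_⟩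
  rw [Matrix.map_one _ (map_zero _) (map_one _), e]

end GFPR

end

open GFPR

theorem theorem4p6 (m n r : ℕ) (S : Realization (Fin n) r)
    (hdeg : ∀ i j, (S.P i j).natDegree ≤ m) (hlead : S.coeff m ≠ 0) (hmin : S.IsMinimal) :
    (∀ (h : ℕ) (x y : List (ℤ × Matrix (Fin n) (Fin n) ℂ)),
      h < m → Even h → IsCanonicalPair m h x y →
      symmPencilS S m h x y =
        Matrix.fromBlocks (symmPencilP S m h x y)
          ((colBlock (stdCol m (m - invers (indices x ++ simpleTuple h) 0)) S.C).map Polynomial.C)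
          ((rowBlock (stdCol m
            (m - consec (simpleTuple h ++ simpleComplement h ++ (indices x).reverse) 0))
              S.B).map Polynomial.C)
          (-pencil S.E S.A) ∧
      (∃ D : Data m n, symmPencilS S m h x y = D.gfpr S) ∧
      IsBlockSymmetric (symmPencilS S m h x y) ∧
      (IsNonsingular m x → IsNonsingular m y →
        (Odd m → IsRosenbrockStrongLinearization m S (symmPencilS S m h x y)) ∧
        (Even m → IsUnit (S.coeff m).det →
          IsRosenbrockStrongLinearization m S (symmPencilS S m h x y)))) ∧
    (0 < r → ∀ D : Data m n, D.Nonzero → IsBlockSymmetric (D.gfpr S) →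
      ∃ (h : ℕ) (x y : List (ℤ × Matrix (Fin n) (Fin n) ℂ)),
        h < m ∧ Even h ∧ IsCanonicalPair m h x y ∧ D.gfpr S = symmPencilS S m h x y ∧
        (D.Nonsingular → IsNonsingular m x ∧ IsNonsingular m y)) := by
  refine ⟨fun h x y hh he hxy => ⟨symmPencilS_eq S hh hxy,
    ⟨symmData S hh hxy, symmPencilS_eq_gfpr S hh hxy⟩,
    symmPencilS_isBlockSymmetric S hh he hxy, fun hx hy => ⟨fun hm => ?_, fun _ hm => ?_⟩⟩,
    fun hr D hD hs => exists_symmPencilS_of_isBlockSymmetric S hlead hmin hr D hD hs⟩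
  · exact isRosenbrockStrongLinearization_symmPencilS S hdeg hmin hh he hxy hx hy (Or.inl hm)
  · exact isRosenbrockStrongLinearization_symmPencilS S hdeg hmin hh he hxy hx hy (Or.inr hm)
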